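/- **Notation.** Let $T_n(K)$ be the set of triangular tableaux $w=(w_{ki})_{1\le i\le k\le n}$ with entries in $K$, let $T_{n-1}(\mathbb Z)\subset T_n(\mathbb Z)$ be the tableaux with zero $n$-th row, and for $v\in T_n(\mathbb C)$ let $V(T(v))$ be the complex vector space with basis $\{T(w): w\in v+T_{n-1}(\mathbb Z)\}$. A *singular pair* of $v$ is a triple $(k,i,j)$ with $1<k<n$, $i<j$ and $v_{ki}-v_{kj}\in\mathbb Z$. The vector $v$ is *singular of index 2* if it has a singular pair but no row $k$, $1<k<n$, has three entries with pairwise integral differences. The hyperplane $x_{ki}=x_{kj}$ ($1<k<n$, $i\ne j$) is *critical* if it contains an element of $v+T_{n-1}(\mathbb Z)$, and $w\in v+T_{n-1}(\mathbb Z)$ is *maximal critical* if it lies on all critical hyperplanes. The group $G=S_n\times\dots\times S_1$ acts on tableaux by $\sigma(w)_{ki}=w_{k,\sigma[k]^{-1}(i)}$. Let $\Gamma\subset U(\mathfrak{gl}(n))$ be the Gelfand–Tsetlin subalgebra, generated by the centers of $U(\mathfrak{gl}(m))$, $1\le m\le n$, where $\mathfrak{gl}(m)$ is spanned by $E_{ij}$,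 $i,j\le m$. A $\mathfrak{gl}(n)$-module $V$ is a Gelfand–Tsetlin module if $V=\bigoplus_{\mathfrak m}V_{\mathfrak m}$ over the maximal ideals of $\Gamma$, where $V_{\mathfrak m}=\{x:\mathfrak m^kx=0\text{ for some }k\ge0\}$. Put $c_{mk}=\sum_{(i_1,\dots,i_k)\in\{1,\dots,m\}^k}E_{i_1i_2}E_{i_2i_3}\cdots E_{i_ki_1}$, let $\gamma_{mk}(w)$ be the value at $w$ of the polynomial $\sum_{i=1}^m(x_{mi}+m-1)^k\prod_{j\ne i}\bigl(1-\tfrac1{x_{mi}-x_{mj}}\bigr)$, let $\mathfrak m_w$ be the (maximal) ideal of $\Gamma$ generated by all $c_{mk}-\gamma_{mk}(w)$, $1\le k\le m\le n$, and let $\widehat{\mathfrak m}=\{w\in v+T_{n-1}(\mathbb Z):\mathfrak m_w=\mathfrak m\}$ be the fiber of $\mathfrak m$. For $1\le r,s\le n$ put $$e_{rs}(w)=\begin{cases}-\dfrac{\prod_{j=1}^{s}(w_{s-1,1}-w_{sj})}{\prod_{j=2}^{s-1}(w_{s-1,1}-w_{s-1,j})}\displaystyle\prod_{j=r}^{s-2}\dfrac{\prod_{t=2}^{j+1}(w_{j1}-w_{j+1,t})}{\prod_{t=2}^{j}(w_{j1}-w_{jt})},&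 r<s,\\[3mm]\dfrac{\prod_{j=1}^{s-1}(w_{s1}-w_{s-1,j})}{\prod_{j=2}^{s}(w_{s1}-w_{sj})}\displaystyle\prod_{j=s+2}^{r}\dfrac{\prod_{t=2}^{j-2}(w_{j-1,1}-w_{j-2,t})}{\prod_{t=2}^{j-1}(w_{j-1,1}-w_{j-1,t})},& r>s,\\[3mm] r-1+\sum_{i=1}^{r}w_{ri}-\sum_{i=1}^{r-1}w_{r-1,i},& r=s.\end{cases}$$ Let $\varepsilon_{rs}=\sum_{j=r}^{s-1}\delta^{j1}$ for $r<s$ (where $\delta^{j1}$ has the entry $1$ at $(j,1)$ and $0$ elsewhere), $\varepsilon_{rr}=0$, $\varepsilon_{sr}=-\varepsilon_{rs}$. Let $\Phi_{rs}\subset G$ consist of all $\sigma$ with $\sigma[k]\in\{(1,i):1\le i\le k\}$ (including the identity $(1,1)$) for $\min(r,s)\le k<\max(r,s)$ and $\sigma[k]=\mathrm{id}$ for all other $k$. **Theorem.** Let $v\in T_n(\mathbb C)$ be singular of index $2$ with set of singular pairs $\Sigma$, and $t=|\Sigma|$. There is $u\in v+T_{n-1}(\mathbb Z)$ with $u_{ki}=u_{kj}$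 for all $(k,i,j)\in\Sigma$. For every such $u$ the following holds. Let $\tilde V$ be the complex vector space generated by symbols $\mathcal D_IT(u+z)$, $I\subseteq\Sigma$, $z\in T_{n-1}(\mathbb Z)$, subject to $\mathcal D_IT(u+\tau_p(z))=-\mathcal D_IT(u+z)$ if $p\in I$ and $\mathcal D_IT(u+\tau_p(z))=\mathcal D_IT(u+z)$ if $p\in\Sigma\setminus I$, where $\tau_p\in G$ interchanges the positions $i$ and $j$ of row $k$ for $p=(k,i,j)$. Then $T(u+z)\mapsto\mathcal D_{I(z)}T(u+z)$ with $I(z)=\{(k,i,j)\in\Sigma: z_{ki}>z_{kj}\}$ extends to a linear isomorphism $V(T(v))\cong\tilde V$, by which we identify the two spaces. For $I\subseteq\Sigma$ and a rational function $f$ in the variables $x_{ki}$ without pole at $u$ let $\mathcal D_I^u(f)$ be the value at $u$ of $\prod_{(k,i,j)\in I}\frac12\bigl(\frac{\partial}{\partial x_{ki}}-\frac{\partial}{\partial x_{kj}}\bigr)f$, and $\mathcal D_I^u(fT(x+z))=\sum_{J\subseteq I}\mathcal D^u_{I\setminus J}(f)\,\mathcal D_JT(u+z)$. Then the formulas $$E_{rs}\cdot\mathcal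 D_IT(u+z)=\sum_{\sigma\in\Phi_{rs}}\mathcal D^u_\Sigma\Bigl(\prod_{(k,i,j)\in\Sigma\setminus I}(x_{ki}-x_{kj})\;e_{rs}(\sigma(x+z))\;T\bigl(x+z+\sigma(\varepsilon_{rs})\bigr)\Bigr),$$ for all $1\le r,s\le n$ and all $I$, $z$ such that $z_{ki}\ne z_{kj}$ for every $(k,i,j)\in I$ (otherwise $\mathcal D_IT(u+z)=0$), have coefficients without pole at $u$ and make $V(T(v))$ a Gelfand–Tsetlin $\mathfrak{gl}(n)$-module. Moreover, for every $\mathfrak m$ with $\widehat{\mathfrak m}\ne\emptyset$: $V(T(v))_{\mathfrak m}=\bigoplus_{w\in\widehat{\mathfrak m}}\mathbb CT(w)$; if $\widehat{\mathfrak m}$ is contained in exactly $k$ critical hyperplanes, then $\dim V(T(v))_{\mathfrak m}=2^{t-k}$; and $\dim V(T(v))_{\mathfrak m}=1$ if $\widehat{\mathfrak m}$ consists of maximal critical points. -/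

import Mathlib

open scoped IsMulCommutative

attribute [local instance 100] LieRing.ofAssociativeRing

noncomputable section

namespace GelfandTsetlin

/-! ### Tableaux -/

/-- Positions of a triangular tableau. The row `k : Fin n` (counted from `0`) is the row number
`k + 1`, which has `k + 1` entries. -/
abbrev Pos (n : ℕ) : Type := Σ k : Fin n, Fin (k.val + 1)

/-- `T_n(K)`: triangular tableaux with rows `1, …, n` and entries in `K`. -/
abbrev Tab (n : ℕ) (K : Type) : Type := Pos n → K

/-- The entry `w_{ki}` in the usual numbering `1 ≤ i ≤ k ≤ n` (and `0` outside this range). -/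
def Tab.entry {n : ℕ} {K : Type} [Zero K] (w : Tab n K) (k i : ℕ) : K :=
  if h : 1 ≤ i ∧ i ≤ k ∧ k ≤ n then w ⟨⟨k - 1, by omega⟩, ⟨i - 1, by dsimp only; omega⟩⟩ else 0

/-- The group `G = S_n × ⋯ × S_1`. -/
abbrev RowPerm (n : ℕ) : Type := (k : Fin n) → Equiv.Perm (Fin (k.val + 1))

/-- The action of `G` on tableaux: `σ(w)_{ki} = w_{k, σ[k]⁻¹(i)}`. -/
def permTab {n : ℕ} {K : Type} (σ : RowPerm n) (w : Tab n K) : Tab n K :=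
  fun p => w ⟨p.1, (σ p.1)⁻¹ p.2⟩

/-- `T_{n-1}(ℤ)`: the integral tableaux whose top row is zero. -/
def intTab (n : ℕ) : AddSubgroup (Tab n ℤ) where
  carrier := {z | ∀ p : Pos n, p.1.val + 1 = n → z p = 0}
  add_mem' := fun ha hb p hp => by simp [ha p hp, hb p hp]
  zero_mem' := fun _ _ => rfl
  neg_mem' := fun ha p hp => by simp [ha p hp]

/-- The action of `G` on `T_{n-1}(ℤ)`. -/
def permInt {n : ℕ} (σ : RowPerm n) (z : intTab n) : intTab n :=
  ⟨permTab σ z.1, fun p hp => z.2 ⟨p.1, (σ p.1)⁻¹ p.2⟩ hp⟩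

/-- An integral tableau regarded as a complex one. -/
def toComplex {n : ℕ} (z : intTab n) : Tab n ℂ := fun p => (z.1 p : ℂ)

/-- The set `v + T_{n-1}(ℤ)`. -/
def lattice {n : ℕ} (v : Tab n ℂ) : Set (Tab n ℂ) := {w | ∃ z : intTab n, w = v + toComplex z}

/-- `V(T(v))`: the complex vector space with basis `T(w)`, `w ∈ v + T_{n-1}(ℤ)`. -/
abbrev TabSpace {n : ℕ} (v : Tab n ℂ) : Type := lattice v →₀ ℂ

/-- The basis vector `T(w)` of `V(T(v))`. -/
def basisTab {n : ℕ} {v : Tab n ℂ} (w : lattice v) : TabSpace v := Finsupp.single w 1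

/-! ### Singular pairs and critical hyperplanes -/

/-- The two complex numbers have integral difference. -/
def IntDiff (a b : ℂ) : Prop := ∃ m : ℤ, a - b = m

/-- The row with number `k + 1` satisfies `1 < k + 1 < n`. -/
def IsInnerRow {n : ℕ} (k : Fin n) : Prop := 1 < k.val + 1 ∧ k.val + 1 < n

/-- There are `m` entries in one row `k`, `1 < k < n`, with pairwise integral differences. -/
def HasSingularTuple {n : ℕ} (v : Tab n ℂ) (m : ℕ) : Prop :=
  ∃ k : Fin n, IsInnerRow k ∧ ∃ S : Finset (Fin (k.val + 1)), S.card = m ∧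
    ∀ i ∈ S, ∀ j ∈ S, IntDiff (v ⟨k, i⟩) (v ⟨k, j⟩)

/-- `v` is singular of index `m`. -/
def IsSingularOfIndex {n : ℕ} (v : Tab n ℂ) (m : ℕ) : Prop :=
  2 ≤ m ∧ HasSingularTuple v m ∧ ∀ m', HasSingularTuple v m' → m' ≤ m

/-- Triples `(k, i, j)` with `1 < k < n` and `i < j`; each of them stands for the pair of
positions `(k, i)`, `(k, j)` and for the hyperplane `x_{ki} = x_{kj}`. -/
def PosPair (n : ℕ) : Type :=
  {p : Σ k : Fin n, Fin (k.val + 1) × Fin (k.val + 1) // IsInnerRow p.1 ∧ p.2.1 < p.2.2}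

/-- The position `(k, i)` of a triple `(k, i, j)`. -/
def PosPair.left {n : ℕ} (p : PosPair n) : Pos n := ⟨p.1.1, p.1.2.1⟩

/-- The position `(k, j)` of a triple `(k, i, j)`. -/
def PosPair.right {n : ℕ} (p : PosPair n) : Pos n := ⟨p.1.1, p.1.2.2⟩

/-- The set `Σ` of singular pairs of `v`. -/
def SingPair {n : ℕ} (v : Tab n ℂ) : Type := {p : PosPair n // IntDiff (v p.left) (v p.right)}

instance {n : ℕ} : Finite (PosPair n) := by unfold PosPair; infer_instance

instance {n : ℕ} (v : Tab n ℂ) : Finite (SingPair v) := by unfold SingPair; infer_instance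

instance {n : ℕ} (v : Tab n ℂ) : Fintype (SingPair v) := Fintype.ofFinite _

instance {n : ℕ} (v : Tab n ℂ) : DecidableEq (SingPair v) := Classical.decEq _

/-- The set of all critical hyperplanes that contain the set `S`. -/
def hyperplanesThrough {n : ℕ} (S : Set (Tab n ℂ)) : Set (PosPair n) :=
  {p | ∀ w ∈ S, w p.left = w p.right}

/-- `w` is maximal critical for `v`: it lies on every hyperplane `x_{ki} = x_{kj}`, `1 < k < n`,
`i ≠ j`, that contains some element of `v + T_{n-1}(ℤ)`. -/
def IsMaximalCritical {n : ℕ} (v w : Tab n ℂ) : Prop :=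
  ∀ p : PosPair n, (∃ w' ∈ lattice v, w' p.left = w' p.right) → w p.left = w p.right

/-- All singular pairs of `u` consist of equal entries. -/
def IsNormalized {n : ℕ} (u : Tab n ℂ) : Prop :=
  ∀ r : SingPair u, u r.1.left = u r.1.right

/-- The element `τ_r` of `G` that interchanges the two positions of the pair `r`. -/
def swapPair {n : ℕ} {u : Tab n ℂ} (r : SingPair u) : RowPerm n :=
  Pi.mulSingle r.1.1.1 (Equiv.swap r.1.1.2.1 r.1.1.2.2)

/-! ### Rational functions of the entries -/

/-- The field of rational functions in the variables `x_{ki}`, `1 ≤ i ≤ k ≤ n`. -/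
abbrev RatFun (n : ℕ) : Type := FractionRing (MvPolynomial (Pos n) ℂ)

/-- Numerator of `f` in lowest terms. -/
def numer {n : ℕ} (f : RatFun n) : MvPolynomial (Pos n) ℂ :=
  IsFractionRing.num (MvPolynomial (Pos n) ℂ) f

/-- Denominator of `f` in lowest terms. -/
def denom {n : ℕ} (f : RatFun n) : MvPolynomial (Pos n) ℂ :=
  (IsFractionRing.den (MvPolynomial (Pos n) ℂ) f : MvPolynomial (Pos n) ℂ)

/-- `f` is smooth at `w`, that is, it has no pole there. -/
def RegularAt {n : ℕ} (w : Tab n ℂ) (f : RatFun n) : Prop :=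
  MvPolynomial.eval w (denom f) ≠ 0

/-- The value of `f` at `w` (after cancellation). -/
def valueAt {n : ℕ} (w : Tab n ℂ) (f : RatFun n) : ℂ :=
  MvPolynomial.eval w (numer f) / MvPolynomial.eval w (denom f)

/-- The partial derivative `∂f/∂x_p`, by the quotient rule. -/
def partialDeriv {n : ℕ} (p : Pos n) (f : RatFun n) : RatFun n :=
  algebraMap (MvPolynomial (Pos n) ℂ) (RatFun n)
      (MvPolynomial.pderiv p (numer f) * denom f - numer f * MvPolynomial.pderiv p (denom f)) /
    algebraMap (MvPolynomial (Pos n) ℂ) (RatFun n) (denom f) ^ 2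

/-- The generic tableau `x`, whose entries are the variables. -/
def genTab (n : ℕ) : Tab n (RatFun n) :=
  fun p => algebraMap (MvPolynomial (Pos n) ℂ) (RatFun n) (MvPolynomial.X p)

/-- The generic tableau `x + z`. -/
def shiftedTab {n : ℕ} (z : intTab n) : Tab n (RatFun n) := fun p => genTab n p + (z.1 p : RatFun n)

/-- The operator `½ (∂/∂x_{ki} - ∂/∂x_{kj})` for a singular pair `r = (k, i, j)`. -/
def halfDiff {n : ℕ} {u : Tab n ℂ} (r : SingPair u) (f : RatFun n) : RatFun n :=
  (1 / 2) * (partialDeriv r.1.left f - partialDeriv r.1.right f)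

/-- The operator `𝒟_I`, the composition of the (commuting) operators `halfDiff r`, `r ∈ I`. -/
def diffOp {n : ℕ} {u : Tab n ℂ} (I : Finset (SingPair u)) (f : RatFun n) : RatFun n :=
  I.toList.foldr halfDiff f

/-- `P_Δ(x) = ∏_{(k,i,j) ∈ Δ} (x_{ki} - x_{kj})`. -/
def pairProd {n : ℕ} {u : Tab n ℂ} (Δ : Finset (SingPair u)) : RatFun n :=
  ∏ r ∈ Δ, (genTab n r.1.left - genTab n r.1.right)

/-! ### The generic Gelfand–Tsetlin formulas -/

/-- The coefficients `e_{rs}(w)`, with `1 ≤ r, s ≤ n`. -/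
def coeffE {n : ℕ} {K : Type} [Field K] (r s : ℕ) (w : Tab n K) : K :=
  if r < s then
    -((∏ j ∈ Finset.Icc 1 s, (w.entry (s - 1) 1 - w.entry s j)) /
        ∏ j ∈ Finset.Icc 2 (s - 1), (w.entry (s - 1) 1 - w.entry (s - 1) j)) *
      ∏ j ∈ Finset.Icc r (s - 2),
        ((∏ t ∈ Finset.Icc 2 (j + 1), (w.entry j 1 - w.entry (j + 1) t)) /
          ∏ t ∈ Finset.Icc 2 j, (w.entry j 1 - w.entry j t))
  else if s < r then
    ((∏ j ∈ Finset.Icc 1 (s - 1), (w.entry s 1 - w.entry (s - 1) j)) /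
        ∏ j ∈ Finset.Icc 2 s, (w.entry s 1 - w.entry s j)) *
      ∏ j ∈ Finset.Icc (s + 2) r,
        ((∏ t ∈ Finset.Icc 2 (j - 2), (w.entry (j - 1) 1 - w.entry (j - 2) t)) /
          ∏ t ∈ Finset.Icc 2 (j - 1), (w.entry (j - 1) 1 - w.entry (j - 1) t))
  else
    ((r : K) - 1) + ∑ i ∈ Finset.Icc 1 r, w.entry r i - ∑ i ∈ Finset.Icc 1 (r - 1), w.entry (r - 1) i

/-- `ε_{rs} = δ^{r,1} + ⋯ + δ^{s-1,1}` for `r < s`, `ε_{rr} = 0`, `ε_{sr} = -ε_{rs}`; here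
`1 ≤ r, s ≤ n`. -/
def epsTab (n : ℕ) (r s : Fin n) : intTab n :=
  ⟨fun p =>
    if p.2.val = 0 then
      if r ≤ p.1 ∧ p.1 < s then 1 else if s ≤ p.1 ∧ p.1 < r then -1 else 0
    else 0, by
    rintro ⟨k, i⟩ hk
    have h1 : ¬ (r ≤ k ∧ k < s) := by
      rintro ⟨_, h⟩
      have := s.isLt
      have := Fin.lt_def.mp h
      simp only at hk
      omega
    have h2 : ¬ (s ≤ k ∧ k < r) := by
      rintro ⟨_, h⟩
      have := r.isLt
      have := Fin.lt_def.mp h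
      simp only at hk
      omega
    simp [h1, h2]⟩

open Classical in
/-- `Φ_{rs}`: the elements `σ ∈ G` such that `σ[k]` is one of the transpositions `(1, i)`
(the identity included) for `min(r,s) ≤ k < max(r,s)`, and `σ[k]` is the identity otherwise. -/
def permSet (n : ℕ) (r s : Fin n) : Finset (RowPerm n) :=
  Finset.univ.filter fun σ => ∀ k : Fin n,
    if min r s ≤ k ∧ k < max r s then ∃ i, σ k = Equiv.swap 0 i else σ k = 1

/-! ### Derivative tableaux -/

/-- The relations `𝒟_I T(u + τ_r(z)) = ± 𝒟_I T(u + z)`, with the sign `-` for `r ∈ I` and `+` for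
`r ∉ I`. A subset `I` of the set of singular pairs of `u` is encoded as a `Finset`. -/
def tabRelations {n : ℕ} (u : Tab n ℂ) :
    Submodule ℂ (Finset (SingPair u) × intTab n →₀ ℂ) :=
  Submodule.span ℂ {y | ∃ (I : Finset (SingPair u)) (z : intTab n) (r : SingPair u),
    y = Finsupp.single (I, permInt (swapPair r) z) 1 -
      (if r ∈ I then (-1 : ℂ) else 1) • Finsupp.single (I, z) 1}

/-- The space spanned by the symbols `𝒟_I T(u + z)` subject to the relations above. -/
abbrev DerivSpace {n : ℕ} (u : Tab n ℂ) : Type :=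
  (Finset (SingPair u) × intTab n →₀ ℂ) ⧸ tabRelations u

/-- The derivative tableau `𝒟_I T(u + z)`. -/
def derivTab {n : ℕ} (u : Tab n ℂ) (I : Finset (SingPair u)) (z : intTab n) : DerivSpace u :=
  (tabRelations u).mkQ (Finsupp.single (I, z) 1)

/-- `𝒟_I^u (f T(x + z)) = ∑_{J ⊆ I} 𝒟_{I \ J}(f)(u) 𝒟_J T(u + z)`. -/
def derivEval {n : ℕ} (u : Tab n ℂ) (I : Finset (SingPair u)) (f : RatFun n) (z : intTab n) :
    DerivSpace u :=
  ∑ J ∈ I.powerset, valueAt u (diffOp (I \ J) f) • derivTab u J z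

/-- The rational function `P_{Σ \ I}(x) e_{rs}(σ(x + z))`, the coefficient of
`T(x + z + σ(ε_{rs}))` in `P_{Σ \ I}(x) E_{rs} T(x + z)`. -/
def actionCoeff {n : ℕ} (u : Tab n ℂ) (r s : Fin n) (I : Finset (SingPair u)) (z : intTab n)
    (σ : RowPerm n) : RatFun n :=
  pairProd (Finset.univ \ I) * coeffE (r.val + 1) (s.val + 1) (permTab σ (shiftedTab z))

/-- `𝒟_R^u (P_{Σ \ I}(x) E_{rs} T(x + z))`, where `R` stands for the set of all singular pairs. -/
def actionFormula {n : ℕ} (u : Tab n ℂ) (r s : Fin n) (I : Finset (SingPair u)) (z : intTab n) :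
    DerivSpace u :=
  ∑ σ ∈ permSet n r s,
    derivEval u Finset.univ (actionCoeff u r s I z σ) (z + permInt σ (epsTab n r s))

open Classical in
/-- The set of the singular pairs `(k, i, j)` of `u` with `z_{ki} > z_{kj}`. -/
def positivePairs {n : ℕ} (u : Tab n ℂ) (z : intTab n) : Finset (SingPair u) :=
  Finset.univ.filter fun r => z.1 r.1.right < z.1 r.1.left

/-! ### The Gelfand–Tsetlin subalgebra and Gelfand–Tsetlin modules -/

/-- The Lie algebra `𝔤𝔩(n)`. -/
abbrev LieGL (n : ℕ) : Type := Matrix (Fin n) (Fin n) ℂ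

/-- The universal enveloping algebra of `𝔤𝔩(n)`. -/
abbrev UGL (n : ℕ) : Type := UniversalEnvelopingAlgebra ℂ (LieGL n)

/-- The matrix unit `E_{ij}`. -/
def matUnit {n : ℕ} (i j : Fin n) : LieGL n := Matrix.single i j 1

/-- `U_m = U(𝔤𝔩(m))` as the subalgebra of `U(𝔤𝔩(n))` generated by `E_{ij}`, `i, j ≤ m`. -/
def subU (n m : ℕ) : Subalgebra ℂ (UGL n) :=
  Algebra.adjoin ℂ {a | ∃ i j : Fin n, i.val < m ∧ j.val < m ∧
    a = UniversalEnvelopingAlgebra.ι ℂ (matUnit i j)}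

/-- `Z_m`: the centre of `U_m`. -/
def centerU (n m : ℕ) : Subalgebra ℂ (UGL n) :=
  subU n m ⊓ Subalgebra.centralizer ℂ (subU n m : Set (UGL n))

/-- The Gelfand–Tsetlin subalgebra `Γ`, generated by `Z_1, …, Z_n`. -/
def Gam (n : ℕ) : Subalgebra ℂ (UGL n) :=
  Algebra.adjoin ℂ (⋃ m ∈ Finset.Icc 1 n, (centerU n m : Set (UGL n)))

theorem subU_mono (n : ℕ) {l m : ℕ} (h : l ≤ m) : subU n l ≤ subU n m := by
  refine Algebra.adjoin_mono ?_
  rintro a ⟨i, j, hi, hj, rfl⟩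
  exact ⟨i, j, hi.trans_le h, hj.trans_le h, rfl⟩

instance (n : ℕ) : IsMulCommutative (Gam n) := by
  refine Algebra.isMulCommutative_adjoin ℂ ?_
  have key : ∀ l m : ℕ, l ≤ m → ∀ a ∈ centerU n l, ∀ b ∈ centerU n m, a * b = b * a := by
    intro l m h a ha b hb
    exact Subalgebra.mem_centralizer_iff ℂ |>.mp hb.2 a (subU_mono n h ha.1)
  intro a ha b hb
  simp only [Set.mem_iUnion] at ha hb
  obtain ⟨l, _, ha⟩ := ha
  obtain ⟨m, _, hb⟩ := hb
  rcases le_total l m with h | h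
  · exact key l m h a ha b hb
  · exact (key m l h b hb a ha).symm

/-- `c_{mk} = ∑ E_{i_1 i_2} E_{i_2 i_3} ⋯ E_{i_k i_1}`, the sum over all
`(i_1, …, i_k) ∈ {1, …, m}^k`. -/
def casimir (n m k : ℕ) : UGL n :=
  ∑ f : Fin k → Fin n with ∀ a, (f a).val < m,
    (List.ofFn fun a : Fin k =>
      UniversalEnvelopingAlgebra.ι ℂ (matUnit (f a) (f (finRotate k a)))).prod

/-- `γ_{mk} = ∑_i (x_{mi} + m - 1)^k ∏_{j ≠ i} (1 - 1 / (x_{mi} - x_{mj}))` as a rational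
function (it is in fact a polynomial). -/
def gammaFun (n m k : ℕ) : RatFun n :=
  ∑ i ∈ Finset.Icc 1 m, ((genTab n).entry m i + (m : RatFun n) - 1) ^ k *
    ∏ j ∈ (Finset.Icc 1 m).erase i, (1 - 1 / ((genTab n).entry m i - (genTab n).entry m j))

/-- The value `γ_{mk}(w)`. -/
def gammaVal {n : ℕ} (m k : ℕ) (w : Tab n ℂ) : ℂ := valueAt w (gammaFun n m k)

/-- The ideal `𝔪_w` of `Γ` generated by the elements `c_{mk} - γ_{mk}(w)`, `1 ≤ k ≤ m ≤ n`. -/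
def idealOf {n : ℕ} (w : Tab n ℂ) : Ideal (Gam n) :=
  Ideal.span {g | ∃ m k : ℕ, 1 ≤ k ∧ k ≤ m ∧ m ≤ n ∧
    (g : UGL n) = casimir n m k - algebraMap ℂ (UGL n) (gammaVal m k w)}

/-- The fiber of the ideal `𝔪` in `v + T_{n-1}(ℤ)`. -/
def fiber {n : ℕ} (v : Tab n ℂ) (𝔪 : Ideal (Gam n)) : Set (Tab n ℂ) :=
  {w | w ∈ lattice v ∧ idealOf w = 𝔪}

/-- `V_𝔪 = {x ∈ V | 𝔪^k x = 0 for some k ≥ 0}` for a representation `ρ` of `𝔤𝔩(n)` on `V`. -/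
def rootSpace {n : ℕ} {V : Type} [AddCommGroup V] [Module ℂ V]
    (ρ : LieGL n →ₗ⁅ℂ⁆ Module.End ℂ V) (𝔪 : Ideal (Gam n)) : Submodule ℂ V where
  carrier := {x | ∃ k : ℕ, ∀ g ∈ 𝔪 ^ k, UniversalEnvelopingAlgebra.lift ℂ ρ (g : UGL n) x = 0}
  zero_mem' := ⟨0, fun _ _ => map_zero _⟩
  add_mem' := by
    rintro x y ⟨k, hk⟩ ⟨l, hl⟩
    refine ⟨max k l, fun g hg => ?_⟩
    rw [map_add, hk g (Ideal.pow_le_pow_right (le_max_left k l) hg),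
      hl g (Ideal.pow_le_pow_right (le_max_right k l) hg), add_zero]
  smul_mem' := by
    rintro c x ⟨k, hk⟩
    exact ⟨k, fun g hg => by rw [map_smul, hk g hg, smul_zero]⟩

open Classical in
/-- The representation is a Gelfand–Tsetlin module: `V = ⊕ V_𝔪` over the maximal ideals of `Γ`. -/
def IsGelfandTsetlin {n : ℕ} {V : Type} [AddCommGroup V] [Module ℂ V]
    (ρ : LieGL n →ₗ⁅ℂ⁆ Module.End ℂ V) : Prop :=
  DirectSum.IsInternal fun 𝔪 : MaximalSpectrum (Gam n) => rootSpace ρ 𝔪.asIdeal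

end GelfandTsetlin

end

open GelfandTsetlin

namespace GelfandTsetlin

/-! ### Interpolation identities -/

section Interpolation

open Polynomial Finset

variable {K ι κ : Type*} [Field K] [DecidableEq ι] {s : Finset ι} {v : ι → K} {T : Finset κ}
  {b : κ → K}

/-! The module is obtained by specialising a generic module, so that no relation has to be checked
on derivative tableaux themselves.

Generic module. Over the field of rational functions in the entries, no two entries of the tableau
`x` differ by an integer, and the operators `E_{k,k+1}`, `E_{k+1,k}`, `E_{kk}` are weighted shifts
on the space with basis `T(x + z)`. Their Serre relations are identities between rational functions;
the only global one, for `[E_{k,k+1}, E_{k+1,k}]`, is Lagrange interpolation. The Serre relations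
generate all relations of the matrix units (`SerreRelations.glRelation`), and the iterated
commutators expand into sums over paths with the coefficients `e_{rs}` (`genE_single`). The elements
`c_{mk}` act diagonally with eigenvalue `γ_{mk}` (`sum_powEntry_genE`): the column `E_{a,r+1}`
splits into components `psi` that raise one entry of row `r`, the matrix `(E_{ab})` acts on each
component by a scalar, and the products of raising and lowering components are computed by induction
on the row.

Specialisation at `u`. Index 2 makes the singular pairs disjoint, so the exchanges `τ_p` commute.
Each of them acts simultaneously on variables and tableaux, and the generic action commutes with
this (`twistCommutes_genE`). Take the combinations of the `T(x + z)` whose coefficients are regular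
at `u` and which are antisymmetric under all exchanges. The coefficient at `T(x + z)` is odd for
every pair on which `z` has equal entries, hence divisible by the product of the corresponding
`x_{ki} - x_{kj}`. This product cancels the poles of `e_{rs}(x + z)` at `u`, so the antisymmetric
families are stable (`genE_mem_antiSub`).

On them the evaluation `thetaMap`, `f T(x + z) ↦ 𝒟_Σ^u(f T(x + z))`, has the section `xiMap`, which
sends `𝒟_I T(u + z)` to the antisymmetrisation of `P_{Σ \ I} T(x + z)`. Its kernel on antisymmetric
families is spanned by the multiples by invariant functions that vanish at `u`
(`sub_xiMap_thetaMap_mem`), and operators linear over the rational functions preserve it. The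
derivative tableaux are therefore a quotient of a representation. Since the operators also commute
with antisymmetrisation, they may be applied to `P_{Σ \ I} T(x + z)` itself, which gives the
formulas of the theorem.

Gelfand–Tsetlin structure. On `𝒟_I T(u + z)` the element `c_{mk}` acts by `γ_{mk}(u + z)` plus terms
`𝒟_J T(u + z)` with `J` strictly inside `I`, so a power of `𝔪_{u+z}` kills the vector. The numbers
`γ_{mk}`, `1 ≤ k ≤ m`, are the moments of a monic polynomial with roots given by row `m`, and they
determine it (`eq_of_moment_eq`). Hence a fiber is one orbit under the exchanges, and it has a
factor 2 for each pair with distinct entries. Different ideals `𝔪_w` are comaximal, because the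
generators for some `c_{mk}` differ by a nonzero scalar. Comaximality separates the root spaces, and
their finite dimension gives the decomposition over the maximal ideals of `Γ`. -/

theorem interpolation_sum_eq (hv : Set.InjOn v s) (h : #T = #s) :
    ∑ i ∈ s, (∏ t ∈ T, (v i - b t)) / ∏ j ∈ s.erase i, (v i - v j) =
      ∑ i ∈ s, v i - ∑ t ∈ T, b t := by
  rcases s.eq_empty_or_nonempty with rfl | hs
  · have : T = ∅ := by simpa using h
    simp [this]
  have hpos : 0 < #s := hs.card_pos
  -- Both products are monic of degree `#s`, so the difference is the Lagrange interpolant of the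
  -- values `∏ (v i - b t)`. Its coefficient in degree `#s - 1` is the right-hand side by Vieta and
  -- the left-hand side by interpolation.
  have hd : (Lagrange.nodal T b - Lagrange.nodal s v).degree < #s := by
    rw [← h, ← Lagrange.degree_nodal (s := T) (v := b)]
    refine degree_sub_lt_left ?_ Lagrange.nodal_ne_zero ?_
    · rw [Lagrange.degree_nodal, Lagrange.degree_nodal, h]
    · rw [Lagrange.nodal_monic.leadingCoeff, Lagrange.nodal_monic.leadingCoeff]
  have h1 := Lagrange.coeff_eq_sum hv hd
  rw [coeff_sub, Lagrange.nodal_eq, Lagrange.nodal_eq, prod_X_sub_C_coeff_card_pred _ _ hpos,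
    ← h, prod_X_sub_C_coeff_card_pred _ _ (h ▸ hpos)] at h1
  rw [← neg_sub_neg, h1]
  refine Finset.sum_congr rfl fun i hi => ?_
  rw [eval_sub, ← Lagrange.nodal_eq, ← Lagrange.nodal_eq, Lagrange.eval_nodal_at_node hi, sub_zero,
    Lagrange.eval_nodal]

theorem interpolation_sum_one (hv : Set.InjOn v s) (h : #T + 1 = #s) :
    ∑ i ∈ s, (∏ t ∈ T, (v i - b t)) / ∏ j ∈ s.erase i, (v i - v j) = 1 := by
  have h1 := Lagrange.leadingCoeff_eq_sum hv (P := Lagrange.nodal T b)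
    (by rw [Lagrange.degree_nodal, ← h]; rfl)
  rw [Lagrange.nodal_monic.leadingCoeff] at h1
  simp [h1, Lagrange.eval_nodal]

theorem interpolation_sum_zero (hv : Set.InjOn v s) (h : #T + 1 < #s) :
    ∑ i ∈ s, (∏ t ∈ T, (v i - b t)) / ∏ j ∈ s.erase i, (v i - v j) = 0 := by
  have hd : (Lagrange.nodal T b).degree < #s := by
    rw [Lagrange.degree_nodal]; exact_mod_cast (by omega : #T < #s)
  have h1 := Lagrange.coeff_eq_sum hv hd
  rw [coeff_eq_zero_of_natDegree_lt (by rw [Lagrange.natDegree_nodal]; omega)] at h1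
  simp [h1, Lagrange.eval_nodal]

/-- An evaluation point `X` is adjoined to the nodes as `none`. Its own term is the quotient of
products at `X`, the other terms acquire the denominators `X - v i`; thus each interpolation
identity on the enlarged set is a partial fraction expansion. -/
theorem sum_insertNone_interpolation (X : K) :
    ∑ i ∈ insertNone s, (∏ t ∈ T, (i.elim X v - b t)) /
        ∏ j ∈ (insertNone s).erase i, (i.elim X v - j.elim X v) =
      (∏ t ∈ T, (X - b t)) / ∏ i ∈ s, (X - v i) -
        ∑ i ∈ s, (∏ t ∈ T, (v i - b t)) / (∏ j ∈ s.erase i, (v i - v j)) / (X - v i) := by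
  rw [Finset.sum_insertNone, sub_eq_add_neg, ← Finset.sum_neg_distrib]
  congr 1
  · have : (insertNone s).erase none = s.map Function.Embedding.some := by
      ext (_ | a) <;> simp
    rw [this, prod_map]; simp
  · refine Finset.sum_congr rfl fun i hi => ?_
    have : (insertNone s).erase (some i) = insertNone (s.erase i) := by
      ext (_ | a) <;> simp
    rw [this, prod_insertNone]
    simp only [Option.elim]
    rw [← neg_sub X (v i), div_div, ← div_neg, mul_comm, mul_neg]

theorem injOn_insertNone {K ι : Type*} {s : Finset ι} {v : ι → K} {X : K} (hv : Set.InjOn v s) (hX : ∀ i ∈ s, X ≠ v i) :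
    Set.InjOn (fun i : Option ι => i.elim X v) (insertNone s) := by
  rintro (_ | i) hi (_ | j) hj hij
  · rfl
  · exact absurd hij (hX j (by simpa using hj))
  · exact absurd hij.symm (hX i (by simpa using hi))
  · exact congrArg some (hv (by simpa using hi) (by simpa using hj) hij)

/-- Partial fractions of a quotient of monic products whose degrees differ by one. -/
theorem prod_div_prod_eq_linear (hv : Set.InjOn v s) (h : #T = #s + 1) {X : K}
    (hX : ∀ i ∈ s, X ≠ v i) :
    (∏ t ∈ T, (X - b t)) / ∏ i ∈ s, (X - v i) = X + ∑ i ∈ s, v i - ∑ t ∈ T, b t +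
      ∑ i ∈ s, (∏ t ∈ T, (v i - b t)) / (∏ j ∈ s.erase i, (v i - v j)) / (X - v i) := by
  have h1 := interpolation_sum_eq (b := b) (injOn_insertNone hv hX) (h.trans (card_insertNone s).symm)
  rw [sum_insertNone_interpolation X, sum_insertNone, sub_eq_iff_eq_add] at h1
  simpa using h1

/-- Partial fractions of a proper quotient of monic products. -/
theorem prod_div_prod_eq_sum (hv : Set.InjOn v s) (h : #T < #s) {X : K}
    (hX : ∀ i ∈ s, X ≠ v i) :
    (∏ t ∈ T, (X - b t)) / ∏ i ∈ s, (X - v i) =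
      ∑ i ∈ s, (∏ t ∈ T, (v i - b t)) / (∏ j ∈ s.erase i, (v i - v j)) / (X - v i) := by
  have h1 := interpolation_sum_zero (T := T) (b := b) (injOn_insertNone hv hX)
    (by rw [card_insertNone]; omega)
  rwa [sum_insertNone_interpolation X, sub_eq_zero] at h1

end Interpolation

end GelfandTsetlin

namespace GelfandTsetlin

attribute [local instance 2000] Ring.toAddCommGroup

/-! ### Weighted shift operators -/

/-- Integral shifts of tableaux with infinitely many rows of infinite length. -/
abbrev Shift : Type := ℕ → ℕ → ℤ

/-- The shift by `d` in the position `(k, i)`. -/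
def unitShift (k i : ℕ) (d : ℤ) : Shift := Pi.single k (Pi.single i d)

theorem unitShift_apply (k i : ℕ) (d : ℤ) (l j : ℕ) :
    unitShift k i d l j = if l = k ∧ j = i then d else 0 := by
  unfold unitShift
  by_cases h : l = k
  · subst h
    by_cases h' : j = i <;> simp [h']
  · simp [h]

theorem unitShift_row_ne {k i l : ℕ} {d : ℤ} (h : l ≠ k) : unitShift k i d l = 0 := by
  simp [unitShift, h]

theorem unitShift_neg (k i : ℕ) (d : ℤ) : -unitShift k i d = unitShift k i (-d) := by
  funext l j
  simp only [Pi.neg_apply, unitShift_apply]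
  split_ifs <;> simp

section Op

variable {K : Type*} [Field K]

variable (K) in
/-- The algebra of endomorphisms of the vector space with basis `T(z)`. -/
def OpAlg : Type _ := Module.End K (Shift →₀ K)

noncomputable instance : Ring (OpAlg K) := inferInstanceAs (Ring (Module.End K (Shift →₀ K)))

noncomputable instance : Algebra K (OpAlg K) :=
  inferInstanceAs (Algebra K (Module.End K (Shift →₀ K)))

/-- The action of an operator as a linear map. -/
noncomputable def OpAlg.toEnd : OpAlg K →ₐ[K] Module.End K (Shift →₀ K) := AlgHom.id K _

theorem OpAlg.ext {a b : OpAlg K} (h : ∀ z c, a.toEnd (Finsupp.single z c) =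
    b.toEnd (Finsupp.single z c)) : a = b :=
  Finsupp.lhom_ext h

/-- The operator `T(z) ↦ g(z) T(z + d)`. -/
noncomputable def op (g : Shift → K) (d : Shift) : OpAlg K :=
  Finsupp.linearCombination K fun z => Finsupp.single (z + d) (g z)

@[simp]
theorem op_single (g : Shift → K) (d z : Shift) (a : K) :
    (op g d).toEnd (Finsupp.single z a) = Finsupp.single (z + d) (a * g z) :=
  (Finsupp.linearCombination_single K a z).trans (by simp)

theorem op_mul (g g' : Shift → K) (d d' : Shift) :
    op g d * op g' d' = op (fun z => g (z + d') * g' z) (d + d') := by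
  refine OpAlg.ext fun z a => ?_
  rw [map_mul, Module.End.mul_apply, op_single, op_single, op_single, add_assoc, add_comm d' d]
  congr 1
  ring

theorem op_add (g g' : Shift → K) (d : Shift) : op g d + op g' d = op (fun z => g z + g' z) d := by
  refine OpAlg.ext fun z a => ?_
  simp [mul_add]

theorem op_neg (g : Shift → K) (d : Shift) : -op g d = op (fun z => -g z) d := by
  refine OpAlg.ext fun z a => ?_
  simp

theorem op_sub (g g' : Shift → K) (d : Shift) : op g d - op g' d = op (fun z => g z - g' z) d := by
  rw [sub_eq_add_neg, op_neg, op_add]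
  simp only [sub_eq_add_neg]

theorem op_zero (d : Shift) : op (fun _ => (0 : K)) d = 0 := by
  refine OpAlg.ext fun z a => ?_
  simp

theorem op_one : op (fun _ => (1 : K)) 0 = 1 := by
  refine OpAlg.ext fun z a => ?_
  simp

theorem op_sum {ι : Type*} (s : Finset ι) (g : ι → Shift → K) (d : Shift) :
    ∑ i ∈ s, op (g i) d = op (fun z => ∑ i ∈ s, g i z) d := by
  classical
  induction s using Finset.induction_on with
  | empty => simp [op_zero]
  | insert a s ha ih => rw [Finset.sum_insert ha, ih, op_add]; simp [Finset.sum_insert ha]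

theorem op_lie (g g' : Shift → K) (d d' : Shift) :
    ⁅op g d, op g' d'⁆ = op (fun z => g (z + d') * g' z - g' (z + d) * g z) (d + d') := by
  rw [Ring.lie_def, op_mul, op_mul, add_comm d' d, op_sub]

theorem op_lie_eq_zero {g g' : Shift → K} {d d' : Shift}
    (h : ∀ z, g (z + d') * g' z = g' (z + d) * g z) : ⁅op g d, op g' d'⁆ = 0 := by
  rw [op_lie]
  simp only [h, sub_self, op_zero]

end Op

/-! ### The generic Gelfand–Tsetlin operators -/

section Generic

open Finset

variable {K : Type*} [Field K] (x : ℕ → ℕ → K)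

/-- The entries of `x` are pairwise distinct modulo `ℤ`. -/
def IsGenericTab : Prop :=
  ∀ (k i l j : ℕ) (d : ℤ), (k, i) ≠ (l, j) → x k i - x l j ≠ d

/-- The entry `(k, i)` of the tableau `x + z`. -/
def ent (z : Shift) (k i : ℕ) : K := x k i + z k i

variable {x} in
theorem IsGenericTab.ent_ne (hx : IsGenericTab x) (z z' : Shift) {k i l j : ℕ}
    (h : (k, i) ≠ (l, j)) (d : ℤ) : ent x z k i - ent x z' l j ≠ d := by
  intro h'
  refine hx k i l j (d - z k i + z' l j) h ?_
  simp only [ent] at h'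
  push_cast
  linear_combination h'

variable {x} in
theorem IsGenericTab.sub_ne_zero (hx : IsGenericTab x) (z : Shift) {k i l j : ℕ}
    (h : (k, i) ≠ (l, j)) : ent x z k i - ent x z l j ≠ 0 := by
  simpa using hx.ent_ne z z h 0

theorem ent_add_unitShift (z : Shift) (k i : ℕ) (d : ℤ) (l j : ℕ) :
    ent x (z + unitShift k i d) l j = ent x z l j + if l = k ∧ j = i then (d : K) else 0 := by
  simp only [ent, Pi.add_apply, unitShift_apply]
  split_ifs <;> simp [add_assoc]

theorem ent_add_unitShift_self (z : Shift) (k i : ℕ) (d : ℤ) :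
    ent x (z + unitShift k i d) k i = ent x z k i + d := by
  simp [ent_add_unitShift]

theorem ent_add_unitShift_of_ne (z : Shift) {k i l j : ℕ} (d : ℤ) (h : (l, j) ≠ (k, i)) :
    ent x (z + unitShift k i d) l j = ent x z l j := by
  rw [ent_add_unitShift, if_neg (by simpa using h), add_zero]

/-- The product of the differences of the entry `(k, i)` and the other entries of its row. -/
def rowDen (k i : ℕ) (z : Shift) : K :=
  ∏ t ∈ (range (k + 1)).erase i, (ent x z k i - ent x z k t)

/-- The coefficient of `T(z + δ^{ki})` in `-E_{k,k+1} T(z)`. -/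
def raiseCoeff (k i : ℕ) (z : Shift) : K :=
  (∏ t ∈ range (k + 2), (ent x z k i - ent x z (k + 1) t)) / rowDen x k i z

/-- The coefficient of `T(z - δ^{ki})` in `E_{k+1,k} T(z)`. -/
def lowerCoeff (k i : ℕ) (z : Shift) : K :=
  (∏ t ∈ range k, (ent x z k i - ent x z (k - 1) t)) / rowDen x k i z

/-- The eigenvalue of `E_{kk}` on `T(z)`. -/
def weightCoeff (k : ℕ) (z : Shift) : K :=
  k + ∑ i ∈ range (k + 1), ent x z k i - ∑ i ∈ range k, ent x z (k - 1) i

/-- The operator `E_{k,k+1}`. -/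
noncomputable def raiseOp (k : ℕ) : OpAlg K :=
  -∑ i ∈ range (k + 1), op (raiseCoeff x k i) (unitShift k i 1)

/-- The operator `E_{k+1,k}`. -/
noncomputable def lowerOp (k : ℕ) : OpAlg K :=
  ∑ i ∈ range (k + 1), op (lowerCoeff x k i) (unitShift k i (-1))

/-- The operator `E_{kk}`. -/
noncomputable def weightOp (k : ℕ) : OpAlg K :=
  op (weightCoeff x k) 0

theorem rowDen_congr {k i : ℕ} {z z' : Shift} (h : z k = z' k) :
    rowDen x k i z = rowDen x k i z' := by
  simp only [rowDen, ent, h]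

theorem raiseCoeff_congr {k i : ℕ} {z z' : Shift} (h : z k = z' k) (h' : z (k + 1) = z' (k + 1)) :
    raiseCoeff x k i z = raiseCoeff x k i z' := by
  simp only [raiseCoeff, rowDen_congr x h, ent, h, h']

theorem lowerCoeff_congr {k i : ℕ} {z z' : Shift} (h : z k = z' k) (h' : z (k - 1) = z' (k - 1)) :
    lowerCoeff x k i z = lowerCoeff x k i z' := by
  simp only [lowerCoeff, rowDen_congr x h, ent, h, h']

theorem raiseCoeff_add_unitShift_of_ne {k i l j : ℕ} (d : ℤ) (z : Shift) (h : k ≠ l)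
    (h' : k + 1 ≠ l) : raiseCoeff x k i (z + unitShift l j d) = raiseCoeff x k i z :=
  raiseCoeff_congr x (by simp [unitShift_row_ne h]) (by simp [unitShift_row_ne h'])

theorem lowerCoeff_add_unitShift_of_ne {k i l j : ℕ} (d : ℤ) (z : Shift) (h : k ≠ l)
    (h' : k - 1 ≠ l) : lowerCoeff x k i (z + unitShift l j d) = lowerCoeff x k i z :=
  lowerCoeff_congr x (by simp [unitShift_row_ne h]) (by simp [unitShift_row_ne h'])

variable {x} (hx : IsGenericTab x)

include hx

theorem rowDen_ne_zero (k i : ℕ) (z : Shift) : rowDen x k i z ≠ 0 := by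
  refine prod_ne_zero_iff.mpr fun t ht => hx.sub_ne_zero z ?_
  simpa using (ne_of_mem_erase ht).symm

/-- Only the factor that contains the entry `(k, j)` changes. The four lemmas after this one have
the same reason, and these ratios are what the commutators of operators in different positions
depend on. -/
theorem rowDen_add_unitShift {k i j : ℕ} (hj : j < k + 1) (hij : i ≠ j) (d : ℤ) (z : Shift) :
    rowDen x k i (z + unitShift k j d) =
      rowDen x k i z * ((ent x z k i - ent x z k j - d) / (ent x z k i - ent x z k j)) := by
  have hm : j ∈ (range (k + 1)).erase i := by simp [hij.symm]; omega
  have h0 : ent x z k i - ent x z k j ≠ 0 := hx.sub_ne_zero z (by simpa using hij)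
  simp only [rowDen]
  rw [← mul_prod_erase _ _ hm, ← mul_prod_erase _ (fun t => ent x z k i - ent x z k t) hm,
    ent_add_unitShift_self, ent_add_unitShift_of_ne x z d (by simpa using hij)]
  have : ∏ t ∈ ((range (k + 1)).erase i).erase j, (ent x z k i - ent x (z + unitShift k j d) k t) =
      ∏ t ∈ ((range (k + 1)).erase i).erase j, (ent x z k i - ent x z k t) := by
    refine prod_congr rfl fun t ht => ?_
    rw [ent_add_unitShift_of_ne x z d (by simpa using ne_of_mem_erase ht)]
  rw [this]
  field_simp
  ring

theorem raiseCoeff_add_unitShift_row {k i j : ℕ} (hj : j < k + 1) (hij : i ≠ j) (d : ℤ)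
    (z : Shift) : raiseCoeff x k i (z + unitShift k j d) =
      raiseCoeff x k i z * ((ent x z k i - ent x z k j) / (ent x z k i - ent x z k j - d)) := by
  simp only [raiseCoeff]
  rw [rowDen_add_unitShift hx hj hij, ent_add_unitShift_of_ne x z d (by simpa using hij)]
  simp only [ent_add_unitShift_of_ne x z (k := k) (l := k + 1) d (by simp)]
  rw [div_mul_div_comm, div_mul_eq_div_div, div_div_eq_mul_div, div_mul_eq_mul_div, div_div]

theorem lowerCoeff_add_unitShift_row {k i j : ℕ} (hj : j < k + 1) (hij : i ≠ j) (d : ℤ)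
    (z : Shift) : lowerCoeff x k i (z + unitShift k j d) =
      lowerCoeff x k i z * ((ent x z k i - ent x z k j) / (ent x z k i - ent x z k j - d)) := by
  simp only [lowerCoeff]
  rw [rowDen_add_unitShift hx hj hij, ent_add_unitShift_of_ne x z d (by simpa using hij)]
  have : ∏ t ∈ range k, (ent x z k i - ent x (z + unitShift k j d) (k - 1) t) =
      ∏ t ∈ range k, (ent x z k i - ent x z (k - 1) t) := by
    refine prod_congr rfl fun t ht => ?_
    have := mem_range.mp ht
    rw [ent_add_unitShift_of_ne x z d (by simp; omega)]
  rw [this, div_mul_div_comm, div_mul_eq_div_div, div_div_eq_mul_div, div_mul_eq_mul_div, div_div]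

theorem raiseCoeff_add_unitShift_succ {k i j : ℕ} (hj : j < k + 2) (d : ℤ) (z : Shift) :
    raiseCoeff x k i (z + unitShift (k + 1) j d) = raiseCoeff x k i z *
      ((ent x z k i - ent x z (k + 1) j - d) / (ent x z k i - ent x z (k + 1) j)) := by
  have h0 : ent x z k i - ent x z (k + 1) j ≠ 0 := hx.sub_ne_zero z (by simp)
  have hm : j ∈ range (k + 2) := by simpa using hj
  simp only [raiseCoeff]
  rw [rowDen_congr x (z' := z) (by simp [unitShift_row_ne]), ← mul_prod_erase _ _ hm,
    ← mul_prod_erase _ (fun t => ent x z k i - ent x z (k + 1) t) hm, ent_add_unitShift_self,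
    ent_add_unitShift_of_ne x z d (by simp)]
  have : ∏ t ∈ (range (k + 2)).erase j,
        (ent x z k i - ent x (z + unitShift (k + 1) j d) (k + 1) t) =
      ∏ t ∈ (range (k + 2)).erase j, (ent x z k i - ent x z (k + 1) t) := by
    refine prod_congr rfl fun t ht => ?_
    rw [ent_add_unitShift_of_ne x z d (by simpa using ne_of_mem_erase ht)]
  rw [this]
  field_simp
  ring

theorem lowerCoeff_add_unitShift_pred {k i j : ℕ} (hj : j < k + 1) (d : ℤ) (z : Shift) :
    lowerCoeff x (k + 1) i (z + unitShift k j d) = lowerCoeff x (k + 1) i z *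
      ((ent x z (k + 1) i - ent x z k j - d) / (ent x z (k + 1) i - ent x z k j)) := by
  have h0 : ent x z (k + 1) i - ent x z k j ≠ 0 := hx.sub_ne_zero z (by simp)
  have hm : j ∈ range (k + 1) := by simpa using hj
  simp only [lowerCoeff, Nat.add_sub_cancel]
  rw [rowDen_congr x (z' := z) (by simp [unitShift_row_ne]), ← mul_prod_erase _ _ hm,
    ← mul_prod_erase _ (fun t => ent x z (k + 1) i - ent x z k t) hm, ent_add_unitShift_self,
    ent_add_unitShift_of_ne x z d (by simp)]
  have : ∏ t ∈ (range (k + 1)).erase j, (ent x z (k + 1) i - ent x (z + unitShift k j d) k t) =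
      ∏ t ∈ (range (k + 1)).erase j, (ent x z (k + 1) i - ent x z k t) := by
    refine prod_congr rfl fun t ht => ?_
    rw [ent_add_unitShift_of_ne x z d (by simpa using ne_of_mem_erase ht)]
  rw [this]
  field_simp
  ring

end Generic

end GelfandTsetlin

namespace GelfandTsetlin

attribute [local instance 2000] Ring.toAddCommGroup

/-! ### Serre relations of the generic operators. -/

section Serre

open Finset

/-- Cancellation by the involution `(i, j) ↦ (j, i)`. In the Serre relations only the two orders of
the shifts of two entries cancel against each other, not the single terms. -/
theorem sum_sum_eq_zero_of_antisymm {A ι : Type*} [AddCommGroup A] [DecidableEq ι] {s : Finset ι}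
    {X : ι → ι → A} (h : ∀ i ∈ s, ∀ j ∈ s, i ≠ j → X i j + X j i = 0)
    (h0 : ∀ i ∈ s, X i i = 0) : ∑ i ∈ s, ∑ j ∈ s, X i j = 0 := by
  rw [← sum_product']
  refine sum_involution (fun p _ => p.swap) ?_ ?_ ?_ ?_
  · rintro ⟨i, j⟩ hp
    obtain ⟨hi, hj⟩ := mem_product.mp hp
    by_cases hij : i = j
    · subst hij; simp [h0 i hi]
    · exact h i hi j hj hij
  · rintro ⟨i, j⟩ hp hne heq
    obtain ⟨hi, hj⟩ := mem_product.mp hp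
    obtain rfl : j = i := congrArg Prod.fst heq
    exact hne (h0 _ hi)
  · rintro ⟨i, j⟩ hp
    exact mem_product.mpr (mem_product.mp hp).symm
  · simp

variable {K : Type*} [Field K] (x : ℕ → ℕ → K)

theorem weightOp_lie_weightOp (k l : ℕ) : ⁅weightOp x k, weightOp x l⁆ = 0 :=
  op_lie_eq_zero fun z => by simp [mul_comm]

theorem sum_ent_add_unitShift (z : Shift) (k i : ℕ) (d : ℤ) (l m : ℕ) :
    ∑ j ∈ range m, ent x (z + unitShift k i d) l j =
      ∑ j ∈ range m, ent x z l j + if l = k ∧ i < m then (d : K) else 0 := by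
  simp only [ent_add_unitShift, sum_add_distrib]
  congr 1
  by_cases h : l = k <;> simp [h]

theorem weightCoeff_add_unitShift (k l i : ℕ) (hi : i < l + 1) (d : ℤ) (z : Shift) :
    weightCoeff x k (z + unitShift l i d) = weightCoeff x k z +
      ((if k = l then (d : K) else 0) - if k = l + 1 then (d : K) else 0) := by
  simp only [weightCoeff, sum_ent_add_unitShift]
  rcases k with _ | k
  · rcases l with _ | l
    · obtain rfl : i = 0 := by omega
      simp
    · simp
  · by_cases h : k = l
    · subst h
      simp [hi]; ring
    · by_cases h' : k + 1 = l
      · subst h'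
        have h2 : i < k + 1 + 1 := hi
        simp [h2]; ring
      · simp [h, h']

theorem weightOp_lie_op (k l i : ℕ) (hi : i < l + 1) (d : ℤ) (g : Shift → K) :
    ⁅weightOp x k, op g (unitShift l i d)⁆ =
      ((if k = l then (d : K) else 0) - if k = l + 1 then (d : K) else 0) •
        op g (unitShift l i d) := by
  rw [weightOp, op_lie, zero_add]
  have : ∀ (c : K) (g : Shift → K) d, c • op g d = op (fun z => c * g z) d := by
    intro c g d
    refine OpAlg.ext fun z a => ?_
    rw [map_smul, LinearMap.smul_apply]
    simp only [op_single, Finsupp.smul_single, smul_eq_mul]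
    congr 1; ring
  rw [this]
  congr 1
  funext z
  rw [weightCoeff_add_unitShift x k l i hi, add_zero]
  ring

theorem weightOp_lie_raiseOp (k l : ℕ) : ⁅weightOp x k, raiseOp x l⁆ =
    ((if k = l then (1 : K) else 0) - if k = l + 1 then (1 : K) else 0) • raiseOp x l := by
  rw [raiseOp, lie_neg, lie_sum, smul_neg, smul_sum]
  congr 1
  refine sum_congr rfl fun i hi => ?_
  rw [weightOp_lie_op x k l i (mem_range.mp hi)]
  simp

theorem weightOp_lie_lowerOp (k l : ℕ) : ⁅weightOp x k, lowerOp x l⁆ =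
    -((if k = l then (1 : K) else 0) - if k = l + 1 then (1 : K) else 0) • lowerOp x l := by
  rw [lowerOp, lie_sum, smul_sum]
  refine sum_congr rfl fun i hi => ?_
  rw [weightOp_lie_op x k l i (mem_range.mp hi)]
  congr 1
  push_cast
  split_ifs <;> ring

theorem raiseOp_lie_raiseOp_of_far {k l : ℕ} (h : k + 1 < l) : ⁅raiseOp x k, raiseOp x l⁆ = 0 := by
  rw [raiseOp, raiseOp, neg_lie, lie_neg, neg_neg, sum_lie]
  refine sum_eq_zero fun i _ => ?_
  rw [lie_sum]
  refine sum_eq_zero fun j _ => op_lie_eq_zero fun z => ?_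
  rw [raiseCoeff_add_unitShift_of_ne x _ _ (by omega) (by omega),
    raiseCoeff_add_unitShift_of_ne x _ _ (by omega) (by omega), mul_comm]

theorem lowerOp_lie_lowerOp_of_far {k l : ℕ} (h : k + 1 < l) : ⁅lowerOp x k, lowerOp x l⁆ = 0 := by
  rw [lowerOp, lowerOp, sum_lie]
  refine sum_eq_zero fun i _ => ?_
  rw [lie_sum]
  refine sum_eq_zero fun j _ => op_lie_eq_zero fun z => ?_
  rw [lowerCoeff_add_unitShift_of_ne x _ _ (by omega) (by omega),
    lowerCoeff_add_unitShift_of_ne x _ _ (by omega) (by omega), mul_comm]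

variable {x} (hx : IsGenericTab x)

include hx

/-- For different rows the coefficients interact only if `l = k + 1`. Then both orders multiply the
product of the coefficients by the same ratio, since a step `-1` in the row above and a step `1` in
the row below change the difference of the two entries alike. -/
theorem raiseOp_lie_lowerOp_of_ne {k l : ℕ} (h : k ≠ l) : ⁅raiseOp x k, lowerOp x l⁆ = 0 := by
  rw [raiseOp, lowerOp, neg_lie, sum_lie, neg_eq_zero]
  refine sum_eq_zero fun i hi => ?_
  rw [lie_sum]
  refine sum_eq_zero fun j hj => op_lie_eq_zero fun z => ?_
  by_cases h' : l = k + 1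
  · subst h'
    have h0 : ent x z k i - ent x z (k + 1) j ≠ 0 := hx.sub_ne_zero z (by simp)
    have h1 : ent x z (k + 1) j - ent x z k i ≠ 0 := hx.sub_ne_zero z (by simp)
    rw [raiseCoeff_add_unitShift_succ hx (mem_range.mp hj),
      lowerCoeff_add_unitShift_pred hx (mem_range.mp hi)]
    have : (ent x z k i - ent x z (k + 1) j - ((-1 : ℤ) : K)) / (ent x z k i - ent x z (k + 1) j) =
        (ent x z (k + 1) j - ent x z k i - ((1 : ℤ) : K)) /
          (ent x z (k + 1) j - ent x z k i) := by
      rw [div_eq_div_iff h0 h1]; push_cast; ring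
    rw [this]
    ring
  · by_cases h2 : l = 0
    · subst h2
      rw [raiseCoeff_add_unitShift_of_ne x _ _ (by omega) (by omega),
        lowerCoeff_add_unitShift_of_ne x _ _ (by omega) (by omega), mul_comm]
    · rw [raiseCoeff_add_unitShift_of_ne x _ _ (by omega) (by omega),
        lowerCoeff_add_unitShift_of_ne x _ _ (by omega) (by omega), mul_comm]

theorem raise_lie_lower_row {k i j : ℕ} (hi : i < k + 1) (hj : j < k + 1) (hij : i ≠ j) :
    ⁅op (raiseCoeff x k i) (unitShift k i 1), op (lowerCoeff x k j) (unitShift k j (-1))⁆ = 0 := by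
  refine op_lie_eq_zero fun z => ?_
  rw [raiseCoeff_add_unitShift_row hx hj hij, lowerCoeff_add_unitShift_row hx hi hij.symm]
  have h1 : ent x z k i - ent x z k j - ((-1 : ℤ) : K) ≠ 0 := by
    intro h
    exact hx.ent_ne z z (k := k) (i := i) (l := k) (j := j) (by simpa using hij) (-1)
      (sub_eq_zero.mp h)
  have h2 : ent x z k j - ent x z k i - ((1 : ℤ) : K) ≠ 0 := by
    intro h
    exact hx.ent_ne z z (k := k) (i := j) (l := k) (j := i) (by simpa using hij.symm) 1
      (sub_eq_zero.mp h)
  have : (ent x z k i - ent x z k j) / (ent x z k i - ent x z k j - ((-1 : ℤ) : K)) =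
      (ent x z k j - ent x z k i) / (ent x z k j - ent x z k i - ((1 : ℤ) : K)) := by
    rw [div_eq_div_iff h1 h2]; push_cast; ring
  rw [this]
  ring

/-- One interpolation with `2k + 2` nodes and as many points: the nodes are the entries `a i` of row
`k` and their shifts `a i - 1`, the points are the entries of row `k + 1` and those of row `k - 1`
lowered by 1. The nodes `a i` and `a i - 1` give the two products of coefficients, because they
differ from each other by `±1`; the sum of nodes minus the sum of points is the difference of the
weights. -/
theorem raiseCoeff_mul_lowerCoeff_sum (k : ℕ) (z : Shift) :
    ∑ i ∈ range (k + 1), (lowerCoeff x k i (z + unitShift k i 1) * raiseCoeff x k i z -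
      raiseCoeff x k i (z + unitShift k i (-1)) * lowerCoeff x k i z) =
    weightCoeff x k z - weightCoeff x (k + 1) z := by
  set a := ent x z k with ha
  let v : ℕ × Bool → K := fun p => if p.2 then a p.1 else a p.1 - 1
  let s : Finset (ℕ × Bool) := range (k + 1) ×ˢ univ
  let b : ℕ ⊕ ℕ → K := Sum.elim (ent x z (k + 1)) fun t => ent x z (k - 1) t - 1
  let T : Finset (ℕ ⊕ ℕ) := (range (k + 2)).disjSum (range k)
  have hne : ∀ i j, i ≠ j → ∀ d : ℤ, a i - a j ≠ d := fun i j hij d =>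
    hx.ent_ne z z (by simpa using hij) d
  have hv : Set.InjOn v s := by
    rintro ⟨i, c⟩ - ⟨j, c'⟩ - h
    by_cases hij : i = j
    · subst hij
      have h1 : a i ≠ a i - 1 := fun h => one_ne_zero (α := K) (by linear_combination h)
      rcases c with _ | _ <;> rcases c' with _ | _ <;> simp [v, h1, h1.symm] at h ⊢
    · exfalso
      rcases c with _ | _ <;> rcases c' with _ | _ <;> simp only [v, if_true, if_false, reduceCtorEq] at h
      · exact hne i j hij 0 (by push_cast; linear_combination h)
      · exact hne i j hij 1 (by push_cast; linear_combination h)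
      · exact hne i j hij (-1) (by push_cast; linear_combination h)
      · exact hne i j hij 0 (by push_cast; linear_combination h)
  have hcard : #T = #s := by
    simp only [T, s, card_disjSum, card_product, card_range, card_univ, Fintype.card_bool]
    omega
  have key := interpolation_sum_eq (b := b) hv hcard
  have hR : ∑ p ∈ s, v p - ∑ t ∈ T, b t = weightCoeff x k z - weightCoeff x (k + 1) z := by
    simp only [s, T, sum_product, sum_disjSum, v, b, Fintype.sum_bool, Sum.elim_inl, Sum.elim_inr,
      weightCoeff, ← ha, sum_sub_distrib, sum_add_distrib, if_true]
    simp
    ring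
  rw [← hR, ← key, sum_product]
  refine sum_congr rfl fun i hi => ?_
  have hden : ∀ c, ∏ p ∈ s.erase (i, c), (v (i, c) - v p) =
      (v (i, c) - v (i, !c)) * ∏ t ∈ (range (k + 1)).erase i,
        ((v (i, c) - a t) * (v (i, c) - a t + 1)) := by
    intro c
    have hs : s.erase (i, c) = insert (i, !c) ((range (k + 1)).erase i ×ˢ univ) := by
      ext ⟨j, c'⟩
      simp only [s, mem_erase, mem_product, mem_univ, and_true, mem_insert, Prod.mk.injEq, ne_eq]
      by_cases hj : j = i
      · subst hj
        rcases c with _ | _ <;> rcases c' with _ | _ <;> simp [mem_range.mp hi]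
      · simp [hj]
    rw [hs, prod_insert (by simp), prod_product]
    congr 1
    refine prod_congr rfl fun t _ => ?_
    rw [Fintype.prod_bool]
    simp only [v, if_true, reduceCtorEq, if_false]
    ring
  rw [Fintype.sum_bool, hden, hden]
  simp only [T, prod_disjSum, b, Sum.elim_inl, Sum.elim_inr, v, if_true, reduceCtorEq, if_false,
    Bool.not_true, Bool.not_false, prod_mul_distrib]
  have e1 : lowerCoeff x k i (z + unitShift k i 1) =
      (∏ t ∈ range k, (a i - (ent x z (k - 1) t - 1))) /
        ∏ t ∈ (range (k + 1)).erase i, (a i - a t + 1) := by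
    unfold lowerCoeff rowDen
    rw [ent_add_unitShift_self]
    congr 1
    · refine prod_congr rfl fun t ht => ?_
      have := mem_range.mp ht
      rw [ent_add_unitShift_of_ne x z _ (by simp; omega)]
      push_cast; ring
    · refine prod_congr rfl fun t ht => ?_
      rw [ent_add_unitShift_of_ne x z _ (by simpa using (ne_of_mem_erase ht))]
      push_cast; ring
  have e2 : raiseCoeff x k i (z + unitShift k i (-1)) =
      (∏ t ∈ range (k + 2), (a i - 1 - ent x z (k + 1) t)) /
        ∏ t ∈ (range (k + 1)).erase i, (a i - 1 - a t) := by
    unfold raiseCoeff rowDen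
    rw [ent_add_unitShift_self]
    congr 1
    · refine prod_congr rfl fun t ht => ?_
      rw [ent_add_unitShift_of_ne x z _ (by simp)]
      push_cast; ring
    · refine prod_congr rfl fun t ht => ?_
      rw [ent_add_unitShift_of_ne x z _ (by simpa using (ne_of_mem_erase ht))]
      push_cast; ring
  have e3 : ∏ t ∈ range k, (a i - 1 - (ent x z (k - 1) t - 1)) =
      ∏ t ∈ range k, (a i - ent x z (k - 1) t) := prod_congr rfl fun t _ => by ring
  have e4 : ∏ t ∈ (range (k + 1)).erase i, (a i - 1 - a t + 1) =
      ∏ t ∈ (range (k + 1)).erase i, (a i - a t) := prod_congr rfl fun t _ => by ring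
  rw [e1, e2, e3, e4]
  simp only [lowerCoeff, raiseCoeff, rowDen, ← ha]
  rw [show a i - (a i - 1) = 1 by ring, show a i - 1 - a i = -1 by ring, neg_one_mul, div_neg,
    one_mul, div_mul_div_comm, div_mul_div_comm, sub_eq_add_neg]
  congr 2
  · rw [mul_comm]
  · rw [mul_comm]

theorem raiseOp_lie_lowerOp (k : ℕ) :
    ⁅raiseOp x k, lowerOp x k⁆ = weightOp x k - weightOp x (k + 1) := by
  rw [raiseOp, lowerOp, neg_lie, sum_lie, weightOp, weightOp, op_sub]
  have h1 : ∀ i ∈ range (k + 1), ⁅op (raiseCoeff x k i) (unitShift k i 1),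
      ∑ j ∈ range (k + 1), op (lowerCoeff x k j) (unitShift k j (-1))⁆ =
      op (fun z => raiseCoeff x k i (z + unitShift k i (-1)) * lowerCoeff x k i z -
        lowerCoeff x k i (z + unitShift k i 1) * raiseCoeff x k i z) 0 := by
    intro i hi
    rw [lie_sum, sum_eq_single i, op_lie, ← unitShift_neg, add_neg_cancel]
    · intro j hj hji
      exact raise_lie_lower_row hx (mem_range.mp hi) (mem_range.mp hj) hji.symm
    · exact fun h => absurd hi h
  rw [sum_congr rfl h1, op_sum, op_neg]
  congr 1
  funext z
  rw [← raiseCoeff_mul_lowerCoeff_sum hx, ← sum_neg_distrib]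
  simp only [neg_sub]

/-! ### Double commutators for two adjacent rows, for raising (`s = 1`) and lowering (`s = -1`) at
once. -/

section Pair

variable {p q : ℕ} {s : ℤ} {I J : Finset ℕ} {α β : ℕ → Shift → K}
  (hpq : p ≠ q)
  (hα : ∀ i i' z, i' ∈ I → i ≠ i' → α i (z + unitShift p i' s) =
    α i z * ((ent x z p i - ent x z p i') / (ent x z p i - ent x z p i' - s)))
  (hβ : ∀ j j' z, j' ∈ J → j ≠ j' → β j (z + unitShift q j' s) =
    β j z * ((ent x z q j - ent x z q j') / (ent x z q j - ent x z q j' - s)))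
  (hαq : ∀ i j z, j ∈ J → α i (z + unitShift q j s) =
    α i z * ((ent x z p i - ent x z q j - s) / (ent x z p i - ent x z q j)))
  (hβp : ∀ j i z, β j (z + unitShift p i s) = β j z)

include hβp hαq hpq

theorem op_lie_op_of_interlaced (i : ℕ) {j : ℕ} (hj : j ∈ J) :
    ⁅op (α i) (unitShift p i s), op (β j) (unitShift q j s)⁆ =
      op (fun z => -s * (α i z * β j z / (ent x z p i - ent x z q j)))
        (unitShift p i s + unitShift q j s) := by
  rw [op_lie]
  congr 1
  funext z
  have h0 : ent x z p i - ent x z q j ≠ 0 := hx.sub_ne_zero z (by simp [hpq])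
  rw [hαq i j z hj, hβp]
  field_simp
  ring

include hα

/-- The terms for `(a, b)` and `(b, a)` have the same total shift, and their coefficients cancel by
a rational identity in the three entries `A`, `B`, `C`; a diagonal term vanishes by itself. For
raising operators `p` is the lower row of the two, for lowering operators the upper one. -/
theorem sum_lie_lie_eq_zero_of_interlaced {j : ℕ} (hj : j ∈ J) :
    ∑ i' ∈ I, ∑ i ∈ I, ⁅op (α i') (unitShift p i' s),
      ⁅op (α i) (unitShift p i s), op (β j) (unitShift q j s)⁆⁆ = 0 := by
  apply sum_sum_eq_zero_of_antisymm
  · intro a ha b hb hab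
    rw [op_lie_op_of_interlaced hx hpq hαq hβp _ hj, op_lie_op_of_interlaced hx hpq hαq hβp _ hj,
      op_lie, op_lie, ← add_assoc, ← add_assoc, add_comm (unitShift p b s) (unitShift p a s), op_add]
    convert op_zero _ using 2
    funext z
    have hA : ent x z p a - ent x z q j ≠ 0 := hx.sub_ne_zero z (by simp [hpq])
    have hB : ent x z p b - ent x z q j ≠ 0 := hx.sub_ne_zero z (by simp [hpq])
    have hab1 : ent x z p a - ent x z p b - s ≠ 0 := fun h =>
      hx.ent_ne z z (k := p) (i := a) (l := p) (j := b) (by simpa using hab) s (sub_eq_zero.mp h)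
    have hab2 : ent x z p b - ent x z p a - s ≠ 0 := fun h =>
      hx.ent_ne z z (k := p) (i := b) (l := p) (j := a) (by simpa using hab.symm) s
        (sub_eq_zero.mp h)
    rw [← add_assoc, ← add_assoc, hαq _ _ _ hj, hαq _ _ _ hj, hβp, hβp, hα a b z hb hab,
      hα b a z ha hab.symm]
    simp only [ent_add_unitShift_of_ne x z (k := p) (l := q) s (by simp [hpq.symm]),
      ent_add_unitShift_of_ne x z (k := p) (i := a) (l := p) (j := b) s (by simp [hab.symm]),
      ent_add_unitShift_of_ne x z (k := p) (i := b) (l := p) (j := a) s (by simp [hab])]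
    generalize ent x z p a = A at *
    generalize ent x z p b = B at *
    generalize ent x z q j = C at *
    field_simp
    ring
  · intro a ha
    rw [op_lie_op_of_interlaced hx hpq hαq hβp _ hj]
    refine op_lie_eq_zero fun z => ?_
    have hA : ent x z p a - ent x z q j ≠ 0 := hx.sub_ne_zero z (by simp [hpq])
    have hA' : ent x z p a + s - ent x z q j ≠ 0 := fun h =>
      hx.ent_ne z z (k := p) (i := a) (l := q) (j := j) (by simp [hpq]) (-s)
        (by push_cast; linear_combination h)
    rw [← add_assoc, hαq _ _ _ hj, hβp]
    simp only [ent_add_unitShift_of_ne x z (k := p) (l := q) s (by simp [hpq.symm]),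
      ent_add_unitShift_self]
    generalize ent x z p a = A at *
    generalize ent x z q j = C at *
    field_simp
    ring

omit hα
include hβ

theorem sum_lie_lie_eq_zero_of_interlaced' (i : ℕ) :
    ∑ j' ∈ J, ∑ j ∈ J, ⁅op (β j') (unitShift q j' s),
      ⁅op (β j) (unitShift q j s), op (α i) (unitShift p i s)⁆⁆ = 0 := by
  have hsk : ∀ j ∈ J, ⁅op (β j) (unitShift q j s), op (α i) (unitShift p i s)⁆ =
      -op (fun z => -s * (α i z * β j z / (ent x z p i - ent x z q j)))
        (unitShift p i s + unitShift q j s) := fun j hj => by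
    rw [← lie_skew, op_lie_op_of_interlaced hx hpq hαq hβp _ hj]
  apply sum_sum_eq_zero_of_antisymm
  · intro a ha b hb hab
    rw [hsk a ha, hsk b hb, lie_neg, lie_neg, ← neg_add, neg_eq_zero, op_lie, op_lie,
      add_left_comm (unitShift q a s), add_left_comm (unitShift q b s),
      add_comm (unitShift q b s) (unitShift q a s), op_add]
    convert op_zero _ using 2
    funext z
    have hA : ent x z p i - ent x z q a ≠ 0 := hx.sub_ne_zero z (by simp [hpq])
    have hB : ent x z p i - ent x z q b ≠ 0 := hx.sub_ne_zero z (by simp [hpq])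
    have hab1 : ent x z q a - ent x z q b - s ≠ 0 := fun h =>
      hx.ent_ne z z (k := q) (i := a) (l := q) (j := b) (by simpa using hab) s (sub_eq_zero.mp h)
    have hab2 : ent x z q b - ent x z q a - s ≠ 0 := fun h =>
      hx.ent_ne z z (k := q) (i := b) (l := q) (j := a) (by simpa using hab.symm) s
        (sub_eq_zero.mp h)
    rw [add_comm (unitShift p i s) (unitShift q b s), add_comm (unitShift p i s) (unitShift q a s),
      ← add_assoc, ← add_assoc, hβp, hβp, hβ a b z hb hab, hβ b a z ha hab.symm, hαq _ _ _ ha,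
      hαq _ _ _ hb]
    simp only [ent_add_unitShift_of_ne x z (k := q) (l := p) s (by simp [hpq]),
      ent_add_unitShift_of_ne x z (k := q) (i := a) (l := q) (j := b) s (by simp [hab.symm]),
      ent_add_unitShift_of_ne x z (k := q) (i := b) (l := q) (j := a) s (by simp [hab])]
    generalize ent x z q a = A at *
    generalize ent x z q b = B at *
    generalize ent x z p i = C at *
    field_simp
    ring
  · intro a ha
    rw [hsk a ha, lie_neg, neg_eq_zero]
    refine op_lie_eq_zero fun z => ?_
    have hA : ent x z p i - ent x z q a ≠ 0 := hx.sub_ne_zero z (by simp [hpq])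
    have hA' : ent x z p i - (ent x z q a + s) ≠ 0 := fun h =>
      hx.ent_ne z z (k := p) (i := i) (l := q) (j := a) (by simp [hpq]) s
        (by linear_combination h)
    rw [add_comm (unitShift p i s) (unitShift q a s), ← add_assoc, hβp, hαq _ _ _ ha]
    simp only [ent_add_unitShift_of_ne x z (k := q) (l := p) s (by simp [hpq]),
      ent_add_unitShift_self]
    generalize ent x z q a = A at *
    generalize ent x z p i = C at *
    field_simp
    ring

end Pair

theorem raiseOp_serre (k : ℕ) : ⁅raiseOp x k, ⁅raiseOp x k, raiseOp x (k + 1)⁆⁆ = 0 := by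
  simp only [raiseOp, neg_lie, lie_neg, neg_neg, neg_eq_zero]
  rw [lie_sum, lie_sum]
  refine sum_eq_zero fun j hj => ?_
  simp only [sum_lie]
  simp only [lie_sum]
  exact sum_lie_lie_eq_zero_of_interlaced hx (α := raiseCoeff x k) (β := raiseCoeff x (k + 1))
    (I := range (k + 1))
    (J := range (k + 2)) (by simp)
    (fun i i' z hi' hii' => raiseCoeff_add_unitShift_row hx (mem_range.mp hi') hii' 1 z)
    (fun i j z hj => raiseCoeff_add_unitShift_succ hx (mem_range.mp hj) 1 z)
    (fun j i z => raiseCoeff_add_unitShift_of_ne x 1 z (by omega) (by omega)) hj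

theorem raiseOp_serre' (k : ℕ) : ⁅raiseOp x (k + 1), ⁅raiseOp x (k + 1), raiseOp x k⁆⁆ = 0 := by
  simp only [raiseOp, neg_lie, lie_neg, neg_neg, neg_eq_zero]
  rw [lie_sum, lie_sum]
  refine sum_eq_zero fun i hi => ?_
  simp only [sum_lie]
  simp only [lie_sum]
  exact sum_lie_lie_eq_zero_of_interlaced' hx (α := raiseCoeff x k) (β := raiseCoeff x (k + 1))
    (J := range (k + 2)) (by simp)
    (fun i i' z hi' hii' => raiseCoeff_add_unitShift_row hx (mem_range.mp hi') hii' 1 z)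
    (fun i j z hj => raiseCoeff_add_unitShift_succ hx (mem_range.mp hj) 1 z)
    (fun j i z => raiseCoeff_add_unitShift_of_ne x 1 z (by omega) (by omega)) i

theorem lowerOp_serre (k : ℕ) : ⁅lowerOp x k, ⁅lowerOp x k, lowerOp x (k + 1)⁆⁆ = 0 := by
  simp only [lowerOp]
  rw [lie_sum, lie_sum]
  refine sum_eq_zero fun i hi => ?_
  simp only [sum_lie]
  simp only [lie_sum]
  exact sum_lie_lie_eq_zero_of_interlaced' hx (α := lowerCoeff x (k + 1)) (β := lowerCoeff x k)
    (J := range (k + 1)) (by simp)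
    (fun i i' z hi' hii' => lowerCoeff_add_unitShift_row hx (mem_range.mp hi') hii' (-1) z)
    (fun i j z hj => lowerCoeff_add_unitShift_pred hx (mem_range.mp hj) (-1) z)
    (fun j i z => lowerCoeff_add_unitShift_of_ne x (-1) z (by omega) (by omega)) i

theorem lowerOp_serre' (k : ℕ) : ⁅lowerOp x (k + 1), ⁅lowerOp x (k + 1), lowerOp x k⁆⁆ = 0 := by
  simp only [lowerOp]
  rw [lie_sum, lie_sum]
  refine sum_eq_zero fun j hj => ?_
  simp only [sum_lie]
  simp only [lie_sum]
  exact sum_lie_lie_eq_zero_of_interlaced hx (α := lowerCoeff x (k + 1)) (β := lowerCoeff x k)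
    (I := range (k + 2))
    (J := range (k + 1)) (by simp)
    (fun i i' z hi' hii' => lowerCoeff_add_unitShift_row hx (mem_range.mp hi') hii' (-1) z)
    (fun i j z hj => lowerCoeff_add_unitShift_pred hx (mem_range.mp hj) (-1) z)
    (fun j i z => lowerCoeff_add_unitShift_of_ne x (-1) z (by omega) (by omega)) hj

end Serre

end GelfandTsetlin

namespace GelfandTsetlin

attribute [local instance 2000] Ring.toAddCommGroup

/-! ### From the Serre relations to `𝔤𝔩(∞)` -/

section SerreToGL

variable {L : Type*} [LieRing L]

/-- The Serre relations of `𝔤𝔩(∞)`. -/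
structure SerreRelations (e f h : ℕ → L) : Prop where
  hh : ∀ i j, ⁅h i, h j⁆ = 0
  he : ∀ i, ⁅h i, e i⁆ = e i
  he_succ : ∀ i, ⁅h (i + 1), e i⁆ = -e i
  he_ne : ∀ i j, i ≠ j → i ≠ j + 1 → ⁅h i, e j⁆ = 0
  hf : ∀ i, ⁅h i, f i⁆ = -f i
  hf_succ : ∀ i, ⁅h (i + 1), f i⁆ = f i
  hf_ne : ∀ i j, i ≠ j → i ≠ j + 1 → ⁅h i, f j⁆ = 0
  ef : ∀ i, ⁅e i, f i⁆ = h i - h (i + 1)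
  ef_ne : ∀ i j, i ≠ j → ⁅e i, f j⁆ = 0
  ee_far : ∀ i j, i + 1 < j → ⁅e i, e j⁆ = 0
  ee : ∀ i, ⁅e i, ⁅e i, e (i + 1)⁆⁆ = 0
  ee' : ∀ i, ⁅e (i + 1), ⁅e (i + 1), e i⁆⁆ = 0
  ff_far : ∀ i j, i + 1 < j → ⁅f i, f j⁆ = 0
  ff : ∀ i, ⁅f i, ⁅f i, f (i + 1)⁆⁆ = 0
  ff' : ∀ i, ⁅f (i + 1), ⁅f (i + 1), f i⁆⁆ = 0

/-- The iterated commutator `E_{r,r+d+1}` of the raising elements. -/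
def upper (e : ℕ → L) (r : ℕ) : ℕ → L
  | 0 => e r
  | d + 1 => ⁅upper e r d, e (r + d + 1)⁆

/-- The iterated commutator `E_{r+d+1,r}` of the lowering elements. -/
def lower (f : ℕ → L) (r : ℕ) : ℕ → L
  | 0 => f r
  | d + 1 => ⁅f (r + d + 1), lower f r d⁆

/-- The elements `E_{rs}` generated by `e`, `f` and `h`. -/
def unitElt (e f h : ℕ → L) (r s : ℕ) : L :=
  if r < s then upper e r (s - r - 1) else if s < r then lower f s (r - s - 1) else h r

variable {e f h : ℕ → L}

/-- The Chevalley involution. It transports each bracket with raising elements to one with lowering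
elements, so only half of the brackets is computed. -/
theorem SerreRelations.neg (H : SerreRelations e f h) :
    SerreRelations (fun i => -f i) (fun i => -e i) (fun i => -h i) where
  hh i j := by simp [H.hh]
  he i := by simp [H.hf]
  he_succ i := by simp [H.hf_succ]
  he_ne i j h1 h2 := by simp [H.hf_ne i j h1 h2]
  hf i := by simp [H.he]
  hf_succ i := by simp [H.he_succ]
  hf_ne i j h1 h2 := by simp [H.he_ne i j h1 h2]
  ef i := by simp only [neg_lie, lie_neg, neg_neg]; rw [← lie_skew, H.ef]; abel
  ef_ne i j hij := by simp only [neg_lie, lie_neg, neg_neg]; rw [← lie_skew, H.ef_ne j i hij.symm]; simp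
  ee_far i j hij := by simp [H.ff_far i j hij]
  ee i := by simp [H.ff]
  ee' i := by simp [H.ff']
  ff_far i j hij := by simp [H.ee_far i j hij]
  ff i := by simp [H.ee]
  ff' i := by simp [H.ee']

theorem upper_neg (f : ℕ → L) (r d : ℕ) : upper (fun i => -f i) r d = -lower f r d := by
  induction d with
  | zero => rfl
  | succ d ih => rw [upper, ih, lower, neg_lie, lie_neg, neg_neg, ← lie_skew]

theorem SerreRelations.e_lie_e_far (H : SerreRelations e f h) {i j : ℕ}
    (hij : i + 1 < j ∨ j + 1 < i) : ⁅e i, e j⁆ = 0 := by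
  rcases hij with h1 | h1
  · exact H.ee_far i j h1
  · rw [← lie_skew, H.ee_far j i h1, neg_zero]

theorem lie_lie_eq_zero {a b c : L} (h1 : ⁅a, b⁆ = 0) (h2 : ⁅a, c⁆ = 0) : ⁅a, ⁅b, c⁆⁆ = 0 := by
  rw [leibniz_lie, h1, h2, zero_lie, lie_zero, add_zero]

theorem lie_eq_zero_symm {a b : L} (h1 : ⁅a, b⁆ = 0) : ⁅b, a⁆ = 0 := by
  rw [← lie_skew, h1, neg_zero]

theorem SerreRelations.e_lie_upper_far (H : SerreRelations e f h) (r d k : ℕ)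
    (hk : k + 1 < r ∨ r + d + 1 < k) : ⁅e k, upper e r d⁆ = 0 := by
  induction d with
  | zero => exact H.e_lie_e_far (by omega)
  | succ d ih => exact lie_lie_eq_zero (ih (by omega)) (H.e_lie_e_far (by omega))

theorem SerreRelations.e_lie_upper_top (_ : SerreRelations e f h) (r d : ℕ) :
    ⁅e (r + d + 1), upper e r d⁆ = -upper e r (d + 1) := by
  rw [upper, lie_skew]

theorem SerreRelations.e_lie_upper_bot (H : SerreRelations e f h) (r d : ℕ) :
    ⁅e r, upper e (r + 1) d⁆ = upper e r (d + 1) := by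
  induction d with
  | zero => rfl
  | succ d ih =>
    rw [upper, leibniz_lie, ih, H.e_lie_e_far (i := r) (by omega), lie_zero, add_zero,
      upper, upper, show r + 1 + d + 1 = r + (d + 1) + 1 by ring]
    rfl

/-- The commutator of `e k` and `upper e r d` if `k` is the last index that occurs. -/
theorem SerreRelations.e_lie_upper_last (H : SerreRelations e f h) (r d : ℕ) :
    ⁅e (r + d + 1), upper e r (d + 1)⁆ = 0 := by
  induction d with
  | zero =>
    show ⁅e (r + 1), ⁅e r, e (r + 1)⁆⁆ = 0
    rw [← lie_skew (e r), lie_neg, H.ee', neg_zero]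
  | succ d _ =>
    have h1 : ⁅e (r + d + 2), upper e r d⁆ = 0 := H.e_lie_upper_far r d _ (by omega)
    -- Regrouped so that `e (r + d + 2)` commutes with the left factor and meets only the last two
    -- letters.
    have h2 : upper e r (d + 2) = ⁅upper e r d, ⁅e (r + d + 1), e (r + d + 2)⁆⁆ := by
      rw [upper, upper, lie_lie, show r + (d + 1) + 1 = r + d + 2 by ring,
        lie_eq_zero_symm h1, lie_zero, sub_zero]
    have h3 : ⁅e (r + d + 2), ⁅e (r + d + 1), e (r + d + 2)⁆⁆ = 0 := by
      rw [← lie_skew (e (r + d + 1)), lie_neg]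
      rw [show r + d + 2 = (r + d + 1) + 1 by ring, H.ee', neg_zero]
    rw [h2]
    exact lie_lie_eq_zero h1 h3

theorem SerreRelations.e_lie_upper_first (H : SerreRelations e f h) (r d : ℕ) :
    ⁅e r, upper e r (d + 1)⁆ = 0 := by
  induction d with
  | zero => exact H.ee r
  | succ d ih => exact lie_lie_eq_zero ih (H.e_lie_e_far (by omega))

/-- `[e_1, [[e_0, e_1], e_2]] = 0` in a Lie ring without 2-torsion. -/
theorem SerreRelations.e_lie_upper_two (H : SerreRelations e f h)
    (h2 : ∀ a : L, a + a = 0 → a = 0) (r : ℕ) : ⁅e (r + 1), upper e r 2⁆ = 0 := by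
  show ⁅e (r + 1), ⁅⁅e r, e (r + 1)⁆, e (r + 2)⁆⁆ = 0
  set a := e r
  set b := e (r + 1) with hb
  set c := e (r + 2) with hc
  have hac : ⁅a, c⁆ = 0 := H.ee_far _ _ (by omega)
  have hbab : ⁅b, ⁅a, b⁆⁆ = 0 := by rw [← lie_skew a, lie_neg, H.ee', neg_zero]
  have hbbc : ⁅b, ⁅b, c⁆⁆ = 0 := H.ee (r + 1)
  apply h2
  -- both expansions of `[[a, b], [b, c]]`
  have e1 : ⁅b, ⁅⁅a, b⁆, c⁆⁆ = ⁅⁅a, b⁆, ⁅b, c⁆⁆ := by rw [leibniz_lie, hbab, zero_lie, zero_add]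
  have e2 : ⁅⁅a, b⁆, c⁆ = ⁅a, ⁅b, c⁆⁆ := by rw [lie_lie, hac, lie_zero, sub_zero]
  have e3 : ⁅b, ⁅a, ⁅b, c⁆⁆⁆ = ⁅⁅b, a⁆, ⁅b, c⁆⁆ := by rw [leibniz_lie, hbbc, lie_zero, add_zero]
  have e4 : ⁅⁅b, a⁆, ⁅b, c⁆⁆ = -⁅⁅a, b⁆, ⁅b, c⁆⁆ := by rw [← lie_skew a b, neg_lie, neg_neg]
  calc ⁅b, ⁅⁅a, b⁆, c⁆⁆ + ⁅b, ⁅⁅a, b⁆, c⁆⁆ = ⁅⁅a, b⁆, ⁅b, c⁆⁆ + ⁅b, ⁅a, ⁅b, c⁆⁆⁆ := by rw [e1, ← e2, e1]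
    _ = 0 := by rw [e3, e4, add_neg_cancel]

/-- Letters after `k + 1` commute with `e k` and are removed by induction. When `k` is the
next-to-last letter, the front part, which also commutes with `e k`, is split off; what remains is
the bracket with three letters, the only place where torsion matters. -/
theorem SerreRelations.e_lie_upper_mid (H : SerreRelations e f h)
    (h2 : ∀ a : L, a + a = 0 → a = 0) (r d k : ℕ) (hr : r < k) (hd : k < r + d) :
    ⁅e k, upper e r d⁆ = 0 := by
  induction d with
  | zero => omega
  | succ d ih =>
    by_cases hk : k < r + d
    · exact lie_lie_eq_zero (ih hk) (H.e_lie_e_far (by omega))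
    obtain rfl : k = r + d := by omega
    obtain ⟨d, rfl⟩ : ∃ d', d = d' + 1 := ⟨d - 1, by omega⟩
    -- `upper e r (d + 2)` ends with `e (r + d), e (r + d + 1), e (r + d + 2)`
    rcases d with _ | d
    · exact H.e_lie_upper_two h2 r
    have far : ∀ k, r + d + 1 < k → ⁅upper e r d, e k⁆ = 0 := fun k hk =>
      lie_eq_zero_symm (H.e_lie_upper_far r d k (by omega))
    have e1 : upper e r (d + 3) = ⁅upper e r d, upper e (r + d + 1) 2⁆ := by
      show ⁅⁅⁅upper e r d, e (r + d + 1)⁆, e (r + (d + 1) + 1)⁆, e (r + (d + 2) + 1)⁆ =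
        ⁅upper e r d, ⁅⁅e (r + d + 1), e (r + d + 1 + 1)⁆, e (r + d + 1 + 1 + 1)⁆⁆
      rw [leibniz_lie (upper e r d), far (r + d + 1 + 1 + 1) (by omega), lie_zero, add_zero,
        leibniz_lie (upper e r d), far (r + d + 1 + 1) (by omega), lie_zero, add_zero]
      rfl
    show ⁅e (r + (d + 1 + 1)), upper e r (d + 3)⁆ = 0
    rw [e1]
    refine lie_lie_eq_zero (lie_eq_zero_symm (far _ (by omega))) ?_
    exact H.e_lie_upper_two h2 (r + d + 1)

theorem SerreRelations.h_lie_upper (H : SerreRelations e f h) (r d k : ℕ) :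
    ⁅h k, upper e r d⁆ =
      (if k = r then upper e r d else 0) - if k = r + d + 1 then upper e r d else 0 := by
  induction d with
  | zero =>
    show ⁅h k, e r⁆ = (if k = r then e r else 0) - if k = r + 1 then e r else 0
    by_cases h1 : k = r
    · subst h1; simp [H.he]
    · by_cases h3 : k = r + 1
      · subst h3; simp [H.he_succ]
      · simp [h1, h3, H.he_ne]
  | succ d ih =>
    rw [upper, leibniz_lie, ih]
    by_cases h1 : k = r
    · subst h1
      rw [H.he_ne _ _ (by omega) (by omega)]
      have h3 : k ≠ k + d + 1 := by omega
      have h4 : k ≠ k + (d + 1) + 1 := by omega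
      simp [h3, h4]
    · by_cases h3 : k = r + d + 1
      · subst h3
        rw [H.he]
        simp [h1]
        rw [← lie_skew, neg_add_cancel]
      · by_cases h4 : k = r + (d + 1) + 1
        · subst h4
          rw [show r + (d + 1) + 1 = r + d + 1 + 1 by ring, H.he_succ]
          have h5 : r + d + 1 + 1 ≠ r := by omega
          simp [h5]
        · rw [H.he_ne _ _ h3 (by omega)]
          simp [h1, h3, h4]

theorem SerreRelations.f_lie_e (H : SerreRelations e f h) (i : ℕ) :
    ⁅f i, e i⁆ = h (i + 1) - h i := by
  rw [← lie_skew, H.ef, neg_sub]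

theorem SerreRelations.f_lie_e_ne (H : SerreRelations e f h) {i j : ℕ} (hij : i ≠ j) :
    ⁅f i, e j⁆ = 0 :=
  lie_eq_zero_symm (H.ef_ne j i hij.symm)

theorem SerreRelations.f_lie_upper_last (H : SerreRelations e f h) (r d : ℕ)  :
    ⁅f (r + d + 1), upper e r (d + 1)⁆ = -upper e r d := by
  have far : ∀ d' k, r + d' < k → ⁅f k, upper e r d'⁆ = 0 := by
    intro d' k hk
    induction d' with
    | zero => exact H.f_lie_e_ne (by omega)
    | succ d' ih => exact lie_lie_eq_zero (ih (by omega)) (H.f_lie_e_ne (by omega))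
  rw [upper, leibniz_lie, far d _ (by omega), zero_lie, zero_add, H.f_lie_e, ← lie_skew, sub_lie,
    H.h_lie_upper, H.h_lie_upper]
  have h1 : r + d + 1 + 1 ≠ r := by omega
  have h3 : r + d + 1 ≠ r := by omega
  simp [h1, h3]

theorem SerreRelations.f_lie_upper_first (H : SerreRelations e f h) (r d : ℕ) :
    ⁅f r, upper e r (d + 1)⁆ = upper e (r + 1) d := by
  induction d with
  | zero =>
    show ⁅f r, ⁅e r, e (r + 1)⁆⁆ = e (r + 1)
    rw [leibniz_lie, H.f_lie_e, H.f_lie_e_ne (by omega), lie_zero, add_zero, sub_lie, H.he,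
      H.he_ne _ _ (by omega) (by omega), sub_zero]
  | succ d ih =>
    rw [upper, leibniz_lie, ih, H.f_lie_e_ne (by omega), lie_zero, add_zero, upper]
    congr 2
    ring

theorem SerreRelations.f_lie_upper_ne (H : SerreRelations e f h) (r d k : ℕ) (h1 : k ≠ r)
    (h3 : k ≠ r + d) : ⁅f k, upper e r d⁆ = 0 := by
  induction d with
  | zero => exact H.f_lie_e_ne h1
  | succ d ih =>
    by_cases h4 : k = r + d
    · subst h4
      obtain ⟨d, rfl⟩ : ∃ d', d = d' + 1 := ⟨d - 1, by omega⟩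
      rw [upper, leibniz_lie, H.f_lie_e_ne (by omega), lie_zero, add_zero, ← add_assoc,
        H.f_lie_upper_last, neg_lie, neg_eq_zero]
      exact lie_eq_zero_symm (H.e_lie_upper_far _ _ _ (by omega))
    · exact lie_lie_eq_zero (ih h4) (H.f_lie_e_ne (by omega))

theorem unitElt_upper (e f h : ℕ → L) (r d : ℕ) : unitElt e f h r (r + d + 1) = upper e r d := by
  rw [unitElt, if_pos (by omega)]
  congr 1
  omega

theorem unitElt_lower (e f h : ℕ → L) (r d : ℕ) : unitElt e f h (r + d + 1) r = lower f r d := by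
  rw [unitElt, if_neg (by omega), if_pos (by omega)]
  congr 1
  omega

theorem unitElt_self (e f h : ℕ → L) (r : ℕ) : unitElt e f h r r = h r := by
  simp [unitElt]

theorem unitElt_neg (e f h : ℕ → L) (r s : ℕ) :
    unitElt (fun i => -f i) (fun i => -e i) (fun i => -h i) r s = -unitElt e f h s r := by
  rcases lt_trichotomy r s with hrs | rfl | hrs
  · obtain ⟨d, rfl⟩ := Nat.exists_eq_add_of_lt hrs
    rw [unitElt_upper, unitElt_lower, upper_neg]
  · rw [unitElt_self, unitElt_self]
  · obtain ⟨d, rfl⟩ := Nat.exists_eq_add_of_lt hrs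
    have h1 := upper_neg (fun i => -e i) s d
    simp only [neg_neg] at h1
    rw [unitElt_upper, unitElt_lower, h1, neg_neg]

theorem SerreRelations.e_lie_lower_first (H : SerreRelations e f h) (r d : ℕ) :
    ⁅e r, lower f r (d + 1)⁆ = -lower f (r + 1) d := by
  have h1 := H.neg.f_lie_upper_first r d
  rwa [upper_neg, upper_neg, neg_lie, lie_neg, neg_neg] at h1

theorem SerreRelations.e_lie_lower_last (H : SerreRelations e f h) (r d : ℕ) :
    ⁅e (r + d + 1), lower f r (d + 1)⁆ = lower f r d := by
  have h1 := H.neg.f_lie_upper_last r d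
  rwa [upper_neg, upper_neg, neg_lie, lie_neg, neg_neg, neg_neg] at h1

theorem SerreRelations.e_lie_lower_ne (H : SerreRelations e f h) (r d k : ℕ) (h1 : k ≠ r)
    (h3 : k ≠ r + d) : ⁅e k, lower f r d⁆ = 0 := by
  have h4 := H.neg.f_lie_upper_ne r d k h1 h3
  rwa [upper_neg, neg_lie, lie_neg, neg_neg] at h4

theorem SerreRelations.e_lie_unitElt (H : SerreRelations e f h)
    (h2 : ∀ a : L, a + a = 0 → a = 0) (k r s : ℕ) :
    ⁅e k, unitElt e f h r s⁆ = (if k + 1 = r then unitElt e f h k s else 0) -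
      if k = s then unitElt e f h r (k + 1) else 0 := by
  rcases lt_trichotomy r s with hrs | rfl | hrs
  · obtain ⟨d, rfl⟩ := Nat.exists_eq_add_of_lt hrs
    rw [unitElt_upper]
    by_cases h1 : k + 1 = r
    · subst h1
      rw [if_pos rfl, if_neg (by omega), sub_zero, H.e_lie_upper_bot,
        show k + 1 + d + 1 = k + (d + 1) + 1 by ring, unitElt_upper]
    rw [if_neg h1]
    by_cases h3 : k = r + d + 1
    · subst h3
      rw [if_pos rfl, H.e_lie_upper_top, show r + d + 1 + 1 = r + (d + 1) + 1 by ring,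
        unitElt_upper, zero_sub]
    rw [if_neg h3, sub_zero]
    by_cases h4 : k + 1 < r ∨ r + d + 1 < k
    · exact H.e_lie_upper_far r d k h4
    rcases d with _ | d
    · obtain rfl : k = r := by omega
      exact lie_self _
    by_cases h5 : k = r
    · subst h5
      exact H.e_lie_upper_first k d
    by_cases h6 : k = r + d + 1
    · subst h6
      exact H.e_lie_upper_last r d
    · exact H.e_lie_upper_mid h2 r _ k (by omega) (by omega)
  · rw [unitElt_self, ← lie_skew]
    by_cases h1 : k = r
    · subst h1
      rw [H.he, if_neg (by omega), if_pos rfl, unitElt_upper e f h k 0, zero_sub]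
      rfl
    · rw [if_neg h1]
      by_cases h3 : k + 1 = r
      · subst h3
        rw [H.he_succ, if_pos rfl, unitElt_upper e f h k 0, neg_neg, sub_zero]
        rfl
      · rw [if_neg h3, H.he_ne _ _ (Ne.symm h1) (Ne.symm h3), neg_zero, sub_zero]
  · obtain ⟨d, rfl⟩ := Nat.exists_eq_add_of_lt hrs
    rw [unitElt_lower]
    rcases d with _ | d
    · show ⁅e k, f s⁆ = _
      by_cases h1 : k = s
      · subst h1
        rw [H.ef, if_pos rfl, if_pos rfl]
        simp only [add_zero, unitElt_self]
      · rw [if_neg (by omega), if_neg h1, H.ef_ne _ _ h1, sub_zero]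
    · by_cases h1 : k = s
      · subst h1
        rw [H.e_lie_lower_first, if_neg (by omega), if_pos rfl,
          show k + (d + 1) + 1 = k + 1 + d + 1 by ring, unitElt_lower, zero_sub]
      · rw [if_neg h1]
        by_cases h3 : k = s + d + 1
        · subst h3
          rw [H.e_lie_lower_last, if_pos (by omega), unitElt_lower, sub_zero]
        · rw [if_neg (by omega), H.e_lie_lower_ne _ _ _ h1 (by omega), sub_zero]

theorem SerreRelations.h_lie_unitElt (H : SerreRelations e f h) (k r s : ℕ) :
    ⁅h k, unitElt e f h r s⁆ = (if k = r then unitElt e f h k s else 0) -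
      if k = s then unitElt e f h r k else 0 := by
  rcases lt_trichotomy r s with hrs | rfl | hrs
  · obtain ⟨d, rfl⟩ := Nat.exists_eq_add_of_lt hrs
    rw [unitElt_upper, H.h_lie_upper]
    congr 1
    · split_ifs with h1
      · subst h1; rw [unitElt_upper]
      · rfl
    · split_ifs with h1
      · subst h1; rw [unitElt_upper]
      · rfl
  · rw [unitElt_self, H.hh]
    split_ifs with h1
    · subst h1; simp
    · simp
  · obtain ⟨d, rfl⟩ := Nat.exists_eq_add_of_lt hrs
    have h1 := H.neg.h_lie_upper s d k
    rw [upper_neg, neg_lie, lie_neg, neg_neg] at h1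
    rw [unitElt_lower, h1]
    split_ifs with h3 h4 h4
    · omega
    · subst h3; rw [unitElt_lower]; simp
    · subst h4; rw [unitElt_lower]; simp
    · simp

/-- The structure relations of `𝔤𝔩(∞)`. -/
def GLRelation (E : ℕ → ℕ → L) (i j k l : ℕ) : Prop :=
  ⁅E i j, E k l⁆ = (if j = k then (1 : ℤ) else 0) • E i l - (if i = l then (1 : ℤ) else 0) • E k j

/-- Jacobi identity: as `E i m = [E i j, E j m]`, its brackets follow from those of the two factors.
So the brackets of the simple raising elements with everything suffice. -/
theorem GLRelation.trans {E : ℕ → ℕ → L} {i j m : ℕ} (him : i ≠ m)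
    (h : E i m = ⁅E i j, E j m⁆) (h1 : ∀ k l, GLRelation E i j k l)
    (h2 : ∀ k l, GLRelation E j m k l) (k l : ℕ) : GLRelation E i m k l := by
  unfold GLRelation at *
  rw [h, lie_lie, h2, h1, lie_sub, lie_sub, lie_zsmul, lie_zsmul, lie_zsmul, lie_zsmul, h1, h1, h2,
    h2, if_neg him, if_neg him.symm, if_pos rfl]
  module

theorem SerreRelations.glRelation_upper (H : SerreRelations e f h)
    (h2 : ∀ a : L, a + a = 0 → a = 0) (i d k l : ℕ) :
    GLRelation (unitElt e f h) i (i + d + 1) k l := by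
  have hE : ∀ i, unitElt e f h i (i + 1) = e i := fun i => unitElt_upper e f h i 0
  have hg : ∀ i k l, GLRelation (unitElt e f h) i (i + 1) k l := by
    intro i k l
    unfold GLRelation
    rw [hE, H.e_lie_unitElt h2]
    simp only [ite_smul, one_smul, zero_smul]
  induction d generalizing k l with
  | zero => exact hg i k l
  | succ d ih =>
    refine GLRelation.trans (by omega) ?_ ih (hg (i + d + 1)) k l
    rw [unitElt_upper, hE]
    exact unitElt_upper e f h i (d + 1)

/-- The elements `E_{ij}` satisfy the relations of `𝔤𝔩(∞)`. -/
theorem SerreRelations.glRelation (H : SerreRelations e f h)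
    (h2 : ∀ a : L, a + a = 0 → a = 0) (i j k l : ℕ) : GLRelation (unitElt e f h) i j k l := by
  rcases lt_trichotomy i j with hij | rfl | hij
  · obtain ⟨d, rfl⟩ := Nat.exists_eq_add_of_lt hij
    exact H.glRelation_upper h2 i d k l
  · unfold GLRelation
    rw [unitElt_self, H.h_lie_unitElt]
    simp only [ite_smul, one_smul, zero_smul]
  · obtain ⟨d, rfl⟩ := Nat.exists_eq_add_of_lt hij
    have h1 := H.neg.glRelation_upper h2 j d l k
    unfold GLRelation at h1 ⊢
    simp only [unitElt_neg, neg_lie, lie_neg, neg_neg] at h1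
    rw [h1, if_congr (eq_comm (a := j)) rfl rfl]
    module

end SerreToGL

/-! ### The generic Gelfand–Tsetlin module. -/

section

variable {K : Type*} [Field K] {x : ℕ → ℕ → K}

theorem serreRelations_generic (hx : IsGenericTab x) :
    SerreRelations (raiseOp x) (lowerOp x) (weightOp x) where
  hh := weightOp_lie_weightOp x
  he i := by simp [weightOp_lie_raiseOp]
  he_succ i := by simp [weightOp_lie_raiseOp]
  he_ne i j h1 h2 := by simp [weightOp_lie_raiseOp, h1, h2]
  hf i := by simp [weightOp_lie_lowerOp]
  hf_succ i := by simp [weightOp_lie_lowerOp]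
  hf_ne i j h1 h2 := by simp [weightOp_lie_lowerOp, h1, h2]
  ef := raiseOp_lie_lowerOp hx
  ef_ne _ _ h := raiseOp_lie_lowerOp_of_ne hx h
  ee_far _ _ h := raiseOp_lie_raiseOp_of_far x h
  ee := raiseOp_serre hx
  ee' := raiseOp_serre' hx
  ff_far _ _ h := lowerOp_lie_lowerOp_of_far x h
  ff := lowerOp_serre hx
  ff' := lowerOp_serre' hx

variable (x) in
/-- The operator `E_{rs}` of the generic Gelfand–Tsetlin module (rows and columns are counted
from `0`). -/
noncomputable def genE (r s : ℕ) : OpAlg K := unitElt (raiseOp x) (lowerOp x) (weightOp x) r s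

theorem genE_lie [CharZero K] (hx : IsGenericTab x) (i j k l : ℕ) :
    genE x i j * genE x k l - genE x k l * genE x i j =
      (if j = k then genE x i l else 0) - if i = l then genE x k j else 0 := by
  have h := (serreRelations_generic hx).glRelation (fun a h => ?_) i j k l
  · rw [GLRelation, Ring.lie_def] at h
    simpa only [genE, ite_smul, one_smul, zero_smul] using h
  · have h2 : (2 : K) • a = 0 := by rw [two_smul, h]
    simpa using h2

end

end GelfandTsetlin

namespace GelfandTsetlin

attribute [local instance 2000] Ring.toAddCommGroup

/-! ### Vector operators -/

section VectorOperators

open Finset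

variable {K : Type*} [Field K]

/-- The diagonal operator `T(z) ↦ g(z) T(z)`. -/
noncomputable abbrev dg (g : Shift → K) : OpAlg K := op g 0

theorem dg_mul_op (g g' : Shift → K) (d : Shift) :
    dg g * op g' d = op (fun z => g (z + d) * g' z) d := by
  rw [dg, op_mul, zero_add]

theorem op_mul_dg (g g' : Shift → K) (d : Shift) :
    op g' d * dg g = op (fun z => g' z * g z) d := by
  rw [dg, op_mul, add_zero]
  simp only [add_zero]

theorem dg_mul_dg (g g' : Shift → K) : dg g * dg g' = dg fun z => g z * g' z := by
  rw [op_mul_dg]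

theorem dg_mul_op_comm (g g' : Shift → K) (d : Shift) :
    dg g * op g' d = op g' d * dg fun z => g (z + d) := by
  rw [dg_mul_op, op_mul_dg]
  simp only [mul_comm]

theorem dg_commute (g g' : Shift → K) : Commute (dg g) (dg g') := by
  rw [Commute, SemiconjBy, dg_mul_dg, dg_mul_dg]
  simp only [mul_comm]

/-- The function depends only on the rows from `r` on. -/
def DependsAbove (r : ℕ) (g : Shift → K) : Prop :=
  ∀ z z' : Shift, (∀ k, r ≤ k → z k = z' k) → g z = g z'

theorem DependsAbove.mono {r r' : ℕ} {g : Shift → K} (h : DependsAbove r g) (hr : r' ≤ r) :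
    DependsAbove r' g :=
  fun z z' hz => h z z' fun k hk => hz k (hr.trans hk)

theorem DependsAbove.add_unitShift {r : ℕ} {g : Shift → K} (h : DependsAbove r g) {k : ℕ}
    (hk : k < r) (z : Shift) (i : ℕ) (d : ℤ) : g (z + unitShift k i d) = g z :=
  h _ _ fun l hl => by rw [Pi.add_apply, unitShift_row_ne (by omega), add_zero]

theorem DependsAbove.shift {r : ℕ} {g : Shift → K} (h : DependsAbove r g) (d : Shift) :
    DependsAbove r fun z => g (z + d) :=
  fun z z' hz => h _ _ fun k hk => by rw [Pi.add_apply, Pi.add_apply, hz k hk]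

variable (x : ℕ → ℕ → K)

theorem dg_commute_raiseOp {r k : ℕ} {g : Shift → K} (h : DependsAbove r g) (hk : k < r) :
    Commute (dg g) (raiseOp x k) := by
  refine Commute.neg_right (Commute.sum_right _ _ _ fun i _ => ?_)
  rw [Commute, SemiconjBy, dg_mul_op_comm]
  simp only [h.add_unitShift hk]

theorem dg_commute_lowerOp {r k : ℕ} {g : Shift → K} (h : DependsAbove r g) (hk : k < r) :
    Commute (dg g) (lowerOp x k) := by
  refine Commute.sum_right _ _ _ fun i _ => ?_
  rw [Commute, SemiconjBy, dg_mul_op_comm]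
  simp only [h.add_unitShift hk]

theorem commute_lie {A : Type*} [Ring A] {a b c : A} (h1 : Commute a b) (h2 : Commute a c) :
    Commute a ⁅b, c⁆ := by
  rw [Ring.lie_def]
  exact (h1.mul_right h2).sub_right (h2.mul_right h1)

/-- With indices `a, b ≤ r`, counted from 0, `E_{ab}` is built from operators that shift only rows
below `r`. -/
theorem dg_commute_genE {r a b : ℕ} {g : Shift → K} (h : DependsAbove r g) (ha : a ≤ r)
    (hb : b ≤ r) : Commute (dg g) (genE x a b) := by
  rw [genE]
  rcases lt_trichotomy a b with hab | rfl | hab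
  · obtain ⟨d, rfl⟩ := Nat.exists_eq_add_of_lt hab
    rw [unitElt_upper]
    clear hab
    induction d with
    | zero => exact dg_commute_raiseOp x h (by omega)
    | succ d ih => exact commute_lie (ih (by omega)) (dg_commute_raiseOp x h (by omega))
  · rw [unitElt_self]
    exact dg_commute _ _
  · obtain ⟨d, rfl⟩ := Nat.exists_eq_add_of_lt hab
    rw [unitElt_lower]
    clear hab
    induction d with
    | zero => exact dg_commute_lowerOp x h (by omega)
    | succ d ih => exact commute_lie (dg_commute_lowerOp x h (by omega)) (ih (by omega))

theorem genE_succ (r : ℕ) : genE x r (r + 1) = raiseOp x r := unitElt_upper _ _ _ r 0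

theorem genE_pred (r : ℕ) : genE x (r + 1) r = lowerOp x r := unitElt_lower _ _ _ r 0

theorem genE_self (r : ℕ) : genE x r r = weightOp x r := unitElt_self _ _ _ r

/-- The number operator of the position `(r, i)`. -/
noncomputable def numOp (K : Type*) [Field K] (r i : ℕ) : OpAlg K := dg fun z => (z r i : K)

theorem dependsAbove_num (r i : ℕ) : DependsAbove r fun z => ((z r i : ℤ) : K) :=
  fun z z' hz => by simp only [hz r le_rfl]

theorem numOp_commute_genE {r a b : ℕ} (i : ℕ) (ha : a ≤ r) (hb : b ≤ r) :
    Commute (numOp K r i) (genE x a b) :=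
  dg_commute_genE x (dependsAbove_num r i) ha hb

theorem numOp_lie_op (r i j : ℕ) (d : ℤ) (g : Shift → K) :
    numOp K r i * op g (unitShift r j d) - op g (unitShift r j d) * numOp K r i =
      if i = j then op (fun z => d * g z) (unitShift r j d) else 0 := by
  rw [numOp, dg_mul_op, op_mul_dg, op_sub]
  split_ifs with h
  · subst h
    congr 1
    funext z
    simp [unitShift_apply]
    ring
  · rw [← op_zero]
    congr 1
    funext z
    simp [unitShift_apply, h]
    ring

/-- The component of `E_{a,r+1}` that raises the entry `(r, i)`. -/
noncomputable def psi (r i a : ℕ) : OpAlg K :=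
  numOp K r i * genE x a (r + 1) - genE x a (r + 1) * numOp K r i

/-- The component of `E_{r+1,a}` that lowers the entry `(r, i)`. -/
noncomputable def phi (r i a : ℕ) : OpAlg K :=
  genE x (r + 1) a * numOp K r i - numOp K r i * genE x (r + 1) a

theorem psi_top {r i : ℕ} (hi : i < r + 1) :
    psi x r i r = -op (raiseCoeff x r i) (unitShift r i 1) := by
  rw [psi, genE_succ, raiseOp, mul_neg, neg_mul, ← neg_sub', mul_sum, sum_mul, ← sum_sub_distrib]
  simp only [numOp_lie_op]
  rw [sum_ite_eq, if_pos (mem_range.mpr hi)]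
  simp

theorem phi_top {r i : ℕ} (hi : i < r + 1) :
    phi x r i r = op (lowerCoeff x r i) (unitShift r i (-1)) := by
  rw [phi, genE_pred, lowerOp, ← neg_sub, mul_sum, sum_mul, ← sum_sub_distrib]
  simp only [numOp_lie_op]
  rw [sum_ite_eq, if_pos (mem_range.mpr hi), op_neg]
  simp

variable {x} [CharZero K] (hx : IsGenericTab x)

include hx

theorem genE_mul (i j k l : ℕ) : genE x i j * genE x k l = genE x k l * genE x i j +
    ((if j = k then genE x i l else 0) - if i = l then genE x k j else 0) := by
  rw [← genE_lie hx]; abel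

theorem genE_col {a r : ℕ} (ha : a < r) :
    genE x a (r + 1) = genE x a r * genE x r (r + 1) - genE x r (r + 1) * genE x a r := by
  rw [genE_lie hx, if_pos rfl, if_neg (by omega), sub_zero]

theorem genE_row {a r : ℕ} (ha : a < r) :
    genE x (r + 1) a = genE x (r + 1) r * genE x r a - genE x r a * genE x (r + 1) r := by
  rw [genE_lie hx, if_pos rfl, if_neg (by omega), sub_zero]

/-- `E_{a,r+1}` is the bracket of `E_{ar}` with `E_{r,r+1}`, and the number operator that singles
out the component commutes with `E_{ar}`. Hence every component arises from the top one, which is a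
single weighted shift. -/
theorem psi_of_lt {r i a : ℕ} (ha : a < r) :
    psi x r i a = genE x a r * psi x r i r - psi x r i r * genE x a r := by
  have h := (numOp_commute_genE x i ha.le le_rfl (r := r)).eq
  simp only [psi, genE_col hx ha]
  simp only [mul_sub, sub_mul, ← mul_assoc, h]
  simp only [mul_assoc, h]
  abel

theorem phi_of_lt {r i a : ℕ} (ha : a < r) :
    phi x r i a = phi x r i r * genE x r a - genE x r a * phi x r i r := by
  have h := (numOp_commute_genE x i le_rfl ha.le (r := r)).eq
  simp only [phi, genE_row hx ha]
  simp only [mul_sub, sub_mul, ← mul_assoc, h]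
  simp only [mul_assoc, h]
  abel

theorem sum_psi {r a : ℕ} (ha : a ≤ r) :
    ∑ i ∈ range (r + 1), psi x r i a = genE x a (r + 1) := by
  have htop : ∑ i ∈ range (r + 1), psi x r i r = genE x r (r + 1) := by
    rw [genE_succ, raiseOp, ← sum_neg_distrib]
    exact sum_congr rfl fun i hi => psi_top x (mem_range.mp hi)
  rcases ha.eq_or_lt with rfl | ha
  · exact htop
  · rw [sum_congr rfl fun i _ => psi_of_lt hx ha, sum_sub_distrib, ← mul_sum, ← sum_mul, htop,
      ← genE_col hx ha]

theorem sum_phi {r a : ℕ} (ha : a ≤ r) :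
    ∑ i ∈ range (r + 1), phi x r i a = genE x (r + 1) a := by
  have htop : ∑ i ∈ range (r + 1), phi x r i r = genE x (r + 1) r := by
    rw [genE_pred, lowerOp]
    exact sum_congr rfl fun i hi => phi_top x (mem_range.mp hi)
  rcases ha.eq_or_lt with rfl | ha
  · exact htop
  · rw [sum_congr rfl fun i _ => phi_of_lt hx ha, sum_sub_distrib, ← mul_sum, ← sum_mul, htop,
      ← genE_row hx ha]

/-- Each component is a vector operator by itself: it transforms under `E_{ab}`, `a, b ≤ r`, like
the full column, because the number operator commutes with these `E_{ab}`. -/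
theorem genE_mul_psi {r a b c : ℕ} (i : ℕ) (ha : a ≤ r) (hb : b ≤ r) :
    genE x a b * psi x r i c = psi x r i c * genE x a b + if b = c then psi x r i a else 0 := by
  have h := (numOp_commute_genE x i ha hb (r := r)).eq
  have h1 := genE_mul hx a b c (r + 1)
  rw [if_neg (by omega : a ≠ r + 1), sub_zero] at h1
  have h2 : genE x a b * psi x r i c - psi x r i c * genE x a b =
      numOp K r i * (genE x a b * genE x c (r + 1) - genE x c (r + 1) * genE x a b) -
        (genE x a b * genE x c (r + 1) - genE x c (r + 1) * genE x a b) * numOp K r i := by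
    simp only [psi, mul_sub, sub_mul, ← mul_assoc, h]
    simp only [mul_assoc, h]
    abel
  rw [← sub_eq_iff_eq_add', h2, h1]
  simp only [add_sub_cancel_left, psi]
  split_ifs <;> simp

theorem phi_mul_genE {r a b c : ℕ} (i : ℕ) (ha : a ≤ r) (hb : b ≤ r) :
    phi x r i c * genE x a b = genE x a b * phi x r i c + if a = c then phi x r i b else 0 := by
  have h := (numOp_commute_genE x i ha hb (r := r)).eq
  have h1 := genE_mul hx (r + 1) c a b
  rw [if_neg (by omega : r + 1 ≠ b), sub_zero] at h1
  have h2 : phi x r i c * genE x a b - genE x a b * phi x r i c =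
      (genE x (r + 1) c * genE x a b - genE x a b * genE x (r + 1) c) * numOp K r i -
      numOp K r i * (genE x (r + 1) c * genE x a b - genE x a b * genE x (r + 1) c) := by
    simp only [phi, mul_sub, sub_mul, ← mul_assoc, h]
    simp only [mul_assoc, h]
    abel
  rw [← sub_eq_iff_eq_add', h2, h1]
  simp only [add_sub_cancel_left, phi]
  by_cases hca : c = a
  · simp [hca]
  · simp [hca, Ne.symm hca]

theorem psi_top_commute {r i b : ℕ} (hb : b < r) : Commute (psi x r i r) (genE x r b) := by
  have h := genE_mul_psi hx (c := r) i le_rfl hb.le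
  rw [if_neg (by omega), add_zero] at h
  exact h.symm

theorem phi_top_commute {r i b : ℕ} (hb : b < r) : Commute (phi x r i r) (genE x b r) := by
  have h := phi_mul_genE hx (c := r) i hb.le le_rfl
  rw [if_neg (by omega), add_zero] at h
  exact h

/-- Among the rows from `r` on, `psi r i a` changes only the entry `(r, i)`, and it raises it by 1;
its other shifts are invisible to `g`. -/
theorem dg_mul_psi {r i a : ℕ} {g : Shift → K} (hg : DependsAbove r g) (hi : i < r + 1)
    (ha : a ≤ r) : dg g * psi x r i a = psi x r i a * dg fun z => g (z + unitShift r i 1) := by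
  have htop : dg g * psi x r i r = psi x r i r * dg fun z => g (z + unitShift r i 1) := by
    rw [psi_top x hi, mul_neg, neg_mul, dg_mul_op_comm]
  rcases ha.eq_or_lt with rfl | ha
  · exact htop
  · have h1 := (dg_commute_genE x hg ha.le le_rfl).eq
    have h2 := (dg_commute_genE x (hg.shift (unitShift r i 1)) ha.le le_rfl).eq
    rw [psi_of_lt hx ha, mul_sub, sub_mul, ← mul_assoc (dg g), h1, mul_assoc, htop,
      ← mul_assoc (dg g), htop, mul_assoc, mul_assoc, h2, mul_assoc]

theorem dg_mul_phi {r i a : ℕ} {g : Shift → K} (hg : DependsAbove r g) (hi : i < r + 1)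
    (ha : a ≤ r) : dg g * phi x r i a = phi x r i a * dg fun z => g (z + unitShift r i (-1)) := by
  have htop : dg g * phi x r i r = phi x r i r * dg fun z => g (z + unitShift r i (-1)) := by
    rw [phi_top x hi, dg_mul_op_comm]
  rcases ha.eq_or_lt with rfl | ha
  · exact htop
  · have h1 := (dg_commute_genE x hg le_rfl ha.le).eq
    have h2 := (dg_commute_genE x (hg.shift (unitShift r i (-1))) le_rfl ha.le).eq
    rw [phi_of_lt hx ha, mul_sub, sub_mul, ← mul_assoc, htop, ← mul_assoc (dg g), h1, mul_assoc,
      mul_assoc, mul_assoc, mul_assoc, htop, h2]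

end VectorOperators

end GelfandTsetlin

namespace GelfandTsetlin

attribute [local instance 2000] Ring.toAddCommGroup

/-! ### Quadratic contractions of the vector operators: the identities behind them. -/

section Contractions

open Finset

variable {K : Type*} [Field K]

/-- The divided difference of `X + c + ∑ a j / (X - p j)` at two of its zeros. -/
theorem one_sub_sum_eq_zero_of_roots {s : Finset ℕ} {a p : ℕ → K} {u v c : K} (huv : u ≠ v)
    (hu : ∀ j ∈ s, u - p j ≠ 0) (hv : ∀ j ∈ s, v - p j ≠ 0)
    (Fu : u + c + ∑ j ∈ s, a j / (u - p j) = 0) (Fv : v + c + ∑ j ∈ s, a j / (v - p j) = 0) :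
    1 - ∑ j ∈ s, a j / ((u - p j) * (v - p j)) = 0 := by
  have h : ∑ j ∈ s, a j / (u - p j) - ∑ j ∈ s, a j / (v - p j) =
      -(u - v) * ∑ j ∈ s, a j / ((u - p j) * (v - p j)) := by
    rw [← sum_sub_distrib, mul_sum]
    refine sum_congr rfl fun j hj => ?_
    have h1 := hu j hj
    have h2 := hv j hj
    field_simp
    ring
  have h3 : (u - v) * (1 - ∑ j ∈ s, a j / ((u - p j) * (v - p j))) = 0 := by
    linear_combination Fu - Fv - h
  exact (mul_eq_zero.mp h3).resolve_left (sub_ne_zero.mpr huv)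

variable (x : ℕ → ℕ → K)

/-- The eigenvalue of `∑_b E_{b,r+1} E_{r+1,b}` belonging to the entry `(r, i)`. -/
def dualCoeff (r i : ℕ) (z : Shift) : K :=
  -(∏ t ∈ range (r + 2), (ent x z r i - 1 - ent x z (r + 1) t)) / rowDen x r i z

theorem dependsAbove_raiseCoeff (r i : ℕ) : DependsAbove r (raiseCoeff x r i) :=
  fun _ _ h => raiseCoeff_congr x (h _ le_rfl) (h _ (by omega))

theorem dependsAbove_lowerCoeff (r i : ℕ) : DependsAbove r (lowerCoeff x (r + 1) i) :=
  fun _ _ h => lowerCoeff_congr x (h _ (by omega)) (h _ (by simp))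

variable {x} (hx : IsGenericTab x)

include hx

theorem ent_injOn (r : ℕ) (z : Shift) (s : Set ℕ) : Set.InjOn (ent x z r) s := by
  intro i _ j _ hij
  by_contra hne
  exact hx.sub_ne_zero z (k := r) (l := r) (by simpa using hne) (sub_eq_zero.mpr hij)

/-- The raising coefficients of row `r` are the residues of the quotient of the polynomials with
roots in row `r + 1` and in row `r`. -/
theorem raiseCoeff_partialFractions (r : ℕ) (z : Shift) {X : K}
    (hX : ∀ j ∈ range (r + 1), X ≠ ent x z r j) :
    (∏ t ∈ range (r + 2), (X - ent x z (r + 1) t)) / ∏ j ∈ range (r + 1), (X - ent x z r j) =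
      X + ∑ j ∈ range (r + 1), ent x z r j - ∑ t ∈ range (r + 2), ent x z (r + 1) t +
        ∑ j ∈ range (r + 1), raiseCoeff x r j z / (X - ent x z r j) :=
  prod_div_prod_eq_linear (ent_injOn hx r z _) (by simp) hX

theorem dualCoeff_partialFractions (r : ℕ) (z : Shift) {X : K}
    (hX : ∀ j ∈ range (r + 1), X ≠ ent x z r j) :
    (∏ t ∈ range (r + 2), (X - 1 - ent x z (r + 1) t)) / ∏ j ∈ range (r + 1), (X - ent x z r j) =
      X + ∑ j ∈ range (r + 1), ent x z r j - ∑ t ∈ range (r + 2), (1 + ent x z (r + 1) t) -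
        ∑ j ∈ range (r + 1), dualCoeff x r j z / (X - ent x z r j) := by
  have h := prod_div_prod_eq_linear (T := range (r + 2)) (b := fun t => 1 + ent x z (r + 1) t)
    (ent_injOn hx r z (range (r + 1))) (by simp) hX
  simp only [← sub_sub] at h
  rw [h, sub_eq_add_neg _ (∑ j ∈ range (r + 1), dualCoeff x r j z / _), ← sum_neg_distrib]
  congr 1
  refine sum_congr rfl fun j _ => ?_
  rw [dualCoeff, rowDen, neg_div, neg_div, neg_neg]

/-- An entry of row `r + 1` is a zero of the rational function whose partial fractions have the
raising coefficients as residues. -/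
theorem raiseCoeff_root (r : ℕ) (z : Shift) {i : ℕ} (hi : i < r + 2) :
    ent x z (r + 1) i + (∑ j ∈ range (r + 1), ent x z r j - ∑ t ∈ range (r + 2), ent x z (r + 1) t) +
      ∑ j ∈ range (r + 1), raiseCoeff x r j z / (ent x z (r + 1) i - ent x z r j) = 0 := by
  have h := raiseCoeff_partialFractions hx r z (X := ent x z (r + 1) i) fun j _ =>
    sub_ne_zero.mp (hx.sub_ne_zero z (by simp))
  rw [prod_eq_zero (mem_range.mpr hi) (sub_self _), zero_div] at h
  linear_combination -h

theorem dualCoeff_root (r : ℕ) (z : Shift) {i : ℕ} (hi : i < r + 2) :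
    ent x z (r + 1) i +
      (1 + ∑ j ∈ range (r + 1), ent x z r j - ∑ t ∈ range (r + 2), (1 + ent x z (r + 1) t)) +
      ∑ j ∈ range (r + 1), -dualCoeff x r j z / (ent x z (r + 1) i - (ent x z r j - 1)) = 0 := by
  have h := dualCoeff_partialFractions hx r z (X := ent x z (r + 1) i + 1) fun j _ h0 =>
    hx.ent_ne z z (k := r + 1) (i := i) (l := r) (j := j) (by simp) (-1)
      (by push_cast; linear_combination h0)
  rw [prod_eq_zero (mem_range.mpr hi) (by ring), zero_div] at h
  have h2 : ∑ j ∈ range (r + 1), -dualCoeff x r j z / (ent x z (r + 1) i - (ent x z r j - 1)) =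
      -∑ j ∈ range (r + 1), dualCoeff x r j z / (ent x z (r + 1) i + 1 - ent x z r j) := by
    rw [← sum_neg_distrib]
    refine sum_congr rfl fun j _ => ?_
    rw [neg_div]
    congr 2
    ring
  rw [h2]
  linear_combination -h

theorem dualCoeff_add_unitShift_succ {r i j : ℕ} (hj : j < r + 2) (d : ℤ) (z : Shift) :
    dualCoeff x r i (z + unitShift (r + 1) j d) = dualCoeff x r i z *
      ((ent x z r i - 1 - ent x z (r + 1) j - d) / (ent x z r i - 1 - ent x z (r + 1) j)) := by
  have h0 : ent x z r i - 1 - ent x z (r + 1) j ≠ 0 := fun h =>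
    hx.ent_ne z z (k := r) (i := i) (l := r + 1) (j := j) (by simp) 1
      (by push_cast; linear_combination h)
  have hm : j ∈ range (r + 2) := by simpa using hj
  simp only [dualCoeff]
  rw [rowDen_congr x (z' := z) (by simp [unitShift_row_ne]), ← mul_prod_erase _ _ hm,
    ← mul_prod_erase _ (fun t => ent x z r i - 1 - ent x z (r + 1) t) hm, ent_add_unitShift_self,
    ent_add_unitShift_of_ne x z d (by simp)]
  have : ∏ t ∈ (range (r + 2)).erase j,
        (ent x z r i - 1 - ent x (z + unitShift (r + 1) j d) (r + 1) t) =
      ∏ t ∈ (range (r + 2)).erase j, (ent x z r i - 1 - ent x z (r + 1) t) := by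
    refine prod_congr rfl fun t ht => ?_
    rw [ent_add_unitShift_of_ne x z d (by simpa using ne_of_mem_erase ht)]
  rw [this]
  field_simp
  ring

/-- The mixed second difference of the eigenvalue of a quadratic contraction. -/
theorem second_difference_eq_zero {r i i' : ℕ} (hii : i ≠ i') (hi : i < r + 2) (hi' : i' < r + 2)
    {c : ℕ → Shift → K} {p : ℕ → Shift → K} {z : Shift}
    (hc : ∀ j z k, k < r + 2 → ∀ d : ℤ, c j (z + unitShift (r + 1) k d) =
      c j z * ((p j z - ent x z (r + 1) k - d) / (p j z - ent x z (r + 1) k)))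
    (hp : ∀ j z k (d : ℤ), p j (z + unitShift (r + 1) k d) = p j z)
    (hne : ∀ j z k, ent x z (r + 1) k - p j z ≠ 0)
    (q : K) (hq : ∀ k < r + 2, ent x z (r + 1) k + q +
      ∑ j ∈ range (r + 1), c j z / (ent x z (r + 1) k - p j z) = 0) :
    1 - ∑ j ∈ range (r + 1), c j (z + unitShift (r + 1) i 1) + ∑ j ∈ range (r + 1), c j z +
      ∑ j ∈ range (r + 1), c j (z + unitShift (r + 1) i 1 + unitShift (r + 1) i' (-1)) -
      ∑ j ∈ range (r + 1), c j (z + unitShift (r + 1) i' (-1)) = 0 := by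
  have h := one_sub_sum_eq_zero_of_roots (u := ent x z (r + 1) i) (v := ent x z (r + 1) i')
    (s := range (r + 1)) (a := fun j => c j z) (p := fun j => p j z)
    (sub_ne_zero.mp (hx.sub_ne_zero z (by simpa using hii))) (fun j _ => hne j z i)
    (fun j _ => hne j z i') (hq i hi) (hq i' hi')
  have key : ∑ j ∈ range (r + 1), (-c j (z + unitShift (r + 1) i 1) + c j z +
      c j (z + unitShift (r + 1) i 1 + unitShift (r + 1) i' (-1)) -
      c j (z + unitShift (r + 1) i' (-1))) =
      ∑ j ∈ range (r + 1), -(c j z /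
        ((ent x z (r + 1) i - p j z) * (ent x z (r + 1) i' - p j z))) := by
    refine sum_congr rfl fun j _ => ?_
    have h1 := hne j z i
    have h2 := hne j z i'
    have h1' : p j z - ent x z (r + 1) i ≠ 0 := by rw [← neg_sub]; exact neg_ne_zero.mpr h1
    have h2' : p j z - ent x z (r + 1) i' ≠ 0 := by rw [← neg_sub]; exact neg_ne_zero.mpr h2
    rw [hc j (z + unitShift (r + 1) i 1) i' hi', hc j z i hi, hc j z i' hi', hp,
      ent_add_unitShift_of_ne x z _ (by simpa using hii.symm)]
    push_cast
    generalize ent x z (r + 1) i = A at *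
    generalize ent x z (r + 1) i' = B at *
    generalize p j z = C at *
    field_simp
    ring
  simp only [sum_add_distrib, sum_sub_distrib, sum_neg_distrib] at key
  linear_combination h + key

omit hx in
-- The two commutations let `a` and `b` meet in the product `a * b`, and `f` and `e` in `f * e`.
-- Summed over the index carried by `a` and `b`, the products `a * b` become a quadratic operator
-- that is already known to be diagonal.
theorem mul_lie_lie {A : Type*} [Ring A] {a b e f : A} (h1 : a * e = e * a) (h2 : f * b = b * f) :
    (f * a - a * f) * (b * e - e * b) =
      f * (a * b) * e - f * e * (a * b) - a * b * (f * e) + a * (f * e) * b := by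
  calc (f * a - a * f) * (b * e - e * b)
      = f * (a * b) * e - f * (a * e) * b - a * (f * b) * e + a * (f * e) * b := by noncomm_ring
    _ = _ := by rw [h1, h2]; noncomm_ring

omit hx in
theorem mul_lie_lie' {A : Type*} [Ring A] {a b e f : A} (h1 : a * e = e * a) (h2 : f * b = b * f) :
    (b * e - e * b) * (f * a - a * f) =
      e * (b * a) * f - e * f * (b * a) - b * a * (e * f) + b * (e * f) * a := by
  calc (b * e - e * b) * (f * a - a * f)
      = e * (b * a) * f - e * (b * f) * a - b * (e * a) * f + b * (e * f) * a := by noncomm_ring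
    _ = _ := by rw [← h1, ← h2]; noncomm_ring

variable [CharZero K]

/-- Induction step of the contraction: for `b ≤ r` the components are brackets of the top components
with `E_{r+1,b}` and `E_{b,r+1}`, so only the top components and sums over the smaller algebra
remain. -/
theorem sum_phi_mul_psi_succ (r i i' : ℕ) :
    ∑ b ∈ range (r + 2), phi x (r + 1) i' b * psi x (r + 1) i b =
      phi x (r + 1) i' (r + 1) * psi x (r + 1) i (r + 1) +
      (phi x (r + 1) i' (r + 1) * (∑ b ∈ range (r + 1), genE x (r + 1) b * genE x b (r + 1)) *
          psi x (r + 1) i (r + 1) -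
        phi x (r + 1) i' (r + 1) * psi x (r + 1) i (r + 1) *
          (∑ b ∈ range (r + 1), genE x (r + 1) b * genE x b (r + 1)) -
        (∑ b ∈ range (r + 1), genE x (r + 1) b * genE x b (r + 1)) *
          (phi x (r + 1) i' (r + 1) * psi x (r + 1) i (r + 1)) +
        ∑ b ∈ range (r + 1), genE x (r + 1) b *
          (phi x (r + 1) i' (r + 1) * psi x (r + 1) i (r + 1)) * genE x b (r + 1)) := by
  rw [sum_range_succ, add_comm]
  congr 1
  simp only [mul_sum, sum_mul, ← sum_sub_distrib, ← sum_add_distrib]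
  refine sum_congr rfl fun b hb => ?_
  have hb := mem_range.mp hb
  rw [phi_of_lt hx hb, psi_of_lt hx hb,
    mul_lie_lie (psi_top_commute hx hb).symm.eq (phi_top_commute hx hb).eq]

theorem sum_psi_mul_phi_succ (r i i' : ℕ) :
    ∑ b ∈ range (r + 2), psi x (r + 1) i b * phi x (r + 1) i' b =
      psi x (r + 1) i (r + 1) * phi x (r + 1) i' (r + 1) +
      (psi x (r + 1) i (r + 1) * (∑ b ∈ range (r + 1), genE x b (r + 1) * genE x (r + 1) b) *
          phi x (r + 1) i' (r + 1) -
        psi x (r + 1) i (r + 1) * phi x (r + 1) i' (r + 1) *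
          (∑ b ∈ range (r + 1), genE x b (r + 1) * genE x (r + 1) b) -
        (∑ b ∈ range (r + 1), genE x b (r + 1) * genE x (r + 1) b) *
          (psi x (r + 1) i (r + 1) * phi x (r + 1) i' (r + 1)) +
        ∑ b ∈ range (r + 1), genE x b (r + 1) *
          (psi x (r + 1) i (r + 1) * phi x (r + 1) i' (r + 1)) * genE x (r + 1) b) := by
  rw [sum_range_succ, add_comm]
  congr 1
  simp only [mul_sum, sum_mul, ← sum_sub_distrib, ← sum_add_distrib]
  refine sum_congr rfl fun b hb => ?_
  have hb := mem_range.mp hb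
  rw [phi_of_lt hx hb, psi_of_lt hx hb,
    mul_lie_lie' (psi_top_commute hx hb).symm.eq (phi_top_commute hx hb).eq]

/-- A weighted quadratic contraction of the components of `E_{r+1,b}` and `E_{b,r+1}`. -/
theorem sum_genE_dg_genE {r : ℕ} {g : Shift → K} (hg : DependsAbove r g)
    (H : ∀ i ∈ range (r + 1), ∀ i' ∈ range (r + 1),
      ∑ b ∈ range (r + 1), phi x r i' b * psi x r i b =
        if i = i' then dg (fun z => -raiseCoeff x r i z) else 0) :
    ∑ b ∈ range (r + 1), genE x (r + 1) b * dg g * genE x b (r + 1) =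
      dg fun z => -∑ j ∈ range (r + 1), raiseCoeff x r j z * g (z + unitShift r j 1) := by
  have h1 : ∀ b ∈ range (r + 1), genE x (r + 1) b * dg g * genE x b (r + 1) =
      ∑ j ∈ range (r + 1), ∑ j' ∈ range (r + 1), phi x r j' b * psi x r j b *
        dg fun z => g (z + unitShift r j 1) := by
    intro b hb
    have hb := Nat.lt_succ_iff.mp (mem_range.mp hb)
    rw [← sum_psi hx hb, mul_sum]
    refine sum_congr rfl fun j hj => ?_
    rw [mul_assoc, dg_mul_psi hx hg (mem_range.mp hj) hb, ← sum_phi hx hb, sum_mul]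
    simp only [mul_assoc]
  rw [sum_congr rfl h1, sum_comm]
  have h2 : ∀ j ∈ range (r + 1), ∑ b ∈ range (r + 1), ∑ j' ∈ range (r + 1),
      phi x r j' b * psi x r j b * dg (fun z => g (z + unitShift r j 1)) =
      dg fun z => -(raiseCoeff x r j z * g (z + unitShift r j 1)) := by
    intro j hj
    rw [sum_comm]
    simp only [← sum_mul]
    rw [sum_congr rfl fun j' hj' => H j hj j' hj', sum_ite_eq, if_pos hj, dg_mul_dg]
    simp only [neg_mul]
  rw [sum_congr rfl h2, op_sum]
  simp only [sum_neg_distrib]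

theorem sum_genE_dg_genE' {r : ℕ} {g : Shift → K} (hg : DependsAbove r g)
    (H : ∀ i ∈ range (r + 1), ∀ i' ∈ range (r + 1),
      ∑ b ∈ range (r + 1), psi x r i b * phi x r i' b =
        if i = i' then dg (dualCoeff x r i) else 0) :
    ∑ b ∈ range (r + 1), genE x b (r + 1) * dg g * genE x (r + 1) b =
      dg fun z => ∑ j ∈ range (r + 1), dualCoeff x r j z * g (z + unitShift r j (-1)) := by
  have h1 : ∀ b ∈ range (r + 1), genE x b (r + 1) * dg g * genE x (r + 1) b =
      ∑ j ∈ range (r + 1), ∑ j' ∈ range (r + 1), psi x r j' b * phi x r j b *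
        dg fun z => g (z + unitShift r j (-1)) := by
    intro b hb
    have hb := Nat.lt_succ_iff.mp (mem_range.mp hb)
    rw [← sum_phi hx hb, mul_sum]
    refine sum_congr rfl fun j hj => ?_
    rw [mul_assoc, dg_mul_phi hx hg (mem_range.mp hj) hb, ← sum_psi hx hb, sum_mul]
    simp only [mul_assoc]
  rw [sum_congr rfl h1, sum_comm]
  have h2 : ∀ j ∈ range (r + 1), ∑ b ∈ range (r + 1), ∑ j' ∈ range (r + 1),
      psi x r j' b * phi x r j b * dg (fun z => g (z + unitShift r j (-1))) =
      dg fun z => dualCoeff x r j z * g (z + unitShift r j (-1)) := by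
    intro j hj
    rw [sum_comm]
    simp only [← sum_mul]
    rw [sum_congr rfl fun j' hj' => H j' hj' j hj, sum_ite_eq', if_pos hj, dg_mul_dg]
  rw [sum_congr rfl h2, op_sum]

end Contractions

end GelfandTsetlin

namespace GelfandTsetlin

attribute [local instance 2000] Ring.toAddCommGroup

/-! ### The contractions are diagonal, by induction on the row. -/

section Contractions

open Finset

variable {K : Type*} [Field K]

/-- For commuting shifts the expression of the induction step collapses to a diagonal factor, which
is 1 minus the mixed second difference of the eigenvalue `C`. -/
theorem op_contraction {F A C : Shift → K} {d d' : Shift}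
    (hfe : op A d * op F d' = op F d' * op A d) :
    op F d' * op A d + (op F d' * dg C * op A d - op F d' * op A d * dg C -
      dg C * (op F d' * op A d) + op A d * dg C * op F d') =
    op F d' * op A d * dg fun z => 1 + C (z + d) - C z - C (z + d + d') + C (z + d') := by
  have h1 : op F d' * dg C * op A d = op F d' * op A d * dg fun z => C (z + d) := by
    rw [mul_assoc, dg_mul_op_comm, mul_assoc]
  have h2 : op A d * dg C * op F d' = op F d' * op A d * dg fun z => C (z + d') := by
    rw [mul_assoc, dg_mul_op_comm, ← mul_assoc, hfe]
  have h3 : dg C * (op F d' * op A d) = op F d' * op A d * dg fun z => C (z + d + d') := by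
    rw [← mul_assoc, dg_mul_op_comm, mul_assoc, dg_mul_op_comm, mul_assoc]
  rw [h1, h2, h3]
  have h4 : (dg fun z => 1 + C (z + d) - C z - C (z + d + d') + C (z + d')) =
      1 + (dg fun z => C (z + d)) - dg C - (dg fun z => C (z + d + d')) +
        dg fun z => C (z + d') := by
    rw [← op_one, op_add, op_sub, op_sub, op_add]
  rw [h4]
  noncomm_ring

variable {x : ℕ → ℕ → K} (hx : IsGenericTab x)

theorem lowerCoeff_add_unitShift_self (r i : ℕ) (d : ℤ) (z : Shift) :
    lowerCoeff x (r + 1) i (z + unitShift (r + 1) i d) =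
      (∏ j ∈ range (r + 1), (ent x z (r + 1) i + d - ent x z r j)) /
        ∏ t ∈ (range (r + 2)).erase i, (ent x z (r + 1) i + d - ent x z (r + 1) t) := by
  unfold lowerCoeff rowDen
  rw [ent_add_unitShift_self]
  congr 1
  · refine prod_congr rfl fun t _ => ?_
    rw [ent_add_unitShift_of_ne x z _ (by simp)]
    rfl
  · refine prod_congr rfl fun t ht => ?_
    rw [ent_add_unitShift_of_ne x z _ (by simpa using (ne_of_mem_erase ht))]

theorem raiseCoeff_add_unitShift_self (r i : ℕ) (d : ℤ) (z : Shift) :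
    raiseCoeff x r i (z + unitShift r i d) =
      (∏ j ∈ range (r + 2), (ent x z r i + d - ent x z (r + 1) j)) /
        ∏ t ∈ (range (r + 1)).erase i, (ent x z r i + d - ent x z r t) := by
  unfold raiseCoeff rowDen
  rw [ent_add_unitShift_self]
  congr 1
  · refine prod_congr rfl fun t _ => ?_
    rw [ent_add_unitShift_of_ne x z _ (by simp)]
  · refine prod_congr rfl fun t ht => ?_
    rw [ent_add_unitShift_of_ne x z _ (by simpa using (ne_of_mem_erase ht))]

theorem lowerCoeff_zero (z : Shift) : lowerCoeff x 0 0 z = 1 := by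
  simp [lowerCoeff, rowDen]

theorem DependsAbove.neg_mul {K : Type*} [Field K] {r : ℕ} {g g' : Shift → K}
    (h : DependsAbove r g) (h' : DependsAbove r g') :
    DependsAbove r fun z => -(g z * g' z) :=
  fun z z' hz => by dsimp only; rw [h z z' hz, h' z z' hz]

theorem dependsAbove_one (r : ℕ) : DependsAbove r fun _ => (1 : K) := fun _ _ _ => rfl

include hx

/-- Let `A` be the entry `(r + 1, i)` and `F` the quotient of row polynomials with the raising
coefficients as residues. The bracket is `F (A + 1) - F A`, and `F A = 0`. The value `F (A + 1)` is
inverse to the lowering coefficient at the raised tableau, as the factor of `t = i` is 1. -/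
theorem one_add_sum_raiseCoeff (r : ℕ) (z : Shift) {i : ℕ} (hi : i < r + 2) :
    lowerCoeff x (r + 1) i (z + unitShift (r + 1) i 1) *
      (1 + ∑ j ∈ range (r + 1), raiseCoeff x r j z *
        (1 / (ent x z r j - ent x z (r + 1) i) + 1 / (ent x z (r + 1) i + 1 - ent x z r j))) = 1 := by
  have hne : ∀ j, ent x z (r + 1) i + 1 - ent x z r j ≠ 0 := fun j h =>
    hx.ent_ne z z (k := r + 1) (i := i) (l := r) (j := j) (by simp) (-1)
      (by push_cast; linear_combination h)
  have h1 := raiseCoeff_partialFractions hx r z (X := ent x z (r + 1) i + 1)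
    fun j _ => sub_ne_zero.mp (hne j)
  have h2 := raiseCoeff_root hx r z hi
  have h3 : 1 + ∑ j ∈ range (r + 1), raiseCoeff x r j z *
      (1 / (ent x z r j - ent x z (r + 1) i) + 1 / (ent x z (r + 1) i + 1 - ent x z r j)) =
      (∏ t ∈ range (r + 2), (ent x z (r + 1) i + 1 - ent x z (r + 1) t)) /
        ∏ j ∈ range (r + 1), (ent x z (r + 1) i + 1 - ent x z r j) := by
    have h4 : ∑ j ∈ range (r + 1), raiseCoeff x r j z *
        (1 / (ent x z r j - ent x z (r + 1) i) + 1 / (ent x z (r + 1) i + 1 - ent x z r j)) =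
        ∑ j ∈ range (r + 1), raiseCoeff x r j z / (ent x z (r + 1) i + 1 - ent x z r j) -
        ∑ j ∈ range (r + 1), raiseCoeff x r j z / (ent x z (r + 1) i - ent x z r j) := by
      rw [← sum_sub_distrib]
      refine sum_congr rfl fun j _ => ?_
      rw [← neg_sub (ent x z (r + 1) i) (ent x z r j), one_div, one_div, inv_neg]
      ring
    rw [h4, h1]
    linear_combination -h2
  rw [h3, lowerCoeff_add_unitShift_self, ← mul_prod_erase _ _ (mem_range.mpr hi)]
  have hA : ∏ j ∈ range (r + 1), (ent x z (r + 1) i + 1 - ent x z r j) ≠ 0 :=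
    prod_ne_zero_iff.mpr fun j _ => hne j
  have hB : ∏ t ∈ (range (r + 2)).erase i, (ent x z (r + 1) i + 1 - ent x z (r + 1) t) ≠ 0 :=
    prod_ne_zero_iff.mpr fun t ht h =>
      hx.ent_ne z z (k := r + 1) (i := i) (l := r + 1) (j := t)
        (by simpa using (ne_of_mem_erase ht).symm) (-1) (by push_cast; linear_combination h)
  push_cast
  field_simp
  ring

/-- The same argument for the expansion of `dualCoeff_partialFractions`, whose zeros are the entries
of row `r + 1` raised by 1: now the value at `A + 1` vanishes and the one at `A` contributes. -/
theorem one_add_sum_dualCoeff (r : ℕ) (z : Shift) {i : ℕ} (hi : i < r + 2) :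
    raiseCoeff x (r + 1) i (z + unitShift (r + 1) i (-1)) * lowerCoeff x (r + 1) i z *
      (1 + ∑ j ∈ range (r + 1), dualCoeff x r j z * (1 / (ent x z r j - 1 - ent x z (r + 1) i) +
        1 / (ent x z (r + 1) i - ent x z r j))) = -dualCoeff x (r + 1) i z := by
  have hne : ∀ j, ent x z (r + 1) i - ent x z r j ≠ 0 := fun j => hx.sub_ne_zero z (by simp)
  have h1 := dualCoeff_partialFractions hx r z (X := ent x z (r + 1) i)
    fun j _ => sub_ne_zero.mp (hne j)
  have h2 := dualCoeff_root hx r z hi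
  have h3 : 1 + ∑ j ∈ range (r + 1), dualCoeff x r j z * (1 / (ent x z r j - 1 - ent x z (r + 1) i) +
        1 / (ent x z (r + 1) i - ent x z r j)) =
      -((∏ t ∈ range (r + 2), (ent x z (r + 1) i - 1 - ent x z (r + 1) t)) /
        ∏ j ∈ range (r + 1), (ent x z (r + 1) i - ent x z r j)) := by
    have h4 : ∑ j ∈ range (r + 1), dualCoeff x r j z *
        (1 / (ent x z r j - 1 - ent x z (r + 1) i) + 1 / (ent x z (r + 1) i - ent x z r j)) =
        ∑ j ∈ range (r + 1), -dualCoeff x r j z / (ent x z (r + 1) i - (ent x z r j - 1)) +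
        ∑ j ∈ range (r + 1), dualCoeff x r j z / (ent x z (r + 1) i - ent x z r j) := by
      rw [← sum_add_distrib]
      refine sum_congr rfl fun j _ => ?_
      rw [← neg_sub (ent x z (r + 1) i) (ent x z r j - 1), one_div, one_div, inv_neg]
      ring
    rw [h4, h1]
    linear_combination h2
  rw [h3, raiseCoeff_add_unitShift_self, ← mul_prod_erase _ _ (mem_range.mpr hi), dualCoeff,
    lowerCoeff, rowDen]
  have hA : ∏ j ∈ range (r + 1), (ent x z (r + 1) i - ent x z r j) ≠ 0 :=
    prod_ne_zero_iff.mpr fun j _ => hne j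
  have hB : ∏ t ∈ (range (r + 2)).erase i, (ent x z (r + 1) i - 1 - ent x z (r + 1) t) ≠ 0 :=
    prod_ne_zero_iff.mpr fun t ht h =>
      hx.ent_ne z z (k := r + 1) (i := i) (l := r + 1) (j := t)
        (by simpa using (ne_of_mem_erase ht).symm) 1 (by push_cast; linear_combination h)
  have hD := rowDen_ne_zero hx (r + 1) i z
  rw [rowDen] at hD
  push_cast
  simp only [← sub_eq_add_neg]
  field_simp
  ring

variable [CharZero K]

theorem psi_phi_top_comm {r i i' : ℕ} (hi : i < r + 1) (hi' : i' < r + 1) (hii : i ≠ i') :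
    psi x r i r * phi x r i' r = phi x r i' r * psi x r i r := by
  have h := raise_lie_lower_row hx hi hi' hii
  rw [Ring.lie_def, sub_eq_zero] at h
  rw [psi_top x hi, phi_top x hi', neg_mul, mul_neg, h]

/-- By induction the quadratic operator of the smaller algebra is diagonal with eigenvalue `-∑
raiseCoeff`. For `i ≠ i'` its mixed second difference is 1, since the entries `i` and `i'` are two
zeros of one rational function; for `i = i'` the sums over row `r` are evaluated by
`one_add_sum_raiseCoeff`. -/
theorem sum_phi_mul_psi (r : ℕ) : ∀ i ∈ range (r + 1), ∀ i' ∈ range (r + 1),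
    ∑ b ∈ range (r + 1), phi x r i' b * psi x r i b =
      if i = i' then dg (fun z => -raiseCoeff x r i z) else 0 := by
  induction r with
  | zero =>
    intro i hi i' hi'
    obtain rfl : i = 0 := by simpa using hi
    obtain rfl : i' = 0 := by simpa using hi'
    rw [zero_add, sum_range_one, if_pos rfl, psi_top x (by simp), phi_top x (by simp), mul_neg,
      op_mul, ← unitShift_neg, neg_add_cancel, op_neg]
    simp [lowerCoeff_zero]
  | succ r ih =>
    intro i hi i' hi'
    have hi := mem_range.mp hi
    have hi' := mem_range.mp hi'
    have hC : ∑ b ∈ range (r + 1), genE x (r + 1) b * genE x b (r + 1) =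
        dg fun z => -∑ j ∈ range (r + 1), raiseCoeff x r j z := by
      have h := sum_genE_dg_genE hx (dependsAbove_one r) ih
      simpa only [dg, op_one, mul_one] using h
    rw [sum_phi_mul_psi_succ hx, hC]
    by_cases hii : i = i'
    · subst hii
      rw [if_pos rfl]
      have hfe : phi x (r + 1) i (r + 1) * psi x (r + 1) i (r + 1) =
          dg fun z => -(lowerCoeff x (r + 1) i (z + unitShift (r + 1) i 1) *
            raiseCoeff x (r + 1) i z) := by
        rw [psi_top x hi, phi_top x hi, mul_neg, op_mul, ← unitShift_neg, neg_add_cancel, op_neg]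
      have hdep : DependsAbove r fun z => -(lowerCoeff x (r + 1) i (z + unitShift (r + 1) i 1) *
            raiseCoeff x (r + 1) i z) :=
        ((dependsAbove_lowerCoeff x r i).shift _).neg_mul
          ((dependsAbove_raiseCoeff x (r + 1) i).mono (Nat.le_succ r))
      have hfCe : phi x (r + 1) i (r + 1) * (dg fun z => -∑ j ∈ range (r + 1), raiseCoeff x r j z) *
          psi x (r + 1) i (r + 1) = phi x (r + 1) i (r + 1) * psi x (r + 1) i (r + 1) *
          dg fun z => -∑ j ∈ range (r + 1), raiseCoeff x r j (z + unitShift (r + 1) i 1) := by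
        rw [psi_top x hi, mul_assoc, mul_neg, dg_mul_op_comm, mul_neg, mul_neg, neg_mul, mul_assoc]
      rw [hfCe, hfe, sum_genE_dg_genE hx hdep ih]
      simp only [dg_mul_dg, op_add, op_sub]
      congr 1
      funext z
      have key := one_add_sum_raiseCoeff hx r z hi
      have e1 : ∀ j ∈ range (r + 1), raiseCoeff x r j (z + unitShift (r + 1) i 1) =
          raiseCoeff x r j z * (1 - 1 / (ent x z r j - ent x z (r + 1) i)) := by
        intro j _
        have h0 : ent x z r j - ent x z (r + 1) i ≠ 0 := hx.sub_ne_zero z (by simp)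
        rw [raiseCoeff_add_unitShift_succ hx hi]
        push_cast
        field_simp
      have e2 : ∀ j ∈ range (r + 1),
          raiseCoeff x r j z * -(lowerCoeff x (r + 1) i (z + unitShift r j 1 + unitShift (r + 1) i 1) *
            raiseCoeff x (r + 1) i (z + unitShift r j 1)) =
          -(lowerCoeff x (r + 1) i (z + unitShift (r + 1) i 1) * raiseCoeff x (r + 1) i z) *
            (raiseCoeff x r j z * (1 - 1 / (ent x z (r + 1) i + 1 - ent x z r j))) := by
        intro j hj
        have h0 : ent x z (r + 1) i + 1 - ent x z r j ≠ 0 := fun h =>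
          hx.ent_ne z z (k := r + 1) (i := i) (l := r) (j := j) (by simp) (-1)
            (by push_cast; linear_combination h)
        rw [add_right_comm, lowerCoeff_add_unitShift_pred hx (mem_range.mp hj),
          raiseCoeff_add_unitShift_of_ne x _ _ (by omega) (by omega), ent_add_unitShift_self,
          ent_add_unitShift_of_ne x z _ (by simp)]
        push_cast
        field_simp
      rw [sum_congr rfl e1, sum_congr rfl e2, ← mul_sum]
      simp only [mul_add, mul_sub, mul_one, sum_add_distrib, sum_sub_distrib] at key ⊢
      linear_combination (-raiseCoeff x (r + 1) i z) * key
    · rw [if_neg hii]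
      have hcomm := psi_phi_top_comm hx hi hi' hii
      -- For `i ≠ i'` all the factors involved commute, so the outer matrix units can be moved to
      -- the middle, where they form the diagonal operator again.
      have hlast : ∑ b ∈ range (r + 1), genE x (r + 1) b *
          (phi x (r + 1) i' (r + 1) * psi x (r + 1) i (r + 1)) * genE x b (r + 1) =
          psi x (r + 1) i (r + 1) * (dg fun z => -∑ j ∈ range (r + 1), raiseCoeff x r j z) *
            phi x (r + 1) i' (r + 1) := by
        rw [← hC, mul_sum, sum_mul]
        refine sum_congr rfl fun b hb => ?_
        have hb := mem_range.mp hb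
        rw [← hcomm, ← mul_assoc, ← (psi_top_commute hx hb).eq, mul_assoc (psi x _ _ _ * _),
          (phi_top_commute hx hb).eq]
        simp only [mul_assoc]
      rw [hlast]
      rw [psi_top x hi, phi_top x hi', op_neg] at hcomm ⊢
      rw [op_contraction hcomm]
      have hz : ∀ z, 1 + -∑ j ∈ range (r + 1), raiseCoeff x r j (z + unitShift (r + 1) i 1) -
          -∑ j ∈ range (r + 1), raiseCoeff x r j z -
          -∑ j ∈ range (r + 1), raiseCoeff x r j
            (z + unitShift (r + 1) i 1 + unitShift (r + 1) i' (-1)) +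
          -∑ j ∈ range (r + 1), raiseCoeff x r j (z + unitShift (r + 1) i' (-1)) = 0 := by
        intro z
        have h := second_difference_eq_zero hx hii hi hi' (c := raiseCoeff x r)
          (p := fun j z => ent x z r j) (z := z)
          (fun j z k hk d => raiseCoeff_add_unitShift_succ hx hk d z)
          (fun j z k d => ent_add_unitShift_of_ne x z d (by simp))
          (fun j z k => hx.sub_ne_zero z (by simp)) _ (fun k hk => raiseCoeff_root hx r z hk)
        linear_combination h
      simp only [hz]
      rw [dg, op_zero, mul_zero]

/-- The contraction in the other order. It is not read off from the previous one but has its own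
induction, with poles moved by 1 and the quadratic operator `∑ E_{b,r+1} E_{r+1,b}`. -/
theorem sum_psi_mul_phi (r : ℕ) : ∀ i ∈ range (r + 1), ∀ i' ∈ range (r + 1),
    ∑ b ∈ range (r + 1), psi x r i b * phi x r i' b =
      if i = i' then dg (dualCoeff x r i) else 0 := by
  induction r with
  | zero =>
    intro i hi i' hi'
    obtain rfl : i = 0 := by simpa using hi
    obtain rfl : i' = 0 := by simpa using hi'
    rw [zero_add, sum_range_one, if_pos rfl, psi_top x (by simp), phi_top x (by simp), neg_mul,
      op_mul, ← unitShift_neg, add_neg_cancel, op_neg, unitShift_neg]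
    congr 1
    funext z
    rw [lowerCoeff_zero, raiseCoeff_add_unitShift_self, dualCoeff, rowDen]
    simp [sub_eq_add_neg]
  | succ r ih =>
    intro i hi i' hi'
    have hi := mem_range.mp hi
    have hi' := mem_range.mp hi'
    have hC : ∑ b ∈ range (r + 1), genE x b (r + 1) * genE x (r + 1) b =
        dg fun z => ∑ j ∈ range (r + 1), dualCoeff x r j z := by
      have h := sum_genE_dg_genE' hx (dependsAbove_one r) ih
      simpa only [dg, op_one, mul_one] using h
    rw [sum_psi_mul_phi_succ hx, hC]
    by_cases hii : i = i'
    · subst hii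
      rw [if_pos rfl]
      have hfe : psi x (r + 1) i (r + 1) * phi x (r + 1) i (r + 1) =
          dg fun z => -(raiseCoeff x (r + 1) i (z + unitShift (r + 1) i (-1)) *
            lowerCoeff x (r + 1) i z) := by
        rw [psi_top x hi, phi_top x hi, neg_mul, op_mul, ← unitShift_neg, add_neg_cancel, op_neg]
      have hdep : DependsAbove r fun z => -(raiseCoeff x (r + 1) i (z + unitShift (r + 1) i (-1)) *
            lowerCoeff x (r + 1) i z) :=
        (((dependsAbove_raiseCoeff x (r + 1) i).shift _).mono (Nat.le_succ r)).neg_mul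
          (dependsAbove_lowerCoeff x r i)
      have hfCe : psi x (r + 1) i (r + 1) * (dg fun z => ∑ j ∈ range (r + 1), dualCoeff x r j z) *
          phi x (r + 1) i (r + 1) = psi x (r + 1) i (r + 1) * phi x (r + 1) i (r + 1) *
          dg fun z => ∑ j ∈ range (r + 1), dualCoeff x r j (z + unitShift (r + 1) i (-1)) := by
        rw [phi_top x hi, mul_assoc, dg_mul_op_comm, mul_assoc]
      rw [hfCe, hfe, sum_genE_dg_genE' hx hdep ih]
      simp only [dg_mul_dg, op_add, op_sub]
      congr 1
      funext z
      have key := one_add_sum_dualCoeff hx r z hi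
      have e1 : ∀ j ∈ range (r + 1), dualCoeff x r j (z + unitShift (r + 1) i (-1)) =
          dualCoeff x r j z * (1 + 1 / (ent x z r j - 1 - ent x z (r + 1) i)) := by
        intro j _
        have h0 : ent x z r j - 1 - ent x z (r + 1) i ≠ 0 := fun h =>
          hx.ent_ne z z (k := r) (i := j) (l := r + 1) (j := i) (by simp) 1
            (by push_cast; linear_combination h)
        rw [dualCoeff_add_unitShift_succ hx hi]
        push_cast
        field_simp
        ring
      have e2 : ∀ j ∈ range (r + 1),
          dualCoeff x r j z * -(raiseCoeff x (r + 1) i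
              (z + unitShift r j (-1) + unitShift (r + 1) i (-1)) *
            lowerCoeff x (r + 1) i (z + unitShift r j (-1))) =
          -(raiseCoeff x (r + 1) i (z + unitShift (r + 1) i (-1)) * lowerCoeff x (r + 1) i z) *
            (dualCoeff x r j z * (1 + 1 / (ent x z (r + 1) i - ent x z r j))) := by
        intro j hj
        have h0 : ent x z (r + 1) i - ent x z r j ≠ 0 := hx.sub_ne_zero z (by simp)
        rw [add_right_comm, lowerCoeff_add_unitShift_pred hx (mem_range.mp hj),
          raiseCoeff_add_unitShift_of_ne x _ _ (by omega) (by omega)]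
        push_cast
        field_simp
        ring
      rw [sum_congr rfl e1, sum_congr rfl e2, ← mul_sum]
      simp only [mul_add, mul_one, sum_add_distrib] at key ⊢
      linear_combination -key
    · rw [if_neg hii]
      have hcomm := psi_phi_top_comm hx hi hi' hii
      have hlast : ∑ b ∈ range (r + 1), genE x b (r + 1) *
          (psi x (r + 1) i (r + 1) * phi x (r + 1) i' (r + 1)) * genE x (r + 1) b =
          phi x (r + 1) i' (r + 1) * (dg fun z => ∑ j ∈ range (r + 1), dualCoeff x r j z) *
            psi x (r + 1) i (r + 1) := by
        rw [← hC, mul_sum, sum_mul]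
        refine sum_congr rfl fun b hb => ?_
        have hb := mem_range.mp hb
        rw [hcomm, ← mul_assoc, ← (phi_top_commute hx hb).eq, mul_assoc (phi x _ _ _ * _),
          (psi_top_commute hx hb).eq]
        simp only [mul_assoc]
      rw [hlast]
      rw [psi_top x hi, phi_top x hi', op_neg] at hcomm ⊢
      rw [op_contraction hcomm.symm]
      have hz : ∀ z, 1 + ∑ j ∈ range (r + 1), dualCoeff x r j (z + unitShift (r + 1) i' (-1)) -
          ∑ j ∈ range (r + 1), dualCoeff x r j z -
          ∑ j ∈ range (r + 1), dualCoeff x r j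
            (z + unitShift (r + 1) i' (-1) + unitShift (r + 1) i 1) +
          ∑ j ∈ range (r + 1), dualCoeff x r j (z + unitShift (r + 1) i 1) = 0 := by
        intro z
        have h := second_difference_eq_zero hx hii hi hi' (c := fun j z => -dualCoeff x r j z)
          (p := fun j z => ent x z r j - 1) (z := z)
          (fun j z k hk d => by rw [dualCoeff_add_unitShift_succ hx hk d z, neg_mul])
          (fun j z k d => by rw [ent_add_unitShift_of_ne x z d (by simp)])
          (fun j z k h => hx.ent_ne z z (k := r + 1) (i := k) (l := r) (j := j) (by simp) (-1)
            (by push_cast; linear_combination h)) _ (fun k hk => dualCoeff_root hx r z hk)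
        simp only [sum_neg_distrib] at h
        rw [add_right_comm z] at h
        linear_combination h
      simp only [hz]
      rw [dg, op_zero, mul_zero]

end Contractions

end GelfandTsetlin

namespace GelfandTsetlin

attribute [local instance 2000] Ring.toAddCommGroup

/-! ### Traces of powers -/

section Traces

open Finset

variable {K : Type*} [Field K] {x : ℕ → ℕ → K}

/-- The entry `(a, b)` of the `k`-th power of the matrix `(E a b)` with indices in `s`. -/
def powEntry {A ι : Type*} [Ring A] [DecidableEq ι] (E : ι → ι → A) (s : Finset ι) : ℕ → ι → ι → A
  | 0, a, b => if a = b then 1 else 0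
  | k + 1, a, b => ∑ c ∈ s, E a c * powEntry E s k c b

theorem powEntry_succ {A ι : Type*} [Ring A] [DecidableEq ι] (E : ι → ι → A) (s : Finset ι) (k : ℕ)
    (a b : ι) : powEntry E s (k + 1) a b = ∑ c ∈ s, E a c * powEntry E s k c b := rfl

theorem powEntry_succ' {A ι : Type*} [Ring A] [DecidableEq ι] (E : ι → ι → A) {s : Finset ι} (k : ℕ)
    {a b : ι} (ha : a ∈ s) (hb : b ∈ s) :
    powEntry E s (k + 1) a b = ∑ c ∈ s, powEntry E s k a c * E c b := by
  induction k generalizing a with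
  | zero => simp [powEntry, ha, hb]
  | succ k ih =>
    rw [powEntry_succ, sum_congr rfl fun c hc => by rw [ih hc]]
    simp only [powEntry_succ, mul_sum, sum_mul, ← mul_assoc]
    exact sum_comm

variable [CharZero K] (hx : IsGenericTab x)

include hx

/-- Only the first differences of the eigenvalue enter the characteristic identities, and
`raiseCoeff_root` makes them linear in the entries. For `r = 0` the sum is empty and the eigenvalue
is 0. -/
theorem exists_sum_genE_mul_genE (r : ℕ) : ∃ c : Shift → K,
    ∑ b ∈ range r, genE x r b * genE x b r = dg c ∧ ∀ i < r + 1, ∀ z,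
      c (z + unitShift r i 1) = c z + (ent x z r i + ∑ j ∈ range r, ent x z (r - 1) j -
        ∑ j ∈ range (r + 1), ent x z r j) ∧
      c (z + unitShift r i (-1)) = c z - (ent x z r i + ∑ j ∈ range r, ent x z (r - 1) j -
        ∑ j ∈ range (r + 1), ent x z r j) := by
  cases r with
  | zero =>
    refine ⟨fun _ => 0, by simp [dg, op_zero], fun i hi z => ?_⟩
    obtain rfl : i = 0 := by omega
    simp
  | succ r =>
    refine ⟨fun z => -∑ j ∈ range (r + 1), raiseCoeff x r j z, ?_, fun i hi z => ?_⟩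
    · have h := sum_genE_dg_genE hx (dependsAbove_one r) (sum_phi_mul_psi hx r)
      simpa only [dg, op_one, mul_one] using h
    · have h := raiseCoeff_root hx r z hi
      have hd : ∀ j (d : ℤ), raiseCoeff x r j (z + unitShift (r + 1) i d) = raiseCoeff x r j z +
          d * (raiseCoeff x r j z / (ent x z (r + 1) i - ent x z r j)) := by
        intro j d
        rw [raiseCoeff_add_unitShift_succ hx hi]
        have h1 : ent x z r j - ent x z (r + 1) i ≠ 0 := hx.sub_ne_zero z (by simp)
        have h2 : ent x z (r + 1) i - ent x z r j ≠ 0 := hx.sub_ne_zero z (by simp)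
        rw [← neg_sub (ent x z r j)]
        field_simp
        ring
      simp only [hd, sum_add_distrib, ← mul_sum, Nat.add_sub_cancel]
      push_cast
      exact ⟨by linear_combination -h, by linear_combination h⟩

omit hx [CharZero K] in
theorem weightCoeff_add_unitShift_self {r i : ℕ} (hi : i < r + 1) (d : ℤ) (z : Shift) :
    weightCoeff x r (z + unitShift r i d) = weightCoeff x r z + d := by
  have h : ∀ j ∈ range r, ent x (z + unitShift r i d) (r - 1) j = ent x z (r - 1) j := fun j hj =>
    ent_add_unitShift_of_ne x z d (by have := mem_range.mp hj; simp; omega)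
  simp only [weightCoeff]
  rw [sum_congr rfl h]
  simp only [ent_add_unitShift, sum_add_distrib, true_and, sum_ite_eq', mem_range, hi, if_true]
  ring

/-- Characteristic identity: the matrix `(E_{aj})` acts on the vector operator `psi r i` by a
scalar, placed on the right. For the top row the sum is a commutator with the quadratic operator
plus a weight term; bracketing with `E_{ar}` gives the other rows. -/
theorem sum_genE_mul_psi {r a i : ℕ} (hi : i < r + 1) (ha : a ≤ r) :
    ∑ j ∈ range (r + 1), genE x a j * psi x r i j =
      psi x r i a * dg fun z => ent x z r i + r + 1 := by
  have htop : ∑ j ∈ range (r + 1), genE x r j * psi x r i j =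
      psi x r i r * dg fun z => ent x z r i + r + 1 := by
    obtain ⟨c, hc, hd⟩ := exists_sum_genE_mul_genE hx r
    rw [sum_range_succ, sum_congr rfl fun j hj => show genE x r j * psi x r i j =
      genE x r j * genE x j r * psi x r i r - psi x r i r * (genE x r j * genE x j r) by
        have h := (psi_top_commute hx (i := i) (mem_range.mp hj)).eq
        rw [psi_of_lt hx (mem_range.mp hj), mul_sub, ← mul_assoc, ← mul_assoc, ← mul_assoc, h],
      sum_sub_distrib, ← sum_mul, ← mul_sum, hc, genE_self, weightOp, psi_top x hi]
    simp only [mul_neg, neg_mul]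
    rw [dg_mul_op_comm, dg_mul_op_comm, op_mul_dg, op_mul_dg, op_mul_dg, op_mul_dg, op_neg, op_neg,
      op_neg, op_neg, op_sub, op_add]
    congr 1
    funext z
    rw [(hd i hi z).1, weightCoeff_add_unitShift_self hi, weightCoeff]
    push_cast
    ring
  rcases ha.eq_or_lt with rfl | ha
  · exact htop
  · have h1 : genE x a r * (∑ j ∈ range (r + 1), genE x r j * psi x r i j) -
        (∑ j ∈ range (r + 1), genE x r j * psi x r i j) * genE x a r =
        ∑ j ∈ range (r + 1), genE x a j * psi x r i j := by
      rw [mul_sum, sum_mul, ← sum_sub_distrib]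
      have h2 : ∀ j ∈ range (r + 1), genE x a r * (genE x r j * psi x r i j) -
          genE x r j * psi x r i j * genE x a r = genE x a j * psi x r i j -
            (if a = j then genE x r r * psi x r i j else 0) +
            if j = r then genE x r r * psi x r i a else 0 := by
        intro j hj
        have hj' : j ≤ r := by simpa [Nat.lt_succ_iff] using hj
        have e1 := genE_mul hx a r r j
        have e2 := genE_mul_psi hx (c := j) i ha.le le_rfl
        rw [← mul_assoc, e1, mul_assoc (genE x r j), ← sub_eq_iff_eq_add.mpr e2]
        rcases eq_or_ne j r with rfl | hne
        · simp [ha.ne, mul_sub, add_mul, mul_assoc]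
        · simp only [if_neg hne, if_neg hne.symm, if_true]
          split_ifs <;> simp [add_mul, sub_mul, mul_assoc]
      rw [sum_congr rfl h2, sum_add_distrib, sum_sub_distrib, sum_ite_eq, sum_ite_eq',
        if_pos (by simp; omega), if_pos (by simp)]
      abel
    have h2 := (dg_commute_genE x (r := r) (g := fun z => ent x z r i + r + 1)
      (fun z z' hz => by simp only [ent, hz r le_rfl]) ha.le le_rfl).eq
    rw [← h1, htop, psi_of_lt hx ha, sub_mul, mul_assoc, mul_assoc, mul_assoc, ← h2]

/-- The characteristic identity for rows. The eigenvalue is one less than for columns, since the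
commutator sees the difference of the quadratic operator for the step `-1`. -/
theorem sum_phi_mul_genE {r a i : ℕ} (hi : i < r + 1) (ha : a ≤ r) :
    ∑ j ∈ range (r + 1), phi x r i j * genE x j a =
      phi x r i a * dg fun z => ent x z r i + r := by
  have htop : ∑ j ∈ range (r + 1), phi x r i j * genE x j r =
      phi x r i r * dg fun z => ent x z r i + r := by
    obtain ⟨c, hc, hd⟩ := exists_sum_genE_mul_genE hx r
    rw [sum_range_succ, sum_congr rfl fun j hj => show phi x r i j * genE x j r =
      phi x r i r * (genE x r j * genE x j r) - genE x r j * genE x j r * phi x r i r by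
        have h := (phi_top_commute hx (i := i) (mem_range.mp hj)).eq
        rw [phi_of_lt hx (mem_range.mp hj), sub_mul, mul_assoc, mul_assoc, mul_assoc, h],
      sum_sub_distrib, ← sum_mul, ← mul_sum, hc, genE_self, weightOp, phi_top x hi]
    rw [dg_mul_op_comm, op_mul_dg, op_mul_dg, op_mul_dg, op_mul_dg, op_sub, op_add]
    congr 1
    funext z
    rw [(hd i hi z).2, weightCoeff]
    ring
  rcases ha.eq_or_lt with rfl | ha
  · exact htop
  · have h1 : (∑ j ∈ range (r + 1), phi x r i j * genE x j r) * genE x r a -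
        genE x r a * (∑ j ∈ range (r + 1), phi x r i j * genE x j r) =
        ∑ j ∈ range (r + 1), phi x r i j * genE x j a := by
      rw [mul_sum, sum_mul, ← sum_sub_distrib]
      have h2 : ∀ j ∈ range (r + 1), phi x r i j * genE x j r * genE x r a -
          genE x r a * (phi x r i j * genE x j r) = phi x r i j * genE x j a -
            (if j = a then phi x r i j * genE x r r else 0) +
            if j = r then phi x r i a * genE x r r else 0 := by
        intro j hj
        have e1 := genE_mul hx j r r a
        have e2 := phi_mul_genE hx (c := j) i le_rfl ha.le
        rw [mul_assoc, e1, ← mul_assoc (genE x r a), ← sub_eq_iff_eq_add.mpr e2]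
        rcases eq_or_ne j r with rfl | hne
        · simp [ha.ne', sub_mul, mul_add, mul_assoc]
        · simp only [if_neg hne, if_neg hne.symm, if_true]
          split_ifs <;> simp [mul_add, mul_sub, mul_assoc]
      rw [sum_congr rfl h2, sum_add_distrib, sum_sub_distrib, sum_ite_eq', sum_ite_eq',
        if_pos (by simp; omega), if_pos (by simp)]
      abel
    have h2 := (dg_commute_genE x (r := r) (g := fun z => ent x z r i + r)
      (fun z z' hz => by simp only [ent, hz r le_rfl]) le_rfl ha.le).eq
    rw [← h1, htop, phi_of_lt hx ha, sub_mul, mul_assoc, mul_assoc, mul_assoc, ← h2]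

/-! ### Powers of the matrix of units, and the recursion of their traces from row to row. -/

omit hx [CharZero K]

variable (x)

/-- The eigenvalue of the corner entry of the `k`-th power of the matrix `(E_{ab})_{a,b ≤ r+1}`. -/
def cornerCoeff (r k : ℕ) (z : Shift) : K :=
  ∑ j ∈ range (r + 2), (ent x z (r + 1) j + r + 1) ^ k * lowerCoeff x (r + 1) j z

/-- The coefficients in the last column of the `k`-th power of the matrix `(E_{ab})_{a,b ≤ r+1}`. -/
def columnCoeff (r i k : ℕ) (z : Shift) : K :=
  ∑ j ∈ range (r + 2), (ent x z (r + 1) j + r + 1) ^ k *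
    (lowerCoeff x (r + 1) j z / (ent x z (r + 1) j - ent x z r i))

/-- The eigenvalue of the trace of the `k`-th power of the matrix `(E_{ab})_{a,b ≤ r}`. -/
def traceCoeff (r k : ℕ) (z : Shift) : K :=
  ∑ i ∈ range (r + 1), (ent x z r i + r) ^ k *
    ∏ j ∈ (range (r + 1)).erase i, (1 - 1 / (ent x z r i - ent x z r j))

variable {x}

theorem dependsAbove_columnCoeff (r i k : ℕ) : DependsAbove r (columnCoeff x r i k) := by
  intro z z' h
  have h1 := h r le_rfl
  have h2 := h (r + 1) (by omega)
  simp only [columnCoeff, (dependsAbove_lowerCoeff x r _) z z' h, ent, h1, h2]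

include hx

theorem lowerCoeff_div_eq {r i : ℕ} (hi : i < r + 1) (j : ℕ) (z : Shift) :
    lowerCoeff x (r + 1) j z / (ent x z (r + 1) j - ent x z r i) =
      (∏ t ∈ (range (r + 1)).erase i, (ent x z (r + 1) j - ent x z r t)) /
        rowDen x (r + 1) j z := by
  have h : ent x z (r + 1) j - ent x z r i ≠ 0 := hx.sub_ne_zero z (by simp)
  rw [lowerCoeff, ← mul_prod_erase _ _ (mem_range.mpr hi), Nat.add_sub_cancel, div_right_comm,
    mul_div_cancel_left₀ _ h]

/-- The division in `columnCoeff` removes the only factor with the entry `(r, i)`. This is why the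
coefficient is unchanged when it is moved past the lowering component `phi r i`. -/
theorem columnCoeff_add_unitShift {r i : ℕ} (hi : i < r + 1) (k : ℕ) (d : ℤ) (z : Shift) :
    columnCoeff x r i k (z + unitShift r i d) = columnCoeff x r i k z := by
  refine sum_congr rfl fun j _ => ?_
  rw [lowerCoeff_div_eq hx hi, lowerCoeff_div_eq hx hi,
    ent_add_unitShift_of_ne x z d (by simp), rowDen_congr x (z' := z) (by
      rw [Pi.add_apply, unitShift_row_ne (by omega), add_zero])]
  congr 2
  refine prod_congr rfl fun t ht => ?_
  rw [ent_add_unitShift_of_ne x z d (by simpa using ne_of_mem_erase ht)]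

theorem cornerCoeff_zero (r : ℕ) (z : Shift) : cornerCoeff x r 0 z = 1 := by
  simp only [cornerCoeff, pow_zero, one_mul]
  exact interpolation_sum_one (ent_injOn hx (r + 1) z _) (by simp)

theorem columnCoeff_zero {r i : ℕ} (hi : i < r + 1) (z : Shift) : columnCoeff x r i 0 z = 0 := by
  simp only [columnCoeff, pow_zero, one_mul, lowerCoeff_div_eq hx hi]
  exact interpolation_sum_zero (ent_injOn hx (r + 1) z _) (by
    rw [card_erase_of_mem (mem_range.mpr hi)]; simp)

theorem columnCoeff_succ (r i k : ℕ) (z : Shift) : columnCoeff x r i (k + 1) z =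
    (ent x z r i + r + 1) * columnCoeff x r i k z + cornerCoeff x r k z := by
  simp only [columnCoeff, cornerCoeff, mul_sum, ← sum_add_distrib]
  refine sum_congr rfl fun j _ => ?_
  have h : ent x z (r + 1) j - ent x z r i ≠ 0 := hx.sub_ne_zero z (by simp)
  field_simp
  ring

/-- For each `j`, `raiseCoeff_root` replaces the sum of the raising coefficients over `ent x z (r +
1) j - ent x z r i` by a linear expression, which together with the weight is `ent x z (r + 1) j + r
+ 1`. -/
theorem cornerCoeff_succ (r k : ℕ) (z : Shift) : cornerCoeff x r (k + 1) z =
    -∑ i ∈ range (r + 1), raiseCoeff x r i z * columnCoeff x r i k z +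
      weightCoeff x (r + 1) z * cornerCoeff x r k z := by
  simp only [columnCoeff, cornerCoeff, mul_sum]
  rw [sum_comm, ← sum_neg_distrib, ← sum_add_distrib]
  refine sum_congr rfl fun j hj => ?_
  have h := raiseCoeff_root hx r z (mem_range.mp hj)
  have h1 : ∑ i ∈ range (r + 1), raiseCoeff x r i z * ((ent x z (r + 1) j + r + 1) ^ k *
      (lowerCoeff x (r + 1) j z / (ent x z (r + 1) j - ent x z r i))) =
      (∑ i ∈ range (r + 1), raiseCoeff x r i z / (ent x z (r + 1) j - ent x z r i)) *
      ((ent x z (r + 1) j + r + 1) ^ k * lowerCoeff x (r + 1) j z) := by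
    rw [sum_mul]
    exact sum_congr rfl fun i _ => by ring
  rw [h1, weightCoeff, Nat.add_sub_cancel, pow_succ]
  push_cast
  linear_combination ((ent x z (r + 1) j + r + 1) ^ k * lowerCoeff x (r + 1) j z) * h

/-- Interpolation with the entries of row `r` and the entry `(r + 1, j)` as nodes; the points are
the other entries of row `r + 1`, raised by 1. -/
theorem one_add_sum_dualCoeff_div {r j : ℕ} (hj : j < r + 2) (z : Shift) :
    lowerCoeff x (r + 1) j z * (1 + ∑ i ∈ range (r + 1), dualCoeff x r i z /
      ((ent x z (r + 1) j - ent x z r i) * (ent x z (r + 1) j - ent x z r i + 1))) =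
    ∏ t ∈ (range (r + 2)).erase j, (1 - 1 / (ent x z (r + 1) j - ent x z (r + 1) t)) := by
  have hne : ∀ i, ent x z (r + 1) j - ent x z r i ≠ 0 := fun i => hx.sub_ne_zero z (by simp)
  have hne' : ∀ i, ent x z (r + 1) j - ent x z r i + 1 ≠ 0 := fun i h =>
    hx.ent_ne z z (k := r + 1) (i := j) (l := r) (j := i) (by simp) (-1)
      (by push_cast; linear_combination h)
  have h1 := interpolation_sum_one (T := (range (r + 2)).erase j)
    (b := fun t => ent x z (r + 1) t + 1)
    (injOn_insertNone (X := ent x z (r + 1) j) (ent_injOn hx r z (range (r + 1)))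
      fun i _ => sub_ne_zero.mp (hne i)) (by
        rw [card_erase_of_mem (mem_range.mpr hj), card_insertNone]; simp)
  rw [sum_insertNone_interpolation, sub_eq_iff_eq_add] at h1
  have h2 : ∀ i ∈ range (r + 1), dualCoeff x r i z /
      ((ent x z (r + 1) j - ent x z r i) * (ent x z (r + 1) j - ent x z r i + 1)) =
      (∏ t ∈ (range (r + 2)).erase j, (ent x z r i - (ent x z (r + 1) t + 1))) /
      (∏ t ∈ (range (r + 1)).erase i, (ent x z r i - ent x z r t)) /
        (ent x z (r + 1) j - ent x z r i) := by
    intro i _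
    rw [dualCoeff, ← mul_prod_erase _ _ (mem_range.mpr hj), rowDen]
    have h3 : ∀ t, ent x z r i - (ent x z (r + 1) t + 1) = ent x z r i - 1 - ent x z (r + 1) t :=
      fun t => by ring
    simp only [h3]
    have h4 := hne' i
    have h5 : (∏ t ∈ (range (r + 1)).erase i, (ent x z r i - ent x z r t)) ≠ 0 :=
      rowDen_ne_zero hx r i z
    field_simp [hne i]
    ring
  rw [sum_congr rfl h2, ← h1, lowerCoeff, rowDen, Nat.add_sub_cancel, div_mul_div_comm,
    mul_comm (∏ t ∈ range (r + 1), _), mul_div_mul_right _ _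
      (prod_ne_zero_iff.mpr fun i _ => hne i), ← prod_div_distrib]
  refine prod_congr rfl fun t ht => ?_
  have h3 : ent x z (r + 1) j - ent x z (r + 1) t ≠ 0 :=
    hx.sub_ne_zero z (by simpa using (ne_of_mem_erase ht).symm)
  field_simp
  ring

/-- Partial fractions with poles in row `r + 1` and zeros at the entries of row `r` other than `i`,
evaluated at the entry `(r, i)` lowered by 1. -/
theorem dualCoeff_mul_sum_lowerCoeff {r i : ℕ} (hi : i < r + 1) (z : Shift) :
    dualCoeff x r i z * ∑ j ∈ range (r + 2), lowerCoeff x (r + 1) j z /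
      (ent x z (r + 1) j - ent x z r i) / (ent x z (r + 1) j - ent x z r i + 1) =
    ∏ t ∈ (range (r + 1)).erase i, (1 - 1 / (ent x z r i - ent x z r t)) := by
  have hne' : ∀ j, ent x z r i - 1 - ent x z (r + 1) j ≠ 0 := fun j h =>
    hx.ent_ne z z (k := r + 1) (i := j) (l := r) (j := i) (by simp) (-1)
      (by push_cast; linear_combination -h)
  have h1 := prod_div_prod_eq_sum (T := (range (r + 1)).erase i) (b := ent x z r)
    (X := ent x z r i - 1) (ent_injOn hx (r + 1) z (range (r + 2)))
    (by rw [card_erase_of_mem (mem_range.mpr hi)]; simp) fun j _ => sub_ne_zero.mp (hne' j)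
  have h2 : ∀ j, lowerCoeff x (r + 1) j z /
      (ent x z (r + 1) j - ent x z r i) / (ent x z (r + 1) j - ent x z r i + 1) =
      -((∏ t ∈ (range (r + 1)).erase i, (ent x z (r + 1) j - ent x z r t)) /
      (∏ t ∈ (range (r + 2)).erase j, (ent x z (r + 1) j - ent x z (r + 1) t)) /
        (ent x z r i - 1 - ent x z (r + 1) j)) := fun j => by
    rw [lowerCoeff_div_eq hx hi, rowDen, ← div_neg]
    congr 1
    ring
  have h3 : (∏ j ∈ range (r + 2), (ent x z r i - 1 - ent x z (r + 1) j)) ≠ 0 :=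
    prod_ne_zero_iff.mpr fun j _ => hne' j
  rw [sum_congr rfl fun j _ => h2 j, sum_neg_distrib, ← h1, dualCoeff, rowDen, ← neg_div,
    div_mul_div_comm, neg_mul_neg, mul_comm, mul_div_mul_right _ _ h3, ← prod_div_distrib]
  refine prod_congr rfl fun t ht => ?_
  have h3 : ent x z r i - ent x z r t ≠ 0 :=
    hx.sub_ne_zero z (by simpa using (ne_of_mem_erase ht).symm)
  field_simp
  ring

/-- The sum over `l` is geometric, and the two bases differ by `ent x z (r + 1) j - ent x z r i +
1`. It splits into `k`-th powers attached to rows `r + 1` and `r`, whose coefficients are the two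
preceding identities. -/
theorem traceCoeff_succ (r k : ℕ) (z : Shift) : traceCoeff x (r + 1) k z =
    cornerCoeff x r k z + traceCoeff x r k z + ∑ i ∈ range (r + 1), dualCoeff x r i z *
      ∑ l ∈ range k, columnCoeff x r i l z * (ent x z r i + r) ^ (k - 1 - l) := by
  have hne : ∀ i j, ent x z (r + 1) j - ent x z r i ≠ 0 := fun i j => hx.sub_ne_zero z (by simp)
  have hne' : ∀ i j, ent x z (r + 1) j - ent x z r i + 1 ≠ 0 := fun i j h =>
    hx.ent_ne z z (k := r + 1) (i := j) (l := r) (j := i) (by simp) (-1)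
      (by push_cast; linear_combination h)
  have h1 : ∀ i, ∑ l ∈ range k, columnCoeff x r i l z * (ent x z r i + r) ^ (k - 1 - l) =
      ∑ j ∈ range (r + 2), lowerCoeff x (r + 1) j z / (ent x z (r + 1) j - ent x z r i) /
        (ent x z (r + 1) j - ent x z r i + 1) *
        ((ent x z (r + 1) j + r + 1) ^ k - (ent x z r i + r) ^ k) := by
    intro i
    simp only [columnCoeff, sum_mul]
    rw [sum_comm]
    refine sum_congr rfl fun j _ => ?_
    have hg := (Commute.all (ent x z (r + 1) j + r + 1) (ent x z r i + r)).mul_geom_sum₂ k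
    rw [← hg, mul_sum, mul_sum]
    refine sum_congr rfl fun l _ => ?_
    have := hne i j
    have := hne' i j
    field_simp
    ring
  simp only [h1, mul_sub, sum_sub_distrib, mul_sum]
  have h2 : ∑ i ∈ range (r + 1), ∑ j ∈ range (r + 2), dualCoeff x r i z *
      (lowerCoeff x (r + 1) j z / (ent x z (r + 1) j - ent x z r i) /
        (ent x z (r + 1) j - ent x z r i + 1) * (ent x z r i + r) ^ k) = traceCoeff x r k z := by
    refine sum_congr rfl fun i hi => ?_
    rw [← dualCoeff_mul_sum_lowerCoeff hx (mem_range.mp hi), mul_sum, mul_sum]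
    exact sum_congr rfl fun j _ => by ring
  rw [h2, sum_comm (s := range (r + 1)), add_assoc, add_sub_cancel, traceCoeff, cornerCoeff,
    ← sum_add_distrib]
  refine sum_congr rfl fun j hj => ?_
  rw [← one_add_sum_dualCoeff_div hx (mem_range.mp hj), mul_add, mul_add, mul_sum, mul_sum]
  push_cast
  congr 1
  · ring
  · refine sum_congr rfl fun i _ => ?_
    have := hne i j
    have := hne' i j
    field_simp
    ring

variable [CharZero K]

/-- The last column of a power stays a combination of the vector operators `psi r i` with diagonal
coefficients: left multiplication by the smaller block is the characteristic identity, and by the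
last row it is the contraction `sum_phi_mul_psi`. -/
theorem powEntry_genE_col (r k : ℕ) :
    (∀ a ≤ r, powEntry (genE x) (range (r + 2)) k a (r + 1) =
      ∑ i ∈ range (r + 1), psi x r i a * dg (columnCoeff x r i k)) ∧
    powEntry (genE x) (range (r + 2)) k (r + 1) (r + 1) = dg (cornerCoeff x r k) := by
  induction k with
  | zero =>
    refine ⟨fun a ha => ?_, ?_⟩
    · rw [powEntry, if_neg (by omega), sum_eq_zero fun i hi => ?_]
      rw [show columnCoeff x r i 0 = fun _ => 0 from
        funext fun z => columnCoeff_zero hx (mem_range.mp hi) z, dg, op_zero, mul_zero]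
    · rw [powEntry, if_pos rfl, show cornerCoeff x r 0 = fun _ => 1 from
        funext fun z => cornerCoeff_zero hx r z, dg, op_one]
  | succ k ih =>
    have hcol : ∀ c ∈ range (r + 1), powEntry (genE x) (range (r + 2)) k c (r + 1) =
        ∑ i ∈ range (r + 1), psi x r i c * dg (columnCoeff x r i k) :=
      fun c hc => ih.1 c (by simpa [Nat.lt_succ_iff] using hc)
    refine ⟨fun a ha => ?_, ?_⟩
    · rw [powEntry_succ, sum_range_succ, ih.2, sum_congr rfl fun c hc => by rw [hcol c hc],
        ← sum_psi hx ha, sum_mul]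
      simp only [mul_sum]
      rw [sum_comm, ← sum_add_distrib]
      refine sum_congr rfl fun i hi => ?_
      rw [sum_congr rfl fun c _ => (mul_assoc _ _ _).symm, ← sum_mul,
        sum_genE_mul_psi hx (mem_range.mp hi) ha, mul_assoc, ← mul_add, dg_mul_dg, op_add,
        ← funext (columnCoeff_succ hx r i k)]
    · rw [powEntry_succ, sum_range_succ, ih.2, sum_congr rfl fun c hc => by rw [hcol c hc],
        sum_congr rfl fun c hc => by rw [← sum_phi hx (by simpa [Nat.lt_succ_iff] using hc)],
        funext (cornerCoeff_succ hx r k)]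
      simp only [mul_sum, sum_mul]
      rw [sum_comm, genE_self, weightOp, dg_mul_dg]
      have h : ∀ i ∈ range (r + 1), ∑ c ∈ range (r + 1), ∑ i' ∈ range (r + 1),
          phi x r i' c * (psi x r i c * dg (columnCoeff x r i k)) =
          dg fun z => -(raiseCoeff x r i z * columnCoeff x r i k z) := by
        intro i hi
        rw [sum_comm]
        simp only [← mul_assoc, ← sum_mul]
        rw [sum_congr rfl fun i' hi' => sum_phi_mul_psi hx r i hi i' hi', sum_ite_eq, if_pos hi,
          dg_mul_dg]
        simp only [neg_mul]
      rw [sum_congr rfl h, dg, op_sum, op_add]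
      simp only [sum_neg_distrib]

/-- Products of matrix units are sorted by the last visit to the index `r + 1`: before it stands an
entry of the last column of the `l`-th power, after it the last row times a power of the smaller
matrix, which acts on `phi` by a scalar. -/
theorem powEntry_genE_succ (r k : ℕ) : ∀ a ≤ r, ∀ b ≤ r,
    powEntry (genE x) (range (r + 2)) k a b = powEntry (genE x) (range (r + 1)) k a b +
      ∑ i ∈ range (r + 1), ∑ i' ∈ range (r + 1), ∑ l ∈ range k,
        psi x r i a * dg (columnCoeff x r i l) * (phi x r i' b *
          dg fun z => (ent x z r i' + r) ^ (k - 1 - l)) := by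
  induction k with
  | zero => intro a ha b hb; simp [powEntry]
  | succ k ih =>
    intro a ha b hb
    rw [powEntry_succ' _ k (by simp; omega) (by simp; omega),
      powEntry_succ' _ k (by simp; omega) (by simp; omega), sum_range_succ,
      (powEntry_genE_col hx r k).1 a ha,
      sum_congr rfl fun c hc => by rw [ih a ha c (by simpa [Nat.lt_succ_iff] using hc)]]
    simp only [add_mul, sum_add_distrib, add_assoc]
    congr 1
    simp only [sum_mul]
    rw [sum_comm, ← sum_add_distrib]
    refine sum_congr rfl fun i hi => ?_
    rw [sum_comm, ← sum_phi hx hb, mul_sum, ← sum_add_distrib]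
    refine sum_congr rfl fun i' hi' => ?_
    rw [sum_comm, sum_range_succ]
    congr 1
    · refine sum_congr rfl fun l hl => ?_
      have h : ∀ c ∈ range (r + 1), psi x r i a * dg (columnCoeff x r i l) * (phi x r i' c *
          dg fun z => (ent x z r i' + r) ^ (k - 1 - l)) * genE x c b =
          psi x r i a * dg (columnCoeff x r i l) * ((phi x r i' c * genE x c b) *
          dg fun z => (ent x z r i' + r) ^ (k - 1 - l)) := by
        intro c hc
        have h2 := (dg_commute_genE x (r := r) (g := fun z => (ent x z r i' + r) ^ (k - 1 - l))
          (fun z z' hz => by simp only [ent, hz r le_rfl]) (a := c) (b := b)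
          (by simpa [Nat.lt_succ_iff] using hc) hb).eq
        rw [mul_assoc, mul_assoc (phi x r i' c), h2, mul_assoc (phi x r i' c)]
      rw [sum_congr rfl h, ← mul_sum, ← sum_mul, sum_phi_mul_genE hx (mem_range.mp hi') hb,
        mul_assoc (phi x r i' b), dg_mul_dg]
      have h3 : k + 1 - 1 - l = (k - 1 - l) + 1 := by have := mem_range.mp hl; omega
      rw [h3]
      simp only [pow_succ']
    · simp [dg, op_one]

/-- Induction on the row: the trace is the corner entry, the trace of the smaller matrix, and the
terms that visit the last index. In the latter the sum over `a` is the contraction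
`sum_psi_mul_phi`, so everything is diagonal and `traceCoeff_succ` identifies the eigenvalue. -/
theorem sum_powEntry_genE (r k : ℕ) :
    ∑ a ∈ range (r + 1), powEntry (genE x) (range (r + 1)) k a a = dg (traceCoeff x r k) := by
  induction r with
  | zero =>
    have h : ∀ k, powEntry (genE x) (range 1) k 0 0 = dg fun z => ent x z 0 0 ^ k := by
      intro k
      induction k with
      | zero => simp [powEntry, dg, op_one]
      | succ k ih =>
        rw [powEntry_succ, sum_range_one, ih, genE_self, weightOp, dg_mul_dg]
        simp [weightCoeff, pow_succ']
    rw [sum_range_one, h]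
    congr 1
    funext z
    simp [traceCoeff]
  | succ r ih =>
    rw [sum_range_succ, (powEntry_genE_col hx r k).2, sum_congr rfl fun a ha =>
      powEntry_genE_succ hx r k a (by simpa [Nat.lt_succ_iff] using ha) a
        (by simpa [Nat.lt_succ_iff] using ha), sum_add_distrib, ih]
    have h : ∑ a ∈ range (r + 1), ∑ i ∈ range (r + 1), ∑ i' ∈ range (r + 1), ∑ l ∈ range k,
        psi x r i a * dg (columnCoeff x r i l) * (phi x r i' a *
          dg fun z => (ent x z r i' + r) ^ (k - 1 - l)) =
        dg fun z => ∑ i ∈ range (r + 1), dualCoeff x r i z *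
          ∑ l ∈ range k, columnCoeff x r i l z * (ent x z r i + r) ^ (k - 1 - l) := by
      rw [sum_comm, dg, ← op_sum]
      refine sum_congr rfl fun i hi => ?_
      rw [sum_comm]
      have h1 : ∀ i' ∈ range (r + 1), ∑ a ∈ range (r + 1), ∑ l ∈ range k,
          psi x r i a * dg (columnCoeff x r i l) * (phi x r i' a *
            dg fun z => (ent x z r i' + r) ^ (k - 1 - l)) =
          if i = i' then dg fun z => dualCoeff x r i z *
            ∑ l ∈ range k, columnCoeff x r i l z * (ent x z r i + r) ^ (k - 1 - l) else 0 := by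
        intro i' hi'
        rw [sum_comm]
        have h2 : ∀ l ∈ range k, ∑ a ∈ range (r + 1), psi x r i a * dg (columnCoeff x r i l) *
            (phi x r i' a * dg fun z => (ent x z r i' + r) ^ (k - 1 - l)) =
            (if i = i' then dg (dualCoeff x r i) else 0) * dg fun z =>
              columnCoeff x r i l (z + unitShift r i' (-1)) *
                (ent x z r i' + r) ^ (k - 1 - l) := by
          intro l _
          rw [← sum_psi_mul_phi hx r i hi i' hi', ← dg_mul_dg, sum_mul]
          refine sum_congr rfl fun a ha => ?_
          rw [mul_assoc, ← mul_assoc (dg (columnCoeff x r i l)), dg_mul_phi hx (dependsAbove_columnCoeff r i l)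
            (mem_range.mp hi') (by simpa [Nat.lt_succ_iff] using ha)]
          simp only [mul_assoc]
        rw [sum_congr rfl h2]
        split_ifs with hii
        · subst hii
          simp only [dg_mul_dg, columnCoeff_add_unitShift hx (mem_range.mp hi)]
          rw [dg, op_sum]
          simp only [mul_sum]
        · simp
      rw [sum_congr rfl h1, sum_ite_eq, if_pos hi]
    rw [h, op_add, op_add]
    congr 1
    funext z
    rw [traceCoeff_succ hx]
    ring

end Traces

end GelfandTsetlin

namespace GelfandTsetlin

attribute [local instance 2000] Ring.toAddCommGroup

/-! ### Explicit formulas for all matrix units -/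

section Paths

open Finset

open Classical in
/-- The functions that choose a position in each of the rows `r, …, r + d`. -/
noncomputable def paths (r : ℕ) : ℕ → Finset (ℕ → ℕ)
  | 0 => (range (r + 1)).image fun i => Function.update (0 : ℕ → ℕ) r i
  | d + 1 => (paths r d ×ˢ range (r + d + 2)).image fun q => Function.update q.1 (r + d + 1) q.2

theorem mem_paths {r d : ℕ} {c : ℕ → ℕ} : c ∈ paths r d ↔
    ∀ k, (r ≤ k ∧ k ≤ r + d → c k ≤ k) ∧ (¬ (r ≤ k ∧ k ≤ r + d) → c k = 0) := by
  induction d generalizing c with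
  | zero =>
    simp only [paths, mem_image, mem_range]
    constructor
    · rintro ⟨i, hi, rfl⟩ k
      by_cases h : k = r
      · subst h; simp; omega
      · simp only [Function.update_of_ne h]; exact ⟨fun _ => Nat.zero_le _, fun _ => rfl⟩
    · intro h
      refine ⟨c r, by have := (h r).1 (by omega); omega, funext fun k => ?_⟩
      by_cases hk : k = r
      · subst hk; simp
      · simp [Function.update_of_ne hk, (h k).2 (by omega)]
  | succ d ih =>
    simp only [paths, mem_image, mem_product, mem_range, Prod.exists, ih]
    constructor
    · rintro ⟨c, i, ⟨hc, hi⟩, rfl⟩ k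
      by_cases h : k = r + d + 1
      · subst h; simp; omega
      · rw [Function.update_of_ne h]
        exact ⟨fun _ => (hc k).1 (by omega), fun _ => (hc k).2 (by omega)⟩
    · intro h
      refine ⟨Function.update c (r + d + 1) 0, c (r + d + 1), ⟨fun k => ?_, ?_⟩, by simp⟩
      · by_cases hk : k = r + d + 1
        · subst hk; simp
        · rw [Function.update_of_ne hk]
          exact ⟨fun _ => (h k).1 (by omega), fun _ => (h k).2 (by omega)⟩
      · have := (h (r + d + 1)).1 (by omega)
        omega

theorem sum_paths_zero {M : Type*} [AddCommMonoid M] (r : ℕ) (F : (ℕ → ℕ) → M) :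
    ∑ c ∈ paths r 0, F c = ∑ i ∈ range (r + 1), F (Function.update (0 : ℕ → ℕ) r i) := by
  classical
  rw [paths, sum_image]
  intro i _ j _ hij
  simpa using congrFun hij r

theorem sum_paths_succ {M : Type*} [AddCommMonoid M] (r d : ℕ) (F : (ℕ → ℕ) → M) :
    ∑ c ∈ paths r (d + 1), F c =
      ∑ c ∈ paths r d, ∑ i ∈ range (r + d + 2), F (Function.update c (r + d + 1) i) := by
  classical
  rw [paths, sum_image, sum_product]
  rintro ⟨c, i⟩ hc ⟨c', i'⟩ hc' h
  simp only [coe_product, Set.mem_prod, mem_coe, mem_paths] at hc hc'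
  simp only at h
  refine Prod.ext (funext fun k => ?_) (by simpa using congrFun h (r + d + 1))
  by_cases hk : k = r + d + 1
  · subst hk
    exact ((hc.1 _).2 (by omega)).trans ((hc'.1 _).2 (by omega)).symm
  · simpa [Function.update_of_ne hk] using congrFun h k

/-- The shift by `e` in the chosen positions of the rows `r, …, r + d`. -/
def pathShift (r : ℕ) (c : ℕ → ℕ) (d : ℕ) (e : ℤ) : Shift :=
  ∑ k ∈ Ico r (r + d + 1), unitShift k (c k) e

theorem pathShift_zero (r : ℕ) (c : ℕ → ℕ) (e : ℤ) : pathShift r c 0 e = unitShift r (c r) e := by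
  simp [pathShift]

theorem pathShift_update (r : ℕ) (c : ℕ → ℕ) (d i : ℕ) (e : ℤ) :
    pathShift r (Function.update c (r + d + 1) i) (d + 1) e =
      pathShift r c d e + unitShift (r + d + 1) i e := by
  rw [pathShift, ← add_assoc, sum_Ico_succ_top (by omega), Function.update_self, pathShift]
  congr 1
  refine sum_congr rfl fun k hk => ?_
  rw [Function.update_of_ne (by have := mem_Ico.mp hk; omega)]

theorem pathShift_apply {r : ℕ} {c : ℕ → ℕ} {d : ℕ} {e : ℤ} (k i : ℕ) :
    pathShift r c d e k i = if (r ≤ k ∧ k ≤ r + d) ∧ i = c k then e else 0 := by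
  simp only [pathShift, Finset.sum_apply, unitShift_apply]
  by_cases h : r ≤ k ∧ k ≤ r + d
  · rw [sum_eq_single k]
    · simp [h]
    · intro l _ hl
      simp [hl.symm]
    · intro hk
      exact absurd (mem_Ico.mpr ⟨h.1, by omega⟩) hk
  · rw [if_neg (by tauto)]
    refine sum_eq_zero fun l hl => ?_
    have := mem_Ico.mp hl
    rw [if_neg (by omega)]

variable {K : Type*} [Field K] (x : ℕ → ℕ → K)

/-- The coefficient of `T(z + δ)` in `E_{r,r+d+1} T(z)` for the shift `δ` along the path `c`. -/
def upCoeff (r : ℕ) (c : ℕ → ℕ) (d : ℕ) (z : Shift) : K :=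
  -raiseCoeff x (r + d) (c (r + d)) z * ∏ k ∈ Ico r (r + d),
    (raiseCoeff x k (c k) z / (ent x z k (c k) - ent x z (k + 1) (c (k + 1))))

/-- The coefficient of `T(z - δ)` in `E_{r+d+1,r} T(z)` for the shift `δ` along the path `c`. -/
def downCoeff (r : ℕ) (c : ℕ → ℕ) (d : ℕ) (z : Shift) : K :=
  lowerCoeff x r (c r) z * ∏ k ∈ Ico r (r + d),
    (lowerCoeff x (k + 1) (c (k + 1)) z / (ent x z (k + 1) (c (k + 1)) - ent x z k (c k)))

variable {x} (hx : IsGenericTab x)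

include hx

/-- The two orders of the commutator differ only in the factor that joins the last chosen entry to
the new one. If `D` is their difference, the term is multiplied by `1 - (D - 1) / D = 1 / D`, which
is the link in the product over the path. -/
theorem upCoeff_update (r : ℕ) (c : ℕ → ℕ) (d : ℕ) {i : ℕ} (hi : i < r + d + 2) (z : Shift) :
    upCoeff x r (Function.update c (r + d + 1) i) (d + 1) z =
      raiseCoeff x (r + d + 1) i (z + pathShift r c d 1) * upCoeff x r c d z -
      upCoeff x r c d (z + unitShift (r + d + 1) i 1) * raiseCoeff x (r + d + 1) i z := by
  have h1 : raiseCoeff x (r + d + 1) i (z + pathShift r c d 1) = raiseCoeff x (r + d + 1) i z :=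
    raiseCoeff_congr x (by
      funext j; rw [Pi.add_apply, Pi.add_apply, pathShift_apply, if_neg (by omega), add_zero])
      (by funext j; rw [Pi.add_apply, Pi.add_apply, pathShift_apply, if_neg (by omega), add_zero])
  have h2 : ∀ k ∈ Ico r (r + d), raiseCoeff x k (c k) (z + unitShift (r + d + 1) i 1) /
      (ent x (z + unitShift (r + d + 1) i 1) k (c k) -
        ent x (z + unitShift (r + d + 1) i 1) (k + 1) (c (k + 1))) =
      raiseCoeff x k (c k) z / (ent x z k (c k) - ent x z (k + 1) (c (k + 1))) := by
    intro k hk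
    have := mem_Ico.mp hk
    rw [raiseCoeff_add_unitShift_of_ne x 1 z (by omega) (by omega),
      ent_add_unitShift_of_ne x z 1 (by simp; omega), ent_add_unitShift_of_ne x z 1 (by simp; omega)]
  have h3 : ∀ k ∈ Ico r (r + d), raiseCoeff x k (Function.update c (r + d + 1) i k) z /
      (ent x z k (Function.update c (r + d + 1) i k) -
        ent x z (k + 1) (Function.update c (r + d + 1) i (k + 1))) =
      raiseCoeff x k (c k) z / (ent x z k (c k) - ent x z (k + 1) (c (k + 1))) := by
    intro k hk
    have := mem_Ico.mp hk
    rw [Function.update_of_ne (by omega), Function.update_of_ne (by omega)]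
  rw [h1, upCoeff, upCoeff, upCoeff, prod_congr rfl h2, raiseCoeff_add_unitShift_succ hx hi,
    ← add_assoc, prod_Ico_succ_top (by omega), prod_congr rfl h3, Function.update_self,
    Function.update_of_ne (by omega)]
  have h4 : ent x z (r + d) (c (r + d)) - ent x z (r + d + 1) i ≠ 0 := hx.sub_ne_zero z (by simp)
  push_cast
  field_simp
  ring

theorem downCoeff_update (r : ℕ) (c : ℕ → ℕ) (d : ℕ) {i : ℕ} (hc : c (r + d) ≤ r + d) (z : Shift) :
    downCoeff x r (Function.update c (r + d + 1) i) (d + 1) z =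
      lowerCoeff x (r + d + 1) i (z + pathShift r c d (-1)) * downCoeff x r c d z -
      downCoeff x r c d (z + unitShift (r + d + 1) i (-1)) * lowerCoeff x (r + d + 1) i z := by
  have h1 : lowerCoeff x (r + d + 1) i (z + pathShift r c d (-1)) =
      lowerCoeff x (r + d + 1) i (z + unitShift (r + d) (c (r + d)) (-1)) :=
    lowerCoeff_congr x (by
      funext j
      rw [Pi.add_apply, Pi.add_apply, pathShift_apply, if_neg (by omega), Pi.add_apply,
        Pi.add_apply, unitShift_apply, if_neg (by omega)])
      (by
        funext j
        rw [Pi.add_apply, Pi.add_apply, pathShift_apply, Pi.add_apply, Pi.add_apply,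
          unitShift_apply]
        simp)
  have h2 : ∀ k ∈ Ico r (r + d), lowerCoeff x (k + 1) (c (k + 1))
        (z + unitShift (r + d + 1) i (-1)) /
      (ent x (z + unitShift (r + d + 1) i (-1)) (k + 1) (c (k + 1)) -
        ent x (z + unitShift (r + d + 1) i (-1)) k (c k)) =
      lowerCoeff x (k + 1) (c (k + 1)) z / (ent x z (k + 1) (c (k + 1)) - ent x z k (c k)) := by
    intro k hk
    have := mem_Ico.mp hk
    rw [lowerCoeff_add_unitShift_of_ne x (-1) z (by omega) (by omega),
      ent_add_unitShift_of_ne x z (-1) (by simp; omega),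
      ent_add_unitShift_of_ne x z (-1) (by simp; omega)]
  have h3 : ∀ k ∈ Ico r (r + d), lowerCoeff x (k + 1) (Function.update c (r + d + 1) i (k + 1)) z /
      (ent x z (k + 1) (Function.update c (r + d + 1) i (k + 1)) -
        ent x z k (Function.update c (r + d + 1) i k)) =
      lowerCoeff x (k + 1) (c (k + 1)) z / (ent x z (k + 1) (c (k + 1)) - ent x z k (c k)) := by
    intro k hk
    have := mem_Ico.mp hk
    rw [Function.update_of_ne (by omega), Function.update_of_ne (by omega)]
  rw [h1, downCoeff, downCoeff, downCoeff, prod_congr rfl h2,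
    lowerCoeff_add_unitShift_pred hx (by omega),
    lowerCoeff_add_unitShift_of_ne x (-1) z (by omega) (by omega),
    ← add_assoc, prod_Ico_succ_top (by omega), prod_congr rfl h3, Function.update_self,
    Function.update_of_ne (by omega), Function.update_of_ne (by omega)]
  have h4 : ent x z (r + d + 1) i - ent x z (r + d) (c (r + d)) ≠ 0 := hx.sub_ne_zero z (by simp)
  push_cast
  field_simp
  ring

theorem genE_upper (r d : ℕ) :
    genE x r (r + d + 1) = ∑ c ∈ paths r d, op (upCoeff x r c d) (pathShift r c d 1) := by
  rw [genE, unitElt_upper]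
  induction d with
  | zero =>
    rw [sum_paths_zero, upper, raiseOp, ← sum_neg_distrib]
    refine sum_congr rfl fun i _ => ?_
    rw [op_neg, pathShift_zero, Function.update_self]
    congr 1
    funext z
    simp [upCoeff]
  | succ d ih =>
    rw [upper, ih, sum_paths_succ, Ring.lie_def, raiseOp, mul_neg, neg_mul, sub_neg_eq_add,
      neg_add_eq_sub, sum_mul_sum, sum_mul_sum, sum_comm, ← sum_sub_distrib]
    refine sum_congr rfl fun c _ => ?_
    rw [← sum_sub_distrib]
    refine sum_congr rfl fun i hi => ?_
    rw [op_mul, op_mul, pathShift_update, add_comm (unitShift _ _ _), op_sub]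
    congr 1
    funext z
    rw [upCoeff_update hx r c d (mem_range.mp hi)]

theorem genE_lower (r d : ℕ) :
    genE x (r + d + 1) r = ∑ c ∈ paths r d, op (downCoeff x r c d) (pathShift r c d (-1)) := by
  rw [genE, unitElt_lower]
  induction d with
  | zero =>
    rw [sum_paths_zero, lower, lowerOp]
    refine sum_congr rfl fun i _ => ?_
    rw [pathShift_zero, Function.update_self]
    congr 1
    funext z
    simp [downCoeff]
  | succ d ih =>
    rw [lower, ih, sum_paths_succ, Ring.lie_def, lowerOp, sum_mul_sum, sum_mul_sum, sum_comm, ← sum_sub_distrib]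
    refine sum_congr rfl fun c hc => ?_
    rw [← sum_sub_distrib]
    refine sum_congr rfl fun i hi => ?_
    rw [op_mul, op_mul, pathShift_update, add_comm (unitShift _ _ _), op_sub]
    congr 1
    funext z
    rw [downCoeff_update hx r c d ((mem_paths.mp hc _).1 (by omega))]

end Paths

end GelfandTsetlin

namespace GelfandTsetlin

attribute [local instance 2000] Ring.toAddCommGroup

/-! ### The generic tableau -/

section GenericTableau

open Finset

/-- The variables of the tableau, extended by constants outside the triangle. -/
noncomputable def extPoly (n k i : ℕ) : MvPolynomial (Pos n) ℂ :=
  if h : i ≤ k ∧ k < n then MvPolynomial.X ⟨⟨k, h.2⟩, ⟨i, Nat.lt_succ_of_le h.1⟩⟩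
  else MvPolynomial.C (Complex.I * (1 + Nat.pair k i))

/-- The generic tableau, extended by constants outside the triangle. -/
noncomputable def extTab (n k i : ℕ) : RatFun n :=
  algebraMap (MvPolynomial (Pos n) ℂ) (RatFun n) (extPoly n k i)

theorem extTab_pos {n : ℕ} (p : Pos n) : extTab n p.1 p.2 = genTab n p := by
  obtain ⟨k, i⟩ := p
  simp [extTab, extPoly, genTab, Nat.lt_succ_iff.mp i.2, k.2]

/-- If every variable is specialised to the imaginary constant that its position would carry outside
the triangle, distinct positions have distinct imaginary values, so no difference can be an integer.
-/
theorem isGenericTab_extTab (n : ℕ) : IsGenericTab (extTab n) := by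
  intro k i l j d h hd
  have h1 : extPoly n k i - extPoly n l j = MvPolynomial.C (d : ℂ) := by
    apply IsFractionRing.injective (MvPolynomial (Pos n) ℂ) (RatFun n)
    rw [map_sub]
    refine Eq.trans hd ?_
    rw [map_intCast, map_intCast]
  have h2 : ∀ k i, MvPolynomial.eval (fun p : Pos n => Complex.I * (1 + Nat.pair p.1 p.2))
      (extPoly n k i) = Complex.I * (1 + Nat.pair k i) := by
    intro k i
    unfold extPoly
    split_ifs <;> simp
  have h3 := congrArg (MvPolynomial.eval fun p : Pos n => Complex.I * (1 + Nat.pair p.1 p.2)) h1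
  rw [map_sub, h2, h2, MvPolynomial.eval_C] at h3
  have h4 := congrArg Complex.im h3
  simp at h4
  have h5 : Nat.pair k i = Nat.pair l j := by
    have : (Nat.pair k i : ℝ) = Nat.pair l j := by linarith
    exact_mod_cast this
  exact h (Prod.ext_iff.mpr (Nat.pair_eq_pair.mp h5))

/-- An integral tableau as a shift. -/
def toShift {n : ℕ} (z : intTab n) : Shift := fun k i =>
  if h : i ≤ k ∧ k < n then z.1 ⟨⟨k, h.2⟩, ⟨i, Nat.lt_succ_of_le h.1⟩⟩ else 0

theorem toShift_pos {n : ℕ} (z : intTab n) (p : Pos n) : toShift z p.1 p.2 = z.1 p := by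
  obtain ⟨k, i⟩ := p
  simp [toShift, Nat.lt_succ_iff.mp i.2, k.2]

theorem toShift_add {n : ℕ} (z z' : intTab n) : toShift (z + z') = toShift z + toShift z' := by
  funext k i
  simp only [toShift, Pi.add_apply]
  split_ifs <;> simp

theorem ent_toShift {n : ℕ} (z : intTab n) (p : Pos n) :
    ent (extTab n) (toShift z) p.1 p.2 = shiftedTab z p := by
  rw [ent, extTab_pos, toShift_pos, shiftedTab]

/-! ### Entries of permuted tableaux in the numbering from 1. -/

section Entries

variable {n : ℕ} {K : Type} [Field K] {w : Tab n K} {y : ℕ → ℕ → K}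
  (hy : ∀ p : Pos n, w p = y p.1 p.2) (σ : RowPerm n)

theorem entry_succ (w : Tab n K) (k : Fin n) (i : Fin (k.val + 1)) :
    w.entry (k.val + 1) (i.val + 1) = w ⟨k, i⟩ := by
  have h : 1 ≤ i.val + 1 ∧ i.val + 1 ≤ k.val + 1 ∧ k.val + 1 ≤ n := by omega
  rw [Tab.entry, dif_pos h]
  rfl

include hy

theorem entry_permTab (k : Fin n) (i : Fin (k.val + 1)) :
    (permTab σ w).entry (k.val + 1) (i.val + 1) = y k ((σ k)⁻¹ i).val := by
  rw [entry_succ, permTab, hy]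

theorem entry_permTab_one (k : Fin n) :
    (permTab σ w).entry (k.val + 1) 1 = y k ((σ k)⁻¹ 0).val :=
  entry_permTab hy σ k 0

omit hy in
theorem prod_range_erase_eq {M : Type*} [CommMonoid M] {m : ℕ} (c : Fin m) (F : ℕ → M) :
    ∏ t ∈ (range m).erase c.val, F t = ∏ i ∈ univ.erase c, F i.val := by
  refine (prod_bij (fun i _ => i.val) (fun i hi => ?_) (fun i _ j _ h => Fin.ext h) (fun t ht => ?_)
    fun _ _ => rfl).symm
  · simpa [Fin.val_inj] using hi
  · simp only [mem_erase, mem_range] at ht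
    exact ⟨⟨t, ht.2⟩, by simpa [Fin.ext_iff] using ht.1, rfl⟩

theorem prod_entry_permTab (k : Fin n) (F : K → K) :
    ∏ j ∈ Icc 1 (k.val + 1), F ((permTab σ w).entry (k.val + 1) j) =
      ∏ t ∈ range (k.val + 1), F (y k t) := by
  rw [← Fin.prod_univ_eq_prod_range fun t => F (y k t), ← Equiv.prod_comp (σ k)⁻¹]
  refine (prod_bij (fun i _ => i.val + 1) (fun i _ => ?_) (fun i _ j _ h => ?_) (fun t ht => ?_)
    fun i _ => ?_).symm
  · simp; omega
  · exact Fin.ext (by simpa using h)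
  · have := mem_Icc.mp ht
    exact ⟨⟨t - 1, by omega⟩, mem_univ _, by simp; omega⟩
  · rw [entry_permTab hy]

theorem prod_entry_permTab_two (k : Fin n) (F : K → K) :
    ∏ j ∈ Icc 2 (k.val + 1), F ((permTab σ w).entry (k.val + 1) j) =
      ∏ t ∈ (range (k.val + 1)).erase ((σ k)⁻¹ 0).val, F (y k t) := by
  rw [prod_range_erase_eq ((σ k)⁻¹ 0) fun t => F (y k t)]
  refine (prod_bij (fun i _ => (σ k i).val + 1) (fun i hi => ?_) (fun i _ j _ h => ?_)
    (fun t ht => ?_) fun i _ => ?_).symm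
  · have h1 : σ k i ≠ 0 := fun h => (mem_erase.mp hi).1 (by rw [← h]; simp)
    have h2 : (σ k i).val ≠ 0 := fun h => h1 (Fin.ext h)
    have := (σ k i).2
    simp; omega
  · exact (σ k).injective (Fin.ext (by simpa using h))
  · have h := mem_Icc.mp ht
    refine ⟨(σ k)⁻¹ ⟨t - 1, by omega⟩, ?_, by simp; omega⟩
    simp [Fin.ext_iff]; omega
  · rw [entry_permTab hy]; simp

theorem sum_entry (k : Fin n) :
    ∑ j ∈ Icc 1 (k.val + 1), w.entry (k.val + 1) j = ∑ t ∈ range (k.val + 1), y k t := by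
  rw [← Fin.sum_univ_eq_sum_range fun t => y k t]
  refine (sum_bij (fun i _ => i.val + 1) (fun i _ => ?_) (fun i _ j _ h => ?_) (fun t ht => ?_)
    fun i _ => ?_).symm
  · simp; omega
  · exact Fin.ext (by simpa using h)
  · have := mem_Icc.mp ht
    exact ⟨⟨t - 1, by omega⟩, mem_univ _, by simp; omega⟩
  · rw [entry_succ, hy]

end Entries

/-- The path of positions to which the elements of a row permutation move the first entries. -/
def pathOf {n : ℕ} (σ : RowPerm n) (k : ℕ) : ℕ := if h : k < n then (σ ⟨k, h⟩ 0).val else 0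

/-- A transposition `(1, i)` is determined by the image of the first position, so `Φ_{rs}` is the
set of choices of one position in each row from `min r s` to just below `max r s`. -/
theorem sum_permSet {M : Type*} [AddCommMonoid M] {n : ℕ} (r s lo hi : Fin n) {d : ℕ}
    (hlo : min r s = lo) (hhi : max r s = hi) (hd : lo.val + d + 1 = hi.val)
    (F : (ℕ → ℕ) → M) :
    ∑ σ ∈ permSet n r s, F (pathOf σ) = ∑ c ∈ paths lo.val d, F c := by
  have hcond : ∀ k : Fin n, (min r s ≤ k ∧ k < max r s) ↔ (lo.val ≤ k.val ∧ k.val ≤ lo.val + d) := by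
    intro k
    rw [hlo, hhi, Fin.le_def, Fin.lt_def]
    omega
  refine sum_bij' (fun σ _ => pathOf σ)
    (fun c _ k => if h : c k.val < k.val + 1 then Equiv.swap 0 ⟨c k.val, h⟩ else 1)
    (fun σ hσ => ?_) (fun c hc => ?_) (fun σ hσ => ?_) (fun c hc => ?_) fun σ hσ => rfl
  · simp only [permSet, mem_filter, mem_univ, true_and] at hσ
    refine mem_paths.mpr fun k => ⟨fun hk => ?_, fun hk => ?_⟩
    · have hk' : k < n := by have := hi.2; omega
      rw [pathOf, dif_pos hk']
      exact Nat.lt_succ_iff.mp (Fin.is_lt _)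
    · rw [pathOf]
      split_ifs with hk'
      · have h := hσ ⟨k, hk'⟩
        rw [if_neg (by rw [hcond]; exact hk)] at h
        rw [h]
        rfl
      · rfl
  · have hc := mem_paths.mp hc
    simp only [permSet, mem_filter, mem_univ, true_and]
    intro k
    split_ifs with h1 h2 h2
    · exact ⟨_, rfl⟩
    · exact absurd ((hc k).1 ((hcond k).mp h1)) (by omega)
    · rw [hcond] at h1
      have h3 := (hc k).2 h1
      have h4 : (⟨c k.val, h2⟩ : Fin (k.val + 1)) = 0 := Fin.ext h3
      rw [h4, Equiv.swap_self]
      rfl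
    · rfl
  · simp only [permSet, mem_filter, mem_univ, true_and] at hσ
    funext k
    have h1 : pathOf σ k.val = (σ k 0).val := by rw [pathOf, dif_pos k.2]
    have h2 : pathOf σ k.val < k.val + 1 := by rw [h1]; exact Fin.is_lt _
    rw [dif_pos h2]
    have h3 : (⟨pathOf σ k.val, h2⟩ : Fin (k.val + 1)) = σ k 0 := Fin.ext h1
    rw [h3]
    have h := hσ k
    split_ifs at h
    · obtain ⟨i, hi⟩ := h
      rw [hi, Equiv.swap_apply_left]
    · rw [h, Equiv.Perm.one_apply, Equiv.swap_self]; rfl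
  · have hc := mem_paths.mp hc
    funext k
    rw [pathOf]
    by_cases h : k < n
    · have h2 : c k < k + 1 := by
        by_cases hk : lo.val ≤ k ∧ k ≤ lo.val + d
        · have := (hc k).1 hk; omega
        · have := (hc k).2 hk; omega
      rw [dif_pos h, dif_pos (show c (⟨k, h⟩ : Fin n).val < (⟨k, h⟩ : Fin n).val + 1 from h2),
        Equiv.swap_apply_left]
    · rw [dif_neg h]
      exact ((hc k).2 (by have := hi.2; omega)).symm

/-- Tableaux are permuted with inverses while the path records `σ` itself; for transpositions there
is no difference. -/
theorem inv_apply_zero_of_mem_permSet {n : ℕ} {r s : Fin n} {σ : RowPerm n}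
    (hσ : σ ∈ permSet n r s) (k : Fin n) : ((σ k)⁻¹ 0).val = pathOf σ k.val := by
  simp only [permSet, mem_filter, mem_univ, true_and] at hσ
  have h1 : pathOf σ k.val = (σ k 0).val := by rw [pathOf, dif_pos k.2]
  have h := hσ k
  rw [h1]
  split_ifs at h
  · obtain ⟨i, hi⟩ := h
    rw [hi, Equiv.swap_inv]
  · rw [h]; simp

/-- The link of a path cancels one factor of the numerator. This accounts for the products from `t =
2` in `e_{rs}` and leaves only differences inside one row as denominators. -/
theorem raiseCoeff_div_eq {K : Type*} [Field K] {x : ℕ → ℕ → K} (hx : IsGenericTab x) {k j : ℕ}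
    (hj : j < k + 2) (i : ℕ) (z : Shift) :
    raiseCoeff x k i z / (ent x z k i - ent x z (k + 1) j) =
      (∏ t ∈ (range (k + 2)).erase j, (ent x z k i - ent x z (k + 1) t)) / rowDen x k i z := by
  have h : ent x z k i - ent x z (k + 1) j ≠ 0 := hx.sub_ne_zero z (by simp)
  rw [raiseCoeff, ← mul_prod_erase _ _ (mem_range.mpr hj), div_right_comm,
    mul_div_cancel_left₀ _ h]

theorem Icc_succ_eq_Ico (a b : ℕ) : Icc a b = Ico a (b + 1) := by
  ext; simp

theorem coeffE_upper {n : ℕ} (z : intTab n) {r s : Fin n} {d : ℕ} (hd : r.val + d + 1 = s.val)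
    {σ : RowPerm n} (hσ : σ ∈ permSet n r s) :
    coeffE (r.val + 1) (s.val + 1) (permTab σ (shiftedTab z)) =
      upCoeff (extTab n) r.val (pathOf σ) d (toShift z) := by
  have hy := fun p => (ent_toShift z p).symm
  have hone : ∀ k (hk : k < n), (permTab σ (shiftedTab z)).entry (k + 1) 1 =
      ent (extTab n) (toShift z) k (pathOf σ k) := fun k hk => by
    rw [← inv_apply_zero_of_mem_permSet hσ ⟨k, hk⟩]
    exact entry_permTab_one hy σ ⟨k, hk⟩
  have hall : ∀ k (_ : k < n) (F : RatFun n → RatFun n),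
      ∏ j ∈ Icc 1 (k + 1), F ((permTab σ (shiftedTab z)).entry (k + 1) j) =
        ∏ t ∈ range (k + 1), F (ent (extTab n) (toShift z) k t) := fun k hk F =>
    prod_entry_permTab hy σ ⟨k, hk⟩ F
  have htwo : ∀ k (_ : k < n) (F : RatFun n → RatFun n),
      ∏ j ∈ Icc 2 (k + 1), F ((permTab σ (shiftedTab z)).entry (k + 1) j) =
        ∏ t ∈ (range (k + 1)).erase (pathOf σ k), F (ent (extTab n) (toShift z) k t) :=
    fun k hk F => by
      rw [← inv_apply_zero_of_mem_permSet hσ ⟨k, hk⟩]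
      exact prod_entry_permTab_two hy σ ⟨k, hk⟩ F
  have hs := s.2
  have hlt : ∀ k, k < n → pathOf σ k < k + 1 := fun k hk => by
    rw [← inv_apply_zero_of_mem_permSet hσ ⟨k, hk⟩]; exact Fin.is_lt _
  rw [coeffE, if_pos (by omega), upCoeff, ← hd, show r.val + d + 1 + 1 - 2 = r.val + d by omega,
    Nat.add_sub_cancel, hone _ (by omega), Icc_succ_eq_Ico (r.val + 1), ← prod_Ico_add']
  congr 1
  · rw [hall _ (by omega) fun y => _ - y, htwo _ (by omega) fun y => _ - y, raiseCoeff, rowDen]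
  · refine prod_congr rfl fun k hk => ?_
    have := mem_Ico.mp hk
    rw [hone _ (by omega), htwo _ (by omega) fun y => _ - y, htwo _ (by omega) fun y => _ - y,
      raiseCoeff_div_eq (isGenericTab_extTab n) (hlt _ (by omega)), rowDen]

theorem coeffE_lower {n : ℕ} (z : intTab n) {r s : Fin n} {d : ℕ} (hd : s.val + d + 1 = r.val)
    {σ : RowPerm n} (hσ : σ ∈ permSet n r s) :
    coeffE (r.val + 1) (s.val + 1) (permTab σ (shiftedTab z)) =
      downCoeff (extTab n) s.val (pathOf σ) d (toShift z) := by
  have hy := fun p => (ent_toShift z p).symm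
  have hone : ∀ k (hk : k < n), (permTab σ (shiftedTab z)).entry (k + 1) 1 =
      ent (extTab n) (toShift z) k (pathOf σ k) := fun k hk => by
    rw [← inv_apply_zero_of_mem_permSet hσ ⟨k, hk⟩]
    exact entry_permTab_one hy σ ⟨k, hk⟩
  have hall : ∀ k (_ : k < n) (F : RatFun n → RatFun n),
      ∏ j ∈ Icc 1 k, F ((permTab σ (shiftedTab z)).entry k j) =
        ∏ t ∈ range k, F (ent (extTab n) (toShift z) (k - 1) t) := fun k hk F => by
    cases k with
    | zero => simp
    | succ k => exact prod_entry_permTab hy σ ⟨k, by omega⟩ F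
  have htwo : ∀ k (_ : k < n) (F : RatFun n → RatFun n),
      ∏ j ∈ Icc 2 (k + 1), F ((permTab σ (shiftedTab z)).entry (k + 1) j) =
        ∏ t ∈ (range (k + 1)).erase (pathOf σ k), F (ent (extTab n) (toShift z) k t) :=
    fun k hk F => by
      rw [← inv_apply_zero_of_mem_permSet hσ ⟨k, hk⟩]
      exact prod_entry_permTab_two hy σ ⟨k, hk⟩ F
  have hs := r.2
  have hlt : ∀ k, k < n → pathOf σ k < k + 1 := fun k hk => by
    rw [← inv_apply_zero_of_mem_permSet hσ ⟨k, hk⟩]; exact Fin.is_lt _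
  rw [coeffE, if_neg (by omega), if_pos (by omega), downCoeff, ← hd,
    Nat.add_sub_cancel, hone _ (by omega), Icc_succ_eq_Ico (s.val + 1 + 2),
    show s.val + 1 + 2 = s.val + 3 from rfl,
    show s.val + d + 1 + 1 + 1 = s.val + d + 3 from rfl, ← prod_Ico_add']
  congr 1
  · rw [hall _ (by omega) fun y => _ - y, htwo _ (by omega) fun y => _ - y, lowerCoeff, rowDen]
  · refine prod_congr rfl fun k hk => ?_
    have := mem_Ico.mp hk
    rw [show k + 3 - 1 = k + 1 + 1 from rfl, show k + 3 - 2 = k + 1 from rfl,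
      hone _ (by omega), htwo _ (by omega) fun y => _ - y, htwo _ (by omega) fun y => _ - y,
      lowerCoeff_div_eq (isGenericTab_extTab n) (hlt _ (by omega)), rowDen]

theorem toShift_permInt_epsTab {n : ℕ} {r s lo hi : Fin n} {d : ℕ} (hlo : min r s = lo)
    (hhi : max r s = hi) (hd : lo.val + d + 1 = hi.val) {σ : RowPerm n} (hσ : σ ∈ permSet n r s) :
    toShift (permInt σ (epsTab n r s)) =
      pathShift lo.val (pathOf σ) d (if r < s then 1 else -1) := by
  have hlt : ∀ k, k < n → pathOf σ k < k + 1 := fun k hk => by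
    rw [← inv_apply_zero_of_mem_permSet hσ ⟨k, hk⟩]; exact Fin.is_lt _
  funext k i
  rw [pathShift_apply]
  by_cases h : i ≤ k ∧ k < n
  · simp only [toShift, dif_pos h, permInt, permTab, epsTab]
    have h1 : ((σ ⟨k, h.2⟩)⁻¹ ⟨i, Nat.lt_succ_of_le h.1⟩).val = 0 ↔ i = pathOf σ k := by
      rw [pathOf, dif_pos h.2, ← Fin.val_zero (k + 1), Fin.val_inj, Equiv.Perm.inv_eq_iff_eq,
        Fin.ext_iff]
    simp only [h1, Fin.le_def, Fin.lt_def]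
    rcases le_total r s with hrs | hrs
    · rw [min_eq_left hrs] at hlo
      rw [max_eq_right hrs] at hhi
      subst hlo hhi
      rw [if_pos (show r.val < s.val by omega)]
      by_cases hi : i = pathOf σ k
      · by_cases hk : r.val ≤ k ∧ k ≤ r.val + d
        · rw [if_pos hi, if_pos (by omega), if_pos ⟨hk, hi⟩]
        · rw [if_pos hi, if_neg (by omega), if_neg (by omega), if_neg (by tauto)]
      · rw [if_neg hi, if_neg (by tauto)]
    · rw [min_eq_right hrs] at hlo
      rw [max_eq_left hrs] at hhi
      subst hlo hhi
      rw [if_neg (show ¬ r.val < s.val by omega)]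
      by_cases hi : i = pathOf σ k
      · by_cases hk : s.val ≤ k ∧ k ≤ s.val + d
        · rw [if_pos hi, if_neg (by omega), if_pos (by omega), if_pos ⟨hk, hi⟩]
        · rw [if_pos hi, if_neg (by omega), if_neg (by omega), if_neg (by tauto)]
      · rw [if_neg hi, if_neg (by tauto)]
  · rw [toShift, dif_neg h, if_neg]
    rintro ⟨⟨_, h2⟩, h3⟩
    have hn := hi.2
    have := hlt k (by omega)
    omega

/-- The action of the matrix units on the generic tableaux. -/
theorem genE_single {n : ℕ} (r s : Fin n) (z : intTab n) (f : RatFun n) :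
    (genE (extTab n) r.val s.val).toEnd (Finsupp.single (toShift z) f) =
      ∑ σ ∈ permSet n r s, Finsupp.single (toShift (z + permInt σ (epsTab n r s)))
        (f * coeffE (r.val + 1) (s.val + 1) (permTab σ (shiftedTab z))) := by
  rcases lt_trichotomy r s with hrs | rfl | hrs
  · obtain ⟨d, hd⟩ := Nat.exists_eq_add_of_lt (Fin.lt_def.mp hrs)
    have hlo : min r s = r := min_eq_left hrs.le
    have hhi : max r s = s := max_eq_right hrs.le
    rw [hd, genE_upper (isGenericTab_extTab n), map_sum, LinearMap.sum_apply,
      ← sum_permSet r s r s hlo hhi hd.symm fun c =>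
        (op (upCoeff (extTab n) r.val c d) (pathShift r.val c d 1)).toEnd
          (Finsupp.single (toShift z) f)]
    refine sum_congr rfl fun σ hσ => ?_
    rw [op_single, toShift_add, toShift_permInt_epsTab hlo hhi hd.symm hσ, if_pos hrs, ← hd,
      coeffE_upper z hd.symm hσ]
  · have h1 : permSet n r r = {1} := by
      ext σ
      simp only [permSet, mem_filter, mem_univ, true_and, mem_singleton, min_self, max_self]
      have : ∀ k : Fin n, ¬ (r ≤ k ∧ k < r) := fun k h => absurd h.1 (not_le.mpr h.2)
      simp only [this, if_false]
      exact ⟨fun h => funext h, fun h k => by rw [h]; rfl⟩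
    rw [h1, sum_singleton, genE_self, weightOp, op_single]
    have h2 : permTab (1 : RowPerm n) (shiftedTab z) = shiftedTab z := rfl
    have h3 : permInt (1 : RowPerm n) (epsTab n r r) = 0 := by
      refine Subtype.ext (funext fun p => ?_)
      have : ¬ (r ≤ p.1 ∧ p.1 < r) := fun h => absurd h.1 (not_le.mpr h.2)
      simp [permInt, permTab, epsTab, this]
    have hy := fun p => (ent_toShift z p).symm
    rw [h2, h3, add_zero, add_zero, coeffE, if_neg (lt_irrefl _), if_neg (lt_irrefl _), weightCoeff,
      sum_entry hy r, Nat.add_sub_cancel]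
    congr 2
    have h4 : ∑ i ∈ Icc 1 r.val, (shiftedTab z).entry r.val i =
        ∑ t ∈ range r.val, ent (extTab n) (toShift z) (r.val - 1) t := by
      obtain ⟨r, hr⟩ := r
      cases r with
      | zero => simp
      | succ r => exact sum_entry hy ⟨r, by omega⟩
    rw [h4]
    push_cast
    ring
  · obtain ⟨d, hd⟩ := Nat.exists_eq_add_of_lt (Fin.lt_def.mp hrs)
    have hlo : min r s = s := min_eq_right hrs.le
    have hhi : max r s = r := max_eq_left hrs.le
    rw [hd, genE_lower (isGenericTab_extTab n), map_sum, LinearMap.sum_apply,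
      ← sum_permSet r s s r hlo hhi hd.symm fun c =>
        (op (downCoeff (extTab n) s.val c d) (pathShift s.val c d (-1))).toEnd
          (Finsupp.single (toShift z) f)]
    refine sum_congr rfl fun σ hσ => ?_
    rw [op_single, toShift_add, toShift_permInt_epsTab hlo hhi hd.symm hσ, if_neg hrs.not_gt, ← hd,
      coeffE_lower z hd.symm hσ]

end GenericTableau

end GelfandTsetlin

namespace GelfandTsetlin

attribute [local instance 2000] Ring.toAddCommGroup

/-! ### Calculus of rational functions -/

section Rational

open Finset MvPolynomial

variable {n : ℕ}

/-- The inclusion of the polynomials into the rational functions. -/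
noncomputable abbrev polyFun (p : MvPolynomial (Pos n) ℂ) : RatFun n :=
  algebraMap (MvPolynomial (Pos n) ℂ) (RatFun n) p

theorem polyFun_ne_zero {p : MvPolynomial (Pos n) ℂ} (h : p ≠ 0) : polyFun p ≠ 0 :=
  (map_ne_zero_iff _ (IsFractionRing.injective _ _)).mpr h

theorem denom_ne_zero (f : RatFun n) : denom f ≠ 0 :=
  nonZeroDivisors.coe_ne_zero _

theorem numer_div_denom (f : RatFun n) : polyFun (numer f) / polyFun (denom f) = f :=
  (IsFractionRing.mk'_eq_div ..).symm.trans (IsFractionRing.mk'_num_den _ f)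

theorem ne_zero_of_eval_ne_zero {u : Tab n ℂ} {q : MvPolynomial (Pos n) ℂ} (h : eval u q ≠ 0) :
    q ≠ 0 := by
  rintro rfl
  simp at h

theorem numer_mul_eq {f : RatFun n} {p q : MvPolynomial (Pos n) ℂ} (hq : q ≠ 0)
    (hf : f = polyFun p / polyFun q) : numer f * q = p * denom f := by
  apply IsFractionRing.injective (MvPolynomial (Pos n) ℂ) (RatFun n)
  rw [map_mul, map_mul, ← div_eq_div_iff (polyFun_ne_zero (denom_ne_zero f)) (polyFun_ne_zero hq)]
  exact (numer_div_denom f).trans hf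

/-- The denominator in lowest terms divides every other denominator, so regularity can be tested on
any representation as a fraction. -/
theorem regularAt_iff {u : Tab n ℂ} {f : RatFun n} : RegularAt u f ↔
    ∃ p q : MvPolynomial (Pos n) ℂ, eval u q ≠ 0 ∧ f = polyFun p / polyFun q := by
  refine ⟨fun h => ⟨numer f, denom f, h, (numer_div_denom f).symm⟩, ?_⟩
  rintro ⟨p, q, hq, hf⟩
  have h1 := numer_mul_eq (ne_zero_of_eval_ne_zero hq) hf
  have h2 : denom f ∣ q :=
    (IsFractionRing.num_den_reduced (MvPolynomial (Pos n) ℂ) f).symm.dvd_of_dvd_mul_left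
      (Dvd.intro_left p h1.symm)
  obtain ⟨c, rfl⟩ := h2
  intro h
  exact hq (by rw [map_mul, h, zero_mul])

theorem valueAt_eq {u : Tab n ℂ} {f : RatFun n} {p q : MvPolynomial (Pos n) ℂ} (hq : eval u q ≠ 0)
    (hf : f = polyFun p / polyFun q) : valueAt u f = eval u p / eval u q := by
  have h1 := congrArg (eval u) (numer_mul_eq (ne_zero_of_eval_ne_zero hq) hf)
  have h2 : RegularAt u f := regularAt_iff.mpr ⟨p, q, hq, hf⟩
  rw [map_mul, map_mul] at h1
  rw [valueAt, div_eq_div_iff h2 hq, h1]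

theorem regularAt_polyFun (u : Tab n ℂ) (p : MvPolynomial (Pos n) ℂ) : RegularAt u (polyFun p) :=
  regularAt_iff.mpr ⟨p, 1, by simp, by simp⟩

theorem valueAt_polyFun (u : Tab n ℂ) (p : MvPolynomial (Pos n) ℂ) :
    valueAt u (polyFun p) = eval u p := by
  rw [valueAt_eq (q := 1) (by simp) (by simp : polyFun p = polyFun p / polyFun 1)]
  simp

theorem RegularAt.add_valueAt {u : Tab n ℂ} {f g : RatFun n} (hf : RegularAt u f)
    (hg : RegularAt u g) : RegularAt u (f + g) ∧ valueAt u (f + g) = valueAt u f + valueAt u g := by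
  obtain ⟨p, q, hq, rfl⟩ := regularAt_iff.mp hf
  obtain ⟨p', q', hq', rfl⟩ := regularAt_iff.mp hg
  have h0 := polyFun_ne_zero (ne_zero_of_eval_ne_zero hq)
  have h0' := polyFun_ne_zero (ne_zero_of_eval_ne_zero hq')
  have h1 : eval u (q * q') ≠ 0 := by rw [map_mul]; exact mul_ne_zero hq hq'
  have h2 : polyFun p / polyFun q + polyFun p' / polyFun q' =
      polyFun (p * q' + q * p') / polyFun (q * q') := by
    rw [div_add_div _ _ h0 h0']; simp
  refine ⟨regularAt_iff.mpr ⟨_, _, h1, h2⟩, ?_⟩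
  rw [valueAt_eq h1 h2, valueAt_eq hq rfl, valueAt_eq hq' rfl, div_add_div _ _ hq hq']
  simp

theorem RegularAt.mul_valueAt {u : Tab n ℂ} {f g : RatFun n} (hf : RegularAt u f)
    (hg : RegularAt u g) : RegularAt u (f * g) ∧ valueAt u (f * g) = valueAt u f * valueAt u g := by
  obtain ⟨p, q, hq, rfl⟩ := regularAt_iff.mp hf
  obtain ⟨p', q', hq', rfl⟩ := regularAt_iff.mp hg
  have h1 : eval u (q * q') ≠ 0 := by rw [map_mul]; exact mul_ne_zero hq hq'
  have h2 : polyFun p / polyFun q * (polyFun p' / polyFun q') =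
      polyFun (p * p') / polyFun (q * q') := by
    rw [div_mul_div_comm]; simp
  refine ⟨regularAt_iff.mpr ⟨_, _, h1, h2⟩, ?_⟩
  rw [valueAt_eq h1 h2, valueAt_eq hq rfl, valueAt_eq hq' rfl, div_mul_div_comm]
  simp

theorem RegularAt.inv {u : Tab n ℂ} {f : RatFun n} (hf : RegularAt u f) (h : valueAt u f ≠ 0) :
    RegularAt u f⁻¹ := by
  obtain ⟨p, q, hq, rfl⟩ := regularAt_iff.mp hf
  rw [valueAt_eq hq rfl] at h
  exact regularAt_iff.mpr ⟨q, p, (div_ne_zero_iff.mp h).1, by rw [inv_div]⟩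

theorem algebraMap_eq_polyFun (c : ℂ) : algebraMap ℂ (RatFun n) c = polyFun (C c) :=
  IsScalarTower.algebraMap_apply ℂ (MvPolynomial (Pos n) ℂ) (RatFun n) c

/-- The algebra of the rational functions without pole at `u`. -/
noncomputable def regularRing (u : Tab n ℂ) : Subalgebra ℂ (RatFun n) where
  carrier := {f | RegularAt u f}
  mul_mem' h h' := (h.mul_valueAt h').1
  add_mem' h h' := (h.add_valueAt h').1
  algebraMap_mem' c := by
    rw [algebraMap_eq_polyFun]
    exact regularAt_polyFun u _

theorem valueAt_add {u : Tab n ℂ} {f g : RatFun n} (hf : f ∈ regularRing u)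
    (hg : g ∈ regularRing u) : valueAt u (f + g) = valueAt u f + valueAt u g :=
  (RegularAt.add_valueAt hf hg).2

theorem valueAt_mul {u : Tab n ℂ} {f g : RatFun n} (hf : f ∈ regularRing u)
    (hg : g ∈ regularRing u) : valueAt u (f * g) = valueAt u f * valueAt u g :=
  (RegularAt.mul_valueAt hf hg).2

theorem valueAt_algebraMap (u : Tab n ℂ) (c : ℂ) : valueAt u (algebraMap ℂ (RatFun n) c) = c := by
  rw [algebraMap_eq_polyFun, valueAt_polyFun, eval_C]

/-- The evaluation at `u` of the functions without pole there. -/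
noncomputable def valueHom (u : Tab n ℂ) : regularRing u →ₐ[ℂ] ℂ where
  toFun f := valueAt u f.1
  map_one' := by simpa using valueAt_algebraMap u 1
  map_mul' f g := valueAt_mul f.2 g.2
  map_zero' := by simpa using valueAt_algebraMap u 0
  map_add' f g := valueAt_add f.2 g.2
  commutes' c := valueAt_algebraMap u c

theorem genTab_mem_regularRing (u : Tab n ℂ) (p : Pos n) : genTab n p ∈ regularRing u :=
  regularAt_polyFun u _

theorem valueAt_genTab (u : Tab n ℂ) (p : Pos n) : valueAt u (genTab n p) = u p := by
  rw [genTab, valueAt_polyFun, eval_X]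

/-- Independence of the quotient rule of the chosen fraction `N / D = a / b`: the second hypothesis
is the derivative of the first. -/
theorem quotient_rule_unique {R : Type*} [CommRing R] {N D a b N' D' a' b' : R} (h1 : N * b = a * D)
    (h2 : N * b' + b * N' = a * D' + D * a') :
    (N' * D - N * D') * b ^ 2 = (a' * b - a * b') * D ^ 2 := by
  linear_combination (b * D) * h2 - (b * D' + D * b') * h1

theorem quotient_rule_add {F : Type*} [Field F] {a b c d : F} (a' b' c' d' : F) (hb : b ≠ 0)
    (hd : d ≠ 0) :
    ((a * d' + d * a' + (b * c' + c * b')) * (b * d) - (a * d + b * c) * (b * d' + d * b')) /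
      (b * d) ^ 2 = (a' * b - a * b') / b ^ 2 + (c' * d - c * d') / d ^ 2 := by
  field_simp
  ring

theorem quotient_rule_mul {F : Type*} [Field F] {a b c d : F} (a' b' c' d' : F) (hb : b ≠ 0)
    (hd : d ≠ 0) :
    ((a * c' + c * a') * (b * d) - a * c * (b * d' + d * b')) / (b * d) ^ 2 =
      a / b * ((c' * d - c * d') / d ^ 2) + c / d * ((a' * b - a * b') / b ^ 2) := by
  field_simp
  ring

theorem partialDeriv_div (p : Pos n) (a : MvPolynomial (Pos n) ℂ) {b : MvPolynomial (Pos n) ℂ}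
    (hb : b ≠ 0) : partialDeriv p (polyFun a / polyFun b) =
      polyFun (pderiv p a * b - a * pderiv p b) / polyFun b ^ 2 := by
  obtain ⟨f, hf⟩ : ∃ f, f = polyFun a / polyFun b := ⟨_, rfl⟩
  rw [← hf]
  have h1 := numer_mul_eq hb hf
  have h2 := congrArg (pderiv p) h1
  rw [Derivation.leibniz, Derivation.leibniz] at h2
  have h3 := quotient_rule_unique h1 h2
  rw [partialDeriv, div_eq_div_iff (pow_ne_zero 2 (polyFun_ne_zero (denom_ne_zero f)))
    (pow_ne_zero 2 (polyFun_ne_zero hb)), ← map_pow, ← map_pow, ← map_mul, ← map_mul, h3]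

theorem partialDeriv_polyFun (p : Pos n) (a : MvPolynomial (Pos n) ℂ) :
    partialDeriv p (polyFun a) = polyFun (pderiv p a) := by
  have h := partialDeriv_div p a (b := 1) one_ne_zero
  simpa using h

theorem exists_eq_div (f : RatFun n) : ∃ a b : MvPolynomial (Pos n) ℂ, b ≠ 0 ∧
    f = polyFun a / polyFun b :=
  ⟨numer f, denom f, denom_ne_zero f, (numer_div_denom f).symm⟩

/-- The partial derivatives as derivations. -/
noncomputable def partialDerivation (p : Pos n) : Derivation ℂ (RatFun n) (RatFun n) :=
  Derivation.mk' {
    toFun := partialDeriv p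
    map_add' := fun f g => by
      obtain ⟨a, b, hb, rfl⟩ := exists_eq_div f
      obtain ⟨c, d, hd, rfl⟩ := exists_eq_div g
      have hb' := polyFun_ne_zero hb
      have hd' := polyFun_ne_zero hd
      have h : polyFun a / polyFun b + polyFun c / polyFun d =
          polyFun (a * d + b * c) / polyFun (b * d) := by
        rw [div_add_div _ _ hb' hd']; simp
      rw [h, partialDeriv_div p _ (mul_ne_zero hb hd), partialDeriv_div p _ hb,
        partialDeriv_div p _ hd, map_add, Derivation.leibniz, Derivation.leibniz,
        Derivation.leibniz]
      simp only [map_add, map_sub, map_mul, smul_eq_mul]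
      exact quotient_rule_add _ _ _ _ hb' hd'
    map_smul' := fun c f => by
      obtain ⟨a, b, hb, rfl⟩ := exists_eq_div f
      have h0 : ∀ g : MvPolynomial (Pos n) ℂ, polyFun (c • g) = c • polyFun g := fun g => by
        rw [polyFun, algebraMap.smul]
      rw [← smul_div_assoc, ← h0, partialDeriv_div p _ hb, partialDeriv_div p _ hb,
        RingHom.id_apply, Derivation.map_smul, ← smul_div_assoc, ← h0, smul_sub, smul_mul_assoc,
        smul_mul_assoc] }
    fun f g => by
      obtain ⟨a, b, hb, rfl⟩ := exists_eq_div f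
      obtain ⟨c, d, hd, rfl⟩ := exists_eq_div g
      have hb' := polyFun_ne_zero hb
      have hd' := polyFun_ne_zero hd
      have h : polyFun a / polyFun b * (polyFun c / polyFun d) =
          polyFun (a * c) / polyFun (b * d) := by
        rw [div_mul_div_comm]; simp
      change partialDeriv p _ = _ * partialDeriv p _ + _ * partialDeriv p _
      rw [h, partialDeriv_div p _ (mul_ne_zero hb hd), partialDeriv_div p _ hb,
        partialDeriv_div p _ hd, Derivation.leibniz, Derivation.leibniz]
      simp only [map_add, map_sub, map_mul, smul_eq_mul]
      exact quotient_rule_mul _ _ _ _ hb' hd'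

theorem partialDerivation_apply (p : Pos n) (f : RatFun n) :
    partialDerivation p f = partialDeriv p f := rfl

theorem partialDeriv_mem_regularRing {u : Tab n ℂ} (p : Pos n) {f : RatFun n}
    (hf : f ∈ regularRing u) : partialDeriv p f ∈ regularRing u := by
  obtain ⟨a, b, hb, rfl⟩ := regularAt_iff.mp hf
  rw [partialDeriv_div p a (ne_zero_of_eval_ne_zero hb)]
  exact regularAt_iff.mpr ⟨_, b ^ 2, by rw [map_pow]; exact pow_ne_zero 2 hb,
    by rw [polyFun, polyFun, polyFun, map_pow]⟩

theorem pderiv_comm (p q : Pos n) (a : MvPolynomial (Pos n) ℂ) :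
    pderiv p (pderiv q a) = pderiv q (pderiv p a) := by
  induction a using MvPolynomial.induction_on with
  | C c => simp
  | add a b ha hb => simp only [map_add, ha, hb]
  | mul_X a i ha =>
    simp only [Derivation.leibniz, map_add, smul_eq_mul, ha, pderiv_X, Pi.single_apply]
    split_ifs <;> simp <;> ring

/-- After multiplication with its denominator the function is a polynomial. Expanding both mixed
derivatives of `f * b = a` by Leibniz, all terms except `b` times the mixed derivatives of `f`
agree. -/
theorem partialDeriv_comm (p q : Pos n) (f : RatFun n) :
    partialDeriv p (partialDeriv q f) = partialDeriv q (partialDeriv p f) := by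
  obtain ⟨a, b, hb, hf⟩ := exists_eq_div f
  have hb' := polyFun_ne_zero hb
  have h1 : f * polyFun b = polyFun a := by rw [hf, div_mul_cancel₀ _ hb']
  have h2 : ∀ p q : Pos n, partialDeriv p (partialDeriv q (f * polyFun b)) =
      f * partialDeriv p (partialDeriv q (polyFun b)) +
      partialDeriv q (polyFun b) * partialDeriv p f +
      (polyFun b * partialDeriv p (partialDeriv q f) +
        partialDeriv q f * partialDeriv p (polyFun b)) := by
    intro p q
    simp only [← partialDerivation_apply, Derivation.leibniz, map_add, smul_eq_mul]
  have h3 := h2 p q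
  have h4 := h2 q p
  have h5 : ∀ c : MvPolynomial (Pos n) ℂ, partialDeriv p (partialDeriv q (polyFun c)) =
      partialDeriv q (partialDeriv p (polyFun c)) := by
    intro c
    rw [partialDeriv_polyFun, partialDeriv_polyFun, partialDeriv_polyFun, partialDeriv_polyFun,
      pderiv_comm]
  rw [h1, h5] at h3
  rw [h1] at h4
  have h6 := h3.symm.trans h4
  rw [h5] at h6
  refine mul_left_cancel₀ hb' ?_
  linear_combination h6

/-! ### Exchange of two variables -/

/-- The automorphism of the field of rational functions given by a permutation of the
variables. -/
noncomputable def permVars (e : Equiv.Perm (Pos n)) : RatFun n ≃+* RatFun n :=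
  IsFractionRing.ringEquivOfRingEquiv (renameEquiv ℂ e).toRingEquiv

theorem permVars_polyFun (e : Equiv.Perm (Pos n)) (a : MvPolynomial (Pos n) ℂ) :
    permVars e (polyFun a) = polyFun (rename e a) :=
  IsFractionRing.ringEquivOfRingEquiv_algebraMap _ _

theorem permVars_genTab (e : Equiv.Perm (Pos n)) (p : Pos n) :
    permVars e (genTab n p) = genTab n (e p) := by
  rw [genTab, permVars_polyFun, rename_X, genTab]

theorem permVars_algebraMap (e : Equiv.Perm (Pos n)) (c : ℂ) :
    permVars e (algebraMap ℂ (RatFun n) c) = algebraMap ℂ (RatFun n) c := by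
  rw [algebraMap_eq_polyFun, permVars_polyFun, rename_C]

theorem permVars_smul (e : Equiv.Perm (Pos n)) (c : ℂ) (f : RatFun n) :
    permVars e (c • f) = c • permVars e f := by
  rw [Algebra.smul_def, map_mul, permVars_algebraMap, Algebra.smul_def]

theorem permVars_regular {u : Tab n ℂ} {e : Equiv.Perm (Pos n)} (he : ∀ p, u (e p) = u p)
    {f : RatFun n} (hf : f ∈ regularRing u) :
    permVars e f ∈ regularRing u ∧ valueAt u (permVars e f) = valueAt u f := by
  obtain ⟨a, b, hb, rfl⟩ := regularAt_iff.mp hf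
  have h : ∀ a : MvPolynomial (Pos n) ℂ, eval u (rename e a) = eval u a := by
    intro a
    rw [eval_rename]
    congr 2
    exact funext he
  have h1 : permVars e (polyFun a / polyFun b) = polyFun (rename e a) / polyFun (rename e b) := by
    rw [map_div₀, permVars_polyFun, permVars_polyFun]
  have h2 : eval u (rename e b) ≠ 0 := by rwa [h]
  refine ⟨regularAt_iff.mpr ⟨_, _, h2, h1⟩, ?_⟩
  rw [valueAt_eq h2 h1, valueAt_eq hb rfl, h, h]

theorem partialDeriv_permVars (e : Equiv.Perm (Pos n)) (p : Pos n) (f : RatFun n) :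
    partialDeriv (e p) (permVars e f) = permVars e (partialDeriv p f) := by
  obtain ⟨a, b, hb, rfl⟩ := exists_eq_div f
  have hb' : rename e b ≠ 0 := (map_ne_zero_iff _ (rename_injective _ e.injective)).mpr hb
  rw [map_div₀, permVars_polyFun, permVars_polyFun, partialDeriv_div _ _ hb',
    partialDeriv_div _ _ hb, map_div₀, map_pow, permVars_polyFun, permVars_polyFun,
    pderiv_rename e.injective, pderiv_rename e.injective]
  simp only [map_sub, map_mul]

/-- Modulo `X l - X r` the exchange of the two variables is the identity. -/
theorem X_sub_X_dvd_sub_rename (l r : Pos n) (a : MvPolynomial (Pos n) ℂ) :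
    (X l - X r : MvPolynomial (Pos n) ℂ) ∣ a - rename (Equiv.swap l r) a := by
  rw [← Ideal.mem_span_singleton, ← Ideal.Quotient.eq]
  have h : (Ideal.Quotient.mkₐ ℂ (Ideal.span {(X l - X r : MvPolynomial (Pos n) ℂ)})) =
      (Ideal.Quotient.mkₐ ℂ (Ideal.span {(X l - X r : MvPolynomial (Pos n) ℂ)})).comp
        (rename (Equiv.swap l r)) := by
    refine MvPolynomial.algHom_ext fun p => ?_
    have h1 : Ideal.Quotient.mk (Ideal.span {(X l - X r : MvPolynomial (Pos n) ℂ)}) (X l) =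
        Ideal.Quotient.mk _ (X r) :=
      Ideal.Quotient.eq.mpr (Ideal.mem_span_singleton_self _)
    simp only [AlgHom.comp_apply, rename_X, Ideal.Quotient.mkₐ_eq_mk]
    rcases eq_or_ne p l with rfl | hl
    · rw [Equiv.swap_apply_left, h1]
    · rcases eq_or_ne p r with rfl | hr
      · rw [Equiv.swap_apply_right, h1]
      · rw [Equiv.swap_apply_of_ne_of_ne hl hr]
  exact DFunLike.congr_fun h a

/-- Write `τ` for the exchange. If `f = a / b`, then `f - τ f` has the denominator `b τ(b)`, still
nonzero at `u` because `τ` fixes `u`, and the numerator `c - τ(c)` with `c = a τ(b)`, which is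
divisible by the difference of the variables. -/
theorem sub_permVars_div_mem_regularRing {u : Tab n ℂ} {l r : Pos n} (hu : u l = u r)
    {f : RatFun n} (hf : f ∈ regularRing u) :
    (f - permVars (Equiv.swap l r) f) / (genTab n l - genTab n r) ∈ regularRing u := by
  have he : ∀ p, u (Equiv.swap l r p) = u p := by
    intro p
    rcases eq_or_ne p l with rfl | hl
    · rw [Equiv.swap_apply_left, hu]
    · rcases eq_or_ne p r with rfl | hr
      · rw [Equiv.swap_apply_right, hu]
      · rw [Equiv.swap_apply_of_ne_of_ne hl hr]
  obtain ⟨a, b, hb, rfl⟩ := regularAt_iff.mp hf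
  have hb' : eval u (rename (Equiv.swap l r) b) ≠ 0 := by
    rw [eval_rename, show u ∘ Equiv.swap l r = u from funext he]
    exact hb
  have h0 := polyFun_ne_zero (ne_zero_of_eval_ne_zero hb)
  have h0' := polyFun_ne_zero (ne_zero_of_eval_ne_zero hb')
  rcases eq_or_ne l r with rfl | hlr
  · simp only [sub_self, div_zero]
    exact zero_mem _
  have h1 : genTab n l - genTab n r ≠ 0 := by
    rw [genTab, genTab, ← map_sub]
    refine polyFun_ne_zero (sub_ne_zero.mpr fun h => hlr (X_injective h))
  obtain ⟨c, hc⟩ := X_sub_X_dvd_sub_rename l r (a * rename (Equiv.swap l r) b)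
  have hinv : rename (Equiv.swap l r) (rename (Equiv.swap l r) b) = b := by
    rw [rename_rename]
    convert rename_id_apply b
    refine _root_.funext fun p => ?_
    simp
  rw [map_mul, hinv] at hc
  refine regularAt_iff.mpr ⟨c, b * rename (Equiv.swap l r) b, ?_, ?_⟩
  · rw [map_mul]
    exact mul_ne_zero hb hb'
  · have h2 := congrArg (algebraMap (MvPolynomial (Pos n) ℂ) (RatFun n)) hc
    simp only [map_sub, map_mul] at h2
    rw [map_div₀, permVars_polyFun, permVars_polyFun, div_sub_div _ _ h0 h0', div_div,
      div_eq_div_iff (mul_ne_zero (mul_ne_zero h0 h0') h1)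
        (polyFun_ne_zero (mul_ne_zero (ne_zero_of_eval_ne_zero hb) (ne_zero_of_eval_ne_zero hb')))]
    simp only [genTab, polyFun, map_mul] at h2 ⊢
    linear_combination (algebraMap _ (RatFun n) b *
      algebraMap _ (RatFun n) (rename (Equiv.swap l r) b)) * h2

end Rational

end GelfandTsetlin

namespace GelfandTsetlin

attribute [local instance 2000] Ring.toAddCommGroup

/-! ### Equivariance of the generic operators -/

section Equivariance

open Finset

variable {K : Type*} [Field K] {x : ℕ → ℕ → K} (θ : K ≃+* K) (π : ℕ → Equiv.Perm ℕ)

/-- The action of row permutations on shifts. -/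
def permShift (z : Shift) : Shift := fun k i => z k ((π k).symm i)

theorem permShift_add (z z' : Shift) : permShift π (z + z') = permShift π z + permShift π z' := rfl

theorem permShift_unitShift (k i : ℕ) (d : ℤ) :
    permShift π (unitShift k i d) = unitShift k (π k i) d := by
  funext l j
  simp only [permShift, unitShift_apply]
  by_cases h : l = k
  · subst h
    simp [Equiv.symm_apply_eq]
  · simp [h]

/-- The simultaneous action on coefficients and on tableaux. -/
noncomputable def twist : (Shift →₀ K) →+ (Shift →₀ K) :=
  (Finsupp.mapDomain.addMonoidHom (permShift π)).comp
    (Finsupp.mapRange.addMonoidHom (θ : K →+ K))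

theorem twist_single (z : Shift) (f : K) :
    twist θ π (Finsupp.single z f) = Finsupp.single (permShift π z) (θ f) := by
  simp [twist]

theorem twist_smul (f : K) (y : Shift →₀ K) : twist θ π (f • y) = θ f • twist θ π y := by
  induction y using Finsupp.induction_linear with
  | zero => simp
  | add y y' h h' => rw [smul_add, map_add, h, h', map_add, smul_add]
  | single z g =>
    rw [Finsupp.smul_single, smul_eq_mul, twist_single, twist_single, Finsupp.smul_single, map_mul,
      smul_eq_mul]

/-- The operator commutes with the twisted action. -/
def TwistCommutes (a : OpAlg K) : Prop := ∀ y, twist θ π (a.toEnd y) = a.toEnd (twist θ π y)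

variable {θ π}

theorem TwistCommutes.mul {a b : OpAlg K} (ha : TwistCommutes θ π a) (hb : TwistCommutes θ π b) :
    TwistCommutes θ π (a * b) := fun y => by
  rw [map_mul, Module.End.mul_apply, Module.End.mul_apply, ha, hb]

theorem TwistCommutes.add {a b : OpAlg K} (ha : TwistCommutes θ π a) (hb : TwistCommutes θ π b) :
    TwistCommutes θ π (a + b) := fun y => by
  rw [map_add, LinearMap.add_apply, LinearMap.add_apply, map_add, ha, hb]

theorem TwistCommutes.neg {a : OpAlg K} (ha : TwistCommutes θ π a) : TwistCommutes θ π (-a) :=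
  fun y => by rw [map_neg, LinearMap.neg_apply, LinearMap.neg_apply, map_neg, ha]

theorem TwistCommutes.sub {a b : OpAlg K} (ha : TwistCommutes θ π a) (hb : TwistCommutes θ π b) :
    TwistCommutes θ π (a - b) := by
  rw [sub_eq_add_neg]
  exact ha.add hb.neg

theorem TwistCommutes.lie {a b : OpAlg K} (ha : TwistCommutes θ π a) (hb : TwistCommutes θ π b) :
    TwistCommutes θ π ⁅a, b⁆ := by
  rw [Ring.lie_def]
  exact (ha.mul hb).sub (hb.mul ha)

theorem twistCommutes_sum_op {s : Finset ℕ} {g : ℕ → Shift → K} {d : ℕ → Shift} (e : Equiv.Perm ℕ)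
    (he : ∀ i, e i ∈ s ↔ i ∈ s) (hd : ∀ i ∈ s, permShift π (d i) = d (e i))
    (hg : ∀ i ∈ s, ∀ z, θ (g i z) = g (e i) (permShift π z)) :
    TwistCommutes θ π (∑ i ∈ s, op (g i) (d i)) := by
  intro y
  induction y using Finsupp.induction_linear with
  | zero => simp
  | add y y' h h' => rw [map_add, map_add, h, h', map_add, map_add]
  | single z f =>
    rw [map_sum, LinearMap.sum_apply, map_sum, LinearMap.sum_apply, twist_single]
    refine sum_equiv e (fun i => (he i).symm) fun i hi => ?_
    rw [op_single, op_single, twist_single, map_mul, permShift_add, hd i hi, hg i hi]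

variable (hπ : ∀ k i, π k i < k + 1 ↔ i < k + 1) (hθ : ∀ k i, θ (x k i) = x k (π k i))

include hθ

theorem map_ent (z : Shift) (k i : ℕ) :
    θ (ent x z k i) = ent x (permShift π z) k (π k i) := by
  simp [ent, hθ, permShift]

include hπ

theorem map_rowDen (k i : ℕ) (z : Shift) :
    θ (rowDen x k i z) = rowDen x k (π k i) (permShift π z) := by
  rw [rowDen, map_prod, rowDen]
  refine prod_equiv (π k) (fun t => ?_) fun t _ => ?_
  · simp [hπ]
  · rw [map_sub, map_ent hθ, map_ent hθ]

theorem map_raiseCoeff (k i : ℕ) (z : Shift) :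
    θ (raiseCoeff x k i z) = raiseCoeff x k (π k i) (permShift π z) := by
  rw [raiseCoeff, map_div₀, map_rowDen hπ hθ, map_prod, raiseCoeff]
  congr 1
  refine prod_equiv (π (k + 1)) (fun t => ?_) fun t _ => ?_
  · rw [mem_range, mem_range]
    exact (hπ (k + 1) t).symm
  · rw [map_sub, map_ent hθ, map_ent hθ]

theorem map_lowerCoeff (k i : ℕ) (z : Shift) :
    θ (lowerCoeff x k i z) = lowerCoeff x k (π k i) (permShift π z) := by
  rw [lowerCoeff, map_div₀, map_rowDen hπ hθ, map_prod, lowerCoeff]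
  congr 1
  cases k with
  | zero => simp
  | succ k =>
    refine prod_equiv (π k) (fun t => ?_) fun t _ => ?_
    · simpa using (hπ k t).symm
    · rw [map_sub, map_ent hθ, map_ent hθ]
      rfl

theorem map_weightCoeff (k : ℕ) (z : Shift) :
    θ (weightCoeff x k z) = weightCoeff x k (permShift π z) := by
  have h : ∀ k, θ (∑ i ∈ range (k + 1), ent x z k i) =
      ∑ i ∈ range (k + 1), ent x (permShift π z) k i := by
    intro k
    rw [map_sum]
    refine sum_equiv (π k) (fun t => ?_) fun t _ => ?_
    · simpa using (hπ k t).symm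
    · rw [map_ent hθ]
  have h' : θ (∑ i ∈ range k, ent x z (k - 1) i) =
      ∑ i ∈ range k, ent x (permShift π z) (k - 1) i := by
    cases k with
    | zero => simp
    | succ k => exact h k
  rw [weightCoeff, map_sub, map_add, h, h', map_natCast, weightCoeff]

/-- A permutation inside the rows permutes the terms of the simple operators, as their coefficients
are symmetric in the remaining entries; the property passes to commutators. -/
theorem twistCommutes_genE (a b : ℕ) : TwistCommutes θ π (genE x a b) := by
  have he : ∀ k, TwistCommutes θ π (raiseOp x k) := fun k =>
    (twistCommutes_sum_op (π k) (by simpa using hπ k) (fun i _ => permShift_unitShift π k i 1)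
      fun i _ z => map_raiseCoeff hπ hθ k i z).neg
  have hf : ∀ k, TwistCommutes θ π (lowerOp x k) := fun k =>
    twistCommutes_sum_op (π k) (by simpa using hπ k) (fun i _ => permShift_unitShift π k i (-1))
      fun i _ z => map_lowerCoeff hπ hθ k i z
  have hh : ∀ k, TwistCommutes θ π (weightOp x k) := fun k => by
    have h := twistCommutes_sum_op (θ := θ) (π := π) (s := {0}) (g := fun _ => weightCoeff x k)
      (d := fun _ => 0) 1 (fun _ => Iff.rfl) (fun i _ => rfl)
      fun i _ z => map_weightCoeff hπ hθ k z
    rwa [sum_singleton] at h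
  rw [genE]
  rcases lt_trichotomy a b with hab | rfl | hab
  · obtain ⟨d, rfl⟩ := Nat.exists_eq_add_of_lt hab
    rw [unitElt_upper]
    clear hab
    induction d with
    | zero => exact he a
    | succ d ih => exact ih.lie (he _)
  · rw [unitElt_self]
    exact hh a
  · obtain ⟨d, rfl⟩ := Nat.exists_eq_add_of_lt hab
    rw [unitElt_lower]
    clear hab
    induction d with
    | zero => exact hf b
    | succ d ih => exact (hf _).lie ih

end Equivariance

/-! ### Singular pairs -/

section Pairs

open Finset

variable {n : ℕ} {u : Tab n ℂ}

/-- Different singular pairs have no common position. -/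
def PairsDisjoint (u : Tab n ℂ) : Prop :=
  ∀ p q : SingPair u, p ≠ q → p.1.left ≠ q.1.left ∧ p.1.left ≠ q.1.right ∧
    p.1.right ≠ q.1.left ∧ p.1.right ≠ q.1.right

/-- The exchange of the two positions of a pair. -/
def pairSwap (p : SingPair u) : Equiv.Perm (Pos n) := Equiv.swap p.1.left p.1.right

/-- The exchange of the two variables of a pair. -/
noncomputable def pairVars (p : SingPair u) : RatFun n ≃+* RatFun n := permVars (pairSwap p)

/-- The difference of the two variables of a pair. -/
noncomputable def pairDiff (p : SingPair u) : RatFun n := genTab n p.1.left - genTab n p.1.right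

/-- The exchange of the two positions of a pair, on all rows. -/
def pairPerm (p : SingPair u) (k : ℕ) : Equiv.Perm ℕ :=
  if k = p.1.1.1.val then Equiv.swap p.1.1.2.1.val p.1.1.2.2.val else 1

theorem left_ne_right (p : SingPair u) : p.1.left ≠ p.1.right := by
  obtain ⟨⟨⟨k, i, j⟩, hk, hij⟩, h⟩ := p
  intro h'
  simp only [PosPair.left, PosPair.right] at h'
  simp at h'
  exact hij.ne h'

theorem pairDiff_ne_zero (p : SingPair u) : pairDiff p ≠ 0 := by
  rw [pairDiff, genTab, genTab, ← map_sub]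
  exact polyFun_ne_zero (sub_ne_zero.mpr fun h => left_ne_right p (MvPolynomial.X_injective h))

theorem pairSwap_mk (p : SingPair u) (k : Fin n) (i : Fin (k.val + 1)) :
    ∃ j : Fin (k.val + 1), pairSwap p ⟨k, i⟩ = ⟨k, j⟩ ∧ j.val = pairPerm p k.val i.val := by
  obtain ⟨⟨⟨k', a, b⟩, hk, hij⟩, h⟩ := p
  by_cases hkk : k = k'
  · subst hkk
    refine ⟨Equiv.swap a b i, ?_, ?_⟩
    · simp only [pairSwap, PosPair.left, PosPair.right, Equiv.swap_apply_def]
      by_cases h1 : i = a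
      · subst h1; simp
      · by_cases h2 : i = b
        · subst h2; simp [h1]
        · simp [h1, h2]
    · simp only [pairPerm, if_true, Equiv.swap_apply_def, ← Fin.ext_iff]
      split_ifs <;> rfl
  · refine ⟨i, ?_, ?_⟩
    · simp only [pairSwap, PosPair.left, PosPair.right]
      refine Equiv.swap_apply_of_ne_of_ne ?_ ?_ <;>
      · intro h'
        exact hkk (Sigma.mk.inj h').1
    · have : ¬ k.val = k'.val := fun h => hkk (Fin.ext h)
      simp [pairPerm, this]

theorem pairPerm_of_not {p : SingPair u} {k i : ℕ} (h : ¬ (i ≤ k ∧ k < n)) :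
    pairPerm p k i = i := by
  rw [pairPerm]
  split_ifs with hk
  · refine Equiv.swap_apply_of_ne_of_ne ?_ ?_
    · have := p.1.1.2.1.2
      have := p.1.1.1.2
      omega
    · have := p.1.1.2.2.2
      have := p.1.1.1.2
      omega
  · rfl

theorem pairPerm_lt_iff (p : SingPair u) (k i : ℕ) : pairPerm p k i < k + 1 ↔ i < k + 1 := by
  rw [pairPerm]
  split_ifs with hk
  · have := p.1.1.2.1.2
    have := p.1.1.2.2.2
    rw [Equiv.swap_apply_def]
    split_ifs <;> omega
  · simp

theorem pairPerm_symm (p : SingPair u) (k : ℕ) : (pairPerm p k).symm = pairPerm p k := by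
  rw [pairPerm]
  split_ifs
  · exact Equiv.symm_swap _ _
  · rfl

theorem pairVars_extTab (p : SingPair u) (k i : ℕ) :
    pairVars p (extTab n k i) = extTab n k (pairPerm p k i) := by
  by_cases h : i ≤ k ∧ k < n
  · obtain ⟨j, hj, hj'⟩ := pairSwap_mk p ⟨k, h.2⟩ ⟨i, Nat.lt_succ_of_le h.1⟩
    have h1 := extTab_pos (n := n) ⟨⟨k, h.2⟩, ⟨i, Nat.lt_succ_of_le h.1⟩⟩
    have h2 := extTab_pos (n := n) ⟨⟨k, h.2⟩, j⟩
    simp only at h1 h2 hj'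
    rw [h1, pairVars, permVars_genTab, hj, ← h2, hj']
  · rw [pairPerm_of_not h, extTab, extPoly, dif_neg h]
    exact (permVars_polyFun _ _).trans (by rw [MvPolynomial.rename_C])

theorem permTab_swapPair {K : Type} (p : SingPair u) (z : Tab n K) (q : Pos n) :
    permTab (swapPair p) z q = z (pairSwap p q) := by
  obtain ⟨k, i⟩ := q
  obtain ⟨⟨⟨k', a, b⟩, hk, hij⟩, h⟩ := p
  simp only [permTab, swapPair, pairSwap, PosPair.left, PosPair.right]
  by_cases hkk : k = k'
  · subst hkk
    rw [Pi.mulSingle_eq_same, Equiv.swap_inv]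
    simp only [Equiv.swap_apply_def]
    by_cases h1 : i = a
    · subst h1; simp
    · by_cases h2 : i = b
      · subst h2; simp [h1]
      · simp [h1, h2]
  · rw [Pi.mulSingle_eq_of_ne hkk, inv_one, Equiv.Perm.one_apply,
      Equiv.swap_apply_of_ne_of_ne]
    · intro h'; exact hkk (Sigma.mk.inj h').1
    · intro h'; exact hkk (Sigma.mk.inj h').1

theorem permInt_swapPair (p : SingPair u) (z : intTab n) (q : Pos n) :
    (permInt (swapPair p) z).1 q = z.1 (pairSwap p q) :=
  permTab_swapPair p z.1 q

theorem permShift_toShift (p : SingPair u) (z : intTab n) :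
    permShift (pairPerm p) (toShift z) = toShift (permInt (swapPair p) z) := by
  funext k i
  rw [permShift, pairPerm_symm]
  by_cases h : i ≤ k ∧ k < n
  · obtain ⟨j, hj, hj'⟩ := pairSwap_mk p ⟨k, h.2⟩ ⟨i, Nat.lt_succ_of_le h.1⟩
    have h1 := toShift_pos (permInt (swapPair p) z) ⟨⟨k, h.2⟩, ⟨i, Nat.lt_succ_of_le h.1⟩⟩
    have h2 := toShift_pos z ⟨⟨k, h.2⟩, j⟩
    simp only at h1 h2 hj'
    rw [h1, permInt_swapPair, hj, ← h2, hj']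
  · rw [pairPerm_of_not h, toShift, dif_neg h, toShift, dif_neg h]

theorem pairSwap_apply (hu : IsNormalized u) (p : SingPair u) (q : Pos n) :
    u (pairSwap p q) = u q := by
  rw [pairSwap, Equiv.swap_apply_def]
  split_ifs with h1 h2
  · rw [h1, hu p]
  · rw [h2, hu p]
  · rfl

theorem pairVars_pairVars (p : SingPair u) (f : RatFun n) : pairVars p (pairVars p f) = f := by
  obtain ⟨a, b, hb, rfl⟩ := exists_eq_div f
  have h : ∀ a : MvPolynomial (Pos n) ℂ, pairVars p (pairVars p (polyFun a)) = polyFun a := by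
    intro a
    rw [pairVars, permVars_polyFun, permVars_polyFun, MvPolynomial.rename_rename]
    congr 1
    convert MvPolynomial.rename_id_apply a
    refine funext fun q => ?_
    simp [pairSwap]
  rw [map_div₀, map_div₀, h, h]

theorem pairVars_pairDiff_self (p : SingPair u) : pairVars p (pairDiff p) = -pairDiff p := by
  rw [pairDiff, map_sub, pairVars, permVars_genTab, permVars_genTab, pairSwap,
    Equiv.swap_apply_left, Equiv.swap_apply_right, neg_sub]

theorem pairSwap_left_of_ne (hd : PairsDisjoint u) {p q : SingPair u} (h : p ≠ q) :
    pairSwap p q.1.left = q.1.left :=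
  Equiv.swap_apply_of_ne_of_ne (hd p q h).1.symm (hd p q h).2.2.1.symm

theorem pairSwap_right_of_ne (hd : PairsDisjoint u) {p q : SingPair u} (h : p ≠ q) :
    pairSwap p q.1.right = q.1.right :=
  Equiv.swap_apply_of_ne_of_ne (hd p q h).2.1.symm (hd p q h).2.2.2.symm

theorem pairVars_pairDiff_of_ne (hd : PairsDisjoint u) {p q : SingPair u} (h : p ≠ q) :
    pairVars p (pairDiff q) = pairDiff q := by
  rw [pairDiff, map_sub, pairVars, permVars_genTab, permVars_genTab, pairSwap_left_of_ne hd h,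
    pairSwap_right_of_ne hd h]

theorem pairVars_regular (hu : IsNormalized u) (p : SingPair u) {f : RatFun n}
    (hf : f ∈ regularRing u) : pairVars p f ∈ regularRing u :=
  (permVars_regular (pairSwap_apply hu p) hf).1

theorem valueAt_pairVars (hu : IsNormalized u) (p : SingPair u) {f : RatFun n}
    (hf : f ∈ regularRing u) : valueAt u (pairVars p f) = valueAt u f :=
  (permVars_regular (pairSwap_apply hu p) hf).2

theorem pairDiff_mem_regularRing (p : SingPair u) : pairDiff p ∈ regularRing u :=
  sub_mem (genTab_mem_regularRing _ _) (genTab_mem_regularRing _ _)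

theorem valueAt_pairDiff (hu : IsNormalized u) (p : SingPair u) : valueAt u (pairDiff p) = 0 := by
  rw [pairDiff, sub_eq_add_neg, ← neg_one_mul, ← map_one (algebraMap ℂ (RatFun n)), ← map_neg,
    valueAt_add (genTab_mem_regularRing _ _)
      (mul_mem (Subalgebra.algebraMap_mem _ _) (genTab_mem_regularRing _ _)),
    valueAt_mul (Subalgebra.algebraMap_mem _ _) (genTab_mem_regularRing _ _), valueAt_algebraMap,
    valueAt_genTab, valueAt_genTab, hu p]
  ring

/-! ### Derivatives along singular pairs -/

/-- The operator `halfDiff` as a derivation. -/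
noncomputable def halfDerivation (p : SingPair u) : Derivation ℂ (RatFun n) (RatFun n) :=
  (1 / 2 : ℂ) • (partialDerivation p.1.left - partialDerivation p.1.right)

theorem halfDerivation_apply (p : SingPair u) (f : RatFun n) :
    halfDerivation p f = halfDiff p f := by
  rw [halfDerivation, Derivation.smul_apply, Derivation.sub_apply, Algebra.smul_def, halfDiff,
    partialDerivation_apply, partialDerivation_apply, map_div₀, map_one, map_ofNat]

theorem halfDiff_add (p : SingPair u) (f g : RatFun n) :
    halfDiff p (f + g) = halfDiff p f + halfDiff p g := by
  simp only [← halfDerivation_apply, map_add]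

theorem halfDiff_smul (p : SingPair u) (c : ℂ) (f : RatFun n) :
    halfDiff p (c • f) = c • halfDiff p f := by
  simp only [← halfDerivation_apply, Derivation.map_smul]

theorem halfDiff_mul (p : SingPair u) (f g : RatFun n) :
    halfDiff p (f * g) = halfDiff p f * g + f * halfDiff p g := by
  simp only [← halfDerivation_apply, Derivation.leibniz, smul_eq_mul]
  ring

theorem halfDiff_algebraMap (p : SingPair u) (c : ℂ) :
    halfDiff p (algebraMap ℂ (RatFun n) c) = 0 := by
  rw [← halfDerivation_apply, Derivation.map_algebraMap]

theorem halfDiff_comm (p q : SingPair u) (f : RatFun n) :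
    halfDiff p (halfDiff q f) = halfDiff q (halfDiff p f) := by
  simp only [← halfDerivation_apply, halfDerivation, Derivation.smul_apply, Derivation.sub_apply,
    Derivation.map_smul, map_sub, partialDerivation_apply]
  rw [partialDeriv_comm p.1.left q.1.left, partialDeriv_comm p.1.left q.1.right,
    partialDeriv_comm p.1.right q.1.left, partialDeriv_comm p.1.right q.1.right]
  simp only [smul_sub]
  abel

theorem halfDiff_mem_regularRing (p : SingPair u) {f : RatFun n} (hf : f ∈ regularRing u) :
    halfDiff p f ∈ regularRing u := by
  rw [← halfDerivation_apply, halfDerivation]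
  exact Subalgebra.smul_mem _ (sub_mem (partialDeriv_mem_regularRing _ hf)
    (partialDeriv_mem_regularRing _ hf)) _

/-- The exchange interchanges the two partial derivatives, so it anticommutes with their difference.
-/
theorem halfDiff_pairVars_self (p : SingPair u) (f : RatFun n) :
    halfDiff p (pairVars p f) = -pairVars p (halfDiff p f) := by
  have h1 := partialDeriv_permVars (pairSwap p) p.1.left f
  have h2 := partialDeriv_permVars (pairSwap p) p.1.right f
  rw [pairSwap, Equiv.swap_apply_left] at h1
  rw [pairSwap, Equiv.swap_apply_right] at h2
  simp only [← halfDerivation_apply, halfDerivation, Derivation.smul_apply, Derivation.sub_apply,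
    partialDerivation_apply, pairVars, pairSwap, permVars_smul, map_sub, h1, h2]
  rw [← smul_neg, neg_sub]

theorem halfDiff_pairVars_of_ne (hd : PairsDisjoint u) {p q : SingPair u} (h : p ≠ q)
    (f : RatFun n) : halfDiff q (pairVars p f) = pairVars p (halfDiff q f) := by
  have h1 := partialDeriv_permVars (pairSwap p) q.1.left f
  have h2 := partialDeriv_permVars (pairSwap p) q.1.right f
  rw [pairSwap_left_of_ne hd h] at h1
  rw [pairSwap_right_of_ne hd h] at h2
  simp only [← halfDerivation_apply, halfDerivation, Derivation.smul_apply, Derivation.sub_apply,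
    partialDerivation_apply, pairVars, permVars_smul, map_sub, h1, h2]

theorem partialDeriv_genTab (p q : Pos n) :
    partialDeriv p (genTab n q) = if p = q then 1 else 0 := by
  rw [genTab, partialDeriv_polyFun, MvPolynomial.pderiv_X, Pi.single_apply]
  by_cases h : q = p
  · simp [h]
  · simp [h, Ne.symm h]

theorem halfDiff_pairDiff_self (p : SingPair u) : halfDiff p (pairDiff p) = 1 := by
  rw [halfDiff, pairDiff]
  simp only [← partialDerivation_apply, map_sub]
  simp only [partialDerivation_apply, partialDeriv_genTab, left_ne_right p, (left_ne_right p).symm,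
    if_true, if_false]
  norm_num

theorem halfDiff_pairDiff_of_ne (hd : PairsDisjoint u) {p q : SingPair u} (h : p ≠ q) :
    halfDiff p (pairDiff q) = 0 := by
  obtain ⟨h1, h2, h3, h4⟩ := hd p q h
  rw [halfDiff, pairDiff]
  simp only [← partialDerivation_apply, map_sub]
  simp only [partialDerivation_apply, partialDeriv_genTab, h1, h2, h3, h4, if_false]
  norm_num

theorem diffOp_empty (f : RatFun n) : diffOp (∅ : Finset (SingPair u)) f = f := by
  simp [diffOp]

theorem diffOp_insert {p : SingPair u} {I : Finset (SingPair u)} (hp : p ∉ I) (f : RatFun n) :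
    diffOp (insert p I) f = halfDiff p (diffOp I f) := by
  have : LeftCommutative (halfDiff (u := u) (n := n)) := ⟨halfDiff_comm⟩
  exact (Finset.toList_insert hp).foldr_eq f

theorem diffOp_halfDiff (p : SingPair u) (I : Finset (SingPair u)) (f : RatFun n) :
    diffOp I (halfDiff p f) = halfDiff p (diffOp I f) := by
  induction I using Finset.induction_on with
  | empty => simp [diffOp_empty]
  | insert q I hq ih => rw [diffOp_insert hq, diffOp_insert hq, ih, halfDiff_comm]

theorem diffOp_insert' {p : SingPair u} {I : Finset (SingPair u)} (hp : p ∉ I) (f : RatFun n) :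
    diffOp (insert p I) f = diffOp I (halfDiff p f) := by
  rw [diffOp_insert hp, diffOp_halfDiff]

theorem diffOp_add (I : Finset (SingPair u)) (f g : RatFun n) :
    diffOp I (f + g) = diffOp I f + diffOp I g := by
  induction I using Finset.induction_on with
  | empty => simp [diffOp_empty]
  | insert q I hq ih => simp only [diffOp_insert hq, ih, halfDiff_add]

theorem diffOp_smul (I : Finset (SingPair u)) (c : ℂ) (f : RatFun n) :
    diffOp I (c • f) = c • diffOp I f := by
  induction I using Finset.induction_on with
  | empty => simp [diffOp_empty]
  | insert q I hq ih => simp only [diffOp_insert hq, ih, halfDiff_smul]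

/-- The operator `diffOp I` as a linear map. -/
noncomputable def diffOpLin (I : Finset (SingPair u)) : RatFun n →ₗ[ℂ] RatFun n where
  toFun := diffOp I
  map_add' := diffOp_add I
  map_smul' := diffOp_smul I

theorem diffOp_mem_regularRing (I : Finset (SingPair u)) {f : RatFun n} (hf : f ∈ regularRing u) :
    diffOp I f ∈ regularRing u := by
  induction I using Finset.induction_on with
  | empty => rwa [diffOp_empty]
  | insert q I hq ih => rw [diffOp_insert hq]; exact halfDiff_mem_regularRing q ih

theorem diffOp_pairVars (hd : PairsDisjoint u) (I : Finset (SingPair u)) (p : SingPair u)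
    (f : RatFun n) : diffOp I (pairVars p f) =
      (if p ∈ I then -1 else 1 : ℂ) • pairVars p (diffOp I f) := by
  have hneg : ∀ g : RatFun n, (-1 : ℂ) • g = -g := fun g => neg_one_smul ℂ g
  induction I using Finset.induction_on with
  | empty => simp [diffOp_empty]
  | insert q I hq ih =>
    rw [diffOp_insert hq, ih, halfDiff_smul, diffOp_insert hq]
    by_cases hpq : p = q
    · subst hpq
      rw [halfDiff_pairVars_self, if_neg hq, if_pos (mem_insert_self p I), one_smul, hneg]
    · rw [halfDiff_pairVars_of_ne hd hpq]
      simp [hpq]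

/-- The factor `x_{ki} - x_{kj}` vanishes at `u`, so it must be differentiated, and only the
operator of its own pair does not kill it. The factor `1/2` in that operator makes the derivative
equal to 1. -/
theorem valueAt_diffOp_pairDiff_mul (hu : IsNormalized u) (hd : PairsDisjoint u) (p : SingPair u)
    (A : Finset (SingPair u)) {f : RatFun n} (hf : f ∈ regularRing u) :
    valueAt u (diffOp A (pairDiff p * f)) =
      if p ∈ A then valueAt u (diffOp (A.erase p) f) else 0 := by
  have key : ∀ A : Finset (SingPair u), p ∉ A → ∀ f : RatFun n,
      diffOp A (pairDiff p * f) = pairDiff p * diffOp A f := by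
    intro A
    induction A using Finset.induction_on with
    | empty => intro _ f; simp [diffOp_empty]
    | insert q A hq ih =>
      intro hp f
      rw [mem_insert, not_or] at hp
      rw [diffOp_insert hq, diffOp_insert hq, ih hp.2, halfDiff_mul,
        halfDiff_pairDiff_of_ne hd (Ne.symm hp.1), zero_mul, zero_add]
  have key' : ∀ A : Finset (SingPair u), p ∉ A → ∀ f ∈ regularRing u,
      valueAt u (diffOp A (pairDiff p * f)) = 0 := by
    intro A hA f hf
    rw [key A hA, valueAt_mul (pairDiff_mem_regularRing p) (diffOp_mem_regularRing A hf),
      valueAt_pairDiff hu, zero_mul]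
  split_ifs with h
  · have h1 := notMem_erase p A
    conv_lhs => rw [← insert_erase h]
    rw [diffOp_insert' h1, halfDiff_mul, halfDiff_pairDiff_self, one_mul, diffOp_add,
      valueAt_add (diffOp_mem_regularRing _ hf) (diffOp_mem_regularRing _
        (mul_mem (pairDiff_mem_regularRing p) (halfDiff_mem_regularRing p hf))),
      key' _ h1 _ (halfDiff_mem_regularRing p hf), add_zero]
  · exact key' A h f hf

theorem pairProd_empty : pairProd (∅ : Finset (SingPair u)) = 1 := rfl

theorem pairProd_insert {p : SingPair u} {B : Finset (SingPair u)} (hp : p ∉ B) :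
    pairProd (insert p B) = pairDiff p * pairProd B := by
  classical
  exact prod_insert hp

theorem pairProd_mem_regularRing (B : Finset (SingPair u)) : pairProd B ∈ regularRing u :=
  prod_mem fun p _ => pairDiff_mem_regularRing p

theorem pairVars_pairProd (hd : PairsDisjoint u) (B : Finset (SingPair u)) (p : SingPair u) :
    pairVars p (pairProd B) = if p ∈ B then -pairProd B else pairProd B := by
  induction B using Finset.induction_on with
  | empty => simp [pairProd_empty]
  | insert q B hq ih =>
    rw [pairProd_insert hq, map_mul, ih]
    by_cases hpq : p = q
    · subst hpq
      rw [if_neg hq, if_pos (mem_insert_self _ _), pairVars_pairDiff_self, neg_mul]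
    · rw [pairVars_pairDiff_of_ne hd hpq]
      simp only [mem_insert, hpq, false_or]
      split_ifs <;> ring

theorem valueAt_diffOp_pairProd_mul (hu : IsNormalized u) (hd : PairsDisjoint u)
    (A B : Finset (SingPair u)) {f : RatFun n} (hf : f ∈ regularRing u) :
    valueAt u (diffOp A (pairProd B * f)) =
      if B ⊆ A then valueAt u (diffOp (A \ B) f) else 0 := by
  induction B using Finset.induction_on generalizing A with
  | empty => simp [pairProd_empty]
  | insert q B hq ih =>
    rw [pairProd_insert hq, mul_assoc, valueAt_diffOp_pairDiff_mul hu hd q A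
      (mul_mem (pairProd_mem_regularRing B) hf), ih]
    by_cases hqA : q ∈ A
    · rw [if_pos hqA]
      have h1 : B ⊆ A.erase q ↔ insert q B ⊆ A := by
        rw [insert_subset_iff]
        exact ⟨fun h => ⟨hqA, h.trans (erase_subset _ _)⟩, fun h => subset_erase.mpr ⟨h.2, hq⟩⟩
      have h2 : A.erase q \ B = A \ insert q B := by
        ext; simp only [mem_sdiff, mem_erase, mem_insert]; tauto
      rw [h2]
      exact if_congr h1 rfl rfl
    · rw [if_neg hqA, if_neg fun h => hqA (h (mem_insert_self _ _))]

/-- A derivative of an invariant function along its pair is odd under an exchange that fixes `u`,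
hence vanishes there; in the Leibniz rule only the undifferentiated `f` survives. -/
theorem valueAt_diffOp_invariant_mul (hu : IsNormalized u) (hd : PairsDisjoint u)
    (A : Finset (SingPair u)) {f : RatFun n} (hf : f ∈ regularRing u)
    (hinv : ∀ p ∈ A, pairVars p f = f) {g : RatFun n} (hg : g ∈ regularRing u) :
    valueAt u (diffOp A (f * g)) = valueAt u f * valueAt u (diffOp A g) := by
  -- Both functions vary: the induction is also applied to `halfDiff q f`, which is invariant under
  -- the exchanges of the pairs other than `q`.
  induction A using Finset.induction_on generalizing f g with
  | empty => simp only [diffOp_empty]; exact valueAt_mul hf hg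
  | insert q A hq ih =>
    have h1 : pairVars q (halfDiff q f) = -halfDiff q f := by
      have h := halfDiff_pairVars_self q f
      rw [hinv q (mem_insert_self _ _)] at h
      rw [h, neg_neg, ← h]
    have hqf := halfDiff_mem_regularRing q hf
    have hqg := halfDiff_mem_regularRing q hg
    have h2 : valueAt u (halfDiff q f) = 0 := by
      have h := valueAt_pairVars hu q hqf
      have h3 := valueAt_add hqf (neg_mem hqf)
      rw [add_neg_cancel, ← h1, h] at h3
      have h4 : valueAt u (0 : RatFun n) = 0 := by simpa using valueAt_algebraMap u 0
      rw [h4] at h3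
      linear_combination -(1 / 2 : ℂ) * h3
    rw [diffOp_insert' hq, halfDiff_mul, diffOp_add, valueAt_add
      (diffOp_mem_regularRing _ (mul_mem hqf hg)) (diffOp_mem_regularRing _ (mul_mem hf hqg)),
      ih hqf (fun p hp => ?_) hg, ih hf (fun p hp => hinv p (mem_insert_of_mem hp)) hqg, h2,
      diffOp_insert' hq, zero_mul, zero_add]
    have hpq : p ≠ q := fun h => hq (h ▸ hp)
    rw [← halfDiff_pairVars_of_ne hd hpq, hinv p (mem_insert_of_mem hp)]

end Pairs

end GelfandTsetlin

namespace GelfandTsetlin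

/-! ### Poles of the coefficients -/

section Poles

open Finset

variable {n : ℕ} {u : Tab n ℂ}

open Classical in
/-- The singular pairs with equal entries in `z`. -/
noncomputable def equalPairs (u : Tab n ℂ) (z : intTab n) : Finset (SingPair u) :=
  univ.filter fun p => z.1 p.1.left = z.1 p.1.right

theorem mem_equalPairs {z : intTab n} {p : SingPair u} :
    p ∈ equalPairs u z ↔ z.1 p.1.left = z.1 p.1.right := by
  simp [equalPairs]

theorem shiftedTab_mem_regularRing (u : Tab n ℂ) (z : intTab n) (p : Pos n) :
    shiftedTab z p ∈ regularRing u :=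
  add_mem (genTab_mem_regularRing u p) (intCast_mem _ _)

theorem valueAt_intCast (u : Tab n ℂ) (m : ℤ) : valueAt u (m : RatFun n) = m := by
  rw [← map_intCast (algebraMap ℂ (RatFun n)), valueAt_algebraMap]

theorem valueAt_shiftedTab (u : Tab n ℂ) (z : intTab n) (p : Pos n) :
    valueAt u (shiftedTab z p) = u p + z.1 p := by
  rw [shiftedTab, valueAt_add (genTab_mem_regularRing u p) (intCast_mem _ _), valueAt_genTab,
    valueAt_intCast]

theorem valueAt_zero (u : Tab n ℂ) : valueAt u (0 : RatFun n) = 0 := by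
  simpa using valueAt_algebraMap u 0

theorem valueAt_sub {f g : RatFun n} (hf : f ∈ regularRing u) (hg : g ∈ regularRing u) :
    valueAt u (f - g) = valueAt u f - valueAt u g := by
  have h := valueAt_add (sub_mem hf hg) hg
  rw [sub_add_cancel] at h
  rw [h, add_sub_cancel_right]

theorem exists_pair {k : Fin n} (hk : IsInnerRow k) {i j : Fin (k.val + 1)} (hij : i < j)
    (h : IntDiff (u ⟨k, i⟩) (u ⟨k, j⟩)) :
    ∃ p : SingPair u, p.1.left = ⟨k, i⟩ ∧ p.1.right = ⟨k, j⟩ :=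
  ⟨⟨⟨⟨k, i, j⟩, hk, hij⟩, h⟩, rfl, rfl⟩

theorem extTab_mem_regularRing (u : Tab n ℂ) (k i : ℕ) : extTab n k i ∈ regularRing u :=
  regularAt_polyFun u _

theorem ent_mem_regularRing (u : Tab n ℂ) (z : Shift) (k i : ℕ) :
    ent (extTab n) z k i ∈ regularRing u :=
  add_mem (extTab_mem_regularRing u k i) (intCast_mem _ _)

variable (hu : IsNormalized u) (hd : PairsDisjoint u)

include hu

/-- Entries of one row of `x + z` that coincide at `u` belong to a singular pair. -/
theorem exists_pair_of_valueAt_eq (z : intTab n) {k : Fin n} (hk : k.val + 1 < n)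
    {i j : Fin (k.val + 1)} (hij : i ≠ j)
    (h : valueAt u (shiftedTab z ⟨k, i⟩ - shiftedTab z ⟨k, j⟩) = 0) :
    ∃ p ∈ equalPairs u z, (p.1.left = ⟨k, i⟩ ∧ p.1.right = ⟨k, j⟩ ∨
      p.1.left = ⟨k, j⟩ ∧ p.1.right = ⟨k, i⟩) := by
  rw [valueAt_sub (shiftedTab_mem_regularRing _ _ _) (shiftedTab_mem_regularRing _ _ _),
    valueAt_shiftedTab, valueAt_shiftedTab] at h
  have hpos : 1 < k.val + 1 := by
    have := i.2; have := j.2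
    have : i.val ≠ j.val := fun h => hij (Fin.ext h)
    omega
  have hin : IsInnerRow k := ⟨hpos, hk⟩
  rcases lt_or_gt_of_ne hij with hlt | hlt
  · obtain ⟨p, hl, hr⟩ := exists_pair (u := u) hin hlt
      ⟨z.1 ⟨k, j⟩ - z.1 ⟨k, i⟩, by push_cast; linear_combination h⟩
    refine ⟨p, ?_, Or.inl ⟨hl, hr⟩⟩
    have h2 := hu p
    rw [mem_equalPairs, hl, hr]
    rw [hl, hr] at h2
    have h3 : (z.1 ⟨k, i⟩ : ℂ) = z.1 ⟨k, j⟩ := by linear_combination h - h2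
    exact_mod_cast h3
  · obtain ⟨p, hl, hr⟩ := exists_pair (u := u) hin hlt
      ⟨z.1 ⟨k, i⟩ - z.1 ⟨k, j⟩, by push_cast; linear_combination -h⟩
    refine ⟨p, ?_, Or.inr ⟨hl, hr⟩⟩
    have h2 := hu p
    rw [mem_equalPairs, hl, hr]
    rw [hl, hr] at h2
    have h3 : (z.1 ⟨k, j⟩ : ℂ) = z.1 ⟨k, i⟩ := by linear_combination -h - h2
    exact_mod_cast h3

include hd

open Classical in
-- Since the pairs are disjoint, the chosen entry coincides at `u` with at most one other entry of
-- its row. That single vanishing factor is, up to sign, the `pairDiff` of a pair with equal entries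
-- in `z`; the other factors are units at `u`.
theorem prod_pairDiff_mul_rowDen_inv (z : intTab n) {k c : ℕ} (hk : k + 1 < n) (hc : c ≤ k) :
    (∏ p ∈ equalPairs u z with p.1.1.1.val = k, pairDiff p) *
      (rowDen (extTab n) k c (toShift z))⁻¹ ∈ regularRing u := by
  have hprod : ∀ s : Finset (SingPair u), ∏ p ∈ s, pairDiff p ∈ regularRing u :=
    fun s => prod_mem fun p _ => pairDiff_mem_regularRing p
  let kk : Fin n := ⟨k, by omega⟩
  let cc : Fin (kk.val + 1) := ⟨c, Nat.lt_succ_of_le hc⟩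
  have hent : ∀ t : Fin (kk.val + 1), ent (extTab n) (toShift z) k t.val = shiftedTab z ⟨kk, t⟩ :=
    fun t => ent_toShift z ⟨kk, t⟩
  have hden : rowDen (extTab n) k c (toShift z) =
      ∏ t ∈ univ.erase cc, (shiftedTab z ⟨kk, cc⟩ - shiftedTab z ⟨kk, t⟩) := by
    rw [rowDen]
    refine (prod_range_erase_eq cc fun t => _ - ent (extTab n) (toShift z) k t).trans ?_
    exact prod_congr rfl fun t _ => by rw [hent, ← hent cc]
  have hinv : ∀ t : Fin (kk.val + 1), valueAt u (shiftedTab z ⟨kk, cc⟩ - shiftedTab z ⟨kk, t⟩) ≠ 0 →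
      (shiftedTab z ⟨kk, cc⟩ - shiftedTab z ⟨kk, t⟩)⁻¹ ∈ regularRing u := fun t ht =>
    RegularAt.inv (sub_mem (shiftedTab_mem_regularRing _ _ _) (shiftedTab_mem_regularRing _ _ _)) ht
  rw [hden, ← prod_inv_distrib]
  by_cases h : ∃ t ∈ univ.erase cc, valueAt u (shiftedTab z ⟨kk, cc⟩ - shiftedTab z ⟨kk, t⟩) = 0
  · obtain ⟨t, ht, h0⟩ := h
    obtain ⟨p, hp, hpos⟩ := exists_pair_of_valueAt_eq hu z hk (ne_of_mem_erase ht).symm h0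
    have hrow : p.1.1.1.val = k := by
      rcases hpos with hpos | hpos
      · exact congrArg (fun q : Pos n => q.1.val) hpos.1
      · exact congrArg (fun q : Pos n => q.1.val) hpos.1
    have hp' : p ∈ (equalPairs u z).filter fun p => p.1.1.1.val = k := mem_filter.mpr ⟨hp, hrow⟩
    have hz := mem_equalPairs.mp hp
    have hmain : pairDiff p * (shiftedTab z ⟨kk, cc⟩ - shiftedTab z ⟨kk, t⟩)⁻¹ ∈ regularRing u := by
      have hne := pairDiff_ne_zero p
      rcases hpos with ⟨hl, hr⟩ | ⟨hl, hr⟩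
      · have : shiftedTab z ⟨kk, cc⟩ - shiftedTab z ⟨kk, t⟩ = pairDiff p := by
          rw [← hl, ← hr, shiftedTab, shiftedTab, hz, pairDiff]; ring
        rw [this, mul_inv_cancel₀ hne]
        exact one_mem _
      · have : shiftedTab z ⟨kk, cc⟩ - shiftedTab z ⟨kk, t⟩ = -pairDiff p := by
          rw [← hl, ← hr, shiftedTab, shiftedTab, hz, pairDiff]; ring
        have h1 : pairDiff p * (-pairDiff p)⁻¹ = -1 := by
          rw [mul_inv_eq_iff_eq_mul₀ (neg_ne_zero.mpr hne)]; ring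
        rw [this, h1]
        exact neg_mem (one_mem _)
    rw [← mul_prod_erase _ _ hp', ← mul_prod_erase _ _ ht, mul_mul_mul_comm]
    refine mul_mem hmain (mul_mem (hprod _) (prod_mem fun t' ht' => hinv t' fun h1 => ?_))
    rw [mem_erase] at ht'
    -- A second vanishing factor would give a second singular pair through the same entry.
    obtain ⟨q, hq, hpos'⟩ := exists_pair_of_valueAt_eq hu z hk (ne_of_mem_erase ht'.2).symm h1
    have hqp : p ≠ q := by
      rintro rfl
      have hcancel : ∀ {a b : Fin (kk.val + 1)}, (⟨kk, a⟩ : Pos n) = ⟨kk, b⟩ → a = b := fun h => by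
        simpa using h
      rcases hpos with ⟨hl, hr⟩ | ⟨hl, hr⟩ <;> rcases hpos' with ⟨hl', hr'⟩ | ⟨hl', hr'⟩
      · exact ht'.1 (hcancel (hr'.symm.trans hr))
      · exact ne_of_mem_erase ht'.2 (hcancel (hl'.symm.trans hl))
      · exact ne_of_mem_erase ht'.2 (hcancel (hr'.symm.trans hr))
      · exact ht'.1 (hcancel (hl'.symm.trans hl))
    have h2 := hd p q hqp
    rcases hpos with ⟨hl, hr⟩ | ⟨hl, hr⟩ <;> rcases hpos' with ⟨hl', hr'⟩ | ⟨hl', hr'⟩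
    · exact h2.1 (hl.trans hl'.symm)
    · exact h2.2.1 (hl.trans hr'.symm)
    · exact h2.2.2.1 (hr.trans hl'.symm)
    · exact h2.2.2.2 (hr.trans hr'.symm)
  · push Not at h
    exact mul_mem (hprod _) (prod_mem fun t ht => hinv t (h t ht))

theorem pairProd_mul_prod_rowDen_inv (z : intTab n) {r d : ℕ} (h : r + d + 1 < n) {c : ℕ → ℕ}
    (hc : ∀ k, k < n → c k ≤ k) :
    pairProd (equalPairs u z) * ∏ k ∈ Ico r (r + d + 1),
      (rowDen (extTab n) k (c k) (toShift z))⁻¹ ∈ regularRing u := by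
  classical
  have h1 : pairProd (equalPairs u z) =
      ∏ k ∈ range n, ∏ p ∈ equalPairs u z with p.1.1.1.val = k, pairDiff p :=
    (prod_fiberwise_of_maps_to (fun p _ => mem_range.mpr p.1.1.1.2) _).symm
  have h2 : Ico r (r + d + 1) ⊆ range n := fun k hk => by
    have := mem_Ico.mp hk
    exact mem_range.mpr (by omega)
  rw [h1, ← prod_sdiff h2, mul_assoc, ← prod_mul_distrib]
  refine mul_mem (prod_mem fun k _ => prod_mem fun p _ => pairDiff_mem_regularRing p)
    (prod_mem fun k hk => ?_)
  have := mem_Ico.mp hk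
  exact prod_pairDiff_mul_rowDen_inv hu hd z (by omega) (hc k (by omega))

/-- After the links of the path are cancelled, the denominators are one `rowDen` for each row of the
path, and these rows all lie below the top row. The factors of `pairProd` are distributed over the
rows. For `r = s` there is no denominator. -/
theorem pairProd_mul_coeffE {r s : Fin n} (z : intTab n) {σ : RowPerm n}
    (hσ : σ ∈ permSet n r s) : pairProd (equalPairs u z) *
      coeffE (r.val + 1) (s.val + 1) (permTab σ (shiftedTab z)) ∈ regularRing u := by
  have hlt : ∀ k, k < n → pathOf σ k ≤ k := fun k hk => by
    rw [← inv_apply_zero_of_mem_permSet hσ ⟨k, hk⟩]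
    exact Nat.lt_succ_iff.mp (Fin.is_lt _)
  have hx := isGenericTab_extTab n
  have hs := s.2
  have hr := r.2
  have hE := ent_mem_regularRing u (toShift z)
  rcases lt_trichotomy r s with hrs | rfl | hrs
  · obtain ⟨d, hd'⟩ := Nat.exists_eq_add_of_lt (Fin.lt_def.mp hrs)
    rw [coeffE_upper z hd'.symm hσ, upCoeff]
    have key : ∀ k ∈ Ico r.val (r.val + d), raiseCoeff (extTab n) k (pathOf σ k) (toShift z) /
        (ent (extTab n) (toShift z) k (pathOf σ k) -
          ent (extTab n) (toShift z) (k + 1) (pathOf σ (k + 1))) =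
        (∏ t ∈ (range (k + 2)).erase (pathOf σ (k + 1)), (ent (extTab n) (toShift z) k (pathOf σ k) -
          ent (extTab n) (toShift z) (k + 1) t)) *
          (rowDen (extTab n) k (pathOf σ k) (toShift z))⁻¹ := fun k hk => by
      have := mem_Ico.mp hk
      have := hlt (k + 1) (by omega)
      rw [raiseCoeff_div_eq hx (by omega), div_eq_mul_inv]
    have h1 := pairProd_mul_prod_rowDen_inv hu hd z (r := r.val) (d := d) (by omega) hlt
    rw [prod_Ico_succ_top (by omega)] at h1
    rw [prod_congr rfl key, prod_mul_distrib, raiseCoeff, div_eq_mul_inv]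
    have h2 := mul_mem h1 (mul_mem
      (neg_mem (prod_mem fun t (_ : t ∈ range (r.val + d + 2)) =>
        sub_mem (hE (r.val + d) (pathOf σ (r.val + d))) (hE (r.val + d + 1) t)))
      (prod_mem fun k (_ : k ∈ Ico r.val (r.val + d)) =>
        prod_mem fun t (_ : t ∈ (range (k + 2)).erase (pathOf σ (k + 1))) =>
          sub_mem (hE k (pathOf σ k)) (hE (k + 1) t)))
    convert h2 using 1
    ring
  · refine mul_mem (pairProd_mem_regularRing _) ?_
    rw [coeffE, if_neg (lt_irrefl _), if_neg (lt_irrefl _)]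
    have he : ∀ k i, (permTab σ (shiftedTab z)).entry k i ∈ regularRing u := by
      intro k i
      rw [Tab.entry]
      split_ifs
      · exact shiftedTab_mem_regularRing u z _
      · exact zero_mem _
    exact sub_mem (add_mem (sub_mem (natCast_mem _ _) (one_mem _)) (sum_mem fun i _ => he _ _))
      (sum_mem fun i _ => he _ _)
  · obtain ⟨d, hd'⟩ := Nat.exists_eq_add_of_lt (Fin.lt_def.mp hrs)
    rw [coeffE_lower z hd'.symm hσ, downCoeff]
    have key : ∀ k ∈ Ico s.val (s.val + d),
        lowerCoeff (extTab n) (k + 1) (pathOf σ (k + 1)) (toShift z) /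
        (ent (extTab n) (toShift z) (k + 1) (pathOf σ (k + 1)) -
          ent (extTab n) (toShift z) k (pathOf σ k)) =
        (∏ t ∈ (range (k + 1)).erase (pathOf σ k),
          (ent (extTab n) (toShift z) (k + 1) (pathOf σ (k + 1)) -
          ent (extTab n) (toShift z) k t)) *
          (rowDen (extTab n) (k + 1) (pathOf σ (k + 1)) (toShift z))⁻¹ := fun k hk => by
      have := mem_Ico.mp hk
      have := hlt k (by omega)
      rw [lowerCoeff_div_eq hx (by omega), div_eq_mul_inv]
    have h1 := pairProd_mul_prod_rowDen_inv hu hd z (r := s.val) (d := d) (by omega) hlt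
    rw [prod_eq_prod_Ico_succ_bot (by omega), ← prod_Ico_add' _ s.val (s.val + d) 1] at h1
    rw [prod_congr rfl key, prod_mul_distrib, lowerCoeff, div_eq_mul_inv]
    have h2 := mul_mem h1 (mul_mem
      (prod_mem fun t (_ : t ∈ range s.val) =>
        sub_mem (hE s.val (pathOf σ s.val)) (hE (s.val - 1) t))
      (prod_mem fun k (_ : k ∈ Ico s.val (s.val + d)) =>
        prod_mem fun t (_ : t ∈ (range (k + 1)).erase (pathOf σ k)) =>
          sub_mem (hE (k + 1) (pathOf σ (k + 1))) (hE k t)))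
    convert h2 using 1
    ring

/-- The coefficients in the formulas for the action have no pole. -/
theorem regularAt_actionCoeff {r s : Fin n} {I : Finset (SingPair u)} {z : intTab n}
    (hI : ∀ p ∈ I, z.1 p.1.left ≠ z.1 p.1.right) {σ : RowPerm n} (hσ : σ ∈ permSet n r s) :
    RegularAt u (actionCoeff u r s I z σ) := by
  have h : equalPairs u z ⊆ univ \ I := fun p hp =>
    mem_sdiff.mpr ⟨mem_univ _, fun hpI => hI p hpI (mem_equalPairs.mp hp)⟩
  rw [actionCoeff, pairProd, ← prod_sdiff h, mul_assoc]
  exact mul_mem (prod_mem fun p _ => pairDiff_mem_regularRing p) (pairProd_mul_coeffE hu hd z hσ)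

end Poles

end GelfandTsetlin

namespace GelfandTsetlin

/-! ### Antisymmetric families -/

section AntiSymmetric

open Finset

/-- The space of the generic tableaux. -/
abbrev GenSpace (n : ℕ) : Type := Shift →₀ RatFun n

variable {n : ℕ} {u : Tab n ℂ}

/-- The action of a singular pair on coefficients and tableaux. -/
noncomputable def pairTwist (p : SingPair u) : GenSpace n →ₗ[ℂ] GenSpace n where
  toFun := twist (pairVars p) (pairPerm p)
  map_add' := map_add _
  map_smul' c y := by
    rw [← algebraMap_smul (RatFun n) c y, twist_smul, pairVars, permVars_algebraMap,
      algebraMap_smul, RingHom.id_apply]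

theorem pairTwist_single (p : SingPair u) (z : Shift) (f : RatFun n) :
    pairTwist p (Finsupp.single z f) = Finsupp.single (permShift (pairPerm p) z) (pairVars p f) :=
  twist_single _ _ z f

theorem pairTwist_toShift (p : SingPair u) (z : intTab n) (f : RatFun n) :
    pairTwist p (Finsupp.single (toShift z) f) =
      Finsupp.single (toShift (permInt (swapPair p) z)) (pairVars p f) := by
  rw [pairTwist_single, permShift_toShift]

theorem pairTwist_smul (p : SingPair u) (f : RatFun n) (y : GenSpace n) :
    pairTwist p (f • y) = pairVars p f • pairTwist p y :=
  twist_smul _ _ f y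

theorem pairTwist_pairTwist (p : SingPair u) (y : GenSpace n) :
    pairTwist p (pairTwist p y) = y := by
  induction y using Finsupp.induction_linear with
  | zero => simp
  | add y y' h h' => rw [map_add, map_add, h, h']
  | single z f =>
    rw [pairTwist_single, pairTwist_single, pairVars_pairVars]
    congr 1
    funext k i
    simp only [permShift]
    rw [pairPerm_symm]
    congr 1
    rw [pairPerm]
    split_ifs <;> simp

theorem pairVars_comm (hd : PairsDisjoint u) (p q : SingPair u) (f : RatFun n) :
    pairVars p (pairVars q f) = pairVars q (pairVars p f) := by
  rcases eq_or_ne p q with rfl | hpq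
  · rfl
  have hcomm : pairSwap p * pairSwap q = pairSwap q * pairSwap p := by
    have h := Equiv.mul_swap_eq_swap_mul (pairSwap p) q.1.left q.1.right
    rw [pairSwap_left_of_ne hd hpq, pairSwap_right_of_ne hd hpq] at h
    exact h
  obtain ⟨a, b, hb, rfl⟩ := exists_eq_div f
  have h : ∀ a : MvPolynomial (Pos n) ℂ,
      pairVars p (pairVars q (polyFun a)) = pairVars q (pairVars p (polyFun a)) := by
    intro a
    simp only [pairVars, permVars_polyFun, MvPolynomial.rename_rename]
    rw [← Equiv.Perm.coe_mul, hcomm, Equiv.Perm.coe_mul]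
  simp only [map_div₀, h]

theorem pairPerm_comm (hd : PairsDisjoint u) {p q : SingPair u} (hpq : p ≠ q) (k i : ℕ) :
    pairPerm p k (pairPerm q k i) = pairPerm q k (pairPerm p k i) := by
  by_cases hk : k = q.1.1.1.val
  · have hl : pairPerm p k q.1.1.2.1.val = q.1.1.2.1.val := by
      obtain ⟨j, hj, hj'⟩ := pairSwap_mk p q.1.1.1 q.1.1.2.1
      have h := pairSwap_left_of_ne hd hpq
      rw [PosPair.left, hj] at h
      rw [hk, ← hj']
      exact congrArg Fin.val (eq_of_heq (Sigma.mk.inj h).2)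
    have hr : pairPerm p k q.1.1.2.2.val = q.1.1.2.2.val := by
      obtain ⟨j, hj, hj'⟩ := pairSwap_mk p q.1.1.1 q.1.1.2.2
      have h := pairSwap_right_of_ne hd hpq
      rw [PosPair.right, hj] at h
      rw [hk, ← hj']
      exact congrArg Fin.val (eq_of_heq (Sigma.mk.inj h).2)
    have h := Equiv.mul_swap_eq_swap_mul (pairPerm p k) q.1.1.2.1.val q.1.1.2.2.val
    rw [hl, hr] at h
    have hq : pairPerm q k = Equiv.swap q.1.1.2.1.val q.1.1.2.2.val := if_pos hk
    rw [← hq] at h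
    exact DFunLike.congr_fun h i
  · have hq : pairPerm q k = 1 := if_neg hk
    simp [hq]

theorem pairTwist_comm (hd : PairsDisjoint u) (p q : SingPair u) (y : GenSpace n) :
    pairTwist p (pairTwist q y) = pairTwist q (pairTwist p y) := by
  rcases eq_or_ne p q with rfl | hpq
  · rfl
  induction y using Finsupp.induction_linear with
  | zero => simp
  | add y y' h h' => simp only [map_add, h, h']
  | single z f =>
    simp only [pairTwist_single]
    rw [pairVars_comm hd]
    congr 1
    funext k i
    simp only [permShift, pairPerm_symm]
    rw [pairPerm_comm hd hpq]

variable (u) in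
/-- The combinations of tableaux `T(x + z)` whose coefficients have no pole at `u`. -/
noncomputable def regSub : Submodule ℂ (GenSpace n) :=
  Submodule.span ℂ {y | ∃ (z : intTab n) (f : RatFun n), f ∈ regularRing u ∧
    y = Finsupp.single (toShift z) f}

theorem single_mem_regSub (z : intTab n) {f : RatFun n} (hf : f ∈ regularRing u) :
    Finsupp.single (toShift z) f ∈ regSub u :=
  Submodule.subset_span ⟨z, f, hf, rfl⟩

theorem regSub_le {S : Submodule ℂ (GenSpace n)}
    (h : ∀ (z : intTab n) (f : RatFun n), f ∈ regularRing u →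
      Finsupp.single (toShift z) f ∈ S) : regSub u ≤ S := by
  refine Submodule.span_le.mpr ?_
  rintro _ ⟨z, f, hf, rfl⟩
  exact h z f hf

theorem apply_mem_regularRing {y : GenSpace n} (hy : y ∈ regSub u) (z : Shift) :
    y z ∈ regularRing u := by
  classical
  induction hy using Submodule.span_induction with
  | mem y hy =>
    obtain ⟨w, f, hf, rfl⟩ := hy
    rw [Finsupp.single_apply]
    split_ifs
    · exact hf
    · exact zero_mem _
  | zero => exact zero_mem _
  | add y y' _ _ h h' => exact add_mem h h'
  | smul c y _ h => exact Subalgebra.smul_mem _ h c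

theorem exists_toShift_of_ne_zero {y : GenSpace n} (hy : y ∈ regSub u) {z : Shift} (h : y z ≠ 0) :
    ∃ w : intTab n, z = toShift w := by
  classical
  by_contra hz
  refine h ?_
  clear h
  induction hy using Submodule.span_induction with
  | mem y hy =>
    obtain ⟨w, f, hf, rfl⟩ := hy
    rw [Finsupp.single_apply, if_neg fun h => hz ⟨w, h.symm⟩]
  | zero => rfl
  | add y y' _ _ h h' => rw [Finsupp.add_apply, h, h', add_zero]
  | smul c y _ h => rw [Finsupp.smul_apply, h, smul_zero]

theorem pairTwist_mem_regSub (hu : IsNormalized u) (p : SingPair u) {y : GenSpace n}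
    (hy : y ∈ regSub u) : pairTwist p y ∈ regSub u := by
  have h : regSub u ≤ (regSub u).comap (pairTwist p) := regSub_le fun z f hf => by
    rw [Submodule.mem_comap, pairTwist_toShift]
    exact single_mem_regSub _ (pairVars_regular hu p hf)
  exact h hy

variable (u) in
/-- The antisymmetric combinations of tableaux. -/
noncomputable def antiSub : Submodule ℂ (GenSpace n) where
  carrier := {y | y ∈ regSub u ∧ ∀ p : SingPair u, pairTwist p y = -y}
  zero_mem' := ⟨zero_mem _, fun p => by rw [map_zero, neg_zero]⟩
  add_mem' := fun h h' => ⟨add_mem h.1 h'.1, fun p => by rw [map_add, h.2, h'.2, neg_add]⟩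
  smul_mem' := fun c y h => ⟨Submodule.smul_mem _ c h.1, fun p => by rw [map_smul, h.2, smul_neg]⟩

/-- The function is invariant under the exchange of the variables of each singular pair. -/
def PairInvariant (u : Tab n ℂ) (f : RatFun n) : Prop := ∀ p : SingPair u, pairVars p f = f

/-- The composition of the antisymmetrizations with respect to the pairs of a list. -/
noncomputable def antisym : List (SingPair u) → GenSpace n →ₗ[ℂ] GenSpace n
  | [] => LinearMap.id
  | p :: l => ((1 / 2 : ℂ) • (LinearMap.id - pairTwist p)) ∘ₗ antisym l

theorem antisym_cons (p : SingPair u) (l : List (SingPair u)) (y : GenSpace n) :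
    antisym (p :: l) y = (1 / 2 : ℂ) • (antisym l y - pairTwist p (antisym l y)) := rfl

theorem pairTwist_antisym (hd : PairsDisjoint u) (q : SingPair u) (l : List (SingPair u))
    (y : GenSpace n) : pairTwist q (antisym l y) = antisym l (pairTwist q y) := by
  induction l with
  | nil => rfl
  | cons p l ih => rw [antisym_cons, antisym_cons, map_smul, map_sub, ih, pairTwist_comm hd, ih]

theorem antisym_pairTwist (hd : PairsDisjoint u) {q : SingPair u} {l : List (SingPair u)}
    (hq : q ∈ l) (y : GenSpace n) : antisym l (pairTwist q y) = -antisym l y := by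
  induction l with
  | nil => simp at hq
  | cons p l ih =>
    rw [antisym_cons, antisym_cons]
    by_cases h : q ∈ l
    · rw [ih h, map_neg, ← smul_neg, neg_sub, sub_neg_eq_add, neg_add_eq_sub]
    · obtain rfl : q = p := (List.mem_cons.mp hq).resolve_right h
      rw [← pairTwist_antisym hd, pairTwist_pairTwist, ← smul_neg, neg_sub]

theorem antisym_of_anti {y : GenSpace n} (hy : ∀ p : SingPair u, pairTwist p y = -y)
    (l : List (SingPair u)) : antisym l y = y := by
  induction l with
  | nil => rfl
  | cons p l ih =>
    rw [antisym_cons, ih, hy p, sub_neg_eq_add, smul_add, ← add_smul]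
    norm_num

theorem antisym_mem_regSub (hu : IsNormalized u) (l : List (SingPair u)) {y : GenSpace n}
    (hy : y ∈ regSub u) : antisym l y ∈ regSub u := by
  induction l with
  | nil => exact hy
  | cons p l ih => exact Submodule.smul_mem _ _ (sub_mem ih (pairTwist_mem_regSub hu p ih))

theorem antisym_smul {f : RatFun n} (hf : PairInvariant u f) (l : List (SingPair u))
    (y : GenSpace n) : antisym l (f • y) = f • antisym l y := by
  induction l with
  | nil => rfl
  | cons p l ih => rw [antisym_cons, antisym_cons, ih, pairTwist_smul, hf p, ← smul_sub, smul_comm]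

variable (u) in
/-- The antisymmetrization with respect to all singular pairs. -/
noncomputable def antisymAll : GenSpace n →ₗ[ℂ] GenSpace n := antisym (univ : Finset (SingPair u)).toList

theorem antisymAll_pairTwist (hd : PairsDisjoint u) (p : SingPair u) (y : GenSpace n) :
    antisymAll u (pairTwist p y) = -antisymAll u y :=
  antisym_pairTwist hd (mem_toList.mpr (mem_univ p)) y

theorem antisymAll_mem_antiSub (hu : IsNormalized u) (hd : PairsDisjoint u) {y : GenSpace n}
    (hy : y ∈ regSub u) : antisymAll u y ∈ antiSub u :=
  ⟨antisym_mem_regSub hu _ hy, fun p => by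
    rw [antisymAll, pairTwist_antisym hd]; exact antisymAll_pairTwist hd p y⟩

/-! ### Evaluation of antisymmetric families -/

/-- The extension to functions with poles is arbitrary. It only serves to have a linear evaluation
on all families; it is used on regular coefficients alone. -/
theorem exists_valueLin (u : Tab n ℂ) : ∃ g : RatFun n →ₗ[ℂ] ℂ,
    ∀ f ∈ regularRing u, g f = valueAt u f := by
  obtain ⟨g, hg⟩ := LinearMap.exists_extend (p := Subalgebra.toSubmodule (regularRing u))
    (valueHom u).toLinearMap
  exact ⟨g, fun f hf => DFunLike.congr_fun hg ⟨f, hf⟩⟩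

/-- A linear extension of the evaluation at `u` to all rational functions. -/
noncomputable def valueLin (u : Tab n ℂ) : RatFun n →ₗ[ℂ] ℂ := (exists_valueLin u).choose

theorem valueLin_eq {f : RatFun n} (hf : f ∈ regularRing u) : valueLin u f = valueAt u f :=
  (exists_valueLin u).choose_spec f hf

/-- The integral tableau with the entries of a shift. -/
def ofShift (n : ℕ) (z : Shift) : intTab n :=
  ⟨fun p => if p.1.val + 1 = n then 0 else z p.1.val p.2.val, fun p hp => by simp [hp]⟩

theorem ofShift_toShift (z : intTab n) : ofShift n (toShift z) = z := by
  refine Subtype.ext (funext fun p => ?_)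
  simp only [ofShift]
  split_ifs with h
  · exact (z.2 p h).symm
  · exact toShift_pos z p

variable (u) in
/-- The evaluation `f T(x + z) ↦ 𝒟_Σ^u (f T(x + z))`. -/
noncomputable def thetaMap : GenSpace n →ₗ[ℂ] DerivSpace u :=
  Finsupp.lsum ℂ fun z => ∑ J ∈ (univ : Finset (SingPair u)).powerset,
    ((valueLin u).comp (diffOpLin (univ \ J))).smulRight (derivTab u J (ofShift n z))

theorem thetaMap_single (z : intTab n) {f : RatFun n} (hf : f ∈ regularRing u) :
    thetaMap u (Finsupp.single (toShift z) f) = derivEval u univ f z := by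
  rw [thetaMap, Finsupp.lsum_single, LinearMap.sum_apply, derivEval]
  refine sum_congr rfl fun J _ => ?_
  rw [ofShift_toShift, LinearMap.smulRight_apply]
  congr 1
  exact valueLin_eq (diffOp_mem_regularRing _ hf)

theorem derivTab_swapPair (I : Finset (SingPair u)) (p : SingPair u) (z : intTab n) :
    derivTab u I (permInt (swapPair p) z) = (if p ∈ I then (-1 : ℂ) else 1) • derivTab u I z := by
  rw [← sub_eq_zero, derivTab, derivTab, ← map_smul, ← map_sub]
  exact (Submodule.Quotient.mk_eq_zero _).mpr (Submodule.subset_span ⟨I, z, p, rfl⟩)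

theorem valueAt_smul (c : ℂ) {f : RatFun n} (hf : f ∈ regularRing u) :
    valueAt u (c • f) = c * valueAt u f := by
  rw [Algebra.smul_def, valueAt_mul (Subalgebra.algebraMap_mem _ _) hf, valueAt_algebraMap]

/-- In the term of `J` the pair `p` lies in exactly one of `J` and its complement: it contributes a
sign either through the relation of `𝒟_J T` or through the derivatives along the complement. -/
theorem thetaMap_pairTwist (hu : IsNormalized u) (hd : PairsDisjoint u) (p : SingPair u)
    {y : GenSpace n} (hy : y ∈ regSub u) : thetaMap u (pairTwist p y) = -thetaMap u y := by
  have h : regSub u ≤ LinearMap.ker (thetaMap u ∘ₗ pairTwist p + thetaMap u) :=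
    regSub_le fun z f hf => by
      rw [LinearMap.mem_ker, LinearMap.add_apply, LinearMap.comp_apply, pairTwist_toShift,
        thetaMap_single _ (pairVars_regular hu p hf), thetaMap_single _ hf, derivEval, derivEval,
        ← sum_add_distrib]
      refine sum_eq_zero fun J _ => ?_
      have hreg := diffOp_mem_regularRing (univ \ J) hf
      rw [diffOp_pairVars hd, derivTab_swapPair, valueAt_smul _ (pairVars_regular hu p hreg),
        valueAt_pairVars hu p hreg, smul_smul, ← add_smul]
      by_cases hJ : p ∈ J
      · simp [hJ]
      · simp [hJ]
  exact eq_neg_of_add_eq_zero_left (h hy)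

theorem thetaMap_antisymAll (hu : IsNormalized u) (hd : PairsDisjoint u) {y : GenSpace n}
    (hy : y ∈ regSub u) : thetaMap u (antisymAll u y) = thetaMap u y := by
  have h : ∀ l : List (SingPair u), thetaMap u (antisym l y) = thetaMap u y := by
    intro l
    induction l with
    | nil => rfl
    | cons p l ih =>
      rw [antisym_cons, map_smul, map_sub, thetaMap_pairTwist hu hd p (antisym_mem_regSub hu l hy),
        ih, sub_neg_eq_add, smul_add, ← add_smul]
      norm_num
  exact h _

theorem thetaMap_smul (hu : IsNormalized u) (hd : PairsDisjoint u) {f : RatFun n}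
    (hf : f ∈ regularRing u) (hinv : PairInvariant u f) {y : GenSpace n} (hy : y ∈ regSub u) :
    thetaMap u (f • y) = valueAt u f • thetaMap u y := by
  induction hy using Submodule.span_induction with
  | mem y hy =>
    obtain ⟨z, g, hg, rfl⟩ := hy
    rw [Finsupp.smul_single, smul_eq_mul, thetaMap_single _ (mul_mem hf hg), thetaMap_single _ hg,
      derivEval, derivEval, smul_sum]
    refine sum_congr rfl fun J _ => ?_
    rw [valueAt_diffOp_invariant_mul hu hd _ hf (fun p _ => hinv p) hg, mul_smul]
  | zero => simp
  | add y y' _ _ h h' => rw [smul_add, map_add, h, h', map_add, smul_add]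
  | smul c y _ h => rw [smul_comm, map_smul, h, map_smul, smul_comm]

/-- The antisymmetric family with the value `𝒟_I T(u + z)`. -/
noncomputable def xiTab (u : Tab n ℂ) (I : Finset (SingPair u)) (z : intTab n) : GenSpace n :=
  antisymAll u (Finsupp.single (toShift z) (pairProd (univ \ I)))

/-- Antisymmetrisation gives the sign `-1` for every `p`, and `P_{Σ \ I}` cancels it for `p ∉ I`.
These are the defining relations of the derivative tableaux, so the lift is well defined. -/
theorem xiTab_swapPair (hd : PairsDisjoint u) (I : Finset (SingPair u)) (p : SingPair u)
    (z : intTab n) : xiTab u I (permInt (swapPair p) z) =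
      (if p ∈ I then (-1 : ℂ) else 1) • xiTab u I z := by
  have h1 := antisymAll_pairTwist hd p (Finsupp.single (toShift z) (pairProd (univ \ I)))
  rw [pairTwist_toShift, pairVars_pairProd hd] at h1
  by_cases hp : p ∈ I
  · rw [if_neg (by simp [hp])] at h1
    rw [if_pos hp, neg_one_smul]
    exact h1
  · rw [if_pos (by simp [hp]), Finsupp.single_neg, map_neg, neg_inj] at h1
    rw [if_neg hp, one_smul]
    exact h1

theorem tabRelations_le_ker (hd : PairsDisjoint u) : tabRelations u ≤
    LinearMap.ker (Finsupp.linearCombination ℂ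
      fun q : Finset (SingPair u) × intTab n => xiTab u q.1 q.2) := by
  refine Submodule.span_le.mpr ?_
  rintro _ ⟨I, z, p, rfl⟩
  rw [SetLike.mem_coe, LinearMap.mem_ker, map_sub, map_smul, Finsupp.linearCombination_single,
    Finsupp.linearCombination_single, one_smul, one_smul, xiTab_swapPair hd, sub_self]

/-- The lifting of derivative tableaux to antisymmetric families. -/
noncomputable def xiMap (hd : PairsDisjoint u) : DerivSpace u →ₗ[ℂ] GenSpace n :=
  (tabRelations u).liftQ (Finsupp.linearCombination ℂ fun q => xiTab u q.1 q.2)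
    (tabRelations_le_ker hd)

theorem xiMap_derivTab (hd : PairsDisjoint u) (I : Finset (SingPair u)) (z : intTab n) :
    xiMap hd (derivTab u I z) = xiTab u I z := by
  rw [xiMap, derivTab, Submodule.mkQ_apply, Submodule.liftQ_apply,
    Finsupp.linearCombination_single, one_smul]

theorem xiTab_mem_antiSub (hu : IsNormalized u) (hd : PairsDisjoint u) (I : Finset (SingPair u))
    (z : intTab n) : xiTab u I z ∈ antiSub u :=
  antisymAll_mem_antiSub hu hd (single_mem_regSub z (pairProd_mem_regularRing _))

theorem derivSpace_induction {S : Submodule ℂ (DerivSpace u)}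
    (h : ∀ (I : Finset (SingPair u)) (z : intTab n), derivTab u I z ∈ S) (d : DerivSpace u) :
    d ∈ S := by
  obtain ⟨y, rfl⟩ := Submodule.mkQ_surjective _ d
  induction y using Finsupp.induction_linear with
  | zero => rw [map_zero]; exact zero_mem _
  | add y y' hy hy' => rw [map_add]; exact add_mem hy hy'
  | single q c =>
    have h1 := S.smul_mem c (h q.1 q.2)
    rw [derivTab, ← map_smul, Finsupp.smul_single, smul_eq_mul, mul_one] at h1
    exact h1

theorem xiMap_mem_antiSub (hu : IsNormalized u) (hd : PairsDisjoint u) (d : DerivSpace u) :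
    xiMap hd d ∈ antiSub u :=
  derivSpace_induction (S := (antiSub u).comap (xiMap hd)) (fun I z => by
    rw [Submodule.mem_comap, xiMap_derivTab]
    exact xiTab_mem_antiSub hu hd I z) d

/-- Evaluation of a family of the form `P_{Σ \ I}(x) f T(x + z)`. -/
theorem derivEval_pairProd_mul (hu : IsNormalized u) (hd : PairsDisjoint u)
    (I : Finset (SingPair u)) (z : intTab n) {f : RatFun n} (hf : f ∈ regularRing u) :
    derivEval u univ (pairProd (univ \ I) * f) z =
      ∑ J ∈ I.powerset, valueAt u (diffOp (I \ J) f) • derivTab u J z := by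
  rw [derivEval]
  refine (sum_subset (powerset_mono.mpr (subset_univ I)) fun J _ hJ => ?_).symm.trans
    (sum_congr rfl fun J hJ => ?_)
  · rw [valueAt_diffOp_pairProd_mul hu hd _ _ hf, if_neg, zero_smul]
    intro h
    refine hJ (mem_powerset.mpr fun p hp => ?_)
    by_contra hI
    exact (mem_sdiff.mp (h (mem_sdiff.mpr ⟨mem_univ p, hI⟩))).2 hp
  · have hJ := mem_powerset.mp hJ
    rw [valueAt_diffOp_pairProd_mul hu hd _ _ hf, if_pos (sdiff_subset_sdiff le_rfl hJ)]
    congr 3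
    ext p
    simp only [mem_sdiff, mem_univ, true_and]
    tauto

theorem valueAt_diffOp_one (A : Finset (SingPair u)) :
    valueAt u (diffOp A (1 : RatFun n)) = if A = ∅ then 1 else 0 := by
  have h1 : valueAt u (1 : RatFun n) = 1 := by simpa using valueAt_algebraMap u 1
  split_ifs with h
  · rw [h, diffOp_empty, h1]
  · obtain ⟨p, hp⟩ := nonempty_iff_ne_empty.mpr h
    have h2 : halfDiff p (1 : RatFun n) = 0 := by simpa using halfDiff_algebraMap p 1
    have h3 : diffOp (A.erase p) (0 : RatFun n) = 0 := map_zero (diffOpLin (A.erase p))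
    rw [← insert_erase hp, diffOp_insert' (notMem_erase p A), h2, h3, valueAt_zero]

/-- The factor `P_{Σ \ I}` absorbs exactly the derivatives along `Σ \ I`; the remaining ones are
applied to the constant 1, and only the term `J = I` is left. -/
theorem thetaMap_xiMap (hu : IsNormalized u) (hd : PairsDisjoint u) (d : DerivSpace u) :
    thetaMap u (xiMap hd d) = d := by
  have key : d ∈ LinearMap.ker (thetaMap u ∘ₗ xiMap hd - LinearMap.id) := by
    refine derivSpace_induction (fun I z => ?_) d
    rw [LinearMap.mem_ker, LinearMap.sub_apply, LinearMap.comp_apply, LinearMap.id_apply,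
      xiMap_derivTab, xiTab, thetaMap_antisymAll hu hd
        (single_mem_regSub z (pairProd_mem_regularRing _)),
      thetaMap_single z (pairProd_mem_regularRing _), sub_eq_zero]
    have h := derivEval_pairProd_mul hu hd I z (one_mem (regularRing u))
    rw [mul_one] at h
    rw [h, sum_eq_single I]
    · rw [Finset.sdiff_self, valueAt_diffOp_one, if_pos rfl, one_smul]
    · intro J hJ hne
      rw [valueAt_diffOp_one, if_neg, zero_smul]
      intro h0
      exact hne ((mem_powerset.mp hJ).antisymm (sdiff_eq_empty_iff_subset.mp h0))
    · intro h
      exact absurd (mem_powerset_self I) h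
  exact sub_eq_zero.mp (LinearMap.mem_ker.mp key)

variable (u) in
/-- The antisymmetric families that vanish at `u`. -/
noncomputable def nullSub : Submodule ℂ (GenSpace n) :=
  Submodule.span ℂ {y | ∃ (f : RatFun n) (y' : GenSpace n), f ∈ regularRing u ∧
    PairInvariant u f ∧ valueAt u f = 0 ∧ y' ∈ antiSub u ∧ y = f • y'}

theorem thetaMap_eq_zero (hu : IsNormalized u) (hd : PairsDisjoint u) {y : GenSpace n}
    (hy : y ∈ nullSub u) : thetaMap u y = 0 := by
  have h : nullSub u ≤ LinearMap.ker (thetaMap u) := by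
    refine Submodule.span_le.mpr ?_
    rintro _ ⟨f, y, hf, hinv, h0, hy, rfl⟩
    rw [SetLike.mem_coe, LinearMap.mem_ker, thetaMap_smul hu hd hf hinv hy.1, h0, zero_smul]
  exact h hy

/-- `S` contains the pairs whose exchange may still change `f`. For such a pair write `f = g +
(x_{ki} - x_{kj}) h` with `g` and `h` invariant under it, and move the difference into the product
over `A`. When `f` is invariant it can be pulled out of the antisymmetrisation, and `f = f(u) + (f -
f(u))` separates the lift from the families that vanish at `u`. -/
theorem antisymAll_single_mem (hu : IsNormalized u) (hd : PairsDisjoint u) (z : intTab n)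
    (S : Finset (SingPair u)) : ∀ (A : Finset (SingPair u)) (f : RatFun n), Disjoint A S →
      f ∈ regularRing u → (∀ q, q ∉ S → pairVars q f = f) →
      antisymAll u (Finsupp.single (toShift z) (f * pairProd A)) ∈
        LinearMap.range (xiMap hd) ⊔ nullSub u := by
  induction S using Finset.induction_on with
  | empty =>
    intro A f _ hf hinv
    have hinv' : PairInvariant u f := fun q => hinv q (notMem_empty q)
    have h1 : antisymAll u (Finsupp.single (toShift z) (f * pairProd A)) =
        f • xiTab u (univ \ A) z := by
      rw [← smul_eq_mul, ← Finsupp.smul_single, antisymAll, antisym_smul hinv', xiTab,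
        Finset.sdiff_sdiff_eq_self (subset_univ A), antisymAll]
    set c := algebraMap ℂ (RatFun n) (valueAt u f) with hc
    have hcr : c ∈ regularRing u := Subalgebra.algebraMap_mem _ _
    have h2 : f • xiTab u (univ \ A) z =
        valueAt u f • xiTab u (univ \ A) z + (f - c) • xiTab u (univ \ A) z := by
      rw [← algebraMap_smul (RatFun n) (valueAt u f), ← hc, sub_smul, add_sub_cancel]
    rw [h1, h2]
    refine Submodule.add_mem_sup ?_ (Submodule.subset_span ⟨f - c, _, sub_mem hf hcr,
      fun p => ?_, ?_, xiTab_mem_antiSub hu hd (univ \ A) z, rfl⟩)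
    · exact Submodule.smul_mem _ _ ⟨derivTab u (univ \ A) z, xiMap_derivTab hd _ _⟩
    · rw [map_sub, hinv' p, hc, pairVars, permVars_algebraMap]
    · rw [valueAt_sub hf hcr, hc, valueAt_algebraMap, sub_self]
  | insert p S hp ih =>
    intro A f hA hf hinv
    have hpA : p ∉ A := fun h => disjoint_left.mp hA h (mem_insert_self p S)
    have hne := pairDiff_ne_zero p
    have hpf := pairVars_regular hu p hf
    set g := (1 / 2 : ℂ) • (f + pairVars p f) with hg
    set h := (1 / 2 : ℂ) • ((f - pairVars p f) / pairDiff p) with hh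
    have hgr : g ∈ regularRing u := Subalgebra.smul_mem _ (add_mem hf hpf) _
    have hhr : h ∈ regularRing u :=
      Subalgebra.smul_mem _ (sub_permVars_div_mem_regularRing (hu p) hf) _
    have hsum : f * pairProd A = g * pairProd A + h * pairProd (insert p A) := by
      rw [pairProd_insert hpA, hg, hh, ← mul_assoc, smul_mul_assoc _ _ (pairDiff p),
        div_mul_cancel₀ _ hne, ← add_mul, ← smul_add, add_add_sub_cancel, ← two_smul ℂ f, smul_smul]
      norm_num
    have hginv : ∀ q, q ∉ S → pairVars q g = g := by
      intro q hq
      rw [hg, pairVars, permVars_smul, ← pairVars, map_add]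
      rcases eq_or_ne q p with rfl | hqp
      · rw [pairVars_pairVars, add_comm]
      · rw [pairVars_comm hd, hinv q (by simp [hqp, hq])]
    have hhinv : ∀ q, q ∉ S → pairVars q h = h := by
      intro q hq
      rw [hh, pairVars, permVars_smul, ← pairVars, map_div₀, map_sub]
      rcases eq_or_ne q p with rfl | hqp
      · rw [pairVars_pairVars, pairVars_pairDiff_self]
        congr 1
        rw [div_eq_div_iff (neg_ne_zero.mpr hne) hne]
        ring
      · rw [pairVars_comm hd, hinv q (by simp [hqp, hq]), pairVars_pairDiff_of_ne hd hqp]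
    rw [hsum, Finsupp.single_add, map_add]
    refine add_mem (ih A g (hA.mono_right (subset_insert p S)) hgr hginv)
      (ih (insert p A) h ?_ hhr hhinv)
    rw [disjoint_insert_left]
    exact ⟨hp, hA.mono_right (subset_insert p S)⟩

/-- An antisymmetric family is its own antisymmetrisation, hence a lift plus a vanishing family. As
`thetaMap` kills the latter and inverts the lift, it determines the first summand: the kernel of
`thetaMap` on antisymmetric families is `nullSub`. -/
theorem sub_xiMap_thetaMap_mem (hu : IsNormalized u) (hd : PairsDisjoint u) {y : GenSpace n}
    (hy : y ∈ antiSub u) : y - xiMap hd (thetaMap u y) ∈ nullSub u := by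
  have h1 : regSub u ≤ (LinearMap.range (xiMap hd) ⊔ nullSub u).comap (antisymAll u) :=
    regSub_le fun z f hf => by
      have h := antisymAll_single_mem hu hd z univ ∅ f (disjoint_empty_left _) hf
        fun q hq => absurd (mem_univ q) hq
      rwa [pairProd_empty, mul_one] at h
  have h2 := h1 hy.1
  rw [Submodule.mem_comap, antisymAll, antisym_of_anti hy.2] at h2
  obtain ⟨_, ⟨d, rfl⟩, m, hm, rfl⟩ := Submodule.mem_sup.mp h2
  rw [map_add, thetaMap_xiMap hu hd, thetaMap_eq_zero hu hd hm, add_zero, add_sub_cancel_left]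
  exact hm

end AntiSymmetric

end GelfandTsetlin

namespace GelfandTsetlin

/-! ### The representation on derivative tableaux -/

section Representation

open Finset

variable {n : ℕ} {u : Tab n ℂ}

theorem twist_apply {K : Type*} [Field K] (θ : K ≃+* K) (π : ℕ → Equiv.Perm ℕ) (y : Shift →₀ K)
    (z : Shift) : twist θ π y (permShift π z) = θ (y z) := by
  have hinj : Function.Injective (permShift π) := by
    intro z z' h
    funext k i
    have := congrFun (congrFun h k) (π k i)
    simpa [permShift] using this
  change Finsupp.mapDomain (permShift π) (Finsupp.mapRange.addMonoidHom (θ : K →+ K) y)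
    (permShift π z) = _
  rw [Finsupp.mapDomain_apply hinj]
  rfl

theorem permInt_swapPair_of_eq {p : SingPair u} {z : intTab n}
    (h : z.1 p.1.left = z.1 p.1.right) : permInt (swapPair p) z = z := by
  refine Subtype.ext (funext fun q => ?_)
  rw [permInt_swapPair, pairSwap, Equiv.swap_apply_def]
  split_ifs with h1 h2
  · rw [h1, h]
  · rw [h2, h]
  · rfl

/-- For odd `f` one has `f - τ f = 2 f`, which is divisible by the difference of the variables. The
quotient stays odd for the other pairs, because they are disjoint from this one. -/
theorem exists_eq_pairProd_mul (hu : IsNormalized u) (hd : PairsDisjoint u)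
    (S : Finset (SingPair u)) : ∀ f ∈ regularRing u, (∀ p ∈ S, pairVars p f = -f) →
      ∃ g ∈ regularRing u, f = pairProd S * g := by
  induction S using Finset.induction_on with
  | empty => exact fun f hf _ => ⟨f, hf, by rw [pairProd_empty, one_mul]⟩
  | insert p S hp ih =>
    intro f hf hodd
    have hne := pairDiff_ne_zero p
    have h1 : f / pairDiff p ∈ regularRing u := by
      have h := Subalgebra.smul_mem _ (sub_permVars_div_mem_regularRing (hu p) hf) (1 / 2 : ℂ)
      have h2 : permVars (Equiv.swap p.1.left p.1.right) f = -f := hodd p (mem_insert_self p S)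
      rw [h2, sub_neg_eq_add, ← two_smul ℂ f, smul_div_assoc, smul_smul] at h
      norm_num at h
      exact h
    obtain ⟨g, hg, hfg⟩ := ih _ h1 fun q hq => by
      have hqp : q ≠ p := fun h => hp (h ▸ hq)
      rw [map_div₀, hodd q (mem_insert_of_mem hq), pairVars_pairDiff_of_ne hd hqp]
      ring
    refine ⟨g, hg, ?_⟩
    rw [pairProd_insert hp, mul_assoc, ← hfg, mul_div_cancel₀ _ hne]

/-- If `z` has equal entries on `p`, the exchange fixes the tableau, so antisymmetry makes the
coefficient itself odd. -/
theorem exists_eq_pairProd_equalPairs_mul (hu : IsNormalized u) (hd : PairsDisjoint u)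
    {y : GenSpace n} (hy : y ∈ antiSub u) (z : intTab n) :
    ∃ g ∈ regularRing u, y (toShift z) = pairProd (equalPairs u z) * g := by
  refine exists_eq_pairProd_mul hu hd _ _ (apply_mem_regularRing hy.1 _) fun p hp => ?_
  have h1 := twist_apply (pairVars p) (pairPerm p) y (toShift z)
  rw [permShift_toShift, permInt_swapPair_of_eq (mem_equalPairs.mp hp)] at h1
  rw [← h1]
  change pairTwist p y (toShift z) = _
  rw [hy.2 p]
  rfl

/-- The point where the poles disappear: the coefficient at `T(x + z)` already contains the product
that cancels the poles of `e_{rs}(x + z)`. Antisymmetry is preserved because the action commutes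
with the exchanges. -/
theorem genE_mem_antiSub (hu : IsNormalized u) (hd : PairsDisjoint u) (r s : Fin n)
    {y : GenSpace n} (hy : y ∈ antiSub u) :
    (genE (extTab n) r.val s.val).toEnd y ∈ antiSub u := by
  refine ⟨?_, fun p => ?_⟩
  · rw [← Finsupp.sum_single y, Finsupp.sum, map_sum]
    refine sum_mem fun z hz => ?_
    obtain ⟨w, rfl⟩ := exists_toShift_of_ne_zero hy.1 (Finsupp.mem_support_iff.mp hz)
    obtain ⟨g, hg, hyg⟩ := exists_eq_pairProd_equalPairs_mul hu hd hy w
    rw [hyg, genE_single]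
    refine sum_mem fun σ hσ => single_mem_regSub _ ?_
    rw [mul_right_comm]
    exact mul_mem (pairProd_mul_coeffE hu hd w hσ) hg
  · have h := twistCommutes_genE (x := extTab n) (pairPerm_lt_iff p) (pairVars_extTab p) r.val s.val y
    change pairTwist p _ = (genE (extTab n) r.val s.val).toEnd (pairTwist p y) at h
    rw [h, hy.2 p, map_neg]

variable (u) in
/-- The operators that are linear over the rational functions, preserve the antisymmetric
families and commute with the twists. -/
noncomputable def stableAlg : Subalgebra ℂ (Module.End ℂ (GenSpace n)) where
  carrier := {a | (∀ (f : RatFun n) (y : GenSpace n), a (f • y) = f • a y) ∧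
    (∀ y ∈ antiSub u, a y ∈ antiSub u) ∧
    ∀ (p : SingPair u) (y : GenSpace n), pairTwist p (a y) = a (pairTwist p y)}
  mul_mem' := fun {a b} ha hb => ⟨fun f y => by
      rw [Module.End.mul_apply, hb.1, ha.1, Module.End.mul_apply],
    fun y hy => ha.2.1 _ (hb.2.1 _ hy),
    fun p y => by rw [Module.End.mul_apply, ha.2.2, hb.2.2, Module.End.mul_apply]⟩
  add_mem' := fun {a b} ha hb => ⟨fun f y => by
      rw [LinearMap.add_apply, ha.1, hb.1, LinearMap.add_apply, smul_add],
    fun y hy => add_mem (ha.2.1 _ hy) (hb.2.1 _ hy),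
    fun p y => by rw [LinearMap.add_apply, map_add, ha.2.2, hb.2.2, LinearMap.add_apply]⟩
  algebraMap_mem' := fun c => ⟨fun f y => by
      rw [Module.algebraMap_end_apply, Module.algebraMap_end_apply, smul_comm],
    fun y hy => Submodule.smul_mem _ c hy,
    fun p y => by rw [Module.algebraMap_end_apply, Module.algebraMap_end_apply, map_smul]⟩

noncomputable instance : Ring (stableAlg u) :=
  Subalgebra.toRing (A := Module.End ℂ (GenSpace n)) (stableAlg u)

theorem apply_mem_nullSub {a : Module.End ℂ (GenSpace n)} (ha : a ∈ stableAlg u) {y : GenSpace n}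
    (hy : y ∈ nullSub u) : a y ∈ nullSub u := by
  have h : nullSub u ≤ (nullSub u).comap a := by
    refine Submodule.span_le.mpr ?_
    rintro _ ⟨f, y, hf, hinv, h0, hy, rfl⟩
    exact Submodule.subset_span ⟨f, a y, hf, hinv, h0, ha.2.1 y hy, ha.1 f y⟩
  exact h hy

/-- The action of stable operators on derivative tableaux. -/
noncomputable def stableHom (hu : IsNormalized u) (hd : PairsDisjoint u) :
    stableAlg u →ₐ[ℂ] Module.End ℂ (DerivSpace u) :=
  AlgHom.ofLinearMap
    { toFun := fun a => thetaMap u ∘ₗ a.1 ∘ₗ xiMap hd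
      map_add' := fun a b => LinearMap.ext fun d => map_add (thetaMap u) _ _
      map_smul' := fun c a => LinearMap.ext fun d => map_smul (thetaMap u) _ _ }
    (LinearMap.ext fun d => thetaMap_xiMap hu hd d)
    (fun a b => LinearMap.ext fun d => by
      -- Lifting again after applying `b` changes the family only by an element of `nullSub`, which
      -- `a` preserves and `thetaMap` kills; hence the assignment is multiplicative.
      have h1 := sub_xiMap_thetaMap_mem hu hd (b.2.2.1 _ (xiMap_mem_antiSub hu hd d))
      have h2 := thetaMap_eq_zero hu hd (apply_mem_nullSub a.2 h1)
      rw [map_sub, map_sub, sub_eq_zero] at h2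
      exact h2)

theorem stableHom_apply (hu : IsNormalized u) (hd : PairsDisjoint u) (a : stableAlg u)
    (d : DerivSpace u) : stableHom hu hd a d = thetaMap u (a.1 (xiMap hd d)) := rfl

/-- The linear map on matrices with given values on the matrix units. -/
noncomputable def glLin {A : Type*} [Ring A] [Algebra ℂ A] (R : Fin n → Fin n → A) :
    LieGL n →ₗ[ℂ] A where
  toFun M := ∑ i, ∑ j, M i j • R i j
  map_add' M N := by simp only [Matrix.add_apply, add_smul, sum_add_distrib]
  map_smul' c M := by simp only [Matrix.smul_apply, smul_eq_mul, mul_smul, smul_sum, RingHom.id_apply]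

theorem glLin_single {A : Type*} [Ring A] [Algebra ℂ A] (R : Fin n → Fin n → A) (i j : Fin n)
    (c : ℂ) : glLin R (Matrix.single i j c) = c • R i j := by
  change ∑ k, ∑ l, Matrix.single i j c k l • R k l = _
  rw [sum_eq_single i, sum_eq_single j]
  · rw [Matrix.single_apply_same]
  · intro l _ hl
    rw [Matrix.single_apply_of_ne _ _ _ _ _ (by simp [hl.symm]), zero_smul]
  · simp
  · intro k _ hk
    refine sum_eq_zero fun l _ => ?_
    rw [Matrix.single_apply_of_ne _ _ _ _ _ (by simp [hk.symm]), zero_smul]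
  · simp

theorem glLin_mul_sub {A : Type*} [Ring A] [Algebra ℂ A] {R : Fin n → Fin n → A}
    (h : ∀ i j k l, R i j * R k l - R k l * R i j =
      (if j = k then R i l else 0) - if i = l then R k j else 0) (M N : LieGL n) :
    glLin R (M * N - N * M) = glLin R M * glLin R N - glLin R N * glLin R M := by
  induction M using Matrix.induction_on' with
  | h_zero => simp
  | h_add M M' hM hM' =>
    rw [map_add, add_mul, mul_add, add_sub_add_comm, map_add, hM, hM', add_mul, mul_add,
      add_sub_add_comm]
  | h_std_basis i j a =>
    induction N using Matrix.induction_on' with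
    | h_zero => simp
    | h_add N N' hN hN' =>
      rw [map_add, mul_add, add_mul, add_sub_add_comm, map_add, hN, hN', mul_add, add_mul,
        add_sub_add_comm]
    | h_std_basis k l b =>
      have key : ∀ (i j k l : Fin n) (a b : ℂ),
          glLin R (Matrix.single i j a * Matrix.single k l b) =
            (a * b) • if j = k then R i l else 0 := by
        intro i j k l a b
        split_ifs with hjk
        · subst hjk
          rw [Matrix.single_mul_single_same, glLin_single]
        · rw [Matrix.single_mul_single_of_ne _ _ _ _ hjk, map_zero, smul_zero]
      rw [map_sub, key, key, glLin_single, glLin_single, smul_mul_smul_comm, smul_mul_smul_comm,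
        mul_comm b a, ← smul_sub, ← smul_sub, h]
      simp only [eq_comm]

/-- The Lie algebra homomorphism given by elements that satisfy the relations of the matrix
units. -/
noncomputable def glHom {A : Type*} [Ring A] [Algebra ℂ A] (R : Fin n → Fin n → A)
    (h : ∀ i j k l, R i j * R k l - R k l * R i j =
      (if j = k then R i l else 0) - if i = l then R k j else 0) : LieGL n →ₗ⁅ℂ⁆ A :=
  { glLin R with
    map_lie' := fun {M N} => by
      rw [Ring.lie_def, Ring.lie_def]
      exact glLin_mul_sub h M N }

theorem glHom_matUnit {A : Type*} [Ring A] [Algebra ℂ A] (R : Fin n → Fin n → A)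
    (h : ∀ i j k l, R i j * R k l - R k l * R i j =
      (if j = k then R i l else 0) - if i = l then R k j else 0) (i j : Fin n) :
    glHom R h (matUnit i j) = R i j :=
  (glLin_single R i j 1).trans (one_smul ℂ _)

/-- The generic matrix units as stable operators. -/
noncomputable def stableUnit (hu : IsNormalized u) (hd : PairsDisjoint u) (r s : Fin n) :
    stableAlg u :=
  ⟨(genE (extTab n) r.val s.val).toEnd.restrictScalars ℂ,
    fun f y => map_smul (genE (extTab n) r.val s.val).toEnd f y,
    fun _ hy => genE_mem_antiSub hu hd r s hy,
    fun p y => twistCommutes_genE (x := extTab n) (pairPerm_lt_iff p) (pairVars_extTab p) r.val s.val y⟩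

theorem stableUnit_apply (hu : IsNormalized u) (hd : PairsDisjoint u) (r s : Fin n)
    (y : GenSpace n) :
    (stableUnit hu hd r s).1 y = (genE (extTab n) r.val s.val).toEnd y := rfl

theorem stableUnit_lie (hu : IsNormalized u) (hd : PairsDisjoint u) (i j k l : Fin n) :
    stableUnit hu hd i j * stableUnit hu hd k l - stableUnit hu hd k l * stableUnit hu hd i j =
      (if j = k then stableUnit hu hd i l else 0) - if i = l then stableUnit hu hd k j else 0 := by
  refine Subtype.ext (LinearMap.ext fun y => ?_)
  have h := genE_lie (isGenericTab_extTab n) i.val j.val k.val l.val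
  have h1 := congrArg (fun a : OpAlg (RatFun n) => a.toEnd y) h
  simp only [map_sub, map_mul] at h1
  refine Eq.trans h1 ?_
  simp only [← Fin.ext_iff]
  split_ifs <;> simp [stableUnit_apply, map_zero] <;> rfl

/-- The action of the enveloping algebra on the generic tableaux. -/
noncomputable def stableAct (hu : IsNormalized u) (hd : PairsDisjoint u) :
    UGL n →ₐ[ℂ] stableAlg u :=
  UniversalEnvelopingAlgebra.lift ℂ (glHom (stableUnit hu hd) (stableUnit_lie hu hd))

theorem stableAct_matUnit (hu : IsNormalized u) (hd : PairsDisjoint u) (r s : Fin n) :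
    stableAct hu hd (UniversalEnvelopingAlgebra.ι ℂ (matUnit r s)) = stableUnit hu hd r s := by
  rw [stableAct, UniversalEnvelopingAlgebra.lift_ι_apply, glHom_matUnit]

/-- The action of the enveloping algebra on the derivative tableaux. -/
noncomputable def derivAct (hu : IsNormalized u) (hd : PairsDisjoint u) :
    UGL n →ₐ[ℂ] Module.End ℂ (DerivSpace u) :=
  (stableHom hu hd).comp (stableAct hu hd)

theorem antisymAll_apply (a : stableAlg u) (y : GenSpace n) :
    antisymAll u (a.1 y) = a.1 (antisymAll u y) := by
  unfold antisymAll
  induction (univ : Finset (SingPair u)).toList with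
  | nil => rfl
  | cons p l ih => rw [antisym_cons, antisym_cons, ih, a.2.2.2, map_smul, map_sub]

/-- The operator commutes with antisymmetrisation, which `thetaMap` does not see; so it may be
applied to the single tableau `P_{Σ \ I} T(x + z)`, provided that the result is regular. -/
theorem stableHom_derivTab (hu : IsNormalized u) (hd : PairsDisjoint u) (a : stableAlg u)
    {I : Finset (SingPair u)} {z : intTab n} {y : GenSpace n}
    (h : a.1 (Finsupp.single (toShift z) (pairProd (univ \ I))) = y) (hy : y ∈ regSub u) :
    stableHom hu hd a (derivTab u I z) = thetaMap u y := by
  rw [stableHom_apply, xiMap_derivTab, xiTab, ← antisymAll_apply, h, thetaMap_antisymAll hu hd hy]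

theorem derivAct_matUnit_derivTab (hu : IsNormalized u) (hd : PairsDisjoint u) (r s : Fin n)
    {I : Finset (SingPair u)} {z : intTab n} (hI : ∀ p ∈ I, z.1 p.1.left ≠ z.1 p.1.right) :
    derivAct hu hd (UniversalEnvelopingAlgebra.ι ℂ (matUnit r s)) (derivTab u I z) =
      actionFormula u r s I z := by
  have h1 : (stableUnit hu hd r s).1 (Finsupp.single (toShift z) (pairProd (univ \ I))) =
      ∑ σ ∈ permSet n r s, Finsupp.single (toShift (z + permInt σ (epsTab n r s)))
        (actionCoeff u r s I z σ) := genE_single r s z _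
  change stableHom hu hd (stableAct hu hd _) _ = _
  rw [stableAct_matUnit, stableHom_derivTab hu hd _ h1, map_sum, actionFormula]
  · exact sum_congr rfl fun σ hσ => thetaMap_single _ (regularAt_actionCoeff hu hd hI hσ)
  · exact sum_mem fun σ hσ => single_mem_regSub _ (regularAt_actionCoeff hu hd hI hσ)

end Representation

end GelfandTsetlin

namespace GelfandTsetlin

/-! ### Moments of a monic polynomial -/

section Moments

open Polynomial Finset

variable {R S : Type*} [CommRing R] [CommRing S]

/-- The coefficient of `X⁻ᵏ⁻¹` in the expansion of `1 - Q(X - 1) / Q(X)` at infinity. -/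
noncomputable def moment (Q : R[X]) (k : ℕ) : R :=
  ((X ^ k * (Q - taylor (-1) Q)) %ₘ Q).coeff (Q.natDegree - 1)

theorem moment_map [Nontrivial S] (φ : R →+* S) {Q : R[X]} (hQ : Q.Monic) (k : ℕ) :
    moment (Q.map φ) k = φ (moment Q k) := by
  have h : taylor (-1) (Q.map φ) = (taylor (-1) Q).map φ := by
    rw [taylor_apply, taylor_apply, Polynomial.map_comp]
    simp
  rw [moment, moment, h, hQ.natDegree_map, ← coeff_map, map_modByMonic φ hQ]
  simp

/-- At a root `l i` the remainder takes the value `-l i ^ k * Q (l i - 1)`, and its coefficient in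
degree `#s - 1` is the interpolation sum of these values. The definition by remainders makes sense
for coinciding roots as well. -/
theorem moment_prod_X_sub_C {K ι : Type*} [Field K] [DecidableEq ι] {s : Finset ι} {l : ι → K}
    (hl : Set.InjOn l s) (k : ℕ) :
    moment (∏ i ∈ s, (X - C (l i))) k =
      ∑ i ∈ s, l i ^ k * ∏ j ∈ s.erase i, (1 - 1 / (l i - l j)) := by
  have hm : (∏ i ∈ s, (X - C (l i))).Monic := monic_prod_of_monic _ _ fun i _ => monic_X_sub_C _
  have hdeg : (∏ i ∈ s, (X - C (l i))).natDegree = #s := natDegree_finsetProd_X_sub_C_eq_card s l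
  rw [moment, hdeg]
  have hd : ((X ^ k * ((∏ i ∈ s, (X - C (l i))) - taylor (-1) (∏ i ∈ s, (X - C (l i))))) %ₘ
      ∏ i ∈ s, (X - C (l i))).degree < #s := by
    refine (degree_modByMonic_lt _ hm).trans_le ?_
    rw [degree_eq_natDegree hm.ne_zero, hdeg]
  rw [Lagrange.coeff_eq_sum hl hd]
  refine sum_congr rfl fun i hi => ?_
  have h0 : (∏ i ∈ s, (X - C (l i))).eval (l i) = 0 := by
    rw [eval_prod]
    exact prod_eq_zero hi (by simp)
  have h1 : ∏ j ∈ s.erase i, (1 - 1 / (l i - l j)) =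
      (∏ j ∈ s.erase i, (l i - l j - 1)) / ∏ j ∈ s.erase i, (l i - l j) := by
    rw [← prod_div_distrib]
    refine prod_congr rfl fun j hj => ?_
    have : l i - l j ≠ 0 := sub_ne_zero.mpr fun h =>
      (ne_of_mem_erase hj) (hl (mem_of_mem_erase hj) hi h.symm)
    field_simp
  have h2 : (taylor (-1) (∏ i ∈ s, (X - C (l i)))).eval (l i) =
      -∏ j ∈ s.erase i, (l i - l j - 1) := by
    rw [taylor_eval, eval_prod, ← mul_prod_erase s _ hi]
    have : ∀ j, eval (l i + -1) (X - C (l j)) = l i - l j - 1 := fun j => by simp; ring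
    simp only [this]
    ring
  have h3 := congrArg (eval (l i)) (modByMonic_add_div
    (X ^ k * ((∏ i ∈ s, (X - C (l i))) - taylor (-1) (∏ i ∈ s, (X - C (l i))))) (∏ i ∈ s, (X - C (l i))))
  rw [eval_add, eval_mul, h0, zero_mul, add_zero, eval_mul, eval_pow, eval_X, eval_sub, h0, h2,
    zero_sub, neg_neg] at h3
  rw [h3, h1, mul_div_assoc]

theorem coeff_sub_taylor {Q : R[X]} {d : ℕ} (hQ : Q.natDegree ≤ d + 1) :
    (Q - taylor (-1) Q).coeff d = (d + 1) * Q.coeff (d + 1) := by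
  have h : (hasseDeriv d Q).natDegree < 2 := by
    have := natDegree_hasseDeriv_le Q d
    omega
  rw [coeff_sub, taylor_coeff, eval_eq_sum_range' h, sum_range_succ, sum_range_one,
    hasseDeriv_coeff, hasseDeriv_coeff]
  simp [add_comm 1 d]

theorem coeff_modByMonic_of_natDegree_lt [Nontrivial R] {Q : R[X]} (hQ : Q.Monic) {f : R[X]}
    (hf : f.natDegree < Q.natDegree) (j : ℕ) : (f %ₘ Q).coeff j = f.coeff j := by
  rw [(modByMonic_eq_self_iff hQ).mpr (degree_lt_degree hf)]

/-- The polynomial part of `Q / X ^ (p + 1)` is dual to `X ^ p` for the form that takes the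
coefficient of degree `deg Q - 1` of a product modulo `Q`. For `i ≤ p` no reduction is needed; for
`i > p` subtracting a multiple of `Q` leaves too small a degree. -/
theorem coeff_X_pow_mul_modByMonic [Nontrivial R] {Q : R[X]} (hQ : Q.Monic) {p i : ℕ}
    (hp : p < Q.natDegree) (hi : i < Q.natDegree) :
    ((X ^ i * ∑ j ∈ range (Q.natDegree - p), C (Q.coeff (p + 1 + j)) * X ^ j) %ₘ Q).coeff
      (Q.natDegree - 1) = if i = p then 1 else 0 := by
  set B := ∑ j ∈ range (Q.natDegree - p), C (Q.coeff (p + 1 + j)) * X ^ j with hB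
  set A := ∑ j ∈ range (p + 1), C (Q.coeff j) * X ^ j with hA
  have hQAB : A + X ^ (p + 1) * B = Q := by
    conv_rhs => rw [Q.as_sum_range_C_mul_X_pow' (n := p + 1 + (Q.natDegree - p)) (by omega),
      sum_range_add]
    rw [hA, hB, mul_sum]
    congr 1
    exact sum_congr rfl fun j _ => by ring
  have hBdeg : B.natDegree ≤ Q.natDegree - p - 1 := by
    refine natDegree_sum_le_of_forall_le _ _ fun j hj => (natDegree_C_mul_X_pow_le _ _).trans ?_
    have := mem_range.mp hj
    omega
  have hAdeg : A.natDegree ≤ p := by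
    refine natDegree_sum_le_of_forall_le _ _ fun j hj => (natDegree_C_mul_X_pow_le _ _).trans ?_
    have := mem_range.mp hj
    omega
  have hBcoeff : ∀ j < Q.natDegree - p, B.coeff j = Q.coeff (p + 1 + j) := by
    intro j hj
    rw [hB, finsetSum_coeff]
    simp [coeff_C_mul, coeff_X_pow, hj]
  rcases le_or_gt i p with h | h
  · have hlt : (X ^ i * B).natDegree < Q.natDegree := by
      refine lt_of_le_of_lt natDegree_mul_le ?_
      rw [natDegree_X_pow]
      omega
    rw [coeff_modByMonic_of_natDegree_lt hQ hlt, coeff_X_pow_mul', if_pos (by omega)]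
    rcases h.eq_or_lt with rfl | h
    · rw [if_pos rfl, hBcoeff _ (by omega)]
      convert hQ.coeff_natDegree using 2
      omega
    · rw [if_neg h.ne]
      exact coeff_eq_zero_of_natDegree_lt (by omega)
  · rw [if_neg h.ne']
    have h1 : X ^ i * B = -(X ^ (i - p - 1) * A) + Q * X ^ (i - p - 1) := by
      have : (X : R[X]) ^ i = X ^ (i - p - 1) * X ^ (p + 1) := by rw [← pow_add]; congr 1; omega
      rw [this]
      linear_combination X ^ (i - p - 1) * hQAB
    have hlt : (-(X ^ (i - p - 1) * A)).natDegree < Q.natDegree - 1 := by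
      rw [natDegree_neg]
      refine lt_of_le_of_lt natDegree_mul_le ?_
      rw [natDegree_X_pow]
      omega
    rw [h1, add_modByMonic, (modByMonic_eq_zero_iff_dvd hQ).mpr (dvd_mul_right _ _), add_zero,
      coeff_modByMonic_of_natDegree_lt hQ (by omega), coeff_eq_zero_of_natDegree_lt hlt]

/-- An identity of Newton type: the pairing of `Q - Q(X - 1)` with the dual basis is computed once
through the moments and once through its coefficients. -/
theorem moment_relation [Nontrivial R] {Q : R[X]} (hQ : Q.Monic) {p : ℕ} (hp : p < Q.natDegree)
    (hdeg : (Q - taylor (-1) Q).natDegree < Q.natDegree) :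
    ∑ j ∈ range (Q.natDegree - p), Q.coeff (p + 1 + j) * moment Q j =
      (Q - taylor (-1) Q).coeff p := by
  have h1 : ∑ j ∈ range (Q.natDegree - p), Q.coeff (p + 1 + j) * moment Q j =
      (((Q - taylor (-1) Q) * ∑ j ∈ range (Q.natDegree - p), C (Q.coeff (p + 1 + j)) * X ^ j)
        %ₘ Q).coeff (Q.natDegree - 1) := by
    rw [mul_sum, ← modByMonicHom_apply, map_sum, finsetSum_coeff]
    refine sum_congr rfl fun j _ => ?_
    rw [modByMonicHom_apply, show (Q - taylor (-1) Q) * (C (Q.coeff (p + 1 + j)) * X ^ j) =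
      Q.coeff (p + 1 + j) • (X ^ j * (Q - taylor (-1) Q)) by rw [smul_eq_C_mul]; ring,
      smul_modByMonic, coeff_smul, smul_eq_mul, moment]
  rw [h1]
  conv_lhs => rw [(Q - taylor (-1) Q).as_sum_range_C_mul_X_pow' hdeg]
  rw [sum_mul, ← modByMonicHom_apply, map_sum, finsetSum_coeff]
  rw [sum_congr rfl fun i hi => show _ = if i = p then (Q - taylor (-1) Q).coeff i else 0 from ?_]
  · rw [sum_ite_eq', if_pos (mem_range.mpr hp)]
  · rw [mul_assoc, ← smul_eq_C_mul, map_smul, coeff_smul, modByMonicHom_apply,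
      coeff_X_pow_mul_modByMonic hQ hp (mem_range.mp hi)]
    simp

theorem sum_coeff_mul_moment {Q : R[X]} (hQ : Q.Monic) :
    ∑ j ∈ range (Q.natDegree + 1), Q.coeff j * moment Q j = 0 := by
  have h1 : ∑ j ∈ range (Q.natDegree + 1), Q.coeff j * moment Q j =
      ((Q * (Q - taylor (-1) Q)) %ₘ Q).coeff (Q.natDegree - 1) := by
    conv_rhs => enter [1, 1, 1]; rw [Q.as_sum_range_C_mul_X_pow]
    rw [sum_mul, ← modByMonicHom_apply, map_sum, finsetSum_coeff]
    refine sum_congr rfl fun j _ => ?_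
    rw [mul_assoc, ← smul_eq_C_mul, map_smul, coeff_smul, modByMonicHom_apply, smul_eq_mul, moment]
  rw [h1, (modByMonic_eq_zero_iff_dvd hQ).mpr (dvd_mul_right _ _), coeff_zero]

theorem natDegree_sub_taylor_lt {Q : R[X]} (h : 0 < Q.natDegree) :
    (Q - taylor (-1) Q).natDegree < Q.natDegree := by
  have h0 : Q ≠ 0 := fun h0 => by simp [h0] at h
  have h1 : (Q - taylor (-1) Q).degree < Q.degree :=
    degree_sub_lt_left (degree_taylor Q (-1)).symm h0 (leadingCoeff_taylor (-1) Q).symm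
  rcases eq_or_ne (Q - taylor (-1) Q) 0 with h2 | h2
  · rwa [h2, natDegree_zero]
  · exact natDegree_lt_natDegree h2 h1

/-- Let `d` be the highest degree in which the polynomials differ, by `c`. Subtracting the relations
for `p = d - 1` leaves `c * (deg Q - d) = 0`, impossible as `d < deg Q`. For `d = 0` there is no
such relation; the one with all coefficients, `sum_coeff_mul_moment`, gives `c * deg Q = 0` instead.
-/
theorem eq_of_moment_eq {K : Type*} [Field K] [CharZero K] {P Q : K[X]} (hP : P.Monic)
    (hQ : Q.Monic) (hdeg : P.natDegree = Q.natDegree)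
    (h : ∀ k, 1 ≤ k → k ≤ Q.natDegree → moment P k = moment Q k) : P = Q := by
  rcases Nat.eq_zero_or_pos Q.natDegree with h0 | hpos
  · rw [hP.natDegree_eq_zero.mp (hdeg.trans h0), hQ.natDegree_eq_zero.mp h0]
  -- The moment of order 0 is not among the given ones; the relation for `p = deg F - 1` shows that
  -- it is the degree.
  have hzero : ∀ {F : K[X]}, F.Monic → 0 < F.natDegree → moment F 0 = F.natDegree := by
    intro F hF hFpos
    have h1 := moment_relation hF (Nat.sub_lt hFpos one_pos) (natDegree_sub_taylor_lt hFpos)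
    rw [coeff_sub_taylor (by omega), show F.natDegree - (F.natDegree - 1) = 1 by omega, sum_range_one, add_zero,
      show F.natDegree - 1 + 1 = F.natDegree by omega, hF.coeff_natDegree, one_mul, mul_one] at h1
    rw [h1, ← Nat.cast_add_one]
    congr 1
    omega
  have hmom : ∀ k ≤ Q.natDegree, moment P k = moment Q k := by
    intro k hk
    rcases Nat.eq_zero_or_pos k with rfl | hk'
    · rw [hzero hP (hdeg ▸ hpos), hzero hQ hpos, hdeg]
    · exact h k hk' hk
  by_contra hne
  set D := P - Q with hD
  have hD0 : D ≠ 0 := sub_ne_zero.mpr hne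
  set d := D.natDegree with hd
  have hdm : d < Q.natDegree := by
    refine natDegree_lt_natDegree hD0 ?_
    refine degree_sub_lt_right ?_ hQ.ne_zero (hP.leadingCoeff.trans hQ.leadingCoeff.symm)
    rw [degree_eq_natDegree hP.ne_zero, degree_eq_natDegree hQ.ne_zero, hdeg]
  have hlead : D.coeff d ≠ 0 := leadingCoeff_ne_zero.mpr hD0
  have hbig : ∀ j, d < j → P.coeff j = Q.coeff j := fun j hj => by
    have := coeff_eq_zero_of_natDegree_lt hj
    rwa [hD, coeff_sub, sub_eq_zero] at this
  rcases Nat.eq_zero_or_pos d with hd0 | hdpos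
  · have h1 := sum_coeff_mul_moment hP
    have h2 := sum_coeff_mul_moment hQ
    rw [sum_range_succ'] at h1 h2
    rw [hdeg, sum_congr rfl fun j hj => by
      rw [hbig (j + 1) (by omega), hmom (j + 1) (by have := mem_range.mp hj; omega)]] at h1
    rw [hmom 0 (by omega), hzero hQ hpos] at h1
    rw [hzero hQ hpos] at h2
    have h3 : D.coeff 0 * (Q.natDegree : K) = 0 := by
      rw [hD, coeff_sub]
      linear_combination h1 - h2
    rcases mul_eq_zero.mp h3 with h4 | h4
    · exact hlead (hd0 ▸ h4)
    · have : Q.natDegree = 0 := by exact_mod_cast h4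
      omega
  · obtain ⟨e, he⟩ : ∃ e, d = e + 1 := ⟨d - 1, by omega⟩
    have h1 := moment_relation hP (p := e) (by omega) (natDegree_sub_taylor_lt (hdeg ▸ hpos))
    have h2 := moment_relation hQ (p := e) (by omega) (natDegree_sub_taylor_lt hpos)
    obtain ⟨c, hc⟩ : ∃ c, Q.natDegree - e = c + 1 := ⟨Q.natDegree - e - 1, by omega⟩
    rw [hdeg, hc, sum_range_succ'] at h1
    rw [hc, sum_range_succ'] at h2
    rw [sum_congr rfl fun j hj => by
      rw [hbig (e + 1 + (j + 1)) (by omega), hmom (j + 1) (by have := mem_range.mp hj; omega)]] at h1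
    have h3 := coeff_sub_taylor (Q := D) (d := e) (by omega)
    rw [hD, map_sub, coeff_sub, coeff_sub, coeff_sub, coeff_sub] at h3
    rw [hmom 0 (by omega), hzero hQ hpos, coeff_sub] at h1
    rw [hzero hQ hpos, coeff_sub] at h2
    have h4 : D.coeff d * ((Q.natDegree : K) - (e + 1)) = 0 := by
      rw [hD, he, coeff_sub]
      linear_combination h1 - h2 + h3
    rcases mul_eq_zero.mp h4 with h5 | h5
    · exact hlead h5
    · have : Q.natDegree = e + 1 := by
        rw [sub_eq_zero] at h5
        exact_mod_cast h5
      omega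

end Moments

/-! ### The values of the Casimir elements -/

section RowPolynomials

open Polynomial Finset

variable {n : ℕ} {u : Tab n ℂ}

/-- The monic polynomial with the roots `w_{ki} + k - 1`, for the row with number `k = r + 1`. -/
noncomputable def rowPoly (w : Tab n ℂ) (r : Fin n) : ℂ[X] :=
  ∏ i : Fin (r.val + 1), (X - C (w ⟨r, i⟩ + r.val))

theorem rowPoly_monic (w : Tab n ℂ) (r : Fin n) : (rowPoly w r).Monic :=
  monic_prod_of_monic _ _ fun _ _ => monic_X_sub_C _

theorem natDegree_rowPoly (w : Tab n ℂ) (r : Fin n) : (rowPoly w r).natDegree = r.val + 1 := by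
  rw [rowPoly, natDegree_finsetProd_X_sub_C_eq_card, card_univ, Fintype.card_fin]

/-- The eigenvalue is a moment of the polynomial with the entries of the row as roots, hence a
polynomial in the entries. Its apparent poles cancel, and it may be evaluated where entries
coincide. -/
theorem exists_traceCoeff_eq (r : Fin n) (k : ℕ) (z : intTab n) :
    ∃ p : MvPolynomial (Pos n) ℂ, traceCoeff (extTab n) r.val k (toShift z) = polyFun p ∧
      ∀ u, MvPolynomial.eval u p = moment (rowPoly (u + toComplex z) r) k := by
  set Q : (MvPolynomial (Pos n) ℂ)[X] := ∏ i : Fin (r.val + 1),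
    (X - C (MvPolynomial.X ⟨r, i⟩ + MvPolynomial.C ((z.1 ⟨r, i⟩ : ℂ) + r.val))) with hQ
  have hm : Q.Monic := monic_prod_of_monic _ _ fun _ _ => monic_X_sub_C _
  refine ⟨moment Q k, ?_, fun u => ?_⟩
  · rw [polyFun, ← moment_map _ hm, hQ, Polynomial.map_prod]
    have h1 : ∀ i : Fin (r.val + 1), Polynomial.map (algebraMap (MvPolynomial (Pos n) ℂ) (RatFun n))
        (X - C (MvPolynomial.X ⟨r, i⟩ + MvPolynomial.C ((z.1 ⟨r, i⟩ : ℂ) + r.val))) =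
        X - C (ent (extTab n) (toShift z) r.val i.val + (r.val : RatFun n)) := by
      intro i
      rw [Polynomial.map_sub, map_X, map_C, ent_toShift z ⟨r, i⟩, shiftedTab, genTab]
      simp [add_assoc]
    rw [prod_congr rfl fun i _ => h1 i,
      ← prod_range fun i => X - C (ent (extTab n) (toShift z) r.val i + (r.val : RatFun n)),
      moment_prod_X_sub_C, traceCoeff]
    · simp only [add_sub_add_right_eq_sub]
    · intro i hi j hj hij
      by_contra hne
      have := (isGenericTab_extTab n).ent_ne (toShift z) (toShift z) (k := r.val) (i := i)
        (l := r.val) (j := j) (by simpa using hne) 0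
      exact this (by simpa [sub_eq_zero] using hij)
  · rw [← moment_map _ hm, hQ, Polynomial.map_prod, rowPoly]
    congr 1
    refine prod_congr rfl fun i _ => ?_
    simp [toComplex, add_assoc]

theorem gammaFun_eq (r : Fin n) (k : ℕ) :
    gammaFun n (r.val + 1) k = traceCoeff (extTab n) r.val k (toShift (0 : intTab n)) := by
  have h1 : ∀ i ∈ range (r.val + 1), (genTab n).entry (r.val + 1) (i + 1) =
      ent (extTab n) (toShift (0 : intTab n)) r.val i := by
    intro i hi
    have h := ent_toShift (0 : intTab n) ⟨r, ⟨i, mem_range.mp hi⟩⟩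
    have h2 := entry_succ (genTab n) r ⟨i, mem_range.mp hi⟩
    simp only at h h2
    rw [h, h2]
    simp [shiftedTab]
  have h2 : Icc 1 (r.val + 1) = (range (r.val + 1)).map ⟨Nat.succ, Nat.succ_injective⟩ := by
    ext i
    simp only [mem_Icc, mem_map, mem_range, Function.Embedding.coeFn_mk]
    constructor
    · rintro ⟨h, h'⟩
      exact ⟨i - 1, by omega, by omega⟩
    · rintro ⟨j, hj, rfl⟩
      omega
  rw [gammaFun, traceCoeff, h2, sum_map]
  refine sum_congr rfl fun i hi => ?_
  rw [← map_erase, prod_map]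
  simp only [Function.Embedding.coeFn_mk, Nat.succ_eq_add_one]
  rw [h1 i hi]
  congr 1
  · push_cast
    rw [add_sub_assoc, add_sub_cancel_right]
  · exact prod_congr rfl fun j hj => by rw [h1 j (mem_of_mem_erase hj)]

theorem gammaVal_eq (r : Fin n) (k : ℕ) (w : Tab n ℂ) :
    gammaVal (r.val + 1) k w = moment (rowPoly w r) k := by
  obtain ⟨p, hp, hp'⟩ := exists_traceCoeff_eq r k 0
  rw [gammaVal, gammaFun_eq, hp, valueAt_polyFun, hp']
  congr 2
  funext q
  simp [toComplex]

theorem traceCoeff_mem_regularRing (u : Tab n ℂ) (r : Fin n) (k : ℕ) (z : intTab n) :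
    traceCoeff (extTab n) r.val k (toShift z) ∈ regularRing u := by
  obtain ⟨p, hp, -⟩ := exists_traceCoeff_eq r k z
  rw [hp]
  exact regularAt_polyFun u p

theorem valueAt_traceCoeff (u : Tab n ℂ) (r : Fin n) (k : ℕ) (z : intTab n) :
    valueAt u (traceCoeff (extTab n) r.val k (toShift z)) =
      gammaVal (r.val + 1) k (u + toComplex z) := by
  obtain ⟨p, hp, hp'⟩ := exists_traceCoeff_eq r k z
  rw [hp, valueAt_polyFun, hp', gammaVal_eq]

theorem rowPoly_eq_of_gammaVal_eq {w w' : Tab n ℂ} (r : Fin n)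
    (h : ∀ k, 1 ≤ k → k ≤ r.val + 1 → gammaVal (r.val + 1) k w = gammaVal (r.val + 1) k w') :
    rowPoly w r = rowPoly w' r := by
  refine eq_of_moment_eq (rowPoly_monic w r) (rowPoly_monic w' r)
    ((natDegree_rowPoly w r).trans (natDegree_rowPoly w' r).symm) fun k hk hk' => ?_
  rw [natDegree_rowPoly] at hk'
  rw [← gammaVal_eq, ← gammaVal_eq, h k hk hk']

end RowPolynomials

end GelfandTsetlin

namespace GelfandTsetlin

/-! ### Casimir elements -/

section Casimir

open Finset

theorem powEntry_eq_sum_paths {A ι : Type*} [Ring A] [DecidableEq ι] [Fintype ι] (E : ι → ι → A)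
    (s : Finset ι) (k : ℕ) : ∀ a, ∀ b ∈ s, powEntry E s (k + 1) a b =
      ∑ g : Fin k → ι with ∀ i, g i ∈ s, (List.ofFn fun i : Fin (k + 1) =>
        E (Fin.cons (α := fun _ => ι) a g i) (Fin.snoc (α := fun _ => ι) g b i)).prod := by
  induction k with
  | zero =>
    intro a b hb
    rw [powEntry_succ]
    simp [powEntry, hb, Fin.snoc]
  | succ k ih =>
    intro a b hb
    rw [powEntry_succ, sum_congr rfl fun c _ => by rw [ih c b hb], sum_filter,
      ← (Fin.consEquiv fun _ : Fin (k + 1) => ι).sum_comp, Fintype.sum_prod_type,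
      ← sum_filter_add_sum_filter_not univ (· ∈ s)]
    rw [sum_eq_zero (s := univ.filter (· ∉ s)), add_zero]
    · simp only [filter_mem_eq_inter, univ_inter]
      refine sum_congr rfl fun c hc => ?_
      rw [mul_sum, sum_filter]
      refine sum_congr rfl fun g _ => ?_
      simp only [Fin.consEquiv, Equiv.coe_fn_mk, Fin.forall_fin_succ (n := k), Fin.cons_zero,
        Fin.cons_succ, hc, true_and]
      congr 1
      conv_rhs => rw [List.ofFn_succ, List.prod_cons, Fin.cons_zero]
      congr 1
      · congr 2
        funext i
        rw [Fin.cons_succ, ← Fin.cons_snoc_eq_snoc_cons, Fin.cons_succ]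
    · intro c hc
      refine sum_eq_zero fun g _ => if_neg fun h => ?_
      exact (mem_filter.mp hc).2 (h 0)

theorem sum_powEntry_eq_sum_cycles {A ι : Type*} [Ring A] [DecidableEq ι] [Fintype ι]
    (E : ι → ι → A) (s : Finset ι) (k : ℕ) : ∑ a ∈ s, powEntry E s (k + 1) a a =
      ∑ f : Fin (k + 1) → ι with ∀ i, f i ∈ s, (List.ofFn fun i : Fin (k + 1) =>
        E (f i) (f (finRotate (k + 1) i))).prod := by
  rw [sum_congr rfl fun a ha => powEntry_eq_sum_paths E s k a a ha, sum_filter,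
      ← (Fin.consEquiv fun _ : Fin (k + 1) => ι).sum_comp, Fintype.sum_prod_type,
      ← sum_filter_add_sum_filter_not univ (· ∈ s)]
  rw [sum_eq_zero (s := univ.filter (· ∉ s)), add_zero]
  · simp only [filter_mem_eq_inter, univ_inter]
    refine sum_congr rfl fun a ha => ?_
    rw [sum_filter]
    refine sum_congr rfl fun g _ => ?_
    simp only [Fin.consEquiv, Equiv.coe_fn_mk, Fin.forall_fin_succ (n := k), Fin.cons_zero,
      Fin.cons_succ, ha, true_and]
    congr 4
    funext i
    congr 1
    refine Fin.lastCases ?_ (fun i => ?_) i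
    · rw [Fin.snoc_last, finRotate_last, Fin.cons_zero]
    · rw [Fin.snoc_castSucc, finRotate_apply, Fin.coeSucc_eq_succ, Fin.cons_succ]
  · intro c hc
    refine sum_eq_zero fun g _ => if_neg fun h => ?_
    exact (mem_filter.mp hc).2 (h 0)

/-- The entries of a power of the matrix satisfy the same commutation rules with the matrix units as
the units themselves; hence the trace is central. -/
theorem lie_powEntry {A ι : Type*} [Ring A] [DecidableEq ι] {E : ι → ι → A}
    (hE : ∀ i j k l, E i j * E k l - E k l * E i j =
      (if j = k then E i l else 0) - if i = l then E k j else 0) {s : Finset ι} {a b : ι}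
    (ha : a ∈ s) (hb : b ∈ s) (k : ℕ) : ∀ i j, E a b * powEntry E s k i j - powEntry E s k i j * E a b =
      (if b = i then powEntry E s k a j else 0) - if a = j then powEntry E s k i b else 0 := by
  induction k with
  | zero =>
    intro i j
    simp only [powEntry, eq_comm (a := i) (b := b)]
    split_ifs <;> simp
  | succ k ih =>
    intro i j
    simp only [powEntry_succ, mul_sum, sum_mul]
    rw [← sum_sub_distrib]
    have h1 : ∀ c ∈ s, E a b * (E i c * powEntry E s k c j) - E i c * powEntry E s k c j * E a b =
        (((if b = i then E a c * powEntry E s k c j else 0) -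
          if a = c then E i b * powEntry E s k c j else 0) +
        if b = c then E i c * powEntry E s k a j else 0) -
          if a = j then E i c * powEntry E s k c b else 0 := by
      intro c _
      have h2 := hE a b i c
      have h3 := ih c j
      calc _ = (E a b * E i c - E i c * E a b) * powEntry E s k c j +
            E i c * (E a b * powEntry E s k c j - powEntry E s k c j * E a b) := by noncomm_ring
        _ = _ := by
          rw [h2, h3]
          simp only [sub_mul, mul_sub, ite_mul, mul_ite, zero_mul, mul_zero]
          abel
    rw [sum_congr rfl h1, sum_sub_distrib, sum_add_distrib, sum_sub_distrib, sum_ite_eq, sum_ite_eq,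
      if_pos ha, if_pos hb]
    split_ifs <;> simp

theorem commute_sum_powEntry {A ι : Type*} [Ring A] [DecidableEq ι] {E : ι → ι → A}
    (hE : ∀ i j k l, E i j * E k l - E k l * E i j =
      (if j = k then E i l else 0) - if i = l then E k j else 0) {s : Finset ι} {a b : ι}
    (ha : a ∈ s) (hb : b ∈ s) (k : ℕ) : E a b * ∑ i ∈ s, powEntry E s k i i =
      (∑ i ∈ s, powEntry E s k i i) * E a b := by
  rw [← sub_eq_zero, mul_sum, sum_mul, ← sum_sub_distrib,
    sum_congr rfl fun i _ => lie_powEntry hE ha hb k i i, sum_sub_distrib, sum_ite_eq, sum_ite_eq,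
    if_pos ha, if_pos hb, sub_self]

theorem powEntry_mem {A ι : Type*} [Ring A] [DecidableEq ι] [Algebra ℂ A] {E : ι → ι → A} {s : Finset ι}
    {S : Subalgebra ℂ A} (hE : ∀ i ∈ s, ∀ j ∈ s, E i j ∈ S) (k : ℕ) :
    ∀ i ∈ s, ∀ j, powEntry E s k i j ∈ S := by
  induction k with
  | zero =>
    intro i _ j
    rw [powEntry]
    split_ifs
    exacts [one_mem _, zero_mem _]
  | succ k ih =>
    intro i hi j
    exact sum_mem fun c hc => mul_mem (hE i hi c hc) (ih c hc j)

theorem map_powEntry {A B ι : Type*} [Ring A] [Ring B] [DecidableEq ι] (φ : A →+* B) (E : ι → ι → A)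
    (s : Finset ι) (k : ℕ) (i j : ι) :
    φ (powEntry E s k i j) = powEntry (fun a b => φ (E a b)) s k i j := by
  induction k generalizing i with
  | zero => simp only [powEntry]; split_ifs <;> simp
  | succ k ih => simp only [powEntry_succ, map_sum, map_mul, ih]

variable {n : ℕ} {u : Tab n ℂ}

/-- The image of the matrix unit in the enveloping algebra. -/
noncomputable def unitU (i j : Fin n) : UGL n := UniversalEnvelopingAlgebra.ι ℂ (matUnit i j)

theorem unitU_lie (i j k l : Fin n) : unitU i j * unitU k l - unitU k l * unitU i j =
    (if j = k then unitU i l else 0) - if i = l then unitU k j else 0 := by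
  have h : ∀ i j k l : Fin n, matUnit i j * matUnit k l = if j = k then matUnit i l else 0 := by
    intro i j k l
    unfold matUnit
    split_ifs with h
    · subst h
      rw [Matrix.single_mul_single_same, one_mul]
    · rw [Matrix.single_mul_single_of_ne _ _ _ _ h]
  unfold unitU
  rw [← Ring.lie_def, ← LieHom.map_lie, Ring.lie_def, h, h, map_sub]
  simp only [eq_comm (a := l)]
  split_ifs <;> simp

theorem casimir_eq (m k : ℕ) : casimir n m (k + 1) =
    ∑ a : Fin n with a.val < m, powEntry unitU (univ.filter fun a : Fin n => a.val < m) (k + 1) a a := by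
  rw [sum_powEntry_eq_sum_cycles, casimir]
  simp only [mem_filter, mem_univ, true_and]
  rfl

theorem casimir_mem_Gam {m : ℕ} (h1 : 1 ≤ m) (hm : m ≤ n) (k : ℕ) :
    casimir n m (k + 1) ∈ Gam n := by
  have hsub : ∀ i ∈ univ.filter (fun a : Fin n => a.val < m),
      ∀ j ∈ univ.filter (fun a : Fin n => a.val < m), unitU i j ∈ subU n m := fun i hi j hj =>
    Algebra.subset_adjoin ⟨i, j, (mem_filter.mp hi).2, (mem_filter.mp hj).2, rfl⟩
  refine Algebra.subset_adjoin (Set.mem_biUnion (mem_Icc.mpr ⟨h1, hm⟩) ⟨?_, ?_⟩)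
  · rw [casimir_eq]
    exact sum_mem fun a ha => powEntry_mem hsub _ a ha a
  · refine (Subalgebra.mem_centralizer_iff ℂ).mpr fun g hg => ?_
    refine Algebra.adjoin_induction ?_ ?_ ?_ ?_ hg
    · rintro _ ⟨i, j, hi, hj, rfl⟩
      rw [casimir_eq]
      exact commute_sum_powEntry unitU_lie (mem_filter.mpr ⟨mem_univ _, hi⟩)
        (mem_filter.mpr ⟨mem_univ _, hj⟩) _
    · exact fun c => Algebra.commutes c _
    · intro x y _ _ hx hy
      rw [add_mul, mul_add, hx, hy]
    · intro x y _ _ hx hy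
      rw [mul_assoc, hy, ← mul_assoc, hx, mul_assoc]

theorem sum_filter_lt {M : Type*} [AddCommMonoid M] {m : ℕ} (hm : m ≤ n) (f : ℕ → M) :
    ∑ a : Fin n with a.val < m, f a.val = ∑ a ∈ range m, f a := by
  have h : range m = (univ.filter fun a : Fin n => a.val < m).map Fin.valEmbedding := by
    ext a
    simp only [mem_range, mem_map, mem_filter, mem_univ, true_and, Fin.valEmbedding_apply]
    exact ⟨fun h => ⟨⟨a, h.trans_le hm⟩, h, rfl⟩, by rintro ⟨b, hb, rfl⟩; exact hb⟩
  rw [h, sum_map]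
  rfl

theorem powEntry_stableUnit (hu : IsNormalized u) (hd : PairsDisjoint u) {m : ℕ} (hm : m ≤ n) (k : ℕ)
    (i j : Fin n) (y : GenSpace n) :
    (powEntry (stableUnit hu hd) (univ.filter fun a : Fin n => a.val < m) k i j).1 y =
      (powEntry (genE (extTab n)) (range m) k i.val j.val).toEnd y := by
  induction k generalizing i with
  | zero =>
    simp only [powEntry, Fin.ext_iff]
    split_ifs
    · rw [map_one]; rfl
    · rw [map_zero]; rfl
  | succ k ih =>
    rw [powEntry_succ, powEntry_succ, map_sum, ← sum_filter_lt hm, LinearMap.sum_apply,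
      AddSubmonoidClass.coe_finsetSum, LinearMap.sum_apply]
    refine sum_congr rfl fun c _ => ?_
    rw [map_mul, Module.End.mul_apply, ← ih c]
    rfl

theorem stableAct_casimir (hu : IsNormalized u) (hd : PairsDisjoint u) (r : Fin n) (k : ℕ)
    (y : GenSpace n) : (stableAct hu hd (casimir n (r.val + 1) (k + 1))).1 y =
      (dg (traceCoeff (extTab n) r.val (k + 1))).toEnd y := by
  rw [casimir_eq, map_sum, ← sum_powEntry_genE (isGenericTab_extTab n), map_sum,
    ← sum_filter_lt r.isLt, LinearMap.sum_apply, AddSubmonoidClass.coe_finsetSum,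
    LinearMap.sum_apply]
  refine sum_congr rfl fun a _ => ?_
  rw [← powEntry_stableUnit hu hd r.isLt]
  have h := map_powEntry (stableAct hu hd : UGL n →+* stableAlg u) unitU
    (univ.filter fun a : Fin n => a.val < r.val + 1) (k + 1) a a
  have h2 : (fun a b => (stableAct hu hd : UGL n →+* stableAlg u) (unitU a b)) =
      stableUnit hu hd := funext fun a => funext fun b => stableAct_matUnit hu hd a b
  rw [h2] at h
  exact congrArg (fun b : stableAlg u => b.1 y) h

/-- The Casimir element multiplies the generic tableau by its eigenvalue, and differentiating the
product is triangular in `I`: the term `J = I` carries the value of the eigenvalue at `u`. -/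
theorem derivAct_casimir_derivTab (hu : IsNormalized u) (hd : PairsDisjoint u) (r : Fin n) (k : ℕ)
    (I : Finset (SingPair u)) (z : intTab n) :
    derivAct hu hd (casimir n (r.val + 1) (k + 1)) (derivTab u I z) =
      ∑ J ∈ I.powerset, valueAt u (diffOp (I \ J) (traceCoeff (extTab n) r.val (k + 1) (toShift z))) •
        derivTab u J z := by
  have hreg := traceCoeff_mem_regularRing u r (k + 1) z
  have h1 : (stableAct hu hd (casimir n (r.val + 1) (k + 1))).1
      (Finsupp.single (toShift z) (pairProd (univ \ I))) = Finsupp.single (toShift z)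
        (pairProd (univ \ I) * traceCoeff (extTab n) r.val (k + 1) (toShift z)) := by
    rw [stableAct_casimir, dg, op_single, add_zero]
  have h2 := mul_mem (pairProd_mem_regularRing (univ \ I)) hreg
  change stableHom hu hd (stableAct hu hd _) _ = _
  rw [stableHom_derivTab hu hd _ h1 (single_mem_regSub z h2), thetaMap_single z h2,
    derivEval_pairProd_mul hu hd I z hreg]

end Casimir

end GelfandTsetlin

namespace GelfandTsetlin

/-! ### Orbits of the exchanges of singular pairs -/

section Orbits

open Finset

variable {n : ℕ} {u : Tab n ℂ}

theorem swapPair_left (p : SingPair u) (z : intTab n) :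
    (permInt (swapPair p) z).1 p.1.left = z.1 p.1.right := by
  rw [permInt_swapPair, pairSwap, Equiv.swap_apply_left]

theorem swapPair_right (p : SingPair u) (z : intTab n) :
    (permInt (swapPair p) z).1 p.1.right = z.1 p.1.left := by
  rw [permInt_swapPair, pairSwap, Equiv.swap_apply_right]

theorem swapPair_left_of_ne (hd : PairsDisjoint u) {p q : SingPair u} (h : p ≠ q) (z : intTab n) :
    (permInt (swapPair p) z).1 q.1.left = z.1 q.1.left := by
  rw [permInt_swapPair, pairSwap_left_of_ne hd h]

theorem swapPair_right_of_ne (hd : PairsDisjoint u) {p q : SingPair u} (h : p ≠ q) (z : intTab n) :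
    (permInt (swapPair p) z).1 q.1.right = z.1 q.1.right := by
  rw [permInt_swapPair, pairSwap_right_of_ne hd h]

theorem swapPair_swapPair (p : SingPair u) (z : intTab n) :
    permInt (swapPair p) (permInt (swapPair p) z) = z := by
  refine Subtype.ext (funext fun q => ?_)
  rw [permInt_swapPair, permInt_swapPair, pairSwap, Equiv.swap_apply_self]

/-- The tableaux `z` and `w` differ by exchanges of singular pairs. -/
def SameOrbit (u : Tab n ℂ) (z w : intTab n) : Prop :=
  (∀ p : SingPair u, (z.1 p.1.left = w.1 p.1.left ∧ z.1 p.1.right = w.1 p.1.right) ∨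
    (z.1 p.1.left = w.1 p.1.right ∧ z.1 p.1.right = w.1 p.1.left)) ∧
  ∀ q, (∀ p : SingPair u, q ≠ p.1.left ∧ q ≠ p.1.right) → z.1 q = w.1 q

theorem SameOrbit.refl (z : intTab n) : SameOrbit u z z :=
  ⟨fun _ => Or.inl ⟨rfl, rfl⟩, fun _ _ => rfl⟩

theorem SameOrbit.swapPair (hd : PairsDisjoint u) {z w : intTab n} (h : SameOrbit u z w)
    (p : SingPair u) : SameOrbit u (permInt (swapPair p) z) w := by
  refine ⟨fun q => ?_, fun q hq => ?_⟩
  · by_cases hpq : p = q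
    · subst hpq
      rw [swapPair_left, swapPair_right]
      rcases h.1 p with ⟨h1, h2⟩ | ⟨h1, h2⟩
      · exact Or.inr ⟨h2, h1⟩
      · exact Or.inl ⟨h2, h1⟩
    · rw [swapPair_left_of_ne hd hpq, swapPair_right_of_ne hd hpq]
      exact h.1 q
  · rw [permInt_swapPair, pairSwap, Equiv.swap_apply_of_ne_of_ne (hq p).1 (hq p).2]
    exact h.2 q hq

theorem sameOrbit_swapPair_iff (hd : PairsDisjoint u) {z w : intTab n} (p : SingPair u) :
    SameOrbit u (permInt (swapPair p) z) w ↔ SameOrbit u z w :=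
  ⟨fun h => by simpa only [swapPair_swapPair] using h.swapPair hd p, fun h => h.swapPair hd p⟩

open Classical in
/-- The pairs on which `z` and `w` differ. -/
noncomputable def diffPairs (u : Tab n ℂ) (z w : intTab n) : Finset (SingPair u) :=
  univ.filter fun p => z.1 p.1.left ≠ w.1 p.1.left

theorem mem_diffPairs {z w : intTab n} {p : SingPair u} :
    p ∈ diffPairs u z w ↔ z.1 p.1.left ≠ w.1 p.1.left := by
  simp [diffPairs]

theorem SameOrbit.ext {z z' w : intTab n} (h : SameOrbit u z w) (h' : SameOrbit u z' w)
    (heq : diffPairs u z w = diffPairs u z' w) : z = z' := by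
  have key : ∀ p : SingPair u, z.1 p.1.left = z'.1 p.1.left ∧ z.1 p.1.right = z'.1 p.1.right := by
    intro p
    have h1 : z.1 p.1.left ≠ w.1 p.1.left ↔ z'.1 p.1.left ≠ w.1 p.1.left := by
      rw [← mem_diffPairs, ← mem_diffPairs, heq]
    have h2 := h.1 p
    have h3 := h'.1 p
    by_cases h4 : z.1 p.1.left = w.1 p.1.left
    · have h5 : z'.1 p.1.left = w.1 p.1.left := by tauto
      omega
    · have h5 : z'.1 p.1.left ≠ w.1 p.1.left := by tauto
      omega
  refine Subtype.ext (funext fun q => ?_)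
  by_cases hq : ∀ p : SingPair u, q ≠ p.1.left ∧ q ≠ p.1.right
  · rw [h.2 q hq, h'.2 q hq]
  · push Not at hq
    obtain ⟨p, hp⟩ := hq
    by_cases hql : q = p.1.left
    · rw [hql, (key p).1]
    · rw [hp hql, (key p).2]

theorem diffPairs_self (z : intTab n) : diffPairs u z z = ∅ := by
  simp [diffPairs]

theorem diffPairs_swapPair (hd : PairsDisjoint u) {z w : intTab n} (p : SingPair u) :
    (diffPairs u (permInt (swapPair p) z) w).erase p = (diffPairs u z w).erase p := by
  ext q
  simp only [mem_erase, mem_diffPairs]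
  refine and_congr_right fun hq => ?_
  rw [swapPair_left_of_ne hd hq.symm]

theorem SameOrbit.induction (hd : PairsDisjoint u) {P : intTab n → Prop} {w : intTab n} (hw : P w)
    (hstep : ∀ p z, P z → P (permInt (GelfandTsetlin.swapPair (u := u) p) z)) {z : intTab n}
    (h : SameOrbit u z w) : P z := by
  induction hc : #(diffPairs u z w) generalizing z with
  | zero =>
    rwa [h.ext (SameOrbit.refl w) (by rw [diffPairs_self, ← card_eq_zero, hc])]
  | succ d ih =>
    obtain ⟨p, hp⟩ : (diffPairs u z w).Nonempty := by rw [← card_pos]; omega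
    have hp' : p ∉ diffPairs u (permInt (GelfandTsetlin.swapPair p) z) w := by
      rw [mem_diffPairs, swapPair_left, not_not]
      have h1 := h.1 p
      have h2 := mem_diffPairs.mp hp
      omega
    have h1 := diffPairs_swapPair hd (z := z) (w := w) p
    rw [erase_eq_of_notMem hp'] at h1
    have h2 := hstep p _ (ih (h.swapPair hd p) (by rw [h1, card_erase_of_mem hp, hc]; omega))
    rwa [swapPair_swapPair] at h2

/-- An element of the orbit is given by the set of pairs that are really exchanged, an arbitrary set
of pairs with distinct entries. -/
theorem ncard_sameOrbit (hd : PairsDisjoint u) (w : intTab n) :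
    {z | SameOrbit u z w}.ncard = 2 ^ (Fintype.card (SingPair u) - #(equalPairs u w)) := by
  have h1 : Set.BijOn (fun z => diffPairs u z w) {z | SameOrbit u z w}
      ((univ \ equalPairs u w).powerset : Finset (Finset (SingPair u))) := by
    refine ⟨fun z hz => ?_, fun z hz z' hz' h => SameOrbit.ext hz hz' h, fun A hA => ?_⟩
    · rw [mem_coe, mem_powerset]
      intro p hp
      rw [mem_sdiff, mem_equalPairs]
      refine ⟨mem_univ p, fun h => mem_diffPairs.mp hp ?_⟩
      rcases hz.1 p with h' | h'
      · exact h'.1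
      · rw [h'.1, h]
    · rw [mem_coe, mem_powerset] at hA
      induction A using Finset.induction_on with
      | empty => exact ⟨w, SameOrbit.refl w, diffPairs_self w⟩
      | insert p A hp ih =>
        obtain ⟨z, hz, hzA⟩ := ih ((subset_insert p A).trans hA)
        simp only at hzA
        refine ⟨permInt (swapPair p) z, SameOrbit.swapPair hd hz p, ?_⟩
        have h2 := diffPairs_swapPair hd (z := z) (w := w) p
        rw [hzA, erase_eq_of_notMem hp] at h2
        have h3 : p ∈ diffPairs u (permInt (swapPair p) z) w := by
          have h4 : z.1 p.1.left = w.1 p.1.left := by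
            rw [← hzA] at hp
            simpa [mem_diffPairs] using hp
          have h5 := (mem_sdiff.mp (hA (mem_insert_self p A))).2
          rw [mem_equalPairs] at h5
          rw [mem_diffPairs, swapPair_left]
          have := hz.1 p
          omega
        simp only
        rw [← h2, insert_erase h3]
  rw [← h1.injOn.ncard_image, h1.image_eq, Set.ncard_coe_finset, card_powerset,
    card_sdiff_of_subset (subset_univ _), card_univ]

/-! ### The basis of derivative tableaux -/

theorem mem_positivePairs {z : intTab n} {p : SingPair u} :
    p ∈ positivePairs u z ↔ z.1 p.1.right < z.1 p.1.left := by
  simp [positivePairs]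

/-- The sign of `𝒟_I T(u + z)` relative to the basis. -/
def orbitSign (I : Finset (SingPair u)) (z : intTab n) : ℤ :=
  ∏ p ∈ I, Int.sign (z.1 p.1.left - z.1 p.1.right)

theorem orbitSign_swapPair (hd : PairsDisjoint u) (I : Finset (SingPair u)) (z : intTab n)
    (p : SingPair u) :
    orbitSign I (permInt (swapPair p) z) = (if p ∈ I then -1 else 1) * orbitSign I z := by
  have h : ∀ q ∈ I, Int.sign ((permInt (swapPair p) z).1 q.1.left -
      (permInt (swapPair p) z).1 q.1.right) =
      (if q = p then -1 else 1) * Int.sign (z.1 q.1.left - z.1 q.1.right) := by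
    intro q _
    split_ifs with hq
    · subst hq
      rw [swapPair_left, swapPair_right, ← neg_sub, Int.sign_neg, neg_one_mul]
    · rw [swapPair_left_of_ne hd (Ne.symm hq), swapPair_right_of_ne hd (Ne.symm hq), one_mul]
  rw [orbitSign, prod_congr rfl h, prod_mul_distrib, prod_ite_eq']
  rfl

open Classical in
/-- The coordinate of `𝒟_I T(u + z)` with respect to the basis vector given by `w`. -/
noncomputable def orbitCoord (hd : PairsDisjoint u) (w : intTab n) : DerivSpace u →ₗ[ℂ] ℂ :=
  (tabRelations u).liftQ (Finsupp.lsum ℂ fun q : Finset (SingPair u) × intTab n =>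
    LinearMap.toSpanSingleton ℂ ℂ
      (if q.1 = positivePairs u w ∧ SameOrbit u q.2 w then (orbitSign q.1 q.2 : ℂ) else 0)) (by
    refine Submodule.span_le.mpr ?_
    rintro _ ⟨I, z, p, rfl⟩
    rw [SetLike.mem_coe, LinearMap.mem_ker, map_sub, map_smul, Finsupp.lsum_single,
      Finsupp.lsum_single]
    simp only [LinearMap.toSpanSingleton_apply, smul_eq_mul, sameOrbit_swapPair_iff hd,
      orbitSign_swapPair hd]
    split_ifs <;> simp)

open Classical in
theorem orbitCoord_derivTab (hd : PairsDisjoint u) (w : intTab n) (I : Finset (SingPair u))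
    (z : intTab n) : orbitCoord hd w (derivTab u I z) =
      if I = positivePairs u w ∧ SameOrbit u z w then (orbitSign I z : ℂ) else 0 := by
  change Finsupp.lsum ℂ _ (Finsupp.single (I, z) 1) = _
  rw [Finsupp.lsum_single, LinearMap.toSpanSingleton_apply, one_smul]

theorem orbitSign_positivePairs (z : intTab n) : orbitSign (positivePairs u z) z = 1 :=
  prod_eq_one fun p hp => Int.sign_eq_one_of_pos (by have := mem_positivePairs.mp hp; omega)

theorem SameOrbit.eq_of_positivePairs_eq {z w : intTab n} (h : SameOrbit u z w)
    (hp : positivePairs u z = positivePairs u w) : z = w := by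
  refine h.ext (SameOrbit.refl w) ?_
  rw [diffPairs_self, eq_empty_iff_forall_notMem]
  intro p hp'
  rw [mem_diffPairs] at hp'
  have h1 := h.1 p
  have h2 : z.1 p.1.right < z.1 p.1.left ↔ w.1 p.1.right < w.1 p.1.left := by
    rw [← mem_positivePairs, ← mem_positivePairs, hp]
  omega

theorem orbitCoord_basis (hd : PairsDisjoint u) (w z : intTab n) [Decidable (z = w)] :
    orbitCoord hd w (derivTab u (positivePairs u z) z) = if z = w then 1 else 0 := by
  rw [orbitCoord_derivTab, orbitSign_positivePairs]
  by_cases h : z = w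
  · subst h
    simp [SameOrbit.refl]
  · rw [if_neg h, if_neg fun h' => h (h'.2.eq_of_positivePairs_eq h'.1)]

theorem derivTab_eq_zero {I : Finset (SingPair u)} {z : intTab n} {p : SingPair u} (hp : p ∈ I)
    (h : z.1 p.1.left = z.1 p.1.right) : derivTab u I z = 0 := by
  have h1 := derivTab_swapPair I p z
  rw [permInt_swapPair_of_eq h, if_pos hp, neg_one_smul, eq_neg_iff_add_eq_zero, ← two_smul ℂ] at h1
  exact (smul_eq_zero.mp h1).resolve_left two_ne_zero

/-- If some pair in `I` has equal entries the vector is 0. Otherwise exchanging a pair of the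
symmetric difference of `I` and `positivePairs u z` changes the vector only by a sign and removes
this pair from the difference. -/
theorem derivTab_mem_span (hd : PairsDisjoint u) (I : Finset (SingPair u)) (w : intTab n) :
    derivTab u I w ∈ Submodule.span ℂ
      ((fun z => derivTab u (positivePairs u z) z) '' {z | SameOrbit u z w}) := by
  classical
  by_cases hI : ∃ p ∈ I, w.1 p.1.left = w.1 p.1.right
  · obtain ⟨p, hp, h⟩ := hI
    rw [derivTab_eq_zero hp h]
    exact zero_mem _
  push Not at hI
  have key : ∀ z, SameOrbit u z w → (∀ p ∈ I, z.1 p.1.left ≠ z.1 p.1.right) →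
      derivTab u I z ∈ Submodule.span ℂ
        ((fun z => derivTab u (positivePairs u z) z) '' {z | SameOrbit u z w}) := by
    intro z
    induction hc : #(symmDiff I (positivePairs u z)) generalizing z with
    | zero =>
      intro hz _
      have h1 : I = positivePairs u z := by
        rw [card_eq_zero] at hc
        exact symmDiff_eq_bot.mp hc
      exact Submodule.subset_span ⟨z, hz, by rw [h1]⟩
    | succ d ih =>
      intro hz hne
      obtain ⟨p, hp⟩ : (symmDiff I (positivePairs u z)).Nonempty := by rw [← card_pos]; omega
      have hpne : z.1 p.1.left ≠ z.1 p.1.right := by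
        rw [mem_symmDiff, mem_positivePairs] at hp
        rcases hp with h | h
        · exact hne p h.1
        · exact h.1.ne'
      have h1 : symmDiff I (positivePairs u (permInt (swapPair p) z)) =
          (symmDiff I (positivePairs u z)).erase p := by
        ext q
        simp only [mem_erase, mem_symmDiff, mem_positivePairs] at hp ⊢
        by_cases hq : q = p
        · subst hq
          rw [swapPair_left, swapPair_right]
          have : z.1 q.1.left < z.1 q.1.right ↔ ¬ z.1 q.1.right < z.1 q.1.left := by omega
          simp only [this]
          tauto
        · rw [swapPair_left_of_ne hd (Ne.symm hq), swapPair_right_of_ne hd (Ne.symm hq)]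
          tauto
      have h2 := ih (permInt (swapPair p) z) (by rw [h1, card_erase_of_mem hp, hc]; omega)
        (hz.swapPair hd p) fun q hq => by
          by_cases hqp : p = q
          · subst hqp
            rw [swapPair_left, swapPair_right]
            exact hpne.symm
          · rw [swapPair_left_of_ne hd hqp, swapPair_right_of_ne hd hqp]
            exact hne q hq
      rw [derivTab_swapPair] at h2
      have h3 := Submodule.smul_mem _ (if p ∈ I then (-1 : ℂ) else 1) h2
      rw [smul_smul] at h3
      split_ifs at h3 <;> simpa using h3
  exact key w (SameOrbit.refl w) hI

end Orbits

end GelfandTsetlin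

namespace GelfandTsetlin

/-! ### Lattices of tableaux -/

section Lattice

open Finset

variable {n : ℕ} {u v : Tab n ℂ}

theorem toComplex_add (z z' : intTab n) : toComplex (z + z') = toComplex z + toComplex z' := by
  funext q
  simp [toComplex]

theorem toComplex_injective : Function.Injective (toComplex (n := n)) := fun z z' h =>
  Subtype.ext (funext fun q => by simpa [toComplex] using congrFun h q)

/-- The elements of the lattice, relative to one of them. -/
noncomputable def latticeEquiv (hu : u ∈ lattice v) : intTab n ≃ lattice v :=
  Equiv.ofBijective (fun z => ⟨u + toComplex z, by
    obtain ⟨z₀, rfl⟩ := hu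
    exact ⟨z₀ + z, by rw [toComplex_add, add_assoc]⟩⟩)
    ⟨fun z z' h => toComplex_injective (add_left_cancel (Subtype.ext_iff.mp h)), by
      rintro ⟨_, z, rfl⟩
      obtain ⟨z₀, rfl⟩ := hu
      refine ⟨z - z₀, Subtype.ext ?_⟩
      simp only
      rw [add_assoc, ← toComplex_add, add_sub_cancel]⟩

theorem coe_latticeEquiv (hu : u ∈ lattice v) (z : intTab n) :
    (latticeEquiv hu z : Tab n ℂ) = u + toComplex z := rfl

theorem intDiff_iff_of_eq_add_intCast {a b a' b' : ℂ} {k l : ℤ} (ha : a' = a + k) (hb : b' = b + l) :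
    IntDiff a' b' ↔ IntDiff a b := by
  subst ha hb
  constructor
  · rintro ⟨m, hm⟩
    exact ⟨m - k + l, by push_cast; linear_combination hm⟩
  · rintro ⟨m, hm⟩
    exact ⟨m + k - l, by push_cast; linear_combination hm⟩

theorem intDiff_iff_of_mem_lattice (hu : u ∈ lattice v) (p q : Pos n) :
    IntDiff (u p) (u q) ↔ IntDiff (v p) (v q) := by
  obtain ⟨z, rfl⟩ := hu
  exact intDiff_iff_of_eq_add_intCast rfl rfl

theorem IntDiff.symm {a b : ℂ} (h : IntDiff a b) : IntDiff b a := by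
  obtain ⟨m, hm⟩ := h
  exact ⟨-m, by push_cast; linear_combination -hm⟩

theorem IntDiff.trans {a b c : ℂ} (h : IntDiff a b) (h' : IntDiff b c) : IntDiff a c := by
  obtain ⟨m, hm⟩ := h
  obtain ⟨l, hl⟩ := h'
  exact ⟨m + l, by push_cast; linear_combination hm + hl⟩

theorem IntDiff.refl (a : ℂ) : IntDiff a a := ⟨0, by simp⟩

theorem card_singPair_eq (hu : u ∈ lattice v) :
    Fintype.card (SingPair u) = Nat.card (SingPair v) := by
  rw [← Nat.card_eq_fintype_card]
  exact Nat.card_congr (Equiv.subtypeEquivRight fun p => intDiff_iff_of_mem_lattice hu _ _)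

theorem IsSingularOfIndex.not_triple (hv : IsSingularOfIndex v 2) {k : Fin n} (hk : IsInnerRow k)
    {i j l : Fin (k.val + 1)} (hij : i ≠ j) (hil : i ≠ l) (hjl : j ≠ l)
    (h1 : IntDiff (v ⟨k, i⟩) (v ⟨k, j⟩)) : ¬ IntDiff (v ⟨k, i⟩) (v ⟨k, l⟩) := by
  intro h2
  have h3 : HasSingularTuple v 3 := by
    refine ⟨k, hk, {i, j, l}, card_eq_three.mpr ⟨i, j, l, hij, hil, hjl, rfl⟩, ?_⟩
    have h4 : ∀ a ∈ ({i, j, l} : Finset (Fin (k.val + 1))), IntDiff (v ⟨k, i⟩) (v ⟨k, a⟩) := by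
      intro a ha
      rcases mem_insert.mp ha with rfl | ha
      · exact IntDiff.refl _
      · rcases mem_insert.mp ha with rfl | ha
        · exact h1
        · rwa [mem_singleton.mp ha]
    exact fun a ha b hb => (h4 a ha).symm.trans (h4 b hb)
  have := hv.2.2 3 h3
  omega

theorem IsSingularOfIndex.pairsDisjoint (hv : IsSingularOfIndex v 2) : PairsDisjoint v := by
  rintro ⟨⟨⟨k, i, j⟩, hk, hij⟩, h⟩ ⟨⟨⟨k', i', j'⟩, hk', hij'⟩, h'⟩ hne
  simp only [PosPair.left, PosPair.right] at h h' hk hij hk' hij' ⊢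
  by_cases hkk : k = k'
  · subst hkk
    have key : ∀ {a b c : Fin (k.val + 1)}, a ≠ b → a ≠ c → IntDiff (v ⟨k, a⟩) (v ⟨k, b⟩) →
        IntDiff (v ⟨k, a⟩) (v ⟨k, c⟩) → b = c := fun hab hac h1 h2 => by
      by_contra hbc
      exact hv.not_triple hk hab hac hbc h1 h2
    refine ⟨fun he => ?_, fun he => ?_, fun he => ?_, fun he => ?_⟩
    · obtain rfl : i = i' := by simpa using he
      obtain rfl := key hij.ne hij'.ne h h'
      exact hne rfl
    · obtain rfl : i = j' := by simpa using he
      obtain rfl := key hij.ne hij'.ne' h h'.symm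
      exact absurd hij hij'.not_gt
    · obtain rfl : j = i' := by simpa using he
      obtain rfl := key hij.ne' hij'.ne h.symm h'
      exact absurd hij hij'.not_gt
    · obtain rfl : j = j' := by simpa using he
      obtain rfl := key hij.ne' hij'.ne' h.symm h'.symm
      exact hne rfl
  · exact ⟨fun he => hkk (congrArg Sigma.fst he), fun he => hkk (congrArg Sigma.fst he),
      fun he => hkk (congrArg Sigma.fst he), fun he => hkk (congrArg Sigma.fst he)⟩

theorem PairsDisjoint.of_mem_lattice (hd : PairsDisjoint v) (hu : u ∈ lattice v) :
    PairsDisjoint u := fun p q hpq =>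
  hd ⟨p.1, (intDiff_iff_of_mem_lattice hu _ _).mp p.2⟩ ⟨q.1, (intDiff_iff_of_mem_lattice hu _ _).mp q.2⟩
    fun h => hpq (Subtype.ext (congrArg (fun r : SingPair v => r.1) h))

/-- The right entry of each singular pair is moved onto the left one. Disjointness makes the moves
independent and keeps the left entries in place. -/
theorem exists_isNormalized (hd : PairsDisjoint v) : ∃ u ∈ lattice v, IsNormalized u := by
  classical
  have hz : ∀ q : Pos n, ∃ m : ℤ, (∀ p : SingPair v, q = p.1.right → v p.1.left - v p.1.right = m) ∧
      ((∀ p : SingPair v, q ≠ p.1.right) → m = 0) := by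
    intro q
    by_cases hq : ∃ p : SingPair v, q = p.1.right
    · obtain ⟨p, hp⟩ := hq
      obtain ⟨m, hm⟩ := p.2
      refine ⟨m, fun p' hp' => ?_, fun h => absurd hp (h p)⟩
      by_cases hpp : p = p'
      · rw [← hpp, hm]
      · exact absurd (hp.symm.trans hp') (hd p p' hpp).2.2.2
    · push Not at hq
      exact ⟨0, fun p hp => absurd hp (hq p), fun _ => rfl⟩
  choose z hz1 hz2 using hz
  have hzt : ∀ q : Pos n, q.1.val + 1 = n → z q = 0 := fun q hq => hz2 q fun p hp => by
    have h := p.1.2.1.2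
    rw [hp] at hq
    change p.1.1.1.val + 1 = n at hq
    omega
  refine ⟨v + toComplex ⟨z, hzt⟩, ⟨⟨z, hzt⟩, rfl⟩, fun r => ?_⟩
  have hmem : v + toComplex ⟨z, hzt⟩ ∈ lattice v := ⟨⟨z, hzt⟩, rfl⟩
  have hr := (intDiff_iff_of_mem_lattice hmem _ _).mp r.2
  obtain ⟨p, hp⟩ : ∃ p : SingPair v, p.1 = r.1 := ⟨⟨r.1, hr⟩, rfl⟩
  rw [← hp]
  have h1 : z p.1.left = 0 := hz2 _ fun q hq => by
    by_cases hpq : p = q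
    · exact left_ne_right p (by rw [hq, hpq])
    · exact (hd p q hpq).2.1 hq
  have h2 := hz1 p.1.right p rfl
  simp only [Pi.add_apply, toComplex, h1, ← h2]
  push_cast
  ring

theorem add_toComplex_swapPair (hu : IsNormalized u) (p : SingPair u) (z : intTab n) :
    u + toComplex (permInt (swapPair p) z) = permTab (swapPair p) (u + toComplex z) := by
  funext q
  rw [permTab_swapPair]
  simp only [Pi.add_apply, toComplex, pairSwap_apply hu, permInt_swapPair]

theorem rowPoly_permTab (σ : RowPerm n) (w : Tab n ℂ) (r : Fin n) :
    rowPoly (permTab σ w) r = rowPoly w r :=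
  Equiv.prod_comp (σ r)⁻¹ fun i => Polynomial.X - Polynomial.C (w ⟨r, i⟩ + r.val)

theorem exists_eq_of_rowPoly_eq {w w' : Tab n ℂ} {r : Fin n} (h : rowPoly w r = rowPoly w' r)
    (i : Fin (r.val + 1)) : ∃ j, w ⟨r, i⟩ = w' ⟨r, j⟩ := by
  have h1 : (rowPoly w r).eval (w ⟨r, i⟩ + r.val) = 0 := by
    rw [rowPoly, Polynomial.eval_prod]
    exact prod_eq_zero (mem_univ i) (by simp)
  rw [h, rowPoly, Polynomial.eval_prod, prod_eq_zero_iff] at h1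
  obtain ⟨j, -, hj⟩ := h1
  exact ⟨j, by simpa [sub_eq_zero] using hj⟩

/-- Each entry of `u + z` is an entry of `u + w` in the same row. If the positions differ they have
integral difference and form a singular pair, on which `u` is constant; so the entries of `z` are
those of `w` up to exchange. -/
theorem sameOrbit_of_rowPoly_eq (hu : IsNormalized u) (hd : PairsDisjoint u) {z w : intTab n}
    (h : ∀ r, rowPoly (u + toComplex z) r = rowPoly (u + toComplex w) r) : SameOrbit u z w := by
  have key : ∀ {z w : intTab n},
      (∀ r, rowPoly (u + toComplex z) r = rowPoly (u + toComplex w) r) → ∀ q : Pos n,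
        z.1 q = w.1 q ∨ ∃ p : SingPair u, (q = p.1.left ∧ z.1 q = w.1 p.1.right) ∨
          (q = p.1.right ∧ z.1 q = w.1 p.1.left) := by
    rintro z w h ⟨r, i⟩
    obtain ⟨j, hj⟩ := exists_eq_of_rowPoly_eq (h r) i
    simp only [Pi.add_apply, toComplex] at hj
    have hdiff : IntDiff (u ⟨r, i⟩) (u ⟨r, j⟩) :=
      ⟨w.1 ⟨r, j⟩ - z.1 ⟨r, i⟩, by push_cast; linear_combination hj⟩
    by_cases hij : i = j
    · subst hij
      left
      exact_mod_cast add_left_cancel hj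
    by_cases hr : IsInnerRow r
    · right
      rcases lt_or_gt_of_ne hij with hlt | hlt
      · obtain ⟨p, hl, hr'⟩ := exists_pair hr hlt hdiff
        refine ⟨p, Or.inl ⟨hl.symm, ?_⟩⟩
        have h1 := hu p
        rw [hl, hr'] at h1
        rw [hr']
        rw [h1] at hj
        exact_mod_cast add_left_cancel hj
      · obtain ⟨p, hl, hr'⟩ := exists_pair hr hlt hdiff.symm
        refine ⟨p, Or.inr ⟨hr'.symm, ?_⟩⟩
        have h1 := hu p
        rw [hl, hr'] at h1
        rw [hl]
        rw [h1] at hj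
        exact_mod_cast add_left_cancel hj
    · left
      -- A row that is not inner has two different positions only if it is the top row, and there
      -- integral tableaux vanish.
      have hr0 : r.val + 1 = n := by
        have hi := i.isLt
        have hj := j.isLt
        have hrn := r.isLt
        have : i.val ≠ j.val := fun h => hij (Fin.ext h)
        unfold IsInnerRow at hr
        omega
      rw [z.2 ⟨r, i⟩ hr0, w.2 ⟨r, i⟩ hr0]
  have key2 : ∀ {z w : intTab n},
      (∀ r, rowPoly (u + toComplex z) r = rowPoly (u + toComplex w) r) → ∀ p : SingPair u,
        (z.1 p.1.left = w.1 p.1.left ∨ z.1 p.1.left = w.1 p.1.right) ∧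
        (z.1 p.1.right = w.1 p.1.right ∨ z.1 p.1.right = w.1 p.1.left) := by
    intro z w h p
    constructor
    · refine (key h p.1.left).imp id ?_
      rintro ⟨p', ⟨h1, h2⟩ | ⟨h1, -⟩⟩
      · by_cases hp : p = p'
        · rw [h2, hp]
        · exact absurd h1 (hd p p' hp).1
      · by_cases hp : p = p'
        · exact absurd (h1.trans (by rw [hp])) (left_ne_right p)
        · exact absurd h1 (hd p p' hp).2.1
    · refine (key h p.1.right).imp id ?_
      rintro ⟨p', ⟨h1, -⟩ | ⟨h1, h2⟩⟩
      · by_cases hp : p = p'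
        · exact absurd (h1.trans (by rw [hp])).symm (left_ne_right p)
        · exact absurd h1 (hd p p' hp).2.2.1
      · by_cases hp : p = p'
        · rw [h2, hp]
        · exact absurd h1 (hd p p' hp).2.2.2
  refine ⟨fun p => ?_, fun q hq => ?_⟩
  · have h1 := key2 h p
    -- Multiplicities of roots were not recorded; using the inclusion of values in both directions
    -- excludes that one of `z`, `w` has equal entries on `p` and the other has not.
    have h2 := key2 (fun r => (h r).symm) p
    omega
  · refine (key h q).resolve_right ?_
    rintro ⟨p, ⟨h1, -⟩ | ⟨h1, -⟩⟩
    · exact (hq p).1 h1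
    · exact (hq p).2 h1

/-- The Casimir elements have the same values at `w` and `w'`. -/
def SameGamma (w w' : Tab n ℂ) : Prop :=
  ∀ m k, 1 ≤ k → k ≤ m → m ≤ n → gammaVal m k w = gammaVal m k w'

theorem sameGamma_iff_sameOrbit (hu : IsNormalized u) (hd : PairsDisjoint u) {z w : intTab n} :
    SameGamma (u + toComplex z) (u + toComplex w) ↔ SameOrbit u z w := by
  constructor
  · exact fun h => sameOrbit_of_rowPoly_eq hu hd fun r => rowPoly_eq_of_gammaVal_eq r
      fun k hk hk' => h (r.val + 1) k hk hk' r.isLt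
  · intro h m k hk hkm hm
    obtain ⟨r, rfl⟩ : ∃ r : Fin n, m = r.val + 1 := ⟨⟨m - 1, by omega⟩, by simp only; omega⟩
    refine h.induction hd (P := fun z => gammaVal (r.val + 1) k (u + toComplex z) =
      gammaVal (r.val + 1) k (u + toComplex w)) rfl fun p z hz => ?_
    rw [← hz, gammaVal_eq, gammaVal_eq, add_toComplex_swapPair hu, rowPoly_permTab]

theorem idealOf_eq_of_sameGamma {w w' : Tab n ℂ} (h : SameGamma w w') : idealOf w = idealOf w' := by
  unfold idealOf
  congr 1
  ext g
  constructor
  · rintro ⟨m, k, hk, hkm, hm, hg⟩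
    exact ⟨m, k, hk, hkm, hm, by rw [hg, h m k hk hkm hm]⟩
  · rintro ⟨m, k, hk, hkm, hm, hg⟩
    exact ⟨m, k, hk, hkm, hm, by rw [hg, h m k hk hkm hm]⟩

/-- If some `c_{mk}` has different values at `w` and `w'`, the corresponding generators of the two
ideals differ by a nonzero scalar. -/
theorem idealOf_sup_eq_top {w w' : Tab n ℂ} (h : ¬ SameGamma w w') :
    idealOf w ⊔ idealOf w' = ⊤ := by
  unfold SameGamma at h
  push Not at h
  obtain ⟨m, k, hk, hkm, hm, hne⟩ := h
  obtain ⟨l, rfl⟩ : ∃ l, k = l + 1 := ⟨k - 1, by omega⟩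
  have hmem := casimir_mem_Gam (n := n) (by omega : 1 ≤ m) hm l
  have key : ∀ w : Tab n ℂ, (⟨casimir n m (l + 1), hmem⟩ - algebraMap ℂ (Gam n) (gammaVal m (l + 1) w)) ∈
      idealOf w := fun w => Ideal.subset_span ⟨m, l + 1, hk, hkm, hm, rfl⟩
  have h1 : algebraMap ℂ (Gam n) (gammaVal m (l + 1) w' - gammaVal m (l + 1) w) ∈
      idealOf w ⊔ idealOf w' := by
    have h2 := sub_mem (Ideal.mem_sup_left (T := idealOf w') (key w))
      (Ideal.mem_sup_right (S := idealOf w) (key w'))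
    rw [sub_sub_sub_cancel_left, ← map_sub] at h2
    exact h2
  refine Ideal.eq_top_of_isUnit_mem _ h1 ?_
  exact (IsUnit.mk0 _ (sub_ne_zero.mpr (Ne.symm hne))).map (algebraMap ℂ (Gam n))

end Lattice

end GelfandTsetlin

namespace GelfandTsetlin

/-! ### Root spaces of a commutative algebra of operators -/

section CommutativeAction

open Finset

variable {R M : Type*} [CommRing R] [Algebra ℂ R] [AddCommGroup M] [Module ℂ M]
  (a : R →ₐ[ℂ] Module.End ℂ M)

/-- Write `1 = b + c` with `b` in a power of `J i` that kills `x i` and `c` in the product of the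
powers that kill the other summands. Then `b` kills `x i`, and so does `c`, because it kills the sum
and all the other summands. -/
theorem eq_zero_of_sum_eq_zero_of_coprime {ι : Type*} {s : Finset ι} {J : ι → Ideal R}
    (hJ : ∀ i ∈ s, ∀ j ∈ s, i ≠ j → J i ⊔ J j = ⊤) {x : ι → M}
    (hx : ∀ i ∈ s, ∃ k, ∀ g ∈ J i ^ k, a g (x i) = 0) (hsum : ∑ i ∈ s, x i = 0) :
    ∀ i ∈ s, x i = 0 := by
  classical
  intro i hi
  have hx' : ∀ i, ∃ k, i ∈ s → ∀ g ∈ J i ^ k, a g (x i) = 0 := fun i => by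
    by_cases h : i ∈ s
    · exact (hx i h).imp fun k hk _ => hk
    · exact ⟨0, fun h' => absurd h' h⟩
  choose k hk using hx'
  have hcop : IsCoprime (J i ^ k i) (∏ j ∈ s.erase i, J j ^ k j) :=
    IsCoprime.prod_right fun j hj => IsCoprime.pow (Ideal.isCoprime_iff_sup_eq.mpr
      (hJ i hi j (mem_of_mem_erase hj) (ne_of_mem_erase hj).symm))
  obtain ⟨b, hb, c, hc, hbc⟩ := Ideal.isCoprime_iff_exists.mp hcop
  have h1 : ∀ j ∈ s.erase i, a c (x j) = 0 := fun j hj =>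
    hk j (mem_of_mem_erase hj) c ((Ideal.prod_le_inf.trans (Finset.inf_le hj)) hc)
  have h2 : a c (x i) = 0 := by
    have h3 := congrArg (a c) hsum
    rwa [map_zero, map_sum, ← add_sum_erase s _ hi, sum_eq_zero h1, add_zero] at h3
  calc x i = a (b + c) (x i) := by rw [hbc, map_one, Module.End.one_apply]
    _ = 0 := by rw [map_add, LinearMap.add_apply, hk i hi b hb, h2, add_zero]

/-- Generators of the ideal lower the filtration by one step, and so a product of `d` of them kills
`F d`; arbitrary multipliers are harmless as the ring is commutative. -/
theorem apply_eq_zero_of_filtration {S : Set R} {F : ℕ → Set M} (h0 : F 0 ⊆ {0})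
    (hS : ∀ g ∈ S, ∀ d, ∀ x ∈ F (d + 1), a g x ∈ F d) (d : ℕ) :
    ∀ g ∈ Ideal.span S ^ d, ∀ x ∈ F d, a g x = 0 := by
  induction d with
  | zero =>
    intro g _ x hx
    rw [h0 hx, map_zero]
  | succ d ih =>
    intro g hg x hx
    rw [pow_succ] at hg
    refine Submodule.mul_induction_on hg (fun b hb c hc => ?_) fun b c hb hc => ?_
    · refine Submodule.span_induction (p := fun c _ => a (b * c) x = 0) ?_ ?_ ?_ ?_ hc
      · intro c hc
        rw [map_mul, Module.End.mul_apply]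
        exact ih b hb _ (hS c hc d x hx)
      · rw [mul_zero, map_zero, LinearMap.zero_apply]
      · intro c c' _ _ hc hc'
        rw [mul_add, map_add, LinearMap.add_apply, hc, hc', add_zero]
      · intro r c _ hc
        rw [smul_eq_mul, mul_left_comm, map_mul, Module.End.mul_apply, hc, map_zero]
    · rw [map_add, LinearMap.add_apply, hb, hc, add_zero]

/-- The annihilator of a vector. -/
def vectorAnn (x : M) : Ideal R where
  carrier := {g | a g x = 0}
  zero_mem' := by simp
  add_mem' := fun {g h} hg hh => by
    change a (g + h) x = 0
    rw [map_add, LinearMap.add_apply, show a g x = 0 from hg, show a h x = 0 from hh, add_zero]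
  smul_mem' := fun r g hg => by
    change a (r * g) x = 0
    rw [map_mul, Module.End.mul_apply, show a g x = 0 from hg, map_zero]

/-- The quotient by the annihilator of `x` embeds into `N` by acting on `x`, so it is a
finite-dimensional algebra. -/
theorem isArtinianRing_quotient_vectorAnn {x : M} (N : Submodule ℂ M) [FiniteDimensional ℂ N]
    (hN : ∀ g, a g x ∈ N) : IsArtinianRing (R ⧸ vectorAnn a x) := by
  let f : R →ₗ[ℂ] N :=
    { toFun := fun g => ⟨a g x, hN g⟩
      map_add' := fun g h => Subtype.ext (by simp)
      map_smul' := fun c g => Subtype.ext (by simp) }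
  have hf : LinearMap.ker f = (vectorAnn a x).restrictScalars ℂ := by
    ext g
    rw [LinearMap.mem_ker, Subtype.ext_iff]
    rfl
  have h1 : Module.Finite ℂ (R ⧸ LinearMap.ker f) :=
    Module.Finite.equiv f.quotKerEquivRange.symm
  rw [hf] at h1
  have h2 : Module.Finite ℂ (R ⧸ vectorAnn a x) :=
    Module.Finite.equiv (Submodule.Quotient.restrictScalarsEquiv ℂ (vectorAnn a x))
  exact IsArtinianRing.of_finite ℂ _

/-- In the Artinian quotient the unit is a sum of elements each killed by a power of a maximal
ideal. Acting with representatives on `x` decomposes `x` into root vectors for maximal ideals of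
`R`, without knowing which ideals occur. -/
theorem mem_of_forall_maximal_mem {x : M} [IsArtinianRing (R ⧸ vectorAnn a x)]
    {N : Submodule ℂ M} (hN : ∀ (𝔪 : MaximalSpectrum R) (y : M),
      (∃ k, ∀ g ∈ 𝔪.asIdeal ^ k, a g y = 0) → y ∈ N) : x ∈ N := by
  classical
  set A := R ⧸ vectorAnn a x
  have : Fintype (MaximalSpectrum A) := Fintype.ofFinite _
  obtain ⟨k, hk⟩ := IsArtinianRing.isNilpotent_nilradical (R := A)
  rw [IsArtinianRing.nilradical_pow_eq_iInf] at hk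
  have hp : ((univ : Finset (MaximalSpectrum A)) : Set (MaximalSpectrum A)).Pairwise
      fun i j => i.asIdeal ^ k ⊔ j.asIdeal ^ k = ⊤ := fun i _ j _ hij =>
    Ideal.isCoprime_iff_sup_eq.mp (IsCoprime.pow (i.isCoprime_of_ne hij))
  have htop := Submodule.iSup_torsionBySet_ideal_eq_torsionBySet_iInf (M := A) hp
  have h1 : (1 : A) ∈ ⨆ i ∈ (univ : Finset (MaximalSpectrum A)),
      Submodule.torsionBySet A A (i.asIdeal ^ k : Ideal A) := by
    rw [htop]
    simp only [mem_univ, iInf_pos, hk]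
    rw [Submodule.mem_torsionBySet_iff]
    rintro ⟨b, hb⟩
    obtain rfl : b = 0 := hb
    exact zero_smul _ _
  simp only [mem_univ, iSup_pos] at h1
  have key : ∀ b ∈ ⨆ i : MaximalSpectrum A, Submodule.torsionBySet A A (i.asIdeal ^ k : Ideal A),
      ∀ r : R, Ideal.Quotient.mk (vectorAnn a x) r = b → a r x ∈ N := by
    intro b hb
    refine Submodule.iSup_induction _ (motive := fun b => ∀ r : R,
      Ideal.Quotient.mk (vectorAnn a x) r = b → a r x ∈ N) hb ?_ ?_ ?_
    · intro i b hb r hr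
      refine hN ⟨i.asIdeal.comap (Ideal.Quotient.mk (vectorAnn a x)),
        Ideal.comap_isMaximal_of_surjective _ Ideal.Quotient.mk_surjective⟩ _ ⟨k, fun g hg => ?_⟩
      have h2 : Ideal.Quotient.mk (vectorAnn a x) g ∈ i.asIdeal ^ k :=
        Ideal.le_comap_pow _ k hg
      have h3 := (Submodule.mem_torsionBySet_iff _ _).mp hb ⟨_, h2⟩
      rw [← hr] at h3
      have h4 : Ideal.Quotient.mk (vectorAnn a x) (g * r) = 0 := (map_mul _ _ _).trans h3
      have h5 : a (g * r) x = 0 := Ideal.Quotient.eq_zero_iff_mem.mp h4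
      rwa [map_mul, Module.End.mul_apply] at h5
    · intro r hr
      rw [show a r x = 0 from Ideal.Quotient.eq_zero_iff_mem.mp hr]
      exact zero_mem _
    · intro b c hb hc r hr
      obtain ⟨s, rfl⟩ := Ideal.Quotient.mk_surjective b
      have h2 := add_mem (hb s rfl) (hc (r - s) (by rw [map_sub, hr, add_sub_cancel_left]))
      rwa [← LinearMap.add_apply, ← map_add, add_sub_cancel] at h2
  have h2 := key 1 h1 1 (map_one _)
  rwa [map_one, Module.End.one_apply] at h2

end CommutativeAction

end GelfandTsetlin

namespace GelfandTsetlin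

/-! ### The Gelfand–Tsetlin module -/

section TabModule

open Finset

variable {n : ℕ} {u v : Tab n ℂ}

/-- The map `T(u + z) ↦ 𝒟_{I(z)} T(u + z)`. -/
noncomputable def tabLin (h : u ∈ lattice v) : TabSpace v →ₗ[ℂ] DerivSpace u :=
  Finsupp.linearCombination ℂ fun w => derivTab u (positivePairs u ((latticeEquiv h).symm w))
    ((latticeEquiv h).symm w)

theorem tabLin_basisTab (h : u ∈ lattice v) (z : intTab n) :
    tabLin h (basisTab (latticeEquiv h z)) = derivTab u (positivePairs u z) z := by
  rw [tabLin, basisTab, Finsupp.linearCombination_single, one_smul, Equiv.symm_apply_apply]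

theorem orbitCoord_tabLin (hd : PairsDisjoint u) (h : u ∈ lattice v) (x : TabSpace v)
    (z : intTab n) : orbitCoord hd z (tabLin h x) = x (latticeEquiv h z) := by
  classical
  have h1 : (orbitCoord hd z) ∘ₗ tabLin h = Finsupp.lapply (latticeEquiv h z) := by
    refine Finsupp.lhom_ext' fun w => LinearMap.ext_ring ?_
    obtain ⟨z', rfl⟩ := (latticeEquiv h).surjective w
    change orbitCoord hd z (tabLin h (basisTab (latticeEquiv h z'))) = _
    rw [tabLin_basisTab, orbitCoord_basis]
    simp [Finsupp.single_apply]
  exact LinearMap.congr_fun h1 x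

theorem tabLin_bijective (hd : PairsDisjoint u) (h : u ∈ lattice v) :
    Function.Bijective (tabLin h) := by
  refine ⟨(injective_iff_map_eq_zero _).mpr fun x hx => Finsupp.ext fun w => ?_, fun d => ?_⟩
  · obtain ⟨z, rfl⟩ := (latticeEquiv h).surjective w
    rw [← orbitCoord_tabLin hd, hx, map_zero, Finsupp.zero_apply]
  · refine derivSpace_induction (S := LinearMap.range (tabLin h)) (fun I z => ?_) d
    refine Submodule.span_le.mpr ?_ (derivTab_mem_span hd I z)
    rintro _ ⟨z', -, rfl⟩
    exact ⟨_, tabLin_basisTab h z'⟩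

/-- The identification of `V(T(v))` with the space of derivative tableaux. -/
noncomputable def tabEquiv (hd : PairsDisjoint u) (h : u ∈ lattice v) :
    TabSpace v ≃ₗ[ℂ] DerivSpace u :=
  LinearEquiv.ofBijective (tabLin h) (tabLin_bijective hd h)

theorem tabEquiv_basisTab (hd : PairsDisjoint u) (h : u ∈ lattice v) (z : intTab n) :
    tabEquiv hd h (basisTab (latticeEquiv h z)) = derivTab u (positivePairs u z) z :=
  tabLin_basisTab h z

/-- The action of the enveloping algebra on `V(T(v))`. -/
noncomputable def tabAct (hu : IsNormalized u) (hd : PairsDisjoint u) (h : u ∈ lattice v) :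
    UGL n →ₐ[ℂ] Module.End ℂ (TabSpace v) :=
  ((tabEquiv hd h).symm.conjAlgEquiv ℂ : _ →ₐ[ℂ] _).comp (derivAct hu hd)

theorem tabEquiv_tabAct (hu : IsNormalized u) (hd : PairsDisjoint u) (h : u ∈ lattice v) (g : UGL n)
    (x : TabSpace v) :
    tabEquiv hd h (tabAct hu hd h g x) = derivAct hu hd g (tabEquiv hd h x) := by
  change tabEquiv hd h ((tabEquiv hd h).symm (derivAct hu hd g ((tabEquiv hd h).symm.symm x))) = _
  rw [LinearEquiv.apply_symm_apply, LinearEquiv.symm_symm]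

/-- The representation of `𝔤𝔩(n)` on `V(T(v))`. -/
noncomputable def tabRep (hu : IsNormalized u) (hd : PairsDisjoint u) (h : u ∈ lattice v) :
    LieGL n →ₗ⁅ℂ⁆ Module.End ℂ (TabSpace v) :=
  (UniversalEnvelopingAlgebra.lift ℂ).symm (tabAct hu hd h)

theorem lift_tabRep (hu : IsNormalized u) (hd : PairsDisjoint u) (h : u ∈ lattice v) :
    UniversalEnvelopingAlgebra.lift ℂ (tabRep hu hd h) = tabAct hu hd h :=
  Equiv.apply_symm_apply _ _

theorem tabRep_apply (hu : IsNormalized u) (hd : PairsDisjoint u) (h : u ∈ lattice v) (X : LieGL n) :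
    tabRep hu hd h X = tabAct hu hd h (UniversalEnvelopingAlgebra.ι ℂ X) := by
  rw [← lift_tabRep, UniversalEnvelopingAlgebra.lift_ι_apply]

theorem tabEquiv_tabRep_matUnit (hu : IsNormalized u) (hd : PairsDisjoint u) (h : u ∈ lattice v)
    (r s : Fin n) {I : Finset (SingPair u)} {z : intTab n}
    (hI : ∀ p ∈ I, z.1 p.1.left ≠ z.1 p.1.right) :
    tabEquiv hd h (tabRep hu hd h (matUnit r s) ((tabEquiv hd h).symm (derivTab u I z))) =
      actionFormula u r s I z := by
  rw [tabRep_apply, tabEquiv_tabAct, LinearEquiv.apply_symm_apply,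
    derivAct_matUnit_derivTab hu hd r s hI]

/-! ### Root spaces -/

/-- For fixed `z`, filter by the number of derivatives: a generator `c_{mk} - γ_{mk}(u + z)` removes
the leading term and leaves only smaller sets `J`. -/
theorem derivAct_idealOf_pow (hu : IsNormalized u) (hd : PairsDisjoint u) (z : intTab n)
    (I : Finset (SingPair u)) {g : Gam n} (hg : g ∈ idealOf (u + toComplex z) ^ (#I + 1)) :
    derivAct hu hd g (derivTab u I z) = 0 := by
  let F : ℕ → Submodule ℂ (DerivSpace u) := fun d =>
    Submodule.span ℂ {y | ∃ J : Finset (SingPair u), #J < d ∧ y = derivTab u J z}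
  refine apply_eq_zero_of_filtration ((derivAct hu hd).comp (Gam n).val)
    (F := fun d => (F d : Set (DerivSpace u))) ?_ ?_ (#I + 1) g hg _
    (Submodule.subset_span ⟨I, Nat.lt_succ_self _, rfl⟩)
  · have h0 : F 0 = ⊥ := by simp [F]
    rw [h0]
    exact fun x hx => hx
  · rintro c ⟨m, k, hk, hkm, hm, hc⟩ d
    obtain ⟨r, rfl⟩ : ∃ r : Fin n, m = r.val + 1 := ⟨⟨m - 1, by omega⟩, by simp only; omega⟩
    obtain ⟨k, rfl⟩ : ∃ l, k = l + 1 := ⟨k - 1, by omega⟩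
    have hle : F (d + 1) ≤ (F d).comap (derivAct hu hd c) := by
      refine Submodule.span_le.mpr ?_
      rintro _ ⟨J, hJ, rfl⟩
      rw [SetLike.mem_coe, Submodule.mem_comap, hc, map_sub, LinearMap.sub_apply, AlgHom.commutes,
        Module.algebraMap_end_apply, derivAct_casimir_derivTab,
        ← add_sum_erase _ _ (mem_powerset_self J), sdiff_self, bot_eq_empty, diffOp_empty,
        valueAt_traceCoeff, add_sub_cancel_left]
      refine sum_mem fun J' hJ' => Submodule.smul_mem _ _ (Submodule.subset_span ⟨J', ?_, rfl⟩)
      have h1 : J' ⊂ J := (mem_powerset.mp (mem_of_mem_erase hJ')).ssubset_of_ne (ne_of_mem_erase hJ')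
      have := card_lt_card h1
      omega
    exact fun x hx => hle hx

theorem basisTab_mem_rootSpace (hu : IsNormalized u) (hd : PairsDisjoint u) (h : u ∈ lattice v)
    (w : lattice v) : basisTab w ∈ rootSpace (tabRep hu hd h) (idealOf w.1) := by
  obtain ⟨z, rfl⟩ := (latticeEquiv h).surjective w
  refine ⟨#(positivePairs u z) + 1, fun g hg => (tabEquiv hd h).injective ?_⟩
  rw [lift_tabRep, tabEquiv_tabAct, map_zero, tabEquiv_basisTab]
  exact derivAct_idealOf_pow hu hd z _ hg

theorem idealOf_ne_top (hu : IsNormalized u) (hd : PairsDisjoint u) (h : u ∈ lattice v)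
    (w : lattice v) : idealOf w.1 ≠ ⊤ := by
  intro htop
  obtain ⟨k, hk⟩ := basisTab_mem_rootSpace hu hd h w
  have h1 := hk 1 (by rw [htop, Ideal.top_pow]; trivial)
  rw [OneMemClass.coe_one, map_one, Module.End.one_apply, basisTab, Finsupp.single_eq_zero] at h1
  exact one_ne_zero h1

theorem idealOf_eq_iff (hu : IsNormalized u) (hd : PairsDisjoint u) (h : u ∈ lattice v)
    (w w' : lattice v) : idealOf w.1 = idealOf w'.1 ↔ SameGamma w.1 w'.1 := by
  refine ⟨fun heq => ?_, idealOf_eq_of_sameGamma⟩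
  by_contra hne
  have h1 := idealOf_sup_eq_top hne
  rw [heq, sup_idem] at h1
  exact idealOf_ne_top hu hd h w' h1

/-- The ideals of the basis vectors are pairwise equal or comaximal. A root vector has a component
for each ideal that occurs, and by comaximality only the component for its own ideal can be nonzero.
-/
theorem rootSpace_idealOf (hu : IsNormalized u) (hd : PairsDisjoint u) (h : u ∈ lattice v)
    (w₀ : lattice v) : rootSpace (tabRep hu hd h) (idealOf w₀.1) =
      Submodule.span ℂ {x | ∃ w : lattice v, idealOf w.1 = idealOf w₀.1 ∧ x = basisTab w} := by
  classical
  refine le_antisymm (fun x hx => ?_) (Submodule.span_le.mpr ?_)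
  · set s := x.support.image fun w => idealOf w.1 with hs
    set y : Ideal (Gam n) → TabSpace v := fun 𝔪 =>
      ∑ w ∈ x.support with idealOf w.1 = 𝔪, x w • basisTab w with hy
    have hsum : ∑ 𝔪 ∈ s, y 𝔪 = x := by
      rw [hs, hy, sum_fiberwise_of_maps_to fun w hw => mem_image_of_mem _ hw]
      simp only [basisTab, Finsupp.smul_single, smul_eq_mul, mul_one]
      exact Finsupp.sum_single x
    have hymem : ∀ 𝔪, y 𝔪 ∈ rootSpace (tabRep hu hd h) 𝔪 := fun 𝔪 => sum_mem fun w hw => by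
      rw [← (mem_filter.mp hw).2]
      exact Submodule.smul_mem _ _ (basisTab_mem_rootSpace hu hd h w)
    have hyspan : y (idealOf w₀.1) ∈
        Submodule.span ℂ {x | ∃ w : lattice v, idealOf w.1 = idealOf w₀.1 ∧ x = basisTab w} :=
      sum_mem fun w hw => Submodule.smul_mem _ _
        (Submodule.subset_span ⟨w, (mem_filter.mp hw).2, rfl⟩)
    suffices x = y (idealOf w₀.1) by rwa [this]
    have hcop : ∀ i ∈ insert (idealOf w₀.1) s, ∀ j ∈ insert (idealOf w₀.1) s, i ≠ j → i ⊔ j = ⊤ := by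
      have hex : ∀ i ∈ insert (idealOf w₀.1) s, ∃ w : lattice v, idealOf w.1 = i := by
        intro i hi
        rcases mem_insert.mp hi with rfl | hi
        · exact ⟨w₀, rfl⟩
        · obtain ⟨w, -, hw⟩ := mem_image.mp hi
          exact ⟨w, hw⟩
      intro i hi j hj hij
      obtain ⟨w, rfl⟩ := hex i hi
      obtain ⟨w', rfl⟩ := hex j hj
      exact idealOf_sup_eq_top fun hg => hij (idealOf_eq_of_sameGamma hg)
    -- The vector itself is subtracted in the component of its own ideal. The result is a vanishing
    -- sum of root vectors for comaximal ideals, so each term is 0. The ideal is inserted because it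
    -- need not occur in the support of `x`.
    have hzero : ∑ 𝔪 ∈ insert (idealOf w₀.1) s,
        (y 𝔪 - if 𝔪 = idealOf w₀.1 then x else 0) = 0 := by
      rw [sum_sub_distrib, sum_ite_eq', if_pos (mem_insert_self _ _), sub_eq_zero, ← hsum]
      refine sum_insert_of_eq_zero_if_notMem fun hnot => ?_
      refine sum_eq_zero fun w hw => ?_
      exact absurd (mem_image.mpr ⟨w, (mem_filter.mp hw).1, (mem_filter.mp hw).2⟩) hnot
    have hfin := eq_zero_of_sum_eq_zero_of_coprime
      ((UniversalEnvelopingAlgebra.lift ℂ (tabRep hu hd h)).comp (Gam n).val) (J := id) hcop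
      (fun 𝔪 _ => ?_) hzero (idealOf w₀.1) (mem_insert_self _ _)
    · rw [if_pos rfl, sub_eq_zero] at hfin
      exact hfin.symm
    · have : y 𝔪 - (if 𝔪 = idealOf w₀.1 then x else 0) ∈ rootSpace (tabRep hu hd h) 𝔪 := by
        refine sub_mem (hymem 𝔪) ?_
        split_ifs with h1
        · rwa [h1]
        · exact zero_mem _
      exact this
  · rintro _ ⟨w, hw, rfl⟩
    rw [← hw]
    exact basisTab_mem_rootSpace hu hd h w

theorem setOf_idealOf_eq (hu : IsNormalized u) (hd : PairsDisjoint u) (h : u ∈ lattice v)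
    (z₀ : intTab n) : {w : lattice v | idealOf w.1 = idealOf (latticeEquiv h z₀).1} =
      latticeEquiv h '' {z | SameOrbit u z z₀} := by
  ext w
  obtain ⟨z, rfl⟩ := (latticeEquiv h).surjective w
  rw [Set.mem_ofPred_eq, idealOf_eq_iff hu hd h, coe_latticeEquiv, coe_latticeEquiv,
    sameGamma_iff_sameOrbit hu hd, (latticeEquiv h).injective.mem_set_image, Set.mem_ofPred_eq]

theorem rootSpace_eq_supported (hu : IsNormalized u) (hd : PairsDisjoint u) (h : u ∈ lattice v)
    (z₀ : intTab n) : rootSpace (tabRep hu hd h) (idealOf (latticeEquiv h z₀).1) =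
      Finsupp.supported ℂ ℂ (latticeEquiv h '' {z | SameOrbit u z z₀}) := by
  rw [rootSpace_idealOf, Finsupp.supported_eq_span_single, ← setOf_idealOf_eq hu hd h]
  congr 1
  ext x
  exact ⟨fun ⟨w, hw, hx⟩ => ⟨w, hw, hx.symm⟩, fun ⟨w, hw, hx⟩ => ⟨w, hw, hx.symm⟩⟩

theorem finite_sameOrbit (hd : PairsDisjoint u) (z₀ : intTab n) :
    {z | SameOrbit u z z₀}.Finite :=
  Set.finite_of_ncard_ne_zero (by rw [ncard_sameOrbit hd]; positivity)

theorem finiteDimensional_rootSpace (hu : IsNormalized u) (hd : PairsDisjoint u) (h : u ∈ lattice v)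
    (w₀ : lattice v) : FiniteDimensional ℂ (rootSpace (tabRep hu hd h) (idealOf w₀.1)) := by
  obtain ⟨z₀, rfl⟩ := (latticeEquiv h).surjective w₀
  rw [rootSpace_eq_supported]
  have : Finite (latticeEquiv h '' {z | SameOrbit u z z₀}) :=
    ((finite_sameOrbit hd z₀).image _).to_subtype
  exact Module.Finite.equiv (Finsupp.supportedEquivFinsupp _).symm

theorem finrank_rootSpace (hu : IsNormalized u) (hd : PairsDisjoint u) (h : u ∈ lattice v)
    (z₀ : intTab n) :
    Module.finrank ℂ (rootSpace (tabRep hu hd h) (idealOf (latticeEquiv h z₀).1)) =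
      2 ^ (Nat.card (SingPair v) - #(equalPairs u z₀)) := by
  rw [rootSpace_eq_supported]
  have : Fintype (latticeEquiv h '' {z | SameOrbit u z z₀}) :=
    ((finite_sameOrbit hd z₀).image _).fintype
  rw [(Finsupp.supportedEquivFinsupp _).finrank_eq, Module.finrank_finsupp_self,
    ← Nat.card_eq_fintype_card, Nat.card_coe_set_eq, Set.ncard_image_of_injective _
      (latticeEquiv h).injective, ncard_sameOrbit hd, card_singPair_eq h]

/-- Independence holds because distinct maximal ideals are comaximal. For the sum, each basis vector
lies in the root space of its ideal, which is finite-dimensional and stable under `Γ`; so the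
quotient of `Γ` by its annihilator is Artinian and the vector splits over maximal ideals. -/
theorem isGelfandTsetlin_tabRep (hu : IsNormalized u) (hd : PairsDisjoint u) (h : u ∈ lattice v) :
    IsGelfandTsetlin (tabRep hu hd h) := by
  classical
  set a := (UniversalEnvelopingAlgebra.lift ℂ (tabRep hu hd h)).comp (Gam n).val with ha
  refine DirectSum.isInternal_submodule_of_iSupIndep_of_iSup_eq_top
    ((iSupIndep_iff_finsetSum_eq_zero_imp_eq_zero _).mpr fun s x hx hsum => ?_) ?_
  · exact eq_zero_of_sum_eq_zero_of_coprime a (J := fun 𝔪 : MaximalSpectrum (Gam n) => 𝔪.asIdeal)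
      (fun i _ j _ hij => Ideal.isCoprime_iff_sup_eq.mp (i.isCoprime_of_ne hij))
      (fun i hi => hx i hi) hsum
  · rw [eq_top_iff, ← (Finsupp.basisSingleOne (R := ℂ) (ι := lattice v)).span_eq, Submodule.span_le]
    rintro _ ⟨w, rfl⟩
    rw [Finsupp.coe_basisSingleOne]
    have hfin := finiteDimensional_rootSpace hu hd h w
    have hart : IsArtinianRing (Gam n ⧸ vectorAnn a (basisTab w)) :=
      isArtinianRing_quotient_vectorAnn a (rootSpace (tabRep hu hd h) (idealOf w.1)) fun g => by
        obtain ⟨k, hk⟩ := basisTab_mem_rootSpace hu hd h w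
        refine ⟨k, fun b hb => ?_⟩
        change a b (a g (basisTab w)) = 0
        rw [← Module.End.mul_apply, ← map_mul, mul_comm, map_mul, Module.End.mul_apply,
          show a b (basisTab w) = 0 from hk b hb, map_zero]
    refine mem_of_forall_maximal_mem a (x := basisTab w) fun 𝔪 y hy => ?_
    exact Submodule.mem_iSup_of_mem 𝔪 hy

/-- The fiber is an orbit of exchanges, which preserve the equality of the two entries of a pair;
and a hyperplane through one of its points belongs to a singular pair, where `u` contributes equal
entries. -/
theorem hyperplanesThrough_setOf_idealOf_eq (hu : IsNormalized u) (hd : PairsDisjoint u)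
    (h : u ∈ lattice v) (z₀ : intTab n) :
    (hyperplanesThrough {w | w ∈ lattice v ∧ idealOf w = idealOf (latticeEquiv h z₀).1}).ncard =
      #(equalPairs u z₀) := by
  have h1 : hyperplanesThrough {w | w ∈ lattice v ∧ idealOf w = idealOf (latticeEquiv h z₀).1} =
      (fun r : SingPair u => r.1) '' (equalPairs u z₀ : Set (SingPair u)) := by
    ext p
    constructor
    · intro hp
      have h2 := hp _ ⟨(latticeEquiv h z₀).2, rfl⟩
      simp only [coe_latticeEquiv, Pi.add_apply, toComplex] at h2
      have h3 : IntDiff (u p.left) (u p.right) :=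
        ⟨z₀.1 p.right - z₀.1 p.left, by push_cast; linear_combination h2⟩
      have h4 : u p.left = u p.right := hu ⟨p, h3⟩
      rw [h4] at h2
      have h5 : z₀.1 p.left = z₀.1 p.right := by exact_mod_cast add_left_cancel h2
      exact ⟨⟨p, h3⟩, mem_coe.mpr (mem_equalPairs.mpr h5), rfl⟩
    · rintro ⟨r, hr, rfl⟩ w ⟨hw, hw'⟩
      have h2 : (⟨w, hw⟩ : lattice v) ∈ latticeEquiv h '' {z | SameOrbit u z z₀} := by
        rw [← setOf_idealOf_eq hu hd h]
        exact hw'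
      obtain ⟨z, hz, hzw⟩ := h2
      obtain rfl : u + toComplex z = w := congrArg Subtype.val hzw
      have h3 := mem_equalPairs.mp (mem_coe.mp hr)
      have h4 : z.1 r.1.left = z.1 r.1.right := by
        have := hz.1 r
        omega
      simp only [Pi.add_apply, toComplex, hu r, h4]
  have h2 : Function.Injective fun r : SingPair u => r.1 := fun r r' hr => Subtype.ext hr
  rw [h1, Set.ncard_image_of_injective _ h2, Set.ncard_coe_finset]

end TabModule

end GelfandTsetlin

theorem theoremA (n : ℕ) (v : Tab n ℂ) (hv : IsSingularOfIndex v 2) :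
    (∃ u ∈ lattice v, IsNormalized u) ∧
    ∀ u ∈ lattice v, IsNormalized u →
      ∃ (φ : TabSpace v ≃ₗ[ℂ] DerivSpace u) (ρ : LieGL n →ₗ⁅ℂ⁆ Module.End ℂ (TabSpace v)),
        (∀ (w : lattice v) (z : intTab n), (w : Tab n ℂ) = u + toComplex z →
          φ (basisTab w) = derivTab u (positivePairs u z) z) ∧
        (∀ (r s : Fin n) (I : Finset (SingPair u)) (z : intTab n),
          (∀ p ∈ I, z.1 p.1.left ≠ z.1 p.1.right) →
            (∀ σ ∈ permSet n r s, RegularAt u (actionCoeff u r s I z σ)) ∧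
            φ (ρ (matUnit r s) (φ.symm (derivTab u I z))) = actionFormula u r s I z) ∧
        IsGelfandTsetlin ρ ∧
        ∀ 𝔪 : Ideal (Gam n), (fiber v 𝔪).Nonempty →
          rootSpace ρ 𝔪 =
            Submodule.span ℂ {x | ∃ w : lattice v, (w : Tab n ℂ) ∈ fiber v 𝔪 ∧ x = basisTab w} ∧
          (∀ k : ℕ, (hyperplanesThrough (fiber v 𝔪)).ncard = k →
            Module.finrank ℂ (rootSpace ρ 𝔪) = 2 ^ (Nat.card (SingPair v) - k)) ∧
          ((∀ w ∈ fiber v 𝔪, IsMaximalCritical v w) →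
            Module.finrank ℂ (rootSpace ρ 𝔪) = 1) := by
  refine ⟨exists_isNormalized hv.pairsDisjoint, fun u h hu => ?_⟩
  have hd : PairsDisjoint u := hv.pairsDisjoint.of_mem_lattice h
  refine ⟨tabEquiv hd h, tabRep hu hd h, fun w z hw => ?_, fun r s I z hI =>
    ⟨fun σ hσ => regularAt_actionCoeff hu hd hI hσ, tabEquiv_tabRep_matUnit hu hd h r s hI⟩,
    isGelfandTsetlin_tabRep hu hd h, ?_⟩
  · obtain rfl : latticeEquiv h z = w := Subtype.ext hw.symm
    exact tabEquiv_basisTab hd h z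
  rintro _ ⟨w, hw, rfl⟩
  obtain ⟨z, hz⟩ := (latticeEquiv h).surjective ⟨w, hw⟩
  obtain rfl : (latticeEquiv h z : Tab n ℂ) = w := congrArg Subtype.val hz
  refine ⟨?_, fun k hk => ?_, fun hmax => ?_⟩
  · rw [rootSpace_idealOf]
    congr 1
    ext x
    exact exists_congr fun w' => and_congr_left fun _ => (and_iff_right w'.2).symm
  · rw [finrank_rootSpace, ← hyperplanesThrough_setOf_idealOf_eq hu hd h, ← hk]
    rfl
  · have h1 := hmax _ ⟨hw, rfl⟩
    have h2 : equalPairs u z = Finset.univ := by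
      refine Finset.eq_univ_of_forall fun p => mem_equalPairs.mpr ?_
      -- The normalised point `u` itself shows that the hyperplane of every singular pair is
      -- critical.
      have h3 := h1 p.1 ⟨u, h, hu p⟩
      simp only [coe_latticeEquiv, Pi.add_apply, toComplex, hu p] at h3
      exact_mod_cast add_left_cancel h3
    rw [finrank_rootSpace, h2, Finset.card_univ, card_singPair_eq h, Nat.sub_self, pow_zero]
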